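/- **Setting.** Let $\Phi=\{\Phi(n)\}_{n\ge 0}$ be a discrete-time Markov chain on a measurable space ${\sf X}$ with countably generated $\sigma$-field and transition kernel $P$; write ${\sf P}_x,{\sf E}_x,\mathrm{Var}_x$ for its law, expectation and variance when $\Phi(0)=x$. Assume that $\Phi$ is geometrically ergodic with Lyapunov function $V:{\sf X}\to[1,\infty)$. That is, $\Phi$ is $\psi$-irreducible for a maximal irreducibility measure $\psi\neq 0$; it is aperiodic, meaning that for every $\psi$-positive set $A$ and every $x$, $P^n(x,A)>0$ for all large $n$; and, with $R=\sum_{n\ge0}(1-e^{-1})e^{-n}P^n$, there are a probability measure $\nu$, a function $s:{\sf X}\to(0,1]$ and constants $\delta>0$, $b<\infty$ such that $$PV-V\le-\delta V+bs,\qquad R\ge s\otimes\nu .$$ Let $\pi$ be the invariant probability measure, and assume $\pi(V^2)<\infty$. Let $F:{\sf X}\to[-1,1]$ be measurable with $\pi(F)=0$, put $S_n=\sum_{i=0}^{n-1}F(\Phi(i))$, and assume that $F$ has non-trivial asymptotic variance $\sigma^2=\lim_n \frac1n\mathrm{Var}_x(S_n)\ne 0$. **Lattice functionals.** A function $F_\ell:{\sf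 X}\to\mathbb R$ is lattice with step $h>0$ if, for some $0\le d<h$, $(F_\ell(x)-d)/h\in\mathbb Z$ for all $x\in{\sf X}$. The span of $F$ is the largest $h$ for which $F=F_0+F_\ell$ with $F_0$ bounded, measurable and of zero asymptotic variance, and $F_\ell$ lattice with step $h$. "$F$ is a lattice functional with span $h$" means that $h$ is the span of $F$ and that $F$ itself is lattice with step $h$: there is $0\le d<h$ with $F(x)\in d+h\mathbb Z$ for all $x$. **Theorem (Edgeworth expansion for lattice functionals).** Suppose that $F$ is a lattice functional with span $h>0$, with $d$ as above. Then the limits $\sigma^2=\lim_n\frac1n\mathrm{Var}_x(S_n)>0$ (with $\sigma>0$, the same for all $x$), $\hat F(x)=\lim_n{\sf E}_x[S_n]$ (for every $x$) and $\Lambda(a)=\lim_n\frac1n\log{\sf E}_x[e^{aS_n}]$ (for all real $a$ near $0$, the same for all $x$) exist, and $\Lambda$ is analytic at $0$. Put $\rho_3=\Lambda'''(0)$, $G_n(y)={\sf P}_x\{S_n/(\sigma\sqrt n)\le y\}$ and $h_n=h/(\sigma\sqrt n)$, $d_n=nd/(\sigma\sqrt n)$, so that $S_n/(\sigma\sqrt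 n)$ takes values in $\{d_n+kh_n:k\in\mathbb Z\}$. Let $G_n^\#$ be the polygonal approximation of $G_n$: the continuous function that agrees with $G_n$ at the midpoints $d_n+(k+\frac12)h_n$, $k\in\mathbb Z$, and is linear between consecutive midpoints. Let $\gamma$ and ${\cal G}$ be the standard normal density and distribution function. Then, for every $x\in{\sf X}$, $$G_n^\#(y)={\cal G}(y)+\frac{\gamma(y)}{\sigma\sqrt n}\left[\frac{\rho_3}{6\sigma^2}(1-y^2)-\hat F(x)\right]+o(n^{-1/2}),\qquad n\to\infty,$$ uniformly in $y\in\mathbb R$. In particular, the same expansion holds, uniformly in $k\in\mathbb Z$, with $G_n(y)$ in place of $G_n^\#(y)$ at the midpoints $y=d_n+(k+\frac12)h_n$, and with $[G_n(y)+G_n(y-)]/2$ in place of $G_n^\#(y)$ at the lattice points $y=d_n+kh_n$. -/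

import Mathlib

open MeasureTheory ProbabilityTheory Filter Topology

namespace MarkovEdgeworth

/-- The law, on the path space `ℕ → X`, of the time-homogeneous Markov chain with transition
kernel `P` and deterministic initial state `x` (Ionescu-Tulcea construction). -/
noncomputable def chainLaw {X : Type*} [MeasurableSpace X] (P : Kernel X X) [IsMarkovKernel P]
    (x : X) : Measure (ℕ → X) :=
  Kernel.traj (X := fun _ => X)
    (fun n => P.comap (fun (path : Finset.Iic n → X) => path ⟨n, Finset.mem_Iic.2 le_rfl⟩)
      (measurable_pi_apply _)) 0 (fun _ => x)

/-- The partial sums `S_n = ∑_{i < n} F(Φ(i))`, as functions on the path space. -/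
def partialSum {X : Type*} (F : X → ℝ) (n : ℕ) (path : ℕ → X) : ℝ :=
  ∑ i ∈ Finset.range n, F (path i)

/-- The resolvent `R = ∑_{n ≥ 0} (1 - e⁻¹) e⁻ⁿ Pⁿ`, as a family of measures. -/
noncomputable def resolvent {X : Type*} [MeasurableSpace X] (P : Kernel X X) (x : X) : Measure X :=
  Measure.sum fun n : ℕ =>
    ENNReal.ofReal ((1 - Real.exp (-1)) * Real.exp (-(n : ℝ))) • (P ^ n) x

/-- `ψ` is a maximal irreducibility measure: a nonzero σ-finite measure for which `P` is
irreducible, and which dominates every other σ-finite irreducibility measure. -/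
structure IsMaximalIrreducibility {X : Type*} [MeasurableSpace X] (P : Kernel X X)
    (ψ : Measure X) : Prop where
  sigmaFinite : SigmaFinite ψ
  ne_zero : ψ ≠ 0
  irreducible : Kernel.IsIrreducible ψ P
  maximal : ∀ φ : Measure X, SigmaFinite φ → Kernel.IsIrreducible φ P → φ ≪ ψ

/-- Aperiodicity relative to the maximal irreducibility measure `ψ`: every `ψ`-positive set is
charged, from every initial state, at all sufficiently large times. -/
def IsAperiodic {X : Type*} [MeasurableSpace X] (P : Kernel X X) (ψ : Measure X) : Prop :=
  ∀ A : Set X, MeasurableSet A → 0 < ψ A → ∀ x, ∀ᶠ n : ℕ in atTop, 0 < (P ^ n) x A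

/-- The drift condition (V4) for a finite-valued `V ≥ 1`: for some probability measure `ν`,
some `s : X → (0, 1]` and constants `δ > 0`, `b < ∞`,
`P V - V ≤ -δ V + b s` and `R ≥ s ⊗ ν`. -/
def DriftV4 {X : Type*} [MeasurableSpace X] (P : Kernel X X) (V : X → ℝ) : Prop :=
  ∃ (ν : Measure X) (s : X → ℝ) (δ b : ℝ),
    IsProbabilityMeasure ν ∧ Measurable s ∧ (∀ x, 0 < s x ∧ s x ≤ 1) ∧ 0 < δ ∧
    (∀ x, ∫⁻ y, ENNReal.ofReal (V y) ∂(P x) ≤ ENNReal.ofReal ((1 - δ) * V x + b * s x)) ∧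
    (∀ x, ∀ A : Set X, MeasurableSet A → ENNReal.ofReal (s x) * ν A ≤ resolvent P x A)

/-- Geometric ergodicity with (finite-valued) Lyapunov function `V`. -/
structure IsGeometricallyErgodic {X : Type*} [MeasurableSpace X] (P : Kernel X X)
    (V : X → ℝ) : Prop where
  irreducible_aperiodic : ∃ ψ : Measure X, IsMaximalIrreducibility P ψ ∧ IsAperiodic P ψ
  measurable : Measurable V
  one_le : ∀ x, 1 ≤ V x
  drift : DriftV4 P V

/-- `F` has asymptotic variance `v`: `Var_x(S_n) / n → v` for every initial state `x`. -/
def HasAsymptoticVariance {X : Type*} [MeasurableSpace X] (P : Kernel X X) [IsMarkovKernel P]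
    (F : X → ℝ) (v : ℝ) : Prop :=
  ∀ x, Tendsto (fun n : ℕ => variance (partialSum F n) (chainLaw P x) / n) atTop (𝓝 v)

/-- All values of `F` lie in `{d + k h : k ∈ ℤ}`, where `h > 0` and `0 ≤ d < h`. -/
def IsLattice {X : Type*} (F : X → ℝ) (d h : ℝ) : Prop :=
  0 < h ∧ 0 ≤ d ∧ d < h ∧ ∀ x, ∃ k : ℤ, F x = d + k * h

/-- `F = F₀ + F_ℓ` with `F₀` bounded measurable of zero asymptotic variance and `F_ℓ` lattice
with step `h`. -/
def IsAlmostLattice {X : Type*} [MeasurableSpace X] (P : Kernel X X) [IsMarkovKernel P]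
    (F : X → ℝ) (h : ℝ) : Prop :=
  ∃ (F₀ Fl : X → ℝ) (d : ℝ), Measurable F₀ ∧ (∃ C : ℝ, ∀ x, |F₀ x| ≤ C) ∧
    HasAsymptoticVariance P F₀ 0 ∧ IsLattice Fl d h ∧ ∀ x, F x = F₀ x + Fl x

/-- `h` is the span of `F`: the largest `h` for which `F` is (almost) lattice with step `h`. -/
def HasSpan {X : Type*} [MeasurableSpace X] (P : Kernel X X) [IsMarkovKernel P]
    (F : X → ℝ) (h : ℝ) : Prop :=
  IsGreatest {h' : ℝ | IsAlmostLattice P F h'} h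

/-- `Λ(a) = lim_n (1/n) log E_x[exp(a S_n)]`, for all real `a` in a neighbourhood of zero and
every initial state `x`. -/
def IsLimitLogMGF {X : Type*} [MeasurableSpace X] (P : Kernel X X) [IsMarkovKernel P]
    (F : X → ℝ) (Λ : ℝ → ℝ) : Prop :=
  ∀ᶠ a in 𝓝 (0 : ℝ), ∀ x,
    Tendsto (fun n : ℕ => cgf (partialSum F n) (chainLaw P x) a / n) atTop (𝓝 (Λ a))

/-- `Fhat(x) = lim_n E_x[S_n - n π(F)]`, the solution of the Poisson equation. -/
def IsPoissonLimit {X : Type*} [MeasurableSpace X] (P : Kernel X X) [IsMarkovKernel P]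
    (π : Measure X) (F Fhat : X → ℝ) : Prop :=
  ∀ x, Tendsto (fun n : ℕ => ∫ path, (partialSum F n path - n * ∫ y, F y ∂π) ∂(chainLaw P x))
    atTop (𝓝 (Fhat x))

/-- `G_n(y) = P_x{S_n / (σ √n) ≤ y}`. -/
noncomputable def normalizedCDF {X : Type*} [MeasurableSpace X] (P : Kernel X X)
    [IsMarkovKernel P] (F : X → ℝ) (σ : ℝ) (x : X) (n : ℕ) (y : ℝ) : ℝ :=
  (chainLaw P x).real {path | partialSum F n path / (σ * √n) ≤ y}

/-- The polygonal approximation of `G` for the lattice `{d + k h : k ∈ ℤ}`: it agrees with `G` at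
the midpoints `d + (k + 1/2) h` and is linear between consecutive midpoints. -/
noncomputable def polygonal (G : ℝ → ℝ) (d h y : ℝ) : ℝ :=
  let t := (y - d) / h - 1 / 2
  (1 - Int.fract t) * G (d + (⌊t⌋ + 1 / 2) * h) + Int.fract t * G (d + (⌊t⌋ + 1 + 1 / 2) * h)

/-- The one-term Edgeworth approximation
`𝒢(y) + γ(y) / (σ √n) * (ρ₃ / (6 σ²) * (1 - y²) - c)`, with `𝒢` and `γ` the standard normal
distribution function and density. -/
noncomputable def edgeworth (σ ρ₃ c : ℝ) (n : ℕ) (y : ℝ) : ℝ :=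
  cdf (gaussianReal 0 1) y +
    gaussianPDFReal 0 1 y / (σ * √n) * (ρ₃ / (6 * σ ^ 2) * (1 - y ^ 2) - c)

end MarkovEdgeworth

/-! Everything is read off the twisted operators f ↦ e^{zF}Pf, whose n-th iterate applied to 1 is
E_x[e^{zS_n}] (`integral_exp_partialSum`). The proof controls these iterates without spectral
theory, by power iteration near z = 0 and by compactness elsewhere, and then inverts a Fourier
transform.

Ergodicity. The drift keeps a definite discounted number of visits to s, and the minorization turns
each visit into a gain. Hence a bounded subharmonic function never exceeds its π-mean
(`subharmonic_le_integral`); this makes π an irreducibility measure and forces the part of P^n(x,·)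
singular to π to vanish. Compactness and aperiodicity then give total variation convergence, and the
drift makes it uniform relative to V, whence geometric decay of P^n on mean-zero functions
(`exists_geometric_decay`).

Frequencies near zero. The power iteration of the twisted operator, normalized to have π-mean one,
converges geometrically (`exists_normalized_orbit`). Its normalizing constants are ratios of
stationary moment generating functions, hence holomorphic, and their logarithms converge to a
holomorphic L such that E_x[e^{zS_n}]e^{-nL(z)} is bounded by a multiple of V(x), uniformly in n
(`exists_pressure`). Cauchy's estimates turn this one bound into L'(0) = 0, L''(0) = σ², and the
expansion 1 + zE_x[S_n] + O(|z|²) of the prefactor; the term -F̂(x) of the theorem comes from the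
limit of E_x[S_n].

Frequencies 0 < |t| < 2π/h. If the iterates at it did not die out in L¹(π), a weak limit would
produce a bi-infinite orbit of constant L¹ norm. Equality in the triangle inequality then yields a
unimodular eigenfunction (`exists_eigenfunction`), whose argument exhibits F as a zero-variance
function plus a lattice function of step 2π/|t| > h (`isAlmostLattice`), against the definition of
the span. By compactness the characteristic functions decay geometrically on η ≤ |t| ≤ π/h
(`exists_uniform_decay`).

Inversion. The probability that a lattice variable falls between two midpoints is an integral over
one period of its characteristic function against a sum of characters. That sum times sinc(th/2) is
the Fourier transform of the whole interval (`latticeKernel_mul_sinc`), which is also the kernel in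
the Fourier formula for an increment of the Edgeworth approximation. At midpoints one thus compares
φ/sinc with e^{-t²/2} times a polynomial, and the sinc costs only O(1/n) for the step h/(σ√n). This
gives the midpoint estimate (`exists_midpoint_bound`). Linear interpolation of the smooth
approximation costs another O(1/n), which gives the polygonal statement and, at the middle of each
segment, the statement at lattice points (`lattice_expansion`). -/

set_option linter.unusedSectionVars false

namespace MarkovEdgeworth

/-! ### Bounded measurable functions -/

section BoundedMeasurable

/-- Bounded (strongly) measurable functions. -/
structure BM {X E : Type*} [MeasurableSpace X] [NormedAddCommGroup E] (f : X → E) : Prop where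
  sm : StronglyMeasurable f
  bdd : ∃ C, ∀ x, ‖f x‖ ≤ C

variable {X Y E : Type*} [MeasurableSpace X] [MeasurableSpace Y] [NormedAddCommGroup E]

theorem BM.integrable {f : X → E} (hf : BM f) (μ : Measure X) [IsFiniteMeasure μ] :
    Integrable f μ := by
  obtain ⟨C, hC⟩ := hf.bdd
  exact Integrable.of_bound hf.sm.aestronglyMeasurable C (ae_of_all _ hC)

theorem BM.const (c : E) : BM (fun _ : X => c) :=
  ⟨stronglyMeasurable_const, ‖c‖, fun _ => le_rfl⟩

theorem BM.add {f g : X → E} (hf : BM f) (hg : BM g) : BM (fun x => f x + g x) := by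
  obtain ⟨C, hC⟩ := hf.bdd
  obtain ⟨D, hD⟩ := hg.bdd
  exact ⟨hf.sm.add hg.sm, C + D, fun x => (norm_add_le _ _).trans (add_le_add (hC x) (hD x))⟩

theorem BM.sub {f g : X → E} (hf : BM f) (hg : BM g) : BM (fun x => f x - g x) := by
  obtain ⟨C, hC⟩ := hf.bdd
  obtain ⟨D, hD⟩ := hg.bdd
  exact ⟨hf.sm.sub hg.sm, C + D, fun x => (norm_sub_le _ _).trans (add_le_add (hC x) (hD x))⟩

theorem BM.smul {𝕜 : Type*} [NormedField 𝕜] [NormedSpace 𝕜 E]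
    {f : X → 𝕜} {g : X → E} (hf : BM f) (hg : BM g) : BM (fun x => f x • g x) := by
  obtain ⟨C, hC⟩ := hf.bdd
  obtain ⟨D, hD⟩ := hg.bdd
  refine ⟨hf.sm.smul hg.sm, C * D, fun x => ?_⟩
  rw [norm_smul]
  exact mul_le_mul (hC x) (hD x) (norm_nonneg _) ((norm_nonneg _).trans (hC x))

theorem BM.mul {𝕜 : Type*} [NormedField 𝕜] {f g : X → 𝕜} (hf : BM f) (hg : BM g) :
    BM (fun x => f x * g x) := hf.smul hg

theorem BM.norm {f : X → E} (hf : BM f) : BM (fun x => ‖f x‖) := by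
  obtain ⟨C, hC⟩ := hf.bdd
  exact ⟨hf.sm.norm, C, fun x => by simpa using hC x⟩

theorem BM.comp {f : Y → E} (hf : BM f) {g : X → Y} (hg : Measurable g) :
    BM (fun x => f (g x)) := by
  obtain ⟨C, hC⟩ := hf.bdd
  exact ⟨hf.sm.comp_measurable hg, C, fun x => hC _⟩

theorem BM.ofReal {f : X → ℝ} (hf : BM f) : BM (fun x => (f x : ℂ)) := by
  obtain ⟨C, hC⟩ := hf.bdd
  exact ⟨Complex.continuous_ofReal.comp_stronglyMeasurable hf.sm, C, fun x => by
    simpa using hC x⟩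

theorem BM.indicator {A : Set X} (hA : MeasurableSet A) (c : E) :
    BM (A.indicator (fun _ => c)) :=
  ⟨stronglyMeasurable_const.indicator hA, ‖c‖, fun x => by
    by_cases hx : x ∈ A <;> simp [hx]⟩

theorem BM.integral_kernel [NormedSpace ℝ E] {f : Y → E} (hf : BM f) (κ : Kernel X Y)
    [IsMarkovKernel κ] : BM (fun x => ∫ y, f y ∂κ x) := by
  obtain ⟨C, hC⟩ := hf.bdd
  refine ⟨hf.sm.integral_kernel, C, fun x => ?_⟩
  simpa using norm_integral_le_of_norm_le_const (μ := κ x) (ae_of_all _ hC)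

theorem BM.of_measurable_le {f : X → ℝ} (hf : Measurable f) {C : ℝ} (h : ∀ x, |f x| ≤ C) : BM f :=
  ⟨hf.stronglyMeasurable, C, h⟩

end BoundedMeasurable

/-! ### Iterates of the transition kernel and invariance -/

section Powers

variable {X : Type*} [MeasurableSpace X] {P : Kernel X X} [IsMarkovKernel P]
  {E : Type*} [NormedAddCommGroup E] [NormedSpace ℝ E] [CompleteSpace E]

instance isMarkovKernel_pow (n : ℕ) : IsMarkovKernel (P ^ n) := by
  induction n with
  | zero => rw [pow_zero]; exact inferInstanceAs (IsMarkovKernel Kernel.id)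
  | succ n ih => rw [pow_succ]; exact inferInstanceAs (IsMarkovKernel ((P ^ n) ∘ₖ P))

theorem integral_pow_add (m n : ℕ) (x : X) {f : X → E} (hf : Integrable f ((P ^ (m + n)) x)) :
    ∫ y, f y ∂(P ^ (m + n)) x = ∫ z, ∫ y, f y ∂(P ^ m) z ∂(P ^ n) x := by
  rw [Kernel.pow_add] at hf ⊢
  exact Kernel.integral_comp hf

theorem integral_pow_zero (x : X) {f : X → E} (hf : StronglyMeasurable f) :
    ∫ y, f y ∂(P ^ 0) x = f x := by
  rw [pow_zero]
  change ∫ y, f y ∂(Kernel.id x) = f x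
  rw [Kernel.id_apply, integral_dirac' _ _ hf]

theorem lintegral_pow_add (m n : ℕ) (x : X) {f : X → ENNReal} (hf : Measurable f) :
    ∫⁻ y, f y ∂(P ^ (m + n)) x = ∫⁻ z, ∫⁻ y, f y ∂(P ^ m) z ∂(P ^ n) x := by
  rw [Kernel.pow_add, Kernel.lintegral_comp _ _ _ hf]

theorem invariant_pow {π : Measure X} (hπ : Kernel.Invariant P π) (n : ℕ) :
    Kernel.Invariant (P ^ n) π := by
  induction n with
  | zero => 
    rw [pow_zero]
    change π.bind Kernel.id = π
    exact Measure.id_comp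
  | succ n ih =>
    rw [pow_succ]
    exact ih.comp hπ

theorem lintegral_invariant {κ : Kernel X X} {π : Measure X} (hπ : Kernel.Invariant κ π)
    {f : X → ENNReal} (hf : Measurable f) : ∫⁻ x, ∫⁻ y, f y ∂κ x ∂π = ∫⁻ x, f x ∂π := by
  conv_rhs => rw [← hπ.def]
  rw [Measure.lintegral_bind κ.measurable.aemeasurable hf.aemeasurable]

theorem comp_const_apply_of_invariant {κ : Kernel X X} {π : Measure X}
    (hπ : Kernel.Invariant κ π) : (κ ∘ₖ Kernel.const Unit π) () = π := by
  rw [Kernel.comp_const, hπ.def, Kernel.const_apply]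

theorem integral_invariant {κ : Kernel X X} [IsMarkovKernel κ] {π : Measure X}
    (hπ : Kernel.Invariant κ π) {f : X → E} (hf : Integrable f π) :
    ∫ x, ∫ y, f y ∂κ x ∂π = ∫ x, f x ∂π := by
  have hf' : Integrable f ((κ ∘ₖ Kernel.const Unit π) ()) := by
    rwa [comp_const_apply_of_invariant hπ]
  have h := Kernel.integral_comp hf'
  rw [comp_const_apply_of_invariant hπ, Kernel.const_apply] at h
  exact h.symm

end Powers

/-! ### Markov property and marginals of the path law -/

section Path

variable {X : Type*} [MeasurableSpace X] (P : Kernel X X) [IsMarkovKernel P]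

instance isProbabilityMeasure_chainLaw (x : X) : IsProbabilityMeasure (chainLaw P x) := by
  unfold chainLaw; infer_instance

theorem map_chainLaw_zero (x : X) : (chainLaw P x).map (fun w => w 0) = Measure.dirac x := by
  have h := Kernel.traj_map_frestrictLe_apply (X := fun _ => X)
    (κ := fun n => P.comap (fun (path : Finset.Iic n → X) => path ⟨n, Finset.mem_Iic.2 le_rfl⟩)
      (measurable_pi_apply _)) 0 0 (fun _ => x)
  rw [Kernel.partialTraj_self, Kernel.id_apply] at h
  have hc : (fun w : ℕ → X => w 0) =
    (fun p : Finset.Iic 0 → X => p ⟨0, Finset.mem_Iic.2 le_rfl⟩) ∘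
      (Preorder.frestrictLe (π := fun _ => X) 0) := rfl
  rw [hc, ← Measure.map_map (g := fun p : Finset.Iic 0 → X => p ⟨0, Finset.mem_Iic.2 le_rfl⟩)
    (measurable_pi_apply _) (Preorder.measurable_frestrictLe 0)]
  unfold chainLaw
  rw [h, Measure.map_dirac' (measurable_pi_apply _)]

variable {P} {E : Type*} [NormedAddCommGroup E] [NormedSpace ℝ E] [CompleteSpace E]

/-- The Markov property at time `n`, in integrated form. -/
theorem integral_last_step (x : X) (n : ℕ) {g : (Finset.Iic n → X) × X → E} (hg : BM g) :
    ∫ w, g (Preorder.frestrictLe n w, w (n + 1)) ∂chainLaw P x =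
      ∫ w, ∫ y, g (Preorder.frestrictLe n w, y) ∂P (w n) ∂chainLaw P x := by
  set κ : (n : ℕ) → Kernel (Finset.Iic n → X) X := fun n =>
    P.comap (fun (path : Finset.Iic n → X) => path ⟨n, Finset.mem_Iic.2 le_rfl⟩)
      (measurable_pi_apply _) with hκ
  have h1 := Kernel.partialTraj_compProd_eq_map_traj (X := fun _ => X) (κ := κ)
    (Nat.zero_le n) (x₀ := fun _ => x)
  have h2 := Kernel.traj_map_frestrictLe_apply (X := fun _ => X) (κ := κ) 0 n (fun _ => x)
  have hm : Measurable (fun w : ℕ → X => 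
      ((Preorder.frestrictLe n w : Finset.Iic n → X), w (n + 1))) :=
    (Preorder.measurable_frestrictLe n).prodMk (measurable_pi_apply _)
  have e1 : ∫ w, g (Preorder.frestrictLe n w, w (n + 1)) ∂chainLaw P x =
      ∫ p, g p ∂((chainLaw P x).map (fun w => (Preorder.frestrictLe n w, w (n + 1)))) := by
    rw [integral_map hm.aemeasurable hg.sm.aestronglyMeasurable]
  rw [e1]
  unfold chainLaw
  rw [← h1, Measure.integral_compProd (hg.integrable _), ← h2,
    integral_map (Preorder.measurable_frestrictLe n).aemeasurable]
  · rfl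
  · exact (hg.sm.integral_kernel_prod_right' (κ := κ n)).aestronglyMeasurable

theorem integral_pair_chainLaw (x : X) (n : ℕ) {g : X → X → E}
    (hg : BM (fun p : X × X => g p.1 p.2)) :
    ∫ w, g (w n) (w (n + 1)) ∂chainLaw P x = ∫ w, ∫ y, g (w n) y ∂P (w n) ∂chainLaw P x := by
  have := integral_last_step (P := P) x n
    (g := fun p => g (p.1 ⟨n, Finset.mem_Iic.2 le_rfl⟩) p.2)
    (BM.comp (f := fun p : X × X => g p.1 p.2) hg
      (g := fun p : (Finset.Iic n → X) × X => (p.1 ⟨n, Finset.mem_Iic.2 le_rfl⟩, p.2))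
      (((measurable_pi_apply _).comp measurable_fst).prodMk measurable_snd))
  exact this

/-- The one-dimensional marginals of the chain. -/
theorem integral_chainLaw (x : X) (n : ℕ) {f : X → E} (hf : BM f) :
    ∫ w, f (w n) ∂chainLaw P x = ∫ y, f y ∂(P ^ n) x := by
  induction n generalizing f with
  | zero =>
    rw [integral_pow_zero x hf.sm, 
      ← integral_map (φ := fun w : ℕ → X => w 0) (measurable_pi_apply 0).aemeasurable 
        hf.sm.aestronglyMeasurable, map_chainLaw_zero, integral_dirac' _ _ hf.sm]
  | succ n ih =>
    rw [integral_pair_chainLaw x n (g := fun _ y => f y) (hf.comp measurable_snd),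
      ih (hf.integral_kernel P), add_comm n 1, integral_pow_add 1 n x (hf.integrable _), pow_one]

theorem map_chainLaw (x : X) (n : ℕ) : (chainLaw P x).map (fun w => w n) = (P ^ n) x := by
  have : IsProbabilityMeasure ((chainLaw P x).map (fun w => w n)) :=
    Measure.isProbabilityMeasure_map (measurable_pi_apply n).aemeasurable
  ext A hA
  have h := integral_chainLaw (P := P) x n (BM.indicator hA (1 : ℝ))
  rw [← integral_map (φ := fun w : ℕ → X => w n) (measurable_pi_apply n).aemeasurable
      (BM.indicator hA (1 : ℝ)).sm.aestronglyMeasurable, integral_indicator_const _ hA,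
    integral_indicator_const _ hA] at h
  simp only [smul_eq_mul, mul_one, Measure.real] at h
  exact (ENNReal.toReal_eq_toReal_iff' (measure_ne_top _ _) (measure_ne_top _ _)).1 h

end Path

/-! ### Twisted transition operators -/

section Twist

variable {X : Type*} [MeasurableSpace X]

/-- The twisted transition operator `f ↦ e^{zF} P f`. -/
noncomputable def twist (P : Kernel X X) (F : X → ℝ) (z : ℂ) (f : X → ℂ) : X → ℂ :=
  fun x => Complex.exp (z * F x) * ∫ y, f y ∂P x

variable {P : Kernel X X} [IsMarkovKernel P] {F : X → ℝ}

theorem bm_exp (hF : Measurable F) (hF1 : ∀ x, |F x| ≤ 1) (z : ℂ) :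
    BM (fun x => Complex.exp (z * F x)) := by
  refine ⟨(Complex.measurable_exp.comp (measurable_const.mul
    (Complex.measurable_ofReal.comp hF))).stronglyMeasurable, Real.exp ‖z‖, fun x => ?_⟩
  rw [Complex.norm_exp]
  refine Real.exp_le_exp.2 ((Complex.re_le_norm _).trans ?_)
  rw [norm_mul, Complex.norm_real]
  exact mul_le_of_le_one_right (norm_nonneg _) (hF1 x)

theorem BM.twist (hF : Measurable F) (hF1 : ∀ x, |F x| ≤ 1) (z : ℂ) {f : X → ℂ} (hf : BM f) :
    BM (twist P F z f) :=
  (bm_exp hF hF1 z).mul (hf.integral_kernel P)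

theorem BM.twist_iterate (hF : Measurable F) (hF1 : ∀ x, |F x| ≤ 1) (z : ℂ) {f : X → ℂ}
    (hf : BM f) (n : ℕ) : BM ((MarkovEdgeworth.twist P F z)^[n] f) := by
  induction n generalizing f with
  | zero => exact hf
  | succ n ih => rw [Function.iterate_succ_apply]; exact ih (hf.twist hF hF1 z)

theorem measurable_partialSum (hF : Measurable F) (n : ℕ) : Measurable (partialSum F n) :=
  Finset.measurable_sum _ fun i _ => hF.comp (measurable_pi_apply i)

theorem abs_partialSum_le (hF1 : ∀ x, |F x| ≤ 1) (n : ℕ) (w : ℕ → X) : |partialSum F n w| ≤ n := by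
  refine (Finset.abs_sum_le_sum_abs _ _).trans ?_
  calc _ ≤ ∑ i ∈ Finset.range n, (1 : ℝ) := Finset.sum_le_sum fun i _ => hF1 _
    _ = n := by simp

theorem partialSum_succ (n : ℕ) (w : ℕ → X) :
    partialSum F (n + 1) w = partialSum F n w + F (w n) := Finset.sum_range_succ _ _

theorem bm_exp_partialSum (hF : Measurable F) (hF1 : ∀ x, |F x| ≤ 1) (z : ℂ) (n : ℕ) :
    BM (fun w : ℕ → X => Complex.exp (z * partialSum F n w)) := by
  refine ⟨(Complex.measurable_exp.comp (measurable_const.mul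
    (Complex.measurable_ofReal.comp (measurable_partialSum hF n)))).stronglyMeasurable,
      Real.exp (‖z‖ * n), fun x => ?_⟩
  rw [Complex.norm_exp]
  refine Real.exp_le_exp.2 ((Complex.re_le_norm _).trans ?_)
  rw [norm_mul, Complex.norm_real]
  exact mul_le_mul_of_nonneg_left (abs_partialSum_le hF1 n x) (norm_nonneg _)

/-- The Feynman–Kac representation of the iterates of the twisted operator. -/
theorem integral_exp_partialSum (hF : Measurable F) (hF1 : ∀ x, |F x| ≤ 1) (z : ℂ) (n : ℕ) (x : X)
    {f : X → ℂ} (hf : BM f) :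
    ∫ w, Complex.exp (z * partialSum F n w) * f (w n) ∂chainLaw P x =
      (twist P F z)^[n] f x := by
  induction n generalizing f with
  | zero =>
    simp only [partialSum, Finset.range_zero, Finset.sum_empty, Complex.ofReal_zero, mul_zero,
      Complex.exp_zero, one_mul, Function.iterate_zero, id]
    rw [integral_chainLaw x 0 hf, integral_pow_zero x hf.sm]
  | succ n ih =>
    rw [Function.iterate_succ_apply, ← ih (hf.twist hF hF1 z)]
    -- S_{n+1} involves only the coordinates up to n, so it factors through the finite window and
    -- the Markov property at time n applies. The default value 0 is never attained in the range of
    -- summation.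
    let S : (Finset.Iic n → X) → ℝ := fun p =>
      ∑ i ∈ Finset.range (n + 1), if h : i ≤ n then F (p ⟨i, Finset.mem_Iic.2 h⟩) else 0
    have hS : ∀ w : ℕ → X, S (Preorder.frestrictLe n w) = partialSum F (n + 1) w := by
      intro w
      refine Finset.sum_congr rfl fun i hi => ?_
      rw [dif_pos (Nat.lt_succ_iff.1 (Finset.mem_range.1 hi))]
      rfl
    have hSm : Measurable S := by
      refine Finset.measurable_sum _ fun i _ => ?_
      by_cases h : i ≤ n
      · simp only [h, dif_pos]; exact hF.comp (measurable_pi_apply _)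
      · simp only [h, dif_neg, not_false_iff]; exact measurable_const
    have hSb : ∀ p, |S p| ≤ (n + 1 : ℕ) := by
      intro p
      refine (Finset.abs_sum_le_sum_abs _ _).trans ?_
      calc _ ≤ ∑ i ∈ Finset.range (n + 1), (1 : ℝ) := Finset.sum_le_sum fun i _ => by
            split_ifs with h
            · exact hF1 _
            · simp
        _ = (n + 1 : ℕ) := by simp
    have hb : BM (fun p : (Finset.Iic n → X) => Complex.exp (z * S p)) := by
      refine ⟨(Complex.measurable_exp.comp (measurable_const.mul
        (Complex.measurable_ofReal.comp hSm))).stronglyMeasurable,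
          Real.exp (‖z‖ * (n + 1 : ℕ)), fun p => ?_⟩
      rw [Complex.norm_exp]
      refine Real.exp_le_exp.2 ((Complex.re_le_norm _).trans ?_)
      rw [norm_mul, Complex.norm_real]
      exact mul_le_mul_of_nonneg_left (hSb p) (norm_nonneg _)
    have h := integral_last_step (P := P) x n (g := fun p => Complex.exp (z * S p.1) * f p.2)
      ((hb.comp measurable_fst).mul (hf.comp measurable_snd))
    simp only [hS] at h
    rw [h]
    refine integral_congr_ae (ae_of_all _ fun w => ?_)
    simp only [twist]
    rw [integral_const_mul, partialSum_succ, Complex.ofReal_add, mul_add, Complex.exp_add]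
    ring

theorem norm_twist_le (t : ℝ) (f : X → ℂ) (x : X) :
    ‖twist P F (t * Complex.I) f x‖ ≤ ∫ y, ‖f y‖ ∂P x := by
  unfold twist
  rw [norm_mul]
  have : ‖Complex.exp (t * Complex.I * F x)‖ = 1 := by
    rw [show (t * Complex.I * F x : ℂ) = ((t * F x : ℝ) : ℂ) * Complex.I by push_cast; ring]
    exact Complex.norm_exp_ofReal_mul_I _
  rw [this, one_mul]
  exact norm_integral_le_integral_norm _

theorem norm_twist_iterate_le (hF : Measurable F) (hF1 : ∀ x, |F x| ≤ 1) (t : ℝ) {f : X → ℂ}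
    (hf : BM f) (n : ℕ) (x : X) :
    ‖(twist P F (t * Complex.I))^[n] f x‖ ≤ ∫ y, ‖f y‖ ∂(P ^ n) x := by
  induction n generalizing x with
  | zero => rw [integral_pow_zero x hf.norm.sm]; rfl
  | succ n ih =>
    rw [Function.iterate_succ_apply']
    refine (norm_twist_le _ _ _).trans ?_
    rw [integral_pow_add n 1 x (hf.norm.integrable _), pow_one]
    exact integral_mono ((hf.twist_iterate hF hF1 _ n).norm.integrable _)
      ((hf.norm.integral_kernel (P ^ n)).integrable _) fun y => ih y

end Twist

end MarkovEdgeworth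

/-! ### Consequences of drift and minorization -/

namespace MarkovEdgeworth

/-- The weights `(1 - e⁻¹) e⁻ᵏ` of the resolvent. -/
noncomputable def geomWeight (k : ℕ) : ℝ := (1 - Real.exp (-1)) * Real.exp (-(k : ℝ))

theorem geomWeight_pos (k : ℕ) : 0 < geomWeight k :=
  mul_pos (by rw [sub_pos, ← Real.exp_zero]; exact Real.exp_lt_exp.2 (by norm_num)) (Real.exp_pos _)

theorem hasSum_geomWeight : HasSum geomWeight 1 := by
  have h1 : Real.exp (-1) < 1 := by
    rw [← Real.exp_zero]; exact Real.exp_lt_exp.2 (by norm_num)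
  have h := (hasSum_geometric_of_lt_one (Real.exp_pos (-1)).le h1).mul_left (1 - Real.exp (-1))
  rw [mul_inv_cancel₀ (by linarith)] at h
  have e : geomWeight = fun i : ℕ => (1 - Real.exp (-1)) * Real.exp (-1) ^ i := by
    ext i
    rw [geomWeight, ← Real.exp_nat_mul]
    congr 2
    ring
  rw [e]
  exact h

/-- Drift and minorization data of a geometrically ergodic chain, with normalized constants. -/
structure DriftData {X : Type*} [MeasurableSpace X] (P : Kernel X X) (π ν : Measure X)
    (V s : X → ℝ) (δ b : ℝ) : Prop where
  invariant : Kernel.Invariant P π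
  prob : IsProbabilityMeasure ν
  measurable_V : Measurable V
  integrable_V : Integrable V π
  measurable_s : Measurable s
  one_le : ∀ x, 1 ≤ V x
  s_pos : ∀ x, 0 < s x
  s_le_one : ∀ x, s x ≤ 1
  δ_pos : 0 < δ
  δ_lt_one : δ < 1
  one_le_b : 1 ≤ b
  drift : ∀ x, ∫⁻ y, ENNReal.ofReal (V y) ∂(P x) ≤ ENNReal.ofReal ((1 - δ) * V x + b * s x)
  minor : ∀ x, ∀ A : Set X, MeasurableSet A → ENNReal.ofReal (s x) * ν A ≤ resolvent P x A

theorem IsGeometricallyErgodic.exists_driftData {X : Type*} [MeasurableSpace X] {P : Kernel X X}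
    {V : X → ℝ} (h : IsGeometricallyErgodic P V) {π : Measure X} [IsProbabilityMeasure π]
    (hπ : Kernel.Invariant P π) (hV : Integrable V π) :
    ∃ (ν : Measure X) (s : X → ℝ) (δ b : ℝ), DriftData P π ν V s δ b := by
  obtain ⟨ν, s, δ, b, h1, h2, h3, h4, h5, h6⟩ := h.drift
  -- Since V and s are positive, decreasing δ and increasing b only weakens the drift inequality.
  -- The normalization gives 0 < 1 - δ < 1 and δ / b ≤ 1.
  refine ⟨ν, s, min δ (1 / 2), max b 1, hπ, h1, h.measurable, hV, h2, h.one_le, fun x => (h3 x).1,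
    fun x => (h3 x).2, lt_min h4 (by norm_num), (min_le_right _ _).trans_lt (by norm_num),
    le_max_right _ _, fun x => (h5 x).trans (ENNReal.ofReal_le_ofReal ?_), h6⟩
  have := h.one_le x
  gcongr
  · exact min_le_left _ _
  · exact (h3 x).1.le
  · exact le_max_left _ _

namespace DriftData

variable {X : Type*} [MeasurableSpace X] {P : Kernel X X} [IsMarkovKernel P] {π ν : Measure X}
  [IsProbabilityMeasure π] {V s : X → ℝ} {δ b : ℝ}

theorem bm_s (H : DriftData P π ν V s δ b) : BM s :=
  BM.of_measurable_le H.measurable_s (C := 1) fun x => by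
    rw [abs_of_pos (H.s_pos x)]; exact H.s_le_one x

theorem V_pos (H : DriftData P π ν V s δ b) (x : X) : 0 < V x := one_pos.trans_le (H.one_le x)

theorem b_pos (H : DriftData P π ν V s δ b) : 0 < b := one_pos.trans_le H.one_le_b

theorem lintegral_pow_succ_le (H : DriftData P π ν V s δ b) (n : ℕ) (x : X) :
    ∫⁻ y, ENNReal.ofReal (V y) ∂(P ^ (n + 1)) x ≤
      ∫⁻ y, ENNReal.ofReal ((1 - δ) * V y + b * s y) ∂(P ^ n) x := by
  rw [add_comm n 1, lintegral_pow_add 1 n x H.measurable_V.ennreal_ofReal, pow_one]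
  exact lintegral_mono fun y => H.drift y

theorem integrable_V_pow (H : DriftData P π ν V s δ b) (n : ℕ) (x : X) :
    Integrable V ((P ^ n) x) := by
  induction n with
  | zero =>
    rw [pow_zero]
    change Integrable V (Kernel.id x)
    rw [Kernel.id_apply]
    exact integrable_dirac' H.measurable_V.stronglyMeasurable (by simp)
  | succ n ih =>
    refine ⟨H.measurable_V.aestronglyMeasurable, ?_⟩
    rw [hasFiniteIntegral_iff_ofReal (ae_of_all _ fun y => (H.V_pos y).le)]
    refine (H.lintegral_pow_succ_le n x).trans_lt ?_
    have hi : Integrable (fun y => (1 - δ) * V y + b * s y) ((P ^ n) x) :=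
      (ih.const_mul _).add ((H.bm_s.integrable _).const_mul _)
    refine hi.hasFiniteIntegral.trans_le' (lintegral_mono fun y => ?_)
    rw [← ofReal_norm]
    exact ENNReal.ofReal_le_ofReal (le_abs_self _)

theorem integral_V_pow_succ_le (H : DriftData P π ν V s δ b) (n : ℕ) (x : X) :
    ∫ y, V y ∂(P ^ (n + 1)) x ≤ (1 - δ) * ∫ y, V y ∂(P ^ n) x + b * ∫ y, s y ∂(P ^ n) x := by
  have hi : Integrable (fun y => (1 - δ) * V y + b * s y) ((P ^ n) x) :=
    ((H.integrable_V_pow n x).const_mul _).add ((H.bm_s.integrable _).const_mul _)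
  have hn : ∀ y, 0 ≤ (1 - δ) * V y + b * s y := fun y =>
    add_nonneg (mul_nonneg (by linarith [H.δ_lt_one]) (H.V_pos y).le)
      (mul_nonneg H.b_pos.le (H.s_pos y).le)
  have h := H.lintegral_pow_succ_le n x
  rw [← ofReal_integral_eq_lintegral_ofReal (H.integrable_V_pow _ x)
    (ae_of_all _ fun y => (H.V_pos y).le), ← ofReal_integral_eq_lintegral_ofReal hi
    (ae_of_all _ hn), ENNReal.ofReal_le_ofReal_iff (integral_nonneg hn),
    integral_add ((H.integrable_V_pow n x).const_mul _) ((H.bm_s.integrable _).const_mul _),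
    integral_const_mul, integral_const_mul] at h
  exact h

/-- The visits to s are kept explicitly rather than bounded by 1. As P^n V ≥ 1, the inequality can
be read backwards: for n large, the discounted sum of the P^i s is bounded below by nearly 1 / b. -/
theorem integral_V_pow_le_sum (H : DriftData P π ν V s δ b) (n : ℕ) (x : X) :
    ∫ y, V y ∂(P ^ n) x ≤ (1 - δ) ^ n * V x +
      b * ∑ i ∈ Finset.range n, (1 - δ) ^ (n - 1 - i) * ∫ y, s y ∂(P ^ i) x := by
  have h0 : 0 ≤ 1 - δ := by linarith [H.δ_lt_one]
  induction n with
  | zero => rw [integral_pow_zero x H.measurable_V.stronglyMeasurable]; simp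
  | succ n ih =>
    refine (H.integral_V_pow_succ_le n x).trans ?_
    have e : ∑ i ∈ Finset.range (n + 1), (1 - δ) ^ (n + 1 - 1 - i) * ∫ y, s y ∂(P ^ i) x =
        (1 - δ) * ∑ i ∈ Finset.range n, (1 - δ) ^ (n - 1 - i) * ∫ y, s y ∂(P ^ i) x +
          ∫ y, s y ∂(P ^ n) x := by
      rw [Finset.sum_range_succ, Finset.mul_sum]
      congr 1
      · refine Finset.sum_congr rfl fun i hi => ?_
        rw [← mul_assoc, ← pow_succ']
        congr 2
        have := Finset.mem_range.1 hi
        omega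
      · simp
    rw [e]
    calc _ ≤ (1 - δ) * ((1 - δ) ^ n * V x +
          b * ∑ i ∈ Finset.range n, (1 - δ) ^ (n - 1 - i) * ∫ y, s y ∂(P ^ i) x) +
            b * ∫ y, s y ∂(P ^ n) x := by gcongr
      _ = _ := by ring

theorem sum_pow_le (H : DriftData P π ν V s δ b) (n : ℕ) :
    ∑ i ∈ Finset.range n, (1 - δ) ^ (n - 1 - i) ≤ 1 / δ := by
  rw [Finset.sum_range_reflect (fun i => (1 - δ) ^ i) n]
  have h0 : 0 ≤ 1 - δ := by linarith [H.δ_lt_one]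
  have h := (summable_geometric_of_lt_one h0 (by linarith [H.δ_pos])).sum_le_tsum
    (Finset.range n) (fun i _ => pow_nonneg h0 i)
  rw [tsum_geometric_of_lt_one h0 (by linarith [H.δ_pos])] at h
  simpa using h

theorem integral_V_pow_le (H : DriftData P π ν V s δ b) (n : ℕ) (x : X) :
    ∫ y, V y ∂(P ^ n) x ≤ (1 - δ) ^ n * V x + b / δ := by
  refine (H.integral_V_pow_le_sum n x).trans ?_
  have h0 : 0 ≤ 1 - δ := by linarith [H.δ_lt_one]
  have : ∑ i ∈ Finset.range n, (1 - δ) ^ (n - 1 - i) * ∫ y, s y ∂(P ^ i) x ≤ 1 / δ := by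
    refine le_trans (Finset.sum_le_sum fun i _ => ?_) (H.sum_pow_le n)
    refine mul_le_of_le_one_right (pow_nonneg h0 _) ?_
    calc ∫ y, s y ∂(P ^ i) x ≤ ∫ y, (1 : ℝ) ∂(P ^ i) x :=
          integral_mono (H.bm_s.integrable _) (integrable_const _) H.s_le_one
      _ = 1 := by simp
  have := mul_le_mul_of_nonneg_left this H.b_pos.le
  rw [mul_one_div] at this
  linarith

theorem integral_V_pow_le' (H : DriftData P π ν V s δ b) (n : ℕ) (x : X) :
    ∫ y, V y ∂(P ^ n) x ≤ (1 + b / δ) * V x := by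
  refine (H.integral_V_pow_le n x).trans ?_
  have h0 : 0 ≤ 1 - δ := by linarith [H.δ_lt_one]
  have h1 : (1 - δ) ^ n * V x ≤ 1 * V x :=
    mul_le_mul_of_nonneg_right (pow_le_one₀ h0 (by linarith [H.δ_pos])) (H.V_pos x).le
  have h2 : b / δ * 1 ≤ b / δ * V x :=
    mul_le_mul_of_nonneg_left (H.one_le x) (div_pos H.b_pos H.δ_pos).le
  linarith

theorem lintegral_minor (H : DriftData P π ν V s δ b) (x : X) (g : X → ENNReal) :
    ENNReal.ofReal (s x) * ∫⁻ y, g y ∂ν ≤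
      ∑' k, ENNReal.ofReal (geomWeight k) * ∫⁻ y, g y ∂(P ^ k) x := by
  have hle : ENNReal.ofReal (s x) • ν ≤ resolvent P x := by
    refine Measure.le_iff.2 fun A hA => ?_
    rw [Measure.smul_apply, smul_eq_mul]
    exact H.minor x A hA
  have h := lintegral_mono' hle (le_refl g)
  rw [lintegral_smul_measure] at h
  refine h.trans (le_of_eq ?_)
  unfold resolvent
  rw [lintegral_sum_measure]
  simp_rw [lintegral_smul_measure]
  rfl

/-- If `P^k g ≤ a k` for all `k`, the minorization bounds `ν(g)`. -/
theorem integral_minor_le (H : DriftData P π ν V s δ b) (x : X) {g : X → ℝ}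
    (hg : Measurable g) (hg0 : ∀ y, 0 ≤ g y) (hgk : ∀ k, Integrable g ((P ^ k) x)) {a : ℕ → ℝ}
    {A : ℝ} (ha : ∀ k, ∫ y, g y ∂(P ^ k) x ≤ a k)
    (hA : HasSum (fun k => geomWeight k * a k) A) :
    Integrable g ν ∧ s x * ∫ y, g y ∂ν ≤ A := by
  have ha0 : ∀ k, 0 ≤ a k := fun k => (integral_nonneg hg0).trans (ha k)
  have h := H.lintegral_minor x fun y => ENNReal.ofReal (g y)
  have h2 : ∑' k, ENNReal.ofReal (geomWeight k) * ∫⁻ y, ENNReal.ofReal (g y) ∂(P ^ k) x ≤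
      ENNReal.ofReal A := by
    rw [← hA.tsum_eq, ENNReal.ofReal_tsum_of_nonneg
      (fun k => mul_nonneg (geomWeight_pos k).le (ha0 k)) hA.summable]
    refine ENNReal.tsum_le_tsum fun k => ?_
    rw [ENNReal.ofReal_mul (geomWeight_pos k).le,
      ← ofReal_integral_eq_lintegral_ofReal (hgk k) (ae_of_all _ hg0)]
    gcongr
    exact ha k
  have h3 := h.trans h2
  have hs : ENNReal.ofReal (s x) ≠ 0 := by simpa using H.s_pos x
  have hfin : ∫⁻ y, ENNReal.ofReal (g y) ∂ν ≠ ⊤ := by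
    intro htop
    rw [htop, ENNReal.mul_top hs] at h3
    exact ENNReal.ofReal_ne_top (top_le_iff.1 h3)
  have hi : Integrable g ν := by
    refine ⟨hg.aestronglyMeasurable, ?_⟩
    rw [hasFiniteIntegral_iff_ofReal (ae_of_all _ hg0)]
    exact hfin.lt_top
  refine ⟨hi, ?_⟩
  rw [← ofReal_integral_eq_lintegral_ofReal hi (ae_of_all _ hg0),
    ← ENNReal.ofReal_mul (H.s_pos x).le] at h3
  have hA0 : 0 ≤ A := hA.nonneg fun k => mul_nonneg (geomWeight_pos k).le (ha0 k)
  exact (ENNReal.ofReal_le_ofReal_iff hA0).1 h3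

/-- A set charged by `ν` is reached from everywhere. -/
theorem exists_pow_pos (H : DriftData P π ν V s δ b) (x : X) {A : Set X} (hA : MeasurableSet A)
    (hν : ν A ≠ 0) : ∃ k, (P ^ k) x A ≠ 0 := by
  by_contra! hc
  have h := H.lintegral_minor x (A.indicator 1)
  simp_rw [lintegral_indicator_one hA, hc] at h
  simp only [mul_zero, tsum_zero, nonpos_iff_eq_zero, mul_eq_zero, ENNReal.ofReal_eq_zero, hν,
    or_false] at h
  exact absurd (H.s_pos x) (not_lt.2 h)

end DriftData

end MarkovEdgeworth

/-! ### Subharmonic functions and irreducibility of π -/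

namespace MarkovEdgeworth

variable {X : Type*} [MeasurableSpace X] {P : Kernel X X} [IsMarkovKernel P] {π ν : Measure X}
  [IsProbabilityMeasure π] {V s : X → ℝ} {δ b : ℝ}

theorem le_integral_pow_of_subharmonic {f : X → ℝ} (hf : BM f) (h : ∀ x, f x ≤ ∫ y, f y ∂P x)
    (n : ℕ) (x : X) : f x ≤ ∫ y, f y ∂(P ^ n) x := by
  induction n with
  | zero => rw [integral_pow_zero x hf.sm]
  | succ n ih =>
    rw [add_comm n 1, integral_pow_add 1 n x (hf.integrable _), pow_one]
    exact ih.trans (integral_mono (hf.integrable _) ((hf.integral_kernel P).integrable _) h)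

namespace DriftData

/-- An absorbing set which is charged by `ν` is `π`-full. -/
theorem measure_compl_eq_zero_of_absorbing (H : DriftData P π ν V s δ b) {Z : Set X}
    (hZ : MeasurableSet Z) (hν : ν Z ≠ 0) (habs : ∀ x ∈ Z, ∀ n, (P ^ n) x Zᶜ = 0) :
    π Zᶜ = 0 := by
  -- Split π(Z) = ∫ P^n(x, Z) dπ over Z and its complement. The part over Z is already π(Z), so
  -- nothing enters Z from outside. But the minorization reaches Z from every state, so the outside
  -- is null.
  have key : ∀ n, ∀ᵐ x ∂π, x ∈ Zᶜ → (P ^ n) x Z = 0 := by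
    intro n
    have h1 : ∫⁻ x, (P ^ n) x Z ∂π = π Z := by
      have := lintegral_invariant (invariant_pow H.invariant n)
        (measurable_one.indicator hZ (f := (1 : X → ENNReal)))
      simpa [lintegral_indicator_one hZ] using this
    rw [← lintegral_add_compl _ hZ] at h1
    have h2 : ∫⁻ x in Z, (P ^ n) x Z ∂π = π Z := by
      calc ∫⁻ x in Z, (P ^ n) x Z ∂π = ∫⁻ x in Z, 1 ∂π := by
            refine setLIntegral_congr_fun hZ fun x hx => ?_
            exact (prob_compl_eq_zero_iff hZ).1 (habs x hx n)
        _ = π Z := by simp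
    rw [h2] at h1
    have h3 : ∫⁻ x in Zᶜ, (P ^ n) x Z ∂π = 0 := by
      have hfin : π Z ≠ ⊤ := measure_ne_top _ _
      rwa [← add_zero (π Z), add_assoc, zero_add, ENNReal.add_right_inj hfin] at h1
    rw [lintegral_eq_zero_iff (Kernel.measurable_coe _ hZ)] at h3
    exact (ae_restrict_iff' hZ.compl).1 h3
  have h := ae_all_iff.2 key
  rw [← compl_compl Zᶜ]
  change ∀ᵐ x ∂π, x ∈ Zᶜᶜ
  filter_upwards [h] with x hx
  by_contra hc
  rw [compl_compl] at hc
  obtain ⟨k, hk⟩ := H.exists_pow_pos x hZ hν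
  exact hk (hx k hc)

/-- Let g be the gap between f and its supremum; g is superharmonic, so s · ν(g) ≤ g by
minorization. If ν(g) > 0 this would bound g away from zero everywhere, because the chain keeps
visiting s. So ν(g) = 0, and {g = 0} is an absorbing set charged by ν, hence π-full: the π-mean of f
is its supremum. -/
theorem subharmonic_le_integral (H : DriftData P π ν V s δ b) {f : X → ℝ} (hf : BM f)
    (h : ∀ x, f x ≤ ∫ y, f y ∂P x) (x : X) : f x ≤ ∫ y, f y ∂π := by
  have : Nonempty X := ⟨x⟩
  have := H.prob
  obtain ⟨C, hC⟩ := hf.bdd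
  have hbdd : BddAbove (Set.range f) := ⟨C, by rintro _ ⟨y, rfl⟩; exact (le_abs_self _).trans (hC y)⟩
  set D := ⨆ y, f y with hD
  have hfD : ∀ y, f y ≤ D := fun y => le_ciSup hbdd y
  set g : X → ℝ := fun y => D - f y with hg
  have hgB : BM g := (BM.const D).sub hf
  have hg0 : ∀ y, 0 ≤ g y := fun y => sub_nonneg.2 (hfD y)
  have hgP : ∀ n y, ∫ z, g z ∂(P ^ n) y ≤ g y := by
    intro n y
    rw [hg, integral_sub (integrable_const _) (hf.integrable _)]
    simp only [integral_const, probReal_univ, one_smul]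
    linarith [le_integral_pow_of_subharmonic hf h n y]
  have hsg : ∀ y, s y * ∫ z, g z ∂ν ≤ g y := by
    intro y
    have hs : HasSum (fun k => geomWeight k * g y) (g y) := by
      simpa using hasSum_geomWeight.mul_right (g y)
    exact (H.integral_minor_le y hgB.sm.measurable hg0 (fun k => hgB.integrable _)
      (fun k => hgP k y) hs).2
  set q := ∫ z, g z ∂ν with hq
  have hq0 : q = 0 := by
    by_contra hne
    have hqpos : 0 < q := lt_of_le_of_ne (integral_nonneg hg0) (Ne.symm hne)
    -- Insert s ≤ g / q and P^i g ≤ g into 1 ≤ P^n V ≤ (1-δ)^n V + b Σ (1-δ)^{n-1-i} P^i s and let n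
    -- → ∞.
    have hlow : ∀ y, δ * q / b ≤ g y := by
      intro y
      have h1 : ∀ n : ℕ, 1 ≤ (1 - δ) ^ n * V y + b * (1 / δ * (g y / q)) := by
        intro n
        have hV1 : 1 ≤ ∫ z, V z ∂(P ^ n) y := by
          calc (1 : ℝ) = ∫ z, (1 : ℝ) ∂(P ^ n) y := by simp
            _ ≤ _ := integral_mono (integrable_const _) (H.integrable_V_pow n y) H.one_le
        refine hV1.trans ((H.integral_V_pow_le_sum n y).trans ?_)
        have h0 : 0 ≤ 1 - δ := by linarith [H.δ_lt_one]
        have hgq : 0 ≤ g y / q := div_nonneg (hg0 y) hqpos.le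
        have : ∑ i ∈ Finset.range n, (1 - δ) ^ (n - 1 - i) * ∫ z, s z ∂(P ^ i) y ≤
            1 / δ * (g y / q) := by
          refine le_trans (Finset.sum_le_sum fun i _ => ?_)
            (le_trans (Finset.sum_mul _ _ _).symm.le
              (mul_le_mul_of_nonneg_right (H.sum_pow_le n) hgq))
          refine mul_le_mul_of_nonneg_left ?_ (pow_nonneg h0 _)
          rw [le_div_iff₀ hqpos, ← integral_mul_const]
          exact (integral_mono ((H.bm_s.integrable _).mul_const _) (hgB.integrable _) hsg).trans
            (hgP i y)
        have := mul_le_mul_of_nonneg_left this H.b_pos.le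
        linarith
      have ht : Tendsto (fun n : ℕ => (1 - δ) ^ n * V y + b * (1 / δ * (g y / q))) atTop
          (𝓝 (0 * V y + b * (1 / δ * (g y / q)))) :=
        ((tendsto_pow_atTop_nhds_zero_of_lt_one (by linarith [H.δ_lt_one])
          (by linarith [H.δ_pos])).mul_const _).add_const _
      have h2 := ge_of_tendsto' ht h1
      rw [zero_mul, zero_add] at h2
      have hb := H.b_pos
      have hd := H.δ_pos
      have h3 : b * (1 / δ * (g y / q)) = g y / (δ * q / b) := by field_simp
      rw [h3, le_div_iff₀ (by positivity), one_mul] at h2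
      exact h2
    have hpos : 0 < δ * q / b := div_pos (mul_pos H.δ_pos hqpos) H.b_pos
    have : D ≤ D - δ * q / b := ciSup_le fun y => by
      have := hlow y
      simp only [hg] at this
      linarith
    linarith
  -- Absorbing because P^n g ≤ g vanishes at its points and g ≥ 0.
  set Z : Set X := {y | g y = 0} with hZ
  have hZm : MeasurableSet Z := hgB.sm.measurable (measurableSet_singleton 0)
  have hνZ : ν Z ≠ 0 := by
    have hae : g =ᵐ[ν] 0 := (integral_eq_zero_iff_of_nonneg hg0 (hgB.integrable _)).1 hq0
    have : ν Zᶜ = 0 := hae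
    rw [prob_compl_eq_zero_iff hZm] at this
    simp [this]
  have habs : ∀ y ∈ Z, ∀ n, (P ^ n) y Zᶜ = 0 := by
    intro y hy n
    have h1 : ∫ z, g z ∂(P ^ n) y = 0 :=
      le_antisymm ((hgP n y).trans (le_of_eq hy)) (integral_nonneg hg0)
    exact (integral_eq_zero_iff_of_nonneg hg0 (hgB.integrable _)).1 h1
  have hπZ := H.measure_compl_eq_zero_of_absorbing hZm hνZ habs
  have hfae : f =ᵐ[π] fun _ => D := by
    have : ∀ᵐ y ∂π, y ∈ Z := hπZ
    filter_upwards [this] with y hy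
    have : D - f y = 0 := hy
    linarith
  rw [integral_congr_ae hfae]
  simpa using hfD x

/-- By invariance a π-null set is never hit from π-almost every state, whereas a set charged by ν is
hit from every state. -/
theorem absolutelyContinuous (H : DriftData P π ν V s δ b) : ν ≪ π := by
  refine Measure.AbsolutelyContinuous.mk fun A hA hπA => ?_
  by_contra hν
  have key : ∀ n, ∀ᵐ x ∂π, (P ^ n) x A = 0 := by
    intro n
    have h1 : ∫⁻ x, (P ^ n) x A ∂π = π A := by
      have := lintegral_invariant (invariant_pow H.invariant n)
        (measurable_one.indicator hA (f := (1 : X → ENNReal)))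
      simpa [lintegral_indicator_one hA] using this
    rw [hπA, lintegral_eq_zero_iff (Kernel.measurable_coe _ hA)] at h1
    exact h1
  obtain ⟨x, hx⟩ := (ae_all_iff.2 key).exists
  obtain ⟨k, hk⟩ := H.exists_pow_pos x hA hν
  exact hk (hx k)

/-- The indicator of the set Z of states that never reach A is subharmonic. If Z contained a point,
then 1 ≤ π(Z), so A would be unreachable from π-almost everywhere, and invariance would give π(A) =
0. -/
theorem isIrreducible (H : DriftData P π ν V s δ b) : Kernel.IsIrreducible π P := by
  refine ⟨fun A hA hπA x => ?_⟩
  by_contra! hc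
  set Z : Set X := {z | ∀ n, (P ^ n) z A = 0} with hZ
  have hZm : MeasurableSet Z := by
    rw [hZ, Set.ofPred_forall]
    exact MeasurableSet.iInter fun n => Kernel.measurable_coe _ hA (measurableSet_singleton 0)
  have hsub : ∀ z, Z.indicator (fun _ => (1 : ℝ)) z ≤ ∫ y, Z.indicator (fun _ => (1 : ℝ)) y ∂P z := by
    intro z
    by_cases hz : z ∈ Z
    · have h1 : ∀ᵐ y ∂P z, y ∈ Z := by
        refine ae_all_iff.2 fun n => ?_
        have h2 : (P ^ (n + 1)) z A = 0 := hz (n + 1)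
        have h3 : ∫⁻ y, (P ^ n) y A ∂P z = 0 := by
          have := Kernel.pow_add_apply_eq_lintegral P 1 n z hA
          rw [pow_one, add_comm, h2] at this
          exact this.symm
        rwa [lintegral_eq_zero_iff (Kernel.measurable_coe _ hA)] at h3
      have h4 : ∫ y, Z.indicator (fun _ => (1 : ℝ)) y ∂P z = ∫ y, (1 : ℝ) ∂P z :=
        integral_congr_ae (by filter_upwards [h1] with y hy; simp [hy])
      rw [h4]; simp [hz]
    · rw [Set.indicator_of_notMem hz]
      exact integral_nonneg fun y => Set.indicator_nonneg (fun _ _ => zero_le_one) _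
  have h1 := H.subharmonic_le_integral (BM.indicator hZm (1 : ℝ)) hsub x
  have hx : x ∈ Z := fun n => le_antisymm (hc n) zero_le
  rw [Set.indicator_of_mem hx, integral_indicator_const _ hZm, smul_eq_mul, mul_one] at h1
  have h2 : π Z = 1 := by
    refine le_antisymm prob_le_one ?_
    rw [← ENNReal.ofReal_one, ← ofReal_measureReal]
    exact ENNReal.ofReal_le_ofReal h1
  have h3 : ∀ᵐ y ∂π, y ∈ Z := (prob_compl_eq_zero_iff hZm).2 h2
  have h4 : ∫⁻ y, (P ^ 1) y A ∂π = π A := by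
    have := lintegral_invariant (invariant_pow H.invariant 1)
      (measurable_one.indicator hA (f := (1 : X → ENNReal)))
    simpa [lintegral_indicator_one hA] using this
  have h5 : ∫⁻ y, (P ^ 1) y A ∂π = ∫⁻ y, 0 ∂π :=
    lintegral_congr_ae (by filter_upwards [h3] with y hy using hy 1)
  rw [h5, lintegral_zero] at h4
  exact hπA.ne h4

end DriftData

/-! ### Jointly measurable Lebesgue and Hahn decompositions -/

section Decomposition

variable [MeasurableSpace.CountablyGenerated X] (π) (κ : Kernel X X) [IsMarkovKernel κ]

/-- A measurable choice of sets carrying the singular parts of a kernel. -/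
theorem exists_singular_set : ∃ S : Set (X × X), MeasurableSet S ∧ ∀ x,
    π (Prod.mk x ⁻¹' S) = 0 ∧
      ∀ A, MeasurableSet A → π A = 0 → κ x A ≤ κ x (Prod.mk x ⁻¹' S) := by
  refine ⟨κ.mutuallySingularSet (Kernel.const X π), Kernel.measurableSet_mutuallySingularSet _ _,
    fun x => ⟨?_, fun A hA hπA => ?_⟩⟩
  · have h := Kernel.measure_mutuallySingularSetSlice κ (Kernel.const X π) x
    rw [Kernel.const_apply] at h
    exact h
  · have hdec := Kernel.rnDeriv_add_singularPart κ (Kernel.const X π)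
    set S := κ.mutuallySingularSetSlice (Kernel.const X π) x
    have hSm : MeasurableSet S := Kernel.measurableSet_mutuallySingularSetSlice _ _ _
    have happ : ∀ B, κ x B = (Kernel.withDensity (Kernel.const X π) (κ.rnDeriv (Kernel.const X π))) x B +
        κ.singularPart (Kernel.const X π) x B := by
      intro B
      conv_lhs => rw [← hdec]
      rfl
    have h1 : (Kernel.withDensity (Kernel.const X π) (κ.rnDeriv (Kernel.const X π))) x A = 0 := by
      rw [Kernel.withDensity_apply' _ (Kernel.measurable_rnDeriv _ _)]
      exact setLIntegral_measure_zero _ _ (by simpa using hπA)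
    rw [happ A, h1, zero_add, happ]
    refine le_trans ?_ le_add_self
    have h2 := Kernel.singularPart_compl_mutuallySingularSetSlice κ (Kernel.const X π) x
    change κ.singularPart (Kernel.const X π) x A ≤ κ.singularPart (Kernel.const X π) x S
    calc _ ≤ κ.singularPart (Kernel.const X π) x (S ∪ Sᶜ) := measure_mono (by simp)
      _ ≤ κ.singularPart (Kernel.const X π) x S + κ.singularPart (Kernel.const X π) x Sᶜ :=
        measure_union_le _ _
      _ = _ := by rw [h2, add_zero]

/-- The reference measure κ x + π dominates κ x for every x, and the density can be chosen
measurable in both variables. -/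
theorem exists_density_add : ∃ r : X × X → ℝ, Measurable r ∧ (∀ p, 0 ≤ r p) ∧
    (∀ x, ∀ᵐ y ∂(κ x + π), r (x, y) ≤ 1) ∧ ∀ x A, MeasurableSet A →
      ∫⁻ y in A, ENNReal.ofReal (r (x, y)) ∂(κ x + π) = κ x A := by
  have hle : κ ≤ κ + Kernel.const X π := le_add_of_nonneg_right bot_le
  refine ⟨fun p => Kernel.rnDerivAux κ (κ + Kernel.const X π) p.1 p.2,
    Kernel.measurable_rnDerivAux _ _, fun p => Kernel.rnDerivAux_nonneg hle,
    fun x => Kernel.rnDerivAux_le_one hle,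
    fun x A hA => Kernel.setLIntegral_rnDerivAux κ (Kernel.const X π) x hA⟩

/-- A measurable choice of Hahn sets for `π - κ x`. -/
theorem exists_hahn_set : ∃ S : Set (X × X), MeasurableSet S ∧ ∀ x, ∀ A, MeasurableSet A →
    π.real A - (κ x).real A ≤ π.real (Prod.mk x ⁻¹' S) - (κ x).real (Prod.mk x ⁻¹' S) := by
  obtain ⟨R, hRm, hR0, hR1, hRA⟩ := exists_density_add π κ
  -- With respect to κ x + π, the measure π has density 1 - r and κ x has density r; the difference
  -- 1 - 2r is positive exactly where r < 1/2.
  refine ⟨{p | R p < 1 / 2}, measurableSet_lt hRm measurable_const, fun x => ?_⟩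
  obtain ⟨r, hr⟩ : ∃ r : X → ℝ, r = fun y => R (x, y) := ⟨_, rfl⟩
  have hr0 : ∀ y, 0 ≤ r y := fun y => by rw [hr]; exact hR0 _
  have hr1 : ∀ᵐ y ∂(κ x + π), r y ≤ 1 := by rw [hr]; exact hR1 x
  have hrx : Measurable r := by rw [hr]; exact hRm.comp measurable_prodMk_left
  have hri : Integrable r (κ x + π) := by
    refine Integrable.of_bound hrx.aestronglyMeasurable 1 ?_
    filter_upwards [hr1] with y hy
    rwa [Real.norm_of_nonneg (hr0 y)]
  have h1 : ∀ A, MeasurableSet A → ∫ y in A, r y ∂(κ x + π) = (κ x).real A := by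
    intro A hA
    rw [integral_eq_lintegral_of_nonneg_ae (ae_of_all _ hr0) hrx.aestronglyMeasurable, hr,
      hRA x A hA]
    rfl
  have h2 : ∀ A, MeasurableSet A →
      ∫ y in A, (1 - 2 * r y) ∂(κ x + π) = π.real A - (κ x).real A := by
    intro A hA
    rw [integral_sub (integrable_const _) (hri.integrableOn.const_mul 2), integral_const_mul, h1 A hA]
    simp only [integral_const, smul_eq_mul, mul_one, measureReal_restrict_apply_univ]
    rw [measureReal_add_apply]; ring
  intro A hA
  have hE : MeasurableSet {y | r y < 1 / 2} := measurableSet_lt hrx measurable_const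
  have hint : Integrable (fun y => 1 - 2 * r y) (κ x + π) :=
    (integrable_const _).sub (hri.const_mul 2)
  have hS : Prod.mk x ⁻¹' {p | R p < 1 / 2} = {y | r y < 1 / 2} := by rw [hr]; rfl
  rw [hS]
  rw [← h2 A hA, ← h2 _ hE, ← integral_indicator hA, ← integral_indicator hE]
  refine integral_mono (hint.indicator hA) (hint.indicator hE) fun y => ?_
  by_cases h3 : r y < 1 / 2
  · have h4 : y ∈ {y | r y < 1 / 2} := h3
    rw [Set.indicator_of_mem h4]
    by_cases h5 : y ∈ A
    · rw [Set.indicator_of_mem h5]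
    · rw [Set.indicator_of_notMem h5]; linarith
  · have h4 : y ∉ {y | r y < 1 / 2} := h3
    rw [Set.indicator_of_notMem h4]
    by_cases h5 : y ∈ A
    · rw [Set.indicator_of_mem h5]; linarith
    · rw [Set.indicator_of_notMem h5]

end Decomposition

end MarkovEdgeworth

/-! ### Vanishing of the singular part of P^n(x,·) -/

namespace MarkovEdgeworth

variable {X : Type*} [MeasurableSpace X] {P : Kernel X X} [IsMarkovKernel P] {π ν : Measure X}
  [IsProbabilityMeasure π] {V s : X → ℝ} {δ b : ℝ}

theorem ae_pow_eq_zero (hπ : Kernel.Invariant P π) {A : Set X} (hA : MeasurableSet A)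
    (hπA : π A = 0) (n : ℕ) : ∀ᵐ x ∂π, (P ^ n) x A = 0 := by
  have h1 : ∫⁻ x, (P ^ n) x A ∂π = π A := by
    have := lintegral_invariant (invariant_pow hπ n)
      (measurable_one.indicator hA (f := (1 : X → ENNReal)))
    simpa [lintegral_indicator_one hA] using this
  rw [hπA, lintegral_eq_zero_iff (Kernel.measurable_coe _ hA)] at h1
  exact h1

theorem measureReal_pow_add (m n : ℕ) (x : X) {A : Set X} (hA : MeasurableSet A) :
    ((P ^ (m + n)) x).real A = ∫ y, ((P ^ m) y).real A ∂(P ^ n) x := by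
  have := integral_pow_add (P := P) m n x (f := A.indicator fun _ => (1 : ℝ))
    ((BM.indicator hA 1).integrable _)
  simpa [integral_indicator_const _ hA] using this

theorem bm_measureReal (κ : Kernel X X) [IsMarkovKernel κ] {S : Set (X × X)}
    (hS : MeasurableSet S) : BM (fun x => (κ x).real (Prod.mk x ⁻¹' S)) :=
  BM.of_measurable_le (Kernel.measurable_kernel_prodMk_left hS).ennreal_toReal (C := 1) fun x => by
    rw [abs_of_nonneg measureReal_nonneg]; exact measureReal_le_one

theorem bm_measureReal' (κ : Kernel X X) [IsMarkovKernel κ] {S : Set X}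
    (hS : MeasurableSet S) : BM (fun x => (κ x).real S) :=
  BM.of_measurable_le (Kernel.measurable_coe κ hS).ennreal_toReal (C := 1) fun x => by
    rw [abs_of_nonneg measureReal_nonneg]; exact measureReal_le_one

theorem DriftData.integral_s_pos (H : DriftData P π ν V s δ b) : 0 < ∫ x, s x ∂π := by
  rw [integral_pos_iff_support_of_nonneg (fun x => (H.s_pos x).le) (H.bm_s.integrable _)]
  have : Function.support s = Set.univ := by
    ext x; simp [(H.s_pos x).ne']
  rw [this]; simp

/-- The mass of the part of `P^n x` singular to `π` tends to zero, for every `x`. -/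
theorem DriftData.exists_singular_bound [MeasurableSpace.CountablyGenerated X]
    (H : DriftData P π ν V s δ b) : ∃ σ : ℕ → X → ℝ,
      (∀ n x A, MeasurableSet A → π A = 0 → ((P ^ n) x).real A ≤ σ n x) ∧
      ∀ x, Tendsto (fun n => σ n x) atTop (𝓝 0) := by
  have := H.prob
  choose S hSm hS using fun n => exists_singular_set π (P ^ n)
  set σ : ℕ → X → ℝ := fun n x => ((P ^ n) x).real (Prod.mk x ⁻¹' S n) with hσ
  have hSx : ∀ n x, MeasurableSet (Prod.mk x ⁻¹' S n) := fun n x => measurable_prodMk_left (hSm n)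
  have hmax : ∀ n x A, MeasurableSet A → π A = 0 → ((P ^ n) x).real A ≤ σ n x := by
    intro n x A hA hπA
    exact ENNReal.toReal_mono (measure_ne_top _ _) ((hS n x).2 A hA hπA)
  refine ⟨σ, hmax, ?_⟩
  have hBM : ∀ n, BM (σ n) := fun n => bm_measureReal (P ^ n) (hSm n)
  have h0 : ∀ n x, 0 ≤ σ n x := fun n x => measureReal_nonneg
  have h1 : ∀ n x, σ n x ≤ 1 := fun n x => measureReal_le_one
  -- null sets are avoided from almost every starting point
  have hnull : ∀ n A, MeasurableSet A → π A = 0 → π {y | (P ^ n) y A ≠ 0} = 0 :=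
    fun n A hA hπA => ae_pow_eq_zero H.invariant hA hπA n
  have hNm : ∀ n A, MeasurableSet A → MeasurableSet {y | (P ^ n) y A ≠ 0} := fun n A hA =>
    (Kernel.measurable_coe (P ^ n) hA (measurableSet_singleton 0)).compl
  -- Reaching a π-null set A in one more step requires being at time n in {y | P(y, A) > 0}, which
  -- is again π-null, so its mass is at most the singular mass at time n.
  have hanti : ∀ x, Antitone fun n => σ n x := by
    intro x
    refine antitone_nat_of_succ_le fun n => ?_
    have e : σ (n + 1) x = ∫ y, ((P ^ 1) y).real (Prod.mk x ⁻¹' S (n + 1)) ∂(P ^ n) x := by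
      rw [← measureReal_pow_add 1 n x (hSx _ _), add_comm 1 n]
    rw [e]
    set A := Prod.mk x ⁻¹' S (n + 1)
    set N := {y | (P ^ 1) y A ≠ 0}
    have hN := hNm 1 A (hSx _ _)
    calc ∫ y, ((P ^ 1) y).real A ∂(P ^ n) x ≤ ∫ y, N.indicator (fun _ => (1 : ℝ)) y ∂(P ^ n) x := by
          refine integral_mono ((bm_measureReal' (P ^ 1) (hSx _ _)).integrable _)
            ((BM.indicator hN 1).integrable _) fun y => ?_
          by_cases hy : y ∈ N
          · simp only [Set.indicator_of_mem hy]; exact measureReal_le_one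
          · simp only [Set.indicator_of_notMem hy]
            have : (P ^ 1) y A = 0 := by
              by_contra hne
              exact hy hne
            rw [Measure.real, this, ENNReal.toReal_zero]
      _ = ((P ^ n) x).real N := by rw [integral_indicator_const _ hN, smul_eq_mul, mul_one]
      _ ≤ σ n x := hmax n x N hN (hnull 1 A (hSx _ _) (hS _ _).1)
  set τ : X → ℝ := fun x => ⨅ n, σ n x with hτ
  have hlim : ∀ x, Tendsto (fun n => σ n x) atTop (𝓝 (τ x)) := fun x =>
    tendsto_atTop_ciInf (hanti x) ⟨0, by rintro _ ⟨n, rfl⟩; exact h0 n x⟩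
  have hτ0 : ∀ x, 0 ≤ τ x := fun x => le_ciInf fun n => h0 n x
  have hτ1 : ∀ x, τ x ≤ 1 := fun x => le_of_tendsto' (hlim x) fun n => h1 n x
  have hτB : BM τ := ⟨stronglyMeasurable_of_tendsto atTop (fun n => (hBM n).sm)
    (tendsto_pi_nhds.2 hlim), 1, fun x => by rw [Real.norm_of_nonneg (hτ0 x)]; exact hτ1 x⟩
  have hDCT : ∀ (μ : Measure X) [IsFiniteMeasure μ],
      Tendsto (fun n => ∫ y, σ n y ∂μ) atTop (𝓝 (∫ y, τ y ∂μ)) := by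
    intro μ _
    refine tendsto_integral_of_dominated_convergence (fun _ => 1)
      (fun n => (hBM n).sm.aestronglyMeasurable) (integrable_const _)
      (fun n => ae_of_all _ fun y => ?_) (ae_of_all _ hlim)
    rw [Real.norm_of_nonneg (h0 n y)]; exact h1 n y
  -- The first step can be integrated out: σ_{n+1} ≤ P σ_n. The limit τ is therefore subharmonic and
  -- bounded by its π-mean c.
  have hsub : ∀ x, τ x ≤ ∫ y, τ y ∂P x := by
    intro x
    refine le_of_tendsto_of_tendsto' ((tendsto_add_atTop_iff_nat 1).2 (hlim x)) (hDCT (P x))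
      fun n => ?_
    have e : σ (n + 1) x = ∫ y, ((P ^ n) y).real (Prod.mk x ⁻¹' S (n + 1)) ∂P x := by
      have := measureReal_pow_add (P := P) n 1 x (hSx (n + 1) x)
      rwa [pow_one] at this
    rw [e]
    exact integral_mono ((bm_measureReal' (P ^ n) (hSx _ _)).integrable _) ((hBM n).integrable _)
      fun y => hmax n y _ (hSx _ _) (hS _ _).1
  set c := ∫ y, τ y ∂π with hc
  have hτc : ∀ x, τ x ≤ c := H.subharmonic_le_integral hτB hsub
  have hc0 : 0 ≤ c := integral_nonneg hτ0
  -- Singular mass at time n + k must pass at time k through a fixed π-null set N, so τ(x) ≤ c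
  -- P^k(x, N) for all k. Averaging over k with the resolvent weights, the minorization gives N a
  -- mass at most 1 - s(x), since ν(N) = 0. Integrating against π then leaves c ≤ c - cπ(s), and c =
  -- 0.
  have hkey : ∀ x, τ x ≤ c * (1 - s x) := by
    intro x
    set N : Set X := ⋃ p : ℕ × ℕ, {y | (P ^ p.1) y (Prod.mk x ⁻¹' S (p.1 + p.2)) ≠ 0} with hN
    have hNmeas : MeasurableSet N := MeasurableSet.iUnion fun p => hNm _ _ (hSx _ _)
    have hNnull : π N = 0 := measure_iUnion_null fun p => hnull _ _ (hSx _ _) (hS _ _).1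
    have hk : ∀ k, τ x ≤ c * ((P ^ k) x).real N := by
      intro k
      have hb : ∀ n, σ (n + k) x ≤ ∫ y in N, σ n y ∂(P ^ k) x := by
        intro n
        have e : σ (n + k) x = ∫ y, ((P ^ n) y).real (Prod.mk x ⁻¹' S (n + k)) ∂(P ^ k) x :=
          measureReal_pow_add (P := P) n k x (hSx (n + k) x)
        rw [e, ← integral_indicator hNmeas]
        refine integral_mono ((bm_measureReal' (P ^ n) (hSx _ _)).integrable _)
          (((hBM n).integrable _).indicator hNmeas) fun y => ?_
        by_cases hy : y ∈ N
        · simp only [Set.indicator_of_mem hy]; exact hmax n y _ (hSx _ _) (hS _ _).1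
        · simp only [Set.indicator_of_notMem hy]
          have : (P ^ n) y (Prod.mk x ⁻¹' S (n + k)) = 0 := by
            by_contra hne
            exact hy (Set.mem_iUnion.2 ⟨(n, k), hne⟩)
          simp [Measure.real, this]
      have h2 := le_of_tendsto_of_tendsto' ((tendsto_add_atTop_iff_nat k).2 (hlim x))
        (hDCT (((P ^ k) x).restrict N)) hb
      refine h2.trans ?_
      calc ∫ y in N, τ y ∂(P ^ k) x ≤ ∫ y in N, c ∂(P ^ k) x :=
            integral_mono (hτB.integrable _) (integrable_const _) hτc
        _ = _ := by simp [mul_comm]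
    have hg : BM (Nᶜ.indicator fun _ => c) := BM.indicator hNmeas.compl c
    have hsum : HasSum (fun k => geomWeight k * (c - τ x)) (c - τ x) := by
      simpa using hasSum_geomWeight.mul_right (c - τ x)
    have h3 := (H.integral_minor_le x hg.sm.measurable
      (fun y => Set.indicator_nonneg (fun _ _ => hc0) y) (fun k => hg.integrable _)
      (a := fun _ => c - τ x) (fun k => by
        rw [integral_indicator_const _ hNmeas.compl, probReal_compl_eq_one_sub hNmeas, smul_eq_mul]
        linarith [hk k]) hsum).2
    rw [integral_indicator_const _ hNmeas.compl, probReal_compl_eq_one_sub hNmeas] at h3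
    have hνN : ν.real N = 0 := by simp [Measure.real, H.absolutelyContinuous hNnull]
    rw [hνN] at h3
    simp only [sub_zero, one_smul] at h3
    linarith
  have hcle : c ≤ c - c * ∫ x, s x ∂π := by
    have h4 : ∫ x, τ x ∂π ≤ ∫ x, (c - c * s x) ∂π :=
      integral_mono (hτB.integrable _) ((integrable_const _).sub ((H.bm_s.integrable _).const_mul c))
        fun x => by have := hkey x; linarith
    rw [integral_sub (integrable_const _) ((H.bm_s.integrable _).const_mul c),
      integral_const_mul, integral_const, probReal_univ, one_smul] at h4
    exact h4
  have hc' : c = 0 := by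
    have := H.integral_s_pos
    nlinarith
  intro x
  have : τ x = 0 := le_antisymm ((hτc x).trans hc'.le) (hτ0 x)
  rw [← this]
  exact hlim x

/-! ### Weak compactness against L¹(π) -/

section Weak

theorem cauchySeq_of_approx {E : Type*} [PseudoMetricSpace E] {u : ℕ → E}
    (h : ∀ ε > 0, ∃ v : ℕ → E, CauchySeq v ∧ ∀ᶠ k in atTop, dist (u k) (v k) ≤ ε) :
    CauchySeq u := by
  refine Metric.cauchySeq_iff.2 fun ε hε => ?_
  obtain ⟨v, hv, huv⟩ := h (ε / 4) (by positivity)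
  obtain ⟨N, hN⟩ := Metric.cauchySeq_iff.1 hv (ε / 4) (by positivity)
  obtain ⟨M, hM⟩ := eventually_atTop.1 huv
  refine ⟨max N M, fun m hm n hn => ?_⟩
  have h1 := hM m (le_trans (le_max_right _ _) hm)
  have h2 := hM n (le_trans (le_max_right _ _) hn)
  have h3 := hN m (le_trans (le_max_left _ _) hm) n (le_trans (le_max_left _ _) hn)
  have h4 := dist_triangle4 (u m) (v m) (v n) (u n)
  rw [dist_comm (v n)] at h4
  linarith

/-- Simultaneous weak sequential compactness of countably many bounded sequences. -/
theorem exists_subseq_weak_cauchy [MeasurableSpace.CountablyGenerated X] {J : Type*} [Countable J]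
    (h : ℕ → J → X → ℂ) (hB : ∀ n j, BM (h n j)) (h1 : ∀ n j x, ‖h n j x‖ ≤ 1) :
    ∃ φ : ℕ → ℕ, StrictMono φ ∧ ∀ j, ∀ w : X → ℝ, Integrable w π →
      CauchySeq fun k => ∫ x, w x • h (φ k) j x ∂π := by
  have : Fact ((1 : ENNReal) ≠ ⊤) := ⟨ENNReal.one_ne_top⟩
  let W : ℕ → Lp ℝ 1 π := TopologicalSpace.denseSeq (Lp ℝ 1 π)
  have hint : ∀ (w : X → ℝ), Integrable w π → ∀ n j, Integrable (fun x => w x • h n j x) π := by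
    intro w hw n j
    exact hw.smul_bdd 1 (hB n j).sm.aestronglyMeasurable (ae_of_all _ (h1 n j))
  have hbd : ∀ (w : X → ℝ), Integrable w π → ∀ n j, ‖∫ x, w x • h n j x ∂π‖ ≤ ∫ x, ‖w x‖ ∂π := by
    intro w hw n j
    refine norm_integral_le_of_norm_le hw.norm (ae_of_all _ fun x => ?_)
    rw [norm_smul]
    exact mul_le_of_le_one_right (norm_nonneg _) (h1 n j x)
  have hWi : ∀ i, Integrable (W i) π := fun i => L1.integrable_coeFn (W i)
  let a : ℕ → (J × ℕ → ℂ) := fun n p => ∫ x, W p.2 x • h n p.1 x ∂π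
  -- The pairings with a countable dense subset of L¹(π), for all j at once, form a point of a
  -- countable product of discs, which is sequentially compact; this replaces a diagonal extraction.
  have hK : IsCompact (Set.univ.pi fun p : J × ℕ => 
      Metric.closedBall (0 : ℂ) (∫ x, ‖W p.2 x‖ ∂π)) :=
    isCompact_univ_pi fun p => isCompact_closedBall _ _
  obtain ⟨l, -, φ, hφ, hl⟩ := hK.tendsto_subseq (x := a) fun n => by
    intro p _
    rw [mem_closedBall_zero_iff]
    exact hbd _ (hWi _) _ _
  refine ⟨φ, hφ, fun j w hw => cauchySeq_of_approx fun ε hε => ?_⟩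
  obtain ⟨i, hi⟩ := (TopologicalSpace.denseRange_denseSeq (Lp ℝ 1 π)).exists_dist_lt
    (hw.toL1 w) hε
  refine ⟨fun k => a (φ k) (j, i), ((tendsto_pi_nhds.1 hl) (j, i)).cauchySeq,
    Eventually.of_forall fun k => ?_⟩
  rw [dist_eq_norm]
  change ‖∫ x, w x • h (φ k) j x ∂π - ∫ x, W i x • h (φ k) j x ∂π‖ ≤ ε
  rw [← integral_sub (hint w hw _ _) (hint _ (hWi i) _ _)]
  simp_rw [← sub_smul]
  refine (hbd (fun x => w x - W i x) (hw.sub (hWi i)) _ _).trans ?_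
  refine le_of_eq_of_le ?_ hi.le
  rw [dist_eq_norm, L1.norm_eq_integral_norm]
  refine integral_congr_ae ?_
  filter_upwards [Lp.coeFn_sub (hw.toL1 w) (W i), hw.coeFn_toL1] with x hx1 hx2
  change _ = ‖(hw.toL1 w - W i) x‖
  rw [hx1, Pi.sub_apply, hx2]

/-- Weak convergence controls integrals against measures up to their singular mass. -/
theorem exists_cauchy_approx_integral {μ : Measure X} [IsFiniteMeasure μ] {τ : ℝ}
    (hμ : ∀ A, MeasurableSet A → π A = 0 → μ.real A ≤ τ) {u : ℕ → X → ℂ} (hB : ∀ k, BM (u k))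
    (h1 : ∀ k x, ‖u k x‖ ≤ 1)
    (hu : ∀ w : X → ℝ, Integrable w π → CauchySeq fun k => ∫ x, w x • u k x ∂π) :
    ∃ v : ℕ → ℂ, CauchySeq v ∧ ∀ k, ‖∫ x, u k x ∂μ - v k‖ ≤ τ := by
  refine ⟨fun k => ∫ x, (μ.rnDeriv π x).toReal • u k x ∂π, hu _ Measure.integrable_toReal_rnDeriv,
    fun k => ?_⟩
  have hdec := Measure.haveLebesgueDecomposition_add μ π
  have e : ∫ x, u k x ∂μ = ∫ x, u k x ∂(μ.singularPart π) +
      ∫ x, (μ.rnDeriv π x).toReal • u k x ∂π := by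
    conv_lhs => rw [hdec]
    rw [integral_add_measure ((hB k).integrable _) ((hB k).integrable _),
      integral_withDensity_eq_integral_toReal_smul (Measure.measurable_rnDeriv _ _)
        (Measure.rnDeriv_lt_top _ _)]
  rw [e, add_sub_cancel_right]
  refine (norm_integral_le_of_norm_le_const (ae_of_all _ (h1 k))).trans ?_
  rw [one_mul]
  obtain ⟨N, hN, hN1, hN2⟩ := (Measure.mutuallySingular_singularPart μ π)
  have hle : (μ.singularPart π).real Set.univ ≤ (μ.singularPart π).real Nᶜ := by
    rw [← Set.union_compl_self N]
    refine (measureReal_union_le _ _).trans ?_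
    simp [Measure.real, hN1]
  refine hle.trans (le_trans ?_ (hμ _ hN.compl hN2))
  exact ENNReal.toReal_mono (measure_ne_top _ _) (Measure.singularPart_le μ π _)

end Weak

/-! ### Twisted iterates applied to weakly convergent sequences -/

section Representation

variable {F : X → ℝ}

/-- The weight depends on the whole path up to time m, yet its effect on functions of the state at
time m is that of a measure dominated by P^m(x,·). In particular its singular mass is no larger. -/
theorem exists_weighted_marginal (x : X) (m : ℕ) {ψ : (ℕ → X) → ℝ} (hψ : Measurable ψ)
    (h0 : ∀ w, 0 ≤ ψ w) (h1 : ∀ w, ψ w ≤ 1) : ∃ μ : Measure X, IsFiniteMeasure μ ∧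
      (∀ A, MeasurableSet A → μ.real A ≤ ((P ^ m) x).real A) ∧
      ∀ f : X → ℂ, BM f → ∫ y, f y ∂μ = ∫ w, (ψ w : ℂ) * f (w m) ∂chainLaw P x := by
  set ρ := (chainLaw P x).withDensity fun w => ENNReal.ofReal (ψ w) with hρ
  have hle : ρ ≤ chainLaw P x := by
    conv_rhs => rw [← withDensity_one (μ := chainLaw P x)]
    exact withDensity_mono (ae_of_all _ fun w => by simpa using h1 w)
  have hfin : IsFiniteMeasure ρ := isFiniteMeasure_of_le _ hle
  have hm : Measurable fun w : ℕ → X => w m := measurable_pi_apply m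
  refine ⟨ρ.map fun w => w m, inferInstance, fun A hA => ?_, fun f hf => ?_⟩
  · rw [← map_chainLaw]
    exact ENNReal.toReal_mono (measure_ne_top _ _) (Measure.map_mono hle hm A)
  · rw [integral_map hm.aemeasurable hf.sm.aestronglyMeasurable, hρ,
      integral_withDensity_eq_integral_toReal_smul hψ.ennreal_ofReal (ae_of_all _ fun _ => by simp)]
    refine integral_congr_ae (ae_of_all _ fun w => ?_)
    simp only [ENNReal.toReal_ofReal (h0 w), Complex.real_smul]

/-- The iterates of the twisted operator at an imaginary parameter nearly preserve weak
convergence. -/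
theorem exists_cauchy_approx_twist (hF : Measurable F) (hF1 : ∀ x, |F x| ≤ 1) (t : ℝ) (m : ℕ)
    (x : X) {τ : ℝ} (hτ : ∀ A, MeasurableSet A → π A = 0 → ((P ^ m) x).real A ≤ τ)
    {u : ℕ → X → ℂ} (hB : ∀ k, BM (u k)) (h1 : ∀ k x, ‖u k x‖ ≤ 1)
    (hu : ∀ w : X → ℝ, Integrable w π → CauchySeq fun k => ∫ x, w x • u k x ∂π) :
    ∃ v : ℕ → ℂ, CauchySeq v ∧
      ∀ k, ‖(twist P F (t * Complex.I))^[m] (u k) x - v k‖ ≤ 4 * τ := by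
  have hS : Measurable fun w : ℕ → X => t * partialSum F m w :=
    (measurable_partialSum hF m).const_mul t
  have key : ∀ ψ : (ℕ → X) → ℝ, Measurable ψ → (∀ w, 0 ≤ ψ w) → (∀ w, ψ w ≤ 1) →
      ∃ v : ℕ → ℂ, CauchySeq v ∧
        ∀ k, ‖∫ w, (ψ w : ℂ) * u k (w m) ∂chainLaw P x - v k‖ ≤ τ := by
    intro ψ hψ h0 h1'
    obtain ⟨μ, hμ, hμle, hμi⟩ := exists_weighted_marginal (P := P) x m hψ h0 h1'
    obtain ⟨v, hv, hvk⟩ := exists_cauchy_approx_integral (μ := μ) 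
      (fun A hA hπA => (hμle A hA).trans (hτ A hA hπA)) hB h1 hu
    exact ⟨v, hv, fun k => by rw [← hμi _ (hB k)]; exact hvk k⟩
  have hcos : Measurable fun w : ℕ → X => Real.cos (t * partialSum F m w) :=
    Real.measurable_cos.comp hS
  have hsin : Measurable fun w : ℕ → X => Real.sin (t * partialSum F m w) :=
    Real.measurable_sin.comp hS
  set c := fun w : ℕ → X => Real.cos (t * partialSum F m w)
  set d := fun w : ℕ → X => Real.sin (t * partialSum F m w)
  -- The phase e^{itS_m} is split into the positive and negative parts of its cosine and sine, four
  -- weights with values in [0, 1], each contributing one τ to the error.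
  obtain ⟨v₁, hv₁, hk₁⟩ := key (fun w => max (c w) 0) (hcos.max measurable_const)
    (fun w => le_max_right _ _) fun w => max_le (Real.cos_le_one _) zero_le_one
  obtain ⟨v₂, hv₂, hk₂⟩ := key (fun w => max (-c w) 0) (hcos.neg.max measurable_const)
    (fun w => le_max_right _ _) fun w => max_le (by linarith [Real.neg_one_le_cos (t * partialSum F m w)]) zero_le_one
  obtain ⟨v₃, hv₃, hk₃⟩ := key (fun w => max (d w) 0) (hsin.max measurable_const)
    (fun w => le_max_right _ _) fun w => max_le (Real.sin_le_one _) zero_le_one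
  obtain ⟨v₄, hv₄, hk₄⟩ := key (fun w => max (-d w) 0) (hsin.neg.max measurable_const)
    (fun w => le_max_right _ _) fun w => max_le (by linarith [Real.neg_one_le_sin (t * partialSum F m w)]) zero_le_one
  refine ⟨fun k => (v₁ k - v₂ k) + Complex.I * (v₃ k - v₄ k), ?_, fun k => ?_⟩
  · obtain ⟨l₁, h₁⟩ := cauchySeq_tendsto_of_complete hv₁
    obtain ⟨l₂, h₂⟩ := cauchySeq_tendsto_of_complete hv₂
    obtain ⟨l₃, h₃⟩ := cauchySeq_tendsto_of_complete hv₃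
    obtain ⟨l₄, h₄⟩ := cauchySeq_tendsto_of_complete hv₄
    exact ((h₁.sub h₂).add ((h₃.sub h₄).const_mul _)).cauchySeq
  · rw [← integral_exp_partialSum hF hF1 _ m x (hB k)]
    have hbm : ∀ ψ : (ℕ → X) → ℝ, Measurable ψ → (∀ w, 0 ≤ ψ w) → (∀ w, ψ w ≤ 1) →
        Integrable (fun w => (ψ w : ℂ) * u k (w m)) (chainLaw P x) := fun ψ hψ h0 h1' =>
      (BM.mul (BM.of_measurable_le hψ (C := 1) fun w => by
        rw [abs_of_nonneg (h0 w)]; exact h1' w).ofReal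
        ((hB k).comp (measurable_pi_apply m))).integrable _
    have i₁ := hbm (fun w => max (c w) 0) (hcos.max measurable_const)
      (fun w => le_max_right _ _) fun w => max_le (Real.cos_le_one _) zero_le_one
    have i₂ := hbm (fun w => max (-c w) 0) (hcos.neg.max measurable_const)
      (fun w => le_max_right _ _) fun w => max_le (by linarith [Real.neg_one_le_cos (t * partialSum F m w)]) zero_le_one
    have i₃ := hbm (fun w => max (d w) 0) (hsin.max measurable_const)
      (fun w => le_max_right _ _) fun w => max_le (Real.sin_le_one _) zero_le_one
    have i₄ := hbm (fun w => max (-d w) 0) (hsin.neg.max measurable_const)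
      (fun w => le_max_right _ _) fun w => max_le (by linarith [Real.neg_one_le_sin (t * partialSum F m w)]) zero_le_one
    have e : ∫ w, Complex.exp (t * Complex.I * partialSum F m w) * u k (w m) ∂chainLaw P x =
        (∫ w, ((max (c w) 0 : ℝ) : ℂ) * u k (w m) ∂chainLaw P x -
          ∫ w, ((max (-c w) 0 : ℝ) : ℂ) * u k (w m) ∂chainLaw P x) +
        Complex.I * (∫ w, ((max (d w) 0 : ℝ) : ℂ) * u k (w m) ∂chainLaw P x -
          ∫ w, ((max (-d w) 0 : ℝ) : ℂ) * u k (w m) ∂chainLaw P x) := by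
      rw [← integral_sub i₁ i₂, ← integral_sub i₃ i₄, ← integral_const_mul]
      refine Eq.trans ?_ (integral_add (i₁.sub i₂) ((i₃.sub i₄).const_mul _))
      refine integral_congr_ae (ae_of_all _ fun w => ?_)
      have hpm : ∀ a : ℝ, ((max a 0 : ℝ) : ℂ) - ((max (-a) 0 : ℝ) : ℂ) = a := fun a => by
        rw [← Complex.ofReal_sub, max_zero_sub_eq_self]
      simp only
      rw [← sub_mul, ← sub_mul, hpm, hpm,
        show (t * Complex.I * partialSum F m w : ℂ) = ((t * partialSum F m w : ℝ) : ℂ) * Complex.I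
          by push_cast; ring, Complex.exp_mul_I, ← Complex.ofReal_cos, ← Complex.ofReal_sin]
      ring
    rw [e]
    set a₁ := ∫ w, ((max (c w) 0 : ℝ) : ℂ) * u k (w m) ∂chainLaw P x
    set a₂ := ∫ w, ((max (-c w) 0 : ℝ) : ℂ) * u k (w m) ∂chainLaw P x
    set a₃ := ∫ w, ((max (d w) 0 : ℝ) : ℂ) * u k (w m) ∂chainLaw P x
    set a₄ := ∫ w, ((max (-d w) 0 : ℝ) : ℂ) * u k (w m) ∂chainLaw P x
    have e2 : a₁ - a₂ + Complex.I * (a₃ - a₄) - (v₁ k - v₂ k + Complex.I * (v₃ k - v₄ k)) =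
        ((a₁ - v₁ k) - (a₂ - v₂ k)) + Complex.I * ((a₃ - v₃ k) - (a₄ - v₄ k)) := by ring
    rw [e2]
    refine (norm_add_le _ _).trans ?_
    rw [norm_mul, Complex.norm_I, one_mul]
    have n1 := norm_sub_le (a₁ - v₁ k) (a₂ - v₂ k)
    have n2 := norm_sub_le (a₃ - v₃ k) (a₄ - v₄ k)
    linarith [hk₁ k, hk₂ k, hk₃ k, hk₄ k]

end Representation

end MarkovEdgeworth

/-! ### Bi-infinite orbits of constant L¹ norm -/

namespace MarkovEdgeworth

variable {X : Type*} [MeasurableSpace X] {P : Kernel X X} [IsMarkovKernel P] {π ν : Measure X}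
  [IsProbabilityMeasure π] {V s : X → ℝ} {δ b : ℝ} {F : X → ℝ}

theorem integral_norm_le_one {f : X → ℂ} (h1 : ∀ x, ‖f x‖ ≤ 1) (hf : BM f) :
    ∫ x, ‖f x‖ ∂π ≤ 1 := by
  calc ∫ x, ‖f x‖ ∂π ≤ ∫ x, (1 : ℝ) ∂π :=
        integral_mono (hf.norm.integrable _) (integrable_const _) h1
    _ = 1 := by simp

theorem integral_norm_twist_iterate_le (hπ : Kernel.Invariant P π) (hF : Measurable F)
    (hF1 : ∀ x, |F x| ≤ 1) (t : ℝ) {f : X → ℂ} (hf : BM f) (n : ℕ) :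
    ∫ x, ‖(twist P F (t * Complex.I))^[n] f x‖ ∂π ≤ ∫ x, ‖f x‖ ∂π := by
  calc _ ≤ ∫ x, ∫ y, ‖f y‖ ∂(P ^ n) x ∂π :=
        integral_mono ((hf.twist_iterate hF hF1 _ n).norm.integrable _)
          ((hf.norm.integral_kernel _).integrable _) (norm_twist_iterate_le hF hF1 t hf n)
    _ = _ := integral_invariant (invariant_pow hπ n) (hf.norm.integrable _)

theorem tendsto_twist {u : ℕ → X → ℂ} {g : X → ℂ} (hB : ∀ k, BM (u k)) (h1 : ∀ k x, ‖u k x‖ ≤ 1)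
    (hu : ∀ x, Tendsto (fun k => u k x) atTop (𝓝 (g x))) (z : ℂ) (x : X) :
    Tendsto (fun k => twist P F z (u k) x) atTop (𝓝 (twist P F z g x)) :=
  (tendsto_integral_of_dominated_convergence (fun _ => 1)
    (fun n => (hB n).sm.aestronglyMeasurable) (integrable_const _)
    (fun n => ae_of_all _ (h1 n)) (ae_of_all _ hu)).const_mul _

/-- If the iterates of the twisted operator do not contract a class `𝓕` in `L¹(π)`, there is a
bi-infinite orbit in `𝓕` of constant positive `L¹(π)` norm. -/
theorem DriftData.exists_biinfinite_orbit [MeasurableSpace.CountablyGenerated X]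
    (H : DriftData P π ν V s δ b) (hF : Measurable F) (hF1 : ∀ x, |F x| ≤ 1) (t : ℝ)
    (𝓕 : (X → ℂ) → Prop) (h𝓕 : ∀ f, 𝓕 f → BM f ∧ ∀ x, ‖f x‖ ≤ 1)
    (hQ : ∀ f, 𝓕 f → 𝓕 (twist P F (t * Complex.I) f))
    (hlim : ∀ (u : ℕ → X → ℂ) (g : X → ℂ), (∀ n, 𝓕 (u n)) →
      (∀ x, Tendsto (fun n => u n x) atTop (𝓝 (g x))) → 𝓕 g)
    {b₀ : ℝ} (hb₀ : 0 < b₀)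
    (hb : ∀ n, ∃ f, 𝓕 f ∧ b₀ ≤ ∫ x, ‖(twist P F (t * Complex.I))^[n] f x‖ ∂π) :
    ∃ (g : ℤ → X → ℂ) (c : ℝ), 0 < c ∧ ∀ j, 𝓕 (g j) ∧
      twist P F (t * Complex.I) (g j) = g (j + 1) ∧ ∫ x, ‖g j x‖ ∂π = c := by
  set Q := twist P F (t * Complex.I) with hQdef
  have hQn : ∀ n f, 𝓕 f → 𝓕 (Q^[n] f) := by
    intro n f hf
    induction n with
    | zero => exact hf
    | succ n ih => rw [Function.iterate_succ_apply']; exact hQ _ ih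
  obtain ⟨σ, hσ, hσlim⟩ := H.exists_singular_bound
  let A : ℕ → Set ℝ := fun n => {r | ∃ f, 𝓕 f ∧ r = ∫ x, ‖Q^[n] f x‖ ∂π}
  have hAbdd : ∀ n, BddAbove (A n) := fun n => ⟨1, by
    rintro _ ⟨f, hf, rfl⟩
    have := h𝓕 _ (hQn n f hf)
    exact integral_norm_le_one this.2 this.1⟩
  have hAne : ∀ n, (A n).Nonempty := fun n => by
    obtain ⟨f, hf, -⟩ := hb n
    exact ⟨_, f, hf, rfl⟩
  set β : ℕ → ℝ := fun n => sSup (A n) with hβ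
  have hβle : ∀ n f, 𝓕 f → ∫ x, ‖Q^[n] f x‖ ∂π ≤ β n := fun n f hf =>
    le_csSup (hAbdd n) ⟨f, hf, rfl⟩
  have hβ0 : ∀ n, b₀ ≤ β n := fun n => by
    obtain ⟨f, hf, h⟩ := hb n
    exact h.trans (hβle n f hf)
  have hβanti : Antitone β := antitone_nat_of_succ_le fun n => by
    refine csSup_le (hAne _) ?_
    rintro _ ⟨f, hf, rfl⟩
    rw [Function.iterate_succ_apply]
    exact hβle n _ (hQ f hf)
  set c := ⨅ n, β n with hc
  have hβlim : Tendsto β atTop (𝓝 c) :=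
    tendsto_atTop_ciInf hβanti ⟨b₀, by rintro _ ⟨n, rfl⟩; exact hβ0 n⟩
  have hcpos : 0 < c := hb₀.trans_le (le_ciInf hβ0)
  -- Near-optimality at time 2n leaves n steps of past and n steps of future around time n.
  have hchoose : ∀ n : ℕ, ∃ f, 𝓕 f ∧ β (2 * n) - 1 / ((n : ℝ) + 1) ≤ ∫ x, ‖Q^[2 * n] f x‖ ∂π := by
    intro n
    have hlt : β (2 * n) - 1 / ((n : ℝ) + 1) < sSup (A (2 * n)) := by
      have : 0 < 1 / ((n : ℝ) + 1) := by positivity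
      change _ < β (2 * n)
      linarith
    obtain ⟨_, ⟨f, hf, rfl⟩, h⟩ := exists_lt_of_lt_csSup (hAne _) hlt
    exact ⟨f, hf, h.le⟩
  choose f hf hfβ using hchoose
  -- The orbit of f_n recentred at time n. The truncation in `toNat` matters only while n < -j,
  -- hence not in the limit.
  let h : ℕ → ℤ → X → ℂ := fun n j => Q^[((n : ℤ) + j).toNat] (f n)
  have hh𝓕 : ∀ n j, 𝓕 (h n j) := fun n j => hQn _ _ (hf n)
  have hhB : ∀ n j, BM (h n j) := fun n j => (h𝓕 _ (hh𝓕 n j)).1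
  have hh1 : ∀ n j x, ‖h n j x‖ ≤ 1 := fun n j => (h𝓕 _ (hh𝓕 n j)).2
  have hhQ : ∀ (n : ℕ) (j : ℤ) (m : ℕ), 0 ≤ (n : ℤ) + j → Q^[m] (h n j) = h n (j + m) := by
    intro n j m hnj
    change Q^[m] (Q^[_] (f n)) = Q^[_] (f n)
    rw [← Function.iterate_add_apply]
    congr 1
    omega
  obtain ⟨φ, hφ, hweak⟩ := exists_subseq_weak_cauchy (π := π) h hhB hh1
  -- Weak convergence improves to pointwise convergence: the function at j is the m-th twisted
  -- iterate of the one at j - m, and that iterate turns weak Cauchy sequences into pointwise Cauchy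
  -- ones up to 4σ_m(x), which is arbitrarily small.
  have hcauchy : ∀ j x, CauchySeq fun k => h (φ k) j x := by
    intro j x
    refine cauchySeq_of_approx fun ε hε => ?_
    have hev : ∀ᶠ m in atTop, σ m x < ε / 4 := (hσlim x).eventually (gt_mem_nhds (by positivity))
    obtain ⟨m, hm⟩ := hev.exists
    obtain ⟨v, hv, hvk⟩ := exists_cauchy_approx_twist (P := P) hF hF1 t m x
      (fun A hA hπA => hσ m x A hA hπA) (fun k => hhB (φ k) (j - m))
      (fun k => hh1 (φ k) (j - m)) (hweak (j - m))
    refine ⟨v, hv, ?_⟩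
    filter_upwards [hφ.tendsto_atTop.eventually_ge_atTop ((m : ℤ) - j).toNat] with k hk
    have e := hhQ (φ k) (j - m) m (by omega)
    rw [sub_add_cancel] at e
    rw [← e, dist_eq_norm]
    exact (hvk k).trans (by linarith)
  choose g hg using fun j x => cauchySeq_tendsto_of_complete (hcauchy j x)
  refine ⟨g, c, hcpos, fun j => ⟨hlim _ _ (fun k => hh𝓕 (φ k) j) (hg j), ?_, ?_⟩⟩
  · funext x
    have h1 := tendsto_twist (P := P) (F := F) (fun k => hhB (φ k) j) (fun k => hh1 (φ k) j) (hg j)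
      (t * Complex.I) x
    refine tendsto_nhds_unique h1 ((hg (j + 1) x).congr' ?_)
    filter_upwards [hφ.tendsto_atTop.eventually_ge_atTop (-j).toNat] with k hk
    have e := hhQ (φ k) j 1 (by omega)
    exact (congrFun e x).symm
  · have h1 : Tendsto (fun k => ∫ x, ‖h (φ k) j x‖ ∂π) atTop (𝓝 (∫ x, ‖g j x‖ ∂π)) :=
      tendsto_integral_of_dominated_convergence (fun _ => 1)
        (fun n => (hhB (φ n) j).norm.sm.aestronglyMeasurable) (integrable_const _)
        (fun n => ae_of_all _ fun x => by simpa using hh1 (φ n) j x)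
        (ae_of_all _ fun x => (hg j x).norm)
    -- The norm at n + j is at most β(n + j), and at least the norm at the later time 2n because
    -- twisting does not increase the L¹(π) norm; both bounds tend to c.
    have h2 : Tendsto (fun n : ℕ => ∫ x, ‖h n j x‖ ∂π) atTop (𝓝 c) := by
      have ht1 : Tendsto (fun n : ℕ => β (2 * n) - 1 / ((n : ℝ) + 1)) atTop (𝓝 (c - 0)) :=
        (hβlim.comp (tendsto_id.const_mul_atTop' two_pos)).sub
          tendsto_one_div_add_atTop_nhds_zero_nat
      have ht2 : Tendsto (fun n : ℕ => β ((n : ℤ) + j).toNat) atTop (𝓝 c) := by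
        refine hβlim.comp (tendsto_atTop_mono (f := fun n : ℕ => n - (-j).toNat) (fun n => ?_)
          (tendsto_sub_atTop_nat _))
        omega
      rw [sub_zero] at ht1
      refine tendsto_of_tendsto_of_tendsto_of_le_of_le' ht1 ht2 ?_ ?_
      · filter_upwards [eventually_ge_atTop j.toNat, eventually_ge_atTop (-j).toNat] with n hn hn'
        refine (hfβ n).trans ?_
        have e := hhQ n j (2 * n - ((n : ℤ) + j).toNat) (by omega)
        have e2 : h n (j + ((2 * n - ((n : ℤ) + j).toNat : ℕ) : ℤ)) = Q^[2 * n] (f n) := by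
          change Q^[_] (f n) = _
          congr 1
          omega
        rw [← e2, ← e]
        exact integral_norm_twist_iterate_le H.invariant hF hF1 t (hhB n j) _
      · exact Eventually.of_forall fun n => hβle _ _ (hf n)
    exact tendsto_nhds_unique h1 (h2.comp hφ.tendsto_atTop)

end MarkovEdgeworth

/-! ### Aperiodicity and total variation convergence -/

namespace MarkovEdgeworth

variable {X : Type*} [MeasurableSpace X] {P : Kernel X X} [IsMarkovKernel P] {π ν : Measure X}
  [IsProbabilityMeasure π] {V s : X → ℝ} {δ b : ℝ}

theorem twist_zero_iterate {F : X → ℝ} {f : X → ℂ} (hf : BM f) (n : ℕ) (x : X) :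
    (twist P F (((0 : ℝ) : ℂ) * Complex.I))^[n] f x = ∫ y, f y ∂(P ^ n) x := by
  induction n generalizing x with
  | zero => rw [integral_pow_zero x hf.sm]; rfl
  | succ n ih =>
    rw [Function.iterate_succ_apply', integral_pow_add n 1 x (hf.integrable _), pow_one]
    have e : ∀ g : X → ℂ, twist P F (((0 : ℝ) : ℂ) * Complex.I) g x = ∫ y, g y ∂P x := by
      intro g; simp [twist]
    rw [e]
    exact integral_congr_ae (ae_of_all _ ih)

/-- Aperiodicity forces the mean-zero part of the transition semigroup to vanish in
`L^∞ → L¹(π)` operator norm. -/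
theorem DriftData.exists_integral_abs_lt [MeasurableSpace.CountablyGenerated X]
    (H : DriftData P π ν V s δ b) (hap : IsAperiodic P π) {ε : ℝ} (hε : 0 < ε) :
    ∃ n, ∀ f : X → ℝ, BM f → (∀ x, |f x| ≤ 1) → ∫ x, f x ∂π = 0 →
      ∫ x, |∫ y, f y ∂(P ^ n) x| ∂π < ε := by
  by_contra! hcon
  -- The orbit construction is used with the trivial twist, on real mean-zero functions in the unit
  -- ball; reality allows the equality case of the triangle inequality to be decided by signs.
  let 𝓕 : (X → ℂ) → Prop := fun f =>
    BM f ∧ (∀ x, ‖f x‖ ≤ 1) ∧ (∀ x, (f x).im = 0) ∧ ∫ x, f x ∂π = 0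
  have h := H.exists_biinfinite_orbit (F := fun _ => 0) measurable_const (by simp) 0 𝓕
    (fun f hf => ⟨hf.1, hf.2.1⟩) (fun f hf => ?_) (fun u g hu hg => ?_) hε (fun n => ?_)
  · obtain ⟨g, c, hc, hg⟩ := h
    obtain ⟨⟨hB, h1, him, hmean⟩, -, hnorm⟩ := hg 0
    set r : X → ℝ := fun x => (g 0 x).re with hr
    have hgr : ∀ x, g 0 x = (r x : ℂ) := fun x => Complex.ext rfl (by simpa using him x)
    have hrB : BM r := ⟨Complex.continuous_re.comp_stronglyMeasurable hB.sm, 1, fun x =>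
      (Complex.abs_re_le_norm _).trans (h1 x)⟩
    have hr0 : ∫ x, r x ∂π = 0 := by
      have : ∫ x, ((r x : ℝ) : ℂ) ∂π = 0 := by simpa [hgr] using hmean
      rw [integral_complex_ofReal] at this
      exact_mod_cast this
    have hrabs : ∫ x, |r x| ∂π = c := by
      rw [← hnorm]
      exact integral_congr_ae (ae_of_all _ fun x => by simp [hgr])
    have hiter : ∀ m : ℕ, (twist P (fun _ => (0 : ℝ)) (((0 : ℝ) : ℂ) * Complex.I))^[m] (g 0) =
        g m := by
      intro m
      induction m with
      | zero => rfl
      | succ m ih => rw [Function.iterate_succ_apply', ih, (hg m).2.1]; norm_cast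
    have hPm : ∀ m : ℕ, ∫ x, |∫ y, r y ∂(P ^ m) x| ∂π = c := by
      intro m
      rw [← (hg m).2.2, ← hiter m]
      refine integral_congr_ae (ae_of_all _ fun x => ?_)
      simp only [twist_zero_iterate hB, hgr]
      rw [integral_complex_ofReal, Complex.norm_real, Real.norm_eq_abs]
    -- The left side never exceeds the right, and both have π-integral c: one by constancy along the
    -- orbit, the other by invariance.
    have hae : ∀ m : ℕ, ∀ᵐ x ∂π, |∫ y, r y ∂(P ^ m) x| = ∫ y, |r y| ∂(P ^ m) x := by
      intro m
      have hi1 := ((hrB.norm.integral_kernel (P ^ m)).integrable π)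
      have hi2 := ((hrB.integral_kernel (P ^ m)).norm.integrable π)
      have hz : ∫ x, (∫ y, ‖r y‖ ∂(P ^ m) x - ‖∫ y, r y ∂(P ^ m) x‖) ∂π = 0 := by
        rw [integral_sub hi1 hi2, integral_invariant (invariant_pow H.invariant m)
          (hrB.norm.integrable _)]
        exact sub_eq_zero.2 (hrabs.trans (hPm m).symm)
      rw [integral_eq_zero_iff_of_nonneg
        (fun x => sub_nonneg.2 (norm_integral_le_integral_norm _)) (hi1.sub hi2)] at hz
      filter_upwards [hz] with x hx
      exact (sub_eq_zero.1 hx).symm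
    have hA : MeasurableSet {x | 0 < r x} := measurableSet_lt measurable_const hrB.sm.measurable
    have hA' : MeasurableSet {x | r x < 0} := measurableSet_lt hrB.sm.measurable measurable_const
    have hnot : ∀ t : X → ℝ, BM t → ∫ x, t x ∂π = 0 → ∫ x, |t x| ∂π = c →
        0 < π {x | 0 < t x} := by
      intro t ht ht0 htc
      by_contra hle
      have h0 : π {x | 0 < t x} = 0 := le_antisymm (not_lt.1 hle) zero_le
      have hle : ∀ᵐ x ∂π, t x ≤ 0 := by
        have : ∀ᵐ x ∂π, ¬ 0 < t x := by simpa [ae_iff] using h0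
        filter_upwards [this] with x hx using not_lt.1 hx
      have : ∫ x, |t x| ∂π = - ∫ x, t x ∂π := by
        rw [← integral_neg]
        exact integral_congr_ae (by filter_upwards [hle] with x hx using abs_of_nonpos hx)
      rw [htc, ht0] at this
      linarith
    have hpA := hnot r hrB hr0 hrabs
    have hpA' : 0 < π {x | r x < 0} := by
      have := hnot (fun x => 0 - r x) ((BM.const 0).sub hrB) (by simp [integral_neg, hr0])
        (by simpa using hrabs)
      simpa using this
    obtain ⟨x, hx⟩ := (ae_all_iff.2 hae).exists
    -- A nonzero mean-zero function takes both signs with positive π-probability. Aperiodicity makes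
    -- P^m(x,·) charge both signs at a common time, which rules out the equality.
    obtain ⟨m, hm1, hm2⟩ := ((hap _ hA hpA x).and (hap _ hA' hpA' x)).exists
    have hcase := hx m
    have hri : Integrable r ((P ^ m) x) := hrB.integrable _
    have hrn : Integrable (fun y => |r y|) ((P ^ m) x) := hrB.norm.integrable _
    rcases abs_cases (∫ y, r y ∂(P ^ m) x) with ⟨he, -⟩ | ⟨he, -⟩
    · rw [he] at hcase
      have hz : ∫ y, (|r y| - r y) ∂(P ^ m) x = 0 := by rw [integral_sub hrn hri, hcase, sub_self]
      rw [integral_eq_zero_iff_of_nonneg (fun y => sub_nonneg.2 (le_abs_self _))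
        (hrn.sub hri)] at hz
      have : (P ^ m) x {y | r y < 0} = 0 := by
        refine measure_mono_null (fun y hy => ?_) hz
        have hy' : r y < 0 := hy
        change ¬ (|r y| - r y = 0)
        rw [abs_of_neg hy']
        linarith
      exact hm2.ne' this
    · rw [he] at hcase
      have hz : ∫ y, (|r y| + r y) ∂(P ^ m) x = 0 := by rw [integral_add hrn hri, ← hcase]; ring
      rw [integral_eq_zero_iff_of_nonneg (f := fun y => |r y| + r y) (fun y => by
        have := neg_abs_le (r y); change 0 ≤ |r y| + r y; linarith) (hrn.add hri)] at hz
      have : (P ^ m) x {y | 0 < r y} = 0 := by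
        refine measure_mono_null (fun y hy => ?_) hz
        have hy' : 0 < r y := hy
        change ¬ (|r y| + r y = 0)
        rw [abs_of_pos hy']
        linarith
      exact hm1.ne' this
  · obtain ⟨hB, h1, him, hmean⟩ := hf
    have hB' := hB.twist (P := P) (F := fun _ => 0) measurable_const (by simp)
      (((0 : ℝ) : ℂ) * Complex.I)
    have e : ∀ x, twist P (fun _ => (0 : ℝ)) (((0 : ℝ) : ℂ) * Complex.I) f x = ∫ y, f y ∂P x :=
      fun x => by simp [twist]
    refine ⟨hB', fun x => ?_, fun x => ?_, ?_⟩
    · rw [e]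
      simpa using norm_integral_le_of_norm_le_const (μ := P x) (ae_of_all _ h1)
    · rw [e]
      have : ∫ y, f y ∂P x = ((∫ y, (f y).re ∂P x : ℝ) : ℂ) := by
        rw [← integral_complex_ofReal]
        exact integral_congr_ae (ae_of_all _ fun y => Complex.ext rfl (by simpa using him y))
      rw [this, Complex.ofReal_im]
    · simp_rw [e]
      rw [integral_invariant H.invariant (hB.integrable _), hmean]
  · refine ⟨⟨stronglyMeasurable_of_tendsto atTop (fun n => (hu n).1.sm) (tendsto_pi_nhds.2 hg), 1,
      fun x => le_of_tendsto' (hg x).norm fun n => (hu n).2.1 x⟩,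
      fun x => le_of_tendsto' (hg x).norm fun n => (hu n).2.1 x, fun x => ?_, ?_⟩
    · have h1 := (Complex.continuous_im.tendsto (g x)).comp (hg x)
      refine tendsto_nhds_unique h1 (tendsto_const_nhds.congr fun n => ?_)
      exact ((hu n).2.2.1 x).symm
    · have h1 : Tendsto (fun n => ∫ x, u n x ∂π) atTop (𝓝 (∫ x, g x ∂π)) :=
        tendsto_integral_of_dominated_convergence (fun _ => 1)
          (fun n => (hu n).1.sm.aestronglyMeasurable) (integrable_const _)
          (fun n => ae_of_all _ (hu n).2.1) (ae_of_all _ hg)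
      refine tendsto_nhds_unique h1 (tendsto_const_nhds.congr fun n => ?_)
      exact (hu n).2.2.2.symm
  · obtain ⟨f, hf, hf1, hf0, hfε⟩ := hcon n
    refine ⟨fun x => (f x : ℂ), ⟨hf.ofReal, fun x => by simpa using hf1 x, fun x => by simp, ?_⟩, ?_⟩
    · rw [integral_complex_ofReal, hf0, Complex.ofReal_zero]
    · refine hfε.trans (le_of_eq (integral_congr_ae (ae_of_all _ fun x => ?_)))
      simp only
      rw [twist_zero_iterate hf.ofReal, integral_complex_ofReal, Complex.norm_real,
        Real.norm_eq_abs]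

/-- Uniform integrability of a finite measure relative to `π`, up to its singular mass. -/
theorem exists_integral_le_mul_add {μ : Measure X} [IsFiniteMeasure μ] {τ ε : ℝ} (hε : 0 < ε)
    (hμ : ∀ A, MeasurableSet A → π A = 0 → μ.real A ≤ τ) :
    ∃ K : ℝ, 0 ≤ K ∧ ∀ h : X → ℝ, BM h → (∀ x, 0 ≤ h x) → (∀ x, h x ≤ 1) →
      ∫ x, h x ∂μ ≤ K * ∫ x, h x ∂π + τ + ε := by
  set w : X → ℝ := fun x => (μ.rnDeriv π x).toReal with hw
  have hwi : Integrable w π := Measure.integrable_toReal_rnDeriv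
  have hw0 : ∀ x, 0 ≤ w x := fun x => ENNReal.toReal_nonneg
  have hmin : ∀ K : ℕ, Integrable (fun x => min (w x) K) π := fun K =>
    hwi.inf (integrable_const _)
  have hlim : Tendsto (fun K : ℕ => ∫ x, min (w x) K ∂π) atTop (𝓝 (∫ x, w x ∂π)) := by
    refine tendsto_integral_of_dominated_convergence w (fun K => (hmin K).aestronglyMeasurable) hwi
      (fun K => ae_of_all _ fun x => ?_) (ae_of_all _ fun x => ?_)
    · rw [Real.norm_of_nonneg (le_min (hw0 x) K.cast_nonneg)]
      exact min_le_left _ _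
    · refine tendsto_const_nhds.congr' ?_
      filter_upwards [eventually_ge_atTop ⌈w x⌉₊] with K hK
      rw [min_eq_left ((Nat.le_ceil _).trans (by exact_mod_cast hK))]
  -- K is a truncation level for the density of the absolutely continuous part, cutting off mass
  -- less than ε.
  obtain ⟨K, hK⟩ := (hlim.eventually (lt_mem_nhds (sub_lt_self _ hε))).exists
  refine ⟨K, K.cast_nonneg, fun h hB h0 h1 => ?_⟩
  have hdec := Measure.haveLebesgueDecomposition_add μ π
  have e : ∫ x, h x ∂μ = ∫ x, h x ∂(μ.singularPart π) + ∫ x, w x * h x ∂π := by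
    conv_lhs => rw [hdec]
    rw [integral_add_measure (hB.integrable _) (hB.integrable _),
      integral_withDensity_eq_integral_toReal_smul (Measure.measurable_rnDeriv _ _)
        (Measure.rnDeriv_lt_top _ _)]
    rfl
  have hsing : ∫ x, h x ∂(μ.singularPart π) ≤ τ := by
    obtain ⟨N, hN, hN1, hN2⟩ := (Measure.mutuallySingular_singularPart μ π)
    calc ∫ x, h x ∂(μ.singularPart π) ≤ ∫ x, (1 : ℝ) ∂(μ.singularPart π) :=
          integral_mono (hB.integrable _) (integrable_const _) h1
      _ = (μ.singularPart π).real (N ∪ Nᶜ) := by simp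
      _ ≤ (μ.singularPart π).real N + (μ.singularPart π).real Nᶜ := measureReal_union_le _ _
      _ = (μ.singularPart π).real Nᶜ := by simp [Measure.real, hN1]
      _ ≤ μ.real Nᶜ := ENNReal.toReal_mono (measure_ne_top _ _) (Measure.singularPart_le μ π _)
      _ ≤ τ := hμ _ hN.compl hN2
  have hac : ∫ x, w x * h x ∂π ≤ ∫ x, (K * h x + (w x - min (w x) K)) ∂π := by
    refine integral_mono (hwi.mul_bdd (c := 1) hB.sm.aestronglyMeasurable (ae_of_all _ fun x => by
      rw [Real.norm_of_nonneg (h0 x)]; exact h1 x))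
      (((hB.integrable _).const_mul _).add (hwi.sub (hmin K))) fun x => ?_
    simp only
    have h2 : min (w x) K * h x ≤ K * h x := mul_le_mul_of_nonneg_right (min_le_right _ _) (h0 x)
    have h3 : (w x - min (w x) K) * h x ≤ (w x - min (w x) K) * 1 :=
      mul_le_mul_of_nonneg_left (h1 x) (sub_nonneg.2 (min_le_left _ _))
    linarith
  have hsplit : ∫ x, (K * h x + (w x - min (w x) K)) ∂π =
      K * ∫ x, h x ∂π + (∫ x, w x ∂π - ∫ x, min (w x) K ∂π) := by
    rw [← integral_sub hwi (hmin K), ← integral_const_mul]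
    exact integral_add ((hB.integrable _).const_mul _) (hwi.sub (hmin K))
  rw [hsplit] at hac
  rw [e]
  linarith

/-- After m steps from x the law is nearly absolutely continuous with nearly bounded density, so
smallness in L¹(π) of the next n₀ steps transfers to the point x. Any further steps keep f bounded
by 1 and of mean zero, so one threshold serves all n and f. -/
theorem DriftData.eventually_abs_integral_pow_le [MeasurableSpace.CountablyGenerated X]
    (H : DriftData P π ν V s δ b) (hap : IsAperiodic P π) (x : X) {ε : ℝ} (hε : 0 < ε) :
    ∃ N, ∀ n ≥ N, ∀ f : X → ℝ, BM f → (∀ x, |f x| ≤ 1) → ∫ x, f x ∂π = 0 →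
      |∫ y, f y ∂(P ^ n) x| ≤ ε := by
  obtain ⟨σ, hσ, hσlim⟩ := H.exists_singular_bound
  obtain ⟨m, hm⟩ := ((hσlim x).eventually (gt_mem_nhds (show (0 : ℝ) < ε / 3 by positivity))).exists
  obtain ⟨K, hK0, hK⟩ := exists_integral_le_mul_add (show (0 : ℝ) < ε / 3 by positivity)
    (fun A hA hπA => hσ m x A hA hπA)
  obtain ⟨n₀, hn₀⟩ := H.exists_integral_abs_lt hap (show 0 < ε / 3 / (K + 1) by positivity)
  refine ⟨n₀ + m, fun n hn f hf hf1 hf0 => ?_⟩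
  obtain ⟨k, rfl⟩ := Nat.exists_eq_add_of_le hn
  set p : X → ℝ := fun y => ∫ z, f z ∂(P ^ k) y with hp
  have hpB : BM p := hf.integral_kernel _
  have hp1 : ∀ y, |p y| ≤ 1 := fun y => by
    simpa using norm_integral_le_of_norm_le_const (μ := (P ^ k) y) (f := f) (C := 1) (ae_of_all _ hf1)
  have hp0 : ∫ y, p y ∂π = 0 := by
    rw [integral_invariant (invariant_pow H.invariant k) (hf.integrable _), hf0]
  set q : X → ℝ := fun y => ∫ z, p z ∂(P ^ n₀) y with hq
  have hqB : BM q := hpB.integral_kernel _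
  have hq1 : ∀ y, |q y| ≤ 1 := fun y => by
    simpa using norm_integral_le_of_norm_le_const (μ := (P ^ n₀) y) (f := p) (C := 1) (ae_of_all _ hp1)
  have e : ∫ y, f y ∂(P ^ (n₀ + m + k)) x = ∫ y, q y ∂(P ^ m) x := by
    rw [show n₀ + m + k = k + (n₀ + m) by ring, integral_pow_add k (n₀ + m) x (hf.integrable _),
      integral_pow_add n₀ m x (hpB.integrable _)]
  rw [e]
  have h1 := hK (fun y => ‖q y‖) hqB.norm (fun y => norm_nonneg _) hq1
  have h2 := hn₀ p hpB hp1 hp0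
  have h3 : K * ∫ y, ‖q y‖ ∂π ≤ ε / 3 := by
    calc K * ∫ y, ‖q y‖ ∂π ≤ (K + 1) * (ε / 3 / (K + 1)) :=
          mul_le_mul (by linarith) h2.le (integral_nonneg fun y => norm_nonneg _) (by linarith)
      _ = ε / 3 := by field_simp
  have h4 := norm_integral_le_integral_norm (μ := (P ^ m) x) q
  rw [Real.norm_eq_abs] at h4
  linarith

/-- A measurable modulus for the total variation convergence of `P^n x` to `π`. -/
structure TVBound (P : Kernel X X) (π : Measure X) (u : ℕ → X → ℝ) : Prop where
  bm : ∀ n, BM (u n)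
  nonneg : ∀ n x, 0 ≤ u n x
  le_one : ∀ n x, u n x ≤ 1
  bound : ∀ n x (p : X → ℝ), BM p → (∀ y, 0 ≤ p y) → (∀ y, p y ≤ 1) →
    ∫ y, p y ∂π - ∫ y, p y ∂(P ^ n) x ≤ u n x
  anti : ∀ x, Antitone fun n => u n x
  sub : ∀ n x, u (n + 1) x ≤ ∫ y, u n y ∂P x
  lim : ∀ x, Tendsto (fun n => u n x) atTop (𝓝 0)

/-- Layer-cake formula: a function with values in [0, 1] is an average of indicators of its
superlevel sets. -/
theorem integral_sub_integral_le_of_sets {μ₁ μ₂ : Measure X} [IsProbabilityMeasure μ₁]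
    [IsProbabilityMeasure μ₂] {c : ℝ} 
    (h : ∀ A, MeasurableSet A → μ₁.real A - μ₂.real A ≤ c) {p : X → ℝ} (hp : BM p)
    (h0 : ∀ y, 0 ≤ p y) (h1 : ∀ y, p y ≤ 1) : ∫ y, p y ∂μ₁ - ∫ y, p y ∂μ₂ ≤ c := by
  have key : ∀ (μ : Measure X) [IsProbabilityMeasure μ],
      ∫ y, p y ∂μ = ∫ t in Set.Ioc (0 : ℝ) 1, μ.real {y | t < p y} := by
    intro μ _
    rw [(hp.integrable μ).integral_eq_integral_meas_lt (ae_of_all _ h0)]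
    refine setIntegral_eq_of_subset_of_forall_sdiff_eq_zero measurableSet_Ioi
      (fun t ht => ht.1) fun t ht => ?_
    have : {y | t < p y} = ∅ := by
      ext y
      simp only [Set.mem_ofPred_eq, Set.mem_empty_iff_false, iff_false, not_lt]
      by_contra hc
      exact ht.2 ⟨ht.1, (not_le.1 hc).le.trans (h1 y)⟩
    simp [this]
  have hint : ∀ (μ : Measure X) [IsProbabilityMeasure μ],
      IntegrableOn (fun t => μ.real {y | t < p y}) (Set.Ioc (0 : ℝ) 1) := by
    intro μ _
    have hanti : Antitone fun t => μ.real {y | t < p y} := fun s t hst =>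
      measureReal_mono fun y hy => lt_of_le_of_lt hst hy
    exact (hanti.antitoneOn _).integrableOn_isCompact isCompact_Icc |>.mono_set
      Set.Ioc_subset_Icc_self
  rw [key μ₁, key μ₂, ← integral_sub (hint μ₁) (hint μ₂)]
  calc _ ≤ ∫ t in Set.Ioc (0 : ℝ) 1, c :=
        integral_mono ((hint μ₁).sub (hint μ₂)) (integrable_const _) fun t =>
          h _ (measurableSet_lt measurable_const hp.sm.measurable)
    _ = c := by simp

/-- The modulus is the excess of π over P^n(x,·) on the measurably chosen Hahn set. Monotonicity
tests the bound on y ↦ P(y, A) and uses invariance; the one-step inequality conditions on the first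
step. -/
theorem DriftData.exists_tvBound [MeasurableSpace.CountablyGenerated X]
    (H : DriftData P π ν V s δ b) (hap : IsAperiodic P π) : ∃ u, TVBound P π u := by
  choose S hSm hS using fun n => exists_hahn_set π (P ^ n)
  have hSx : ∀ n x, MeasurableSet (Prod.mk x ⁻¹' S n) := fun n x => measurable_prodMk_left (hSm n)
  set u : ℕ → X → ℝ := fun n x =>
    π.real (Prod.mk x ⁻¹' S n) - ((P ^ n) x).real (Prod.mk x ⁻¹' S n) with hu
  have hπB : ∀ n, BM (fun x => π.real (Prod.mk x ⁻¹' S n)) := fun n => by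
    have := bm_measureReal (Kernel.const X π) (hSm n)
    simpa using this
  have hBM : ∀ n, BM (u n) := fun n => (hπB n).sub (bm_measureReal (P ^ n) (hSm n))
  have hbound : ∀ n x (p : X → ℝ), BM p → (∀ y, 0 ≤ p y) → (∀ y, p y ≤ 1) →
      ∫ y, p y ∂π - ∫ y, p y ∂(P ^ n) x ≤ u n x := fun n x p hp h0 h1 =>
    integral_sub_integral_le_of_sets (fun A hA => hS n x A hA) hp h0 h1
  refine ⟨u, hBM, fun n x => by simpa [hu] using hS n x ∅ MeasurableSet.empty, fun n x => ?_, hbound,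
    fun x => antitone_nat_of_succ_le fun n => ?_, fun n x => ?_, fun x => ?_⟩
  · have h1 : π.real (Prod.mk x ⁻¹' S n) ≤ 1 := measureReal_le_one
    have h2 : 0 ≤ ((P ^ n) x).real (Prod.mk x ⁻¹' S n) := measureReal_nonneg
    simp only [hu]
    linarith
  · set A := Prod.mk x ⁻¹' S (n + 1)
    have hA : MeasurableSet A := hSx _ _
    have h1 := hbound n x (fun y => ((P ^ 1) y).real A) (bm_measureReal' _ hA)
      (fun y => measureReal_nonneg) fun y => measureReal_le_one
    rw [← measureReal_pow_add 1 n x hA, add_comm 1 n] at h1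
    have h2 : ∫ y, ((P ^ 1) y).real A ∂π = π.real A := by
      have := integral_invariant (invariant_pow H.invariant 1) ((BM.indicator hA (1 : ℝ)).integrable π)
      simpa only [integral_indicator_const _ hA, smul_eq_mul, mul_one] using this
    rw [h2] at h1
    exact h1
  · set A := Prod.mk x ⁻¹' S (n + 1)
    have hA : MeasurableSet A := hSx _ _
    have e : u (n + 1) x = ∫ y, (π.real A - ((P ^ n) y).real A) ∂P x := by
      rw [integral_sub (integrable_const _) ((bm_measureReal' _ hA).integrable _)]
      have := measureReal_pow_add (P := P) n 1 x hA
      rw [pow_one] at this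
      rw [← this]
      simp [hu, A]
    rw [e]
    exact integral_mono (((BM.const _).sub (bm_measureReal' _ hA)).integrable _)
      ((hBM n).integrable _) fun y => hS n y A hA
  · refine Metric.tendsto_atTop.2 fun ε hε => ?_
    obtain ⟨N, hN⟩ := H.eventually_abs_integral_pow_le hap x (half_pos hε)
    refine ⟨N, fun n hn => ?_⟩
    set A := Prod.mk x ⁻¹' S n
    have hA : MeasurableSet A := hSx _ _
    have hf : BM (fun y => π.real A - A.indicator (fun _ => (1 : ℝ)) y) :=
      (BM.const _).sub (BM.indicator hA 1)
    have h1 := hN n hn _ hf (fun y => ?_) ?_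
    · rw [integral_sub (integrable_const _) ((BM.indicator hA 1).integrable _),
        integral_indicator_const _ hA] at h1
      simp only [integral_const, probReal_univ, smul_eq_mul, mul_one, one_mul] at h1
      rw [dist_zero_right, Real.norm_eq_abs]
      change |π.real A - ((P ^ n) x).real A| < ε
      linarith
    · have h2 : π.real A ≤ 1 := measureReal_le_one
      have h3 : 0 ≤ π.real A := measureReal_nonneg
      rw [abs_le]
      by_cases hy : y ∈ A
      · simp only [Set.indicator_of_mem hy]; constructor <;> linarith
      · simp only [Set.indicator_of_notMem hy]; constructor <;> linarith
    · rw [integral_sub (integrable_const _) ((BM.indicator hA 1).integrable _),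
        integral_indicator_const _ hA]
      simp

end MarkovEdgeworth

/-! ### V-geometric ergodicity -/

namespace MarkovEdgeworth

variable {X : Type*} [MeasurableSpace X] {P : Kernel X X} [IsMarkovKernel P] {π ν : Measure X}
  [IsProbabilityMeasure π] {V s : X → ℝ} {δ b : ℝ} {u : ℕ → X → ℝ}

namespace TVBound

theorem le_integral_pow (hu : TVBound P π u) (m k : ℕ) (x : X) :
    u (m + k) x ≤ ∫ y, u m y ∂(P ^ k) x := by
  induction k generalizing x with
  | zero => rw [integral_pow_zero x (hu.bm m).sm]; rfl
  | succ k ih =>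
    rw [integral_pow_add k 1 x ((hu.bm m).integrable _), pow_one]
    exact (hu.sub (m + k) x).trans (integral_mono ((hu.bm _).integrable _)
      (((hu.bm m).integral_kernel _).integrable _) ih)

theorem abs_integral_sub_le (hu : TVBound P π u) (n : ℕ) (x : X) {f : X → ℝ} (hf : BM f)
    (h1 : ∀ y, |f y| ≤ 1) : |∫ y, f y ∂(P ^ n) x - ∫ y, f y ∂π| ≤ 2 * u n x := by
  have key : ∀ g : X → ℝ, BM g → (∀ y, |g y| ≤ 1) →
      ∫ y, g y ∂π - ∫ y, g y ∂(P ^ n) x ≤ 2 * u n x := by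
    intro g hg hg1
    -- Rescaling [-1, 1] to [0, 1] accounts for the factor 2.
    have h := hu.bound n x (fun y => (1 / 2) * (g y + 1)) ((BM.const _).mul (hg.add (BM.const 1)))
      (fun y => by have := (abs_le.1 (hg1 y)).1; linarith)
      (fun y => by have := (abs_le.1 (hg1 y)).2; linarith)
    rw [integral_const_mul, integral_const_mul, integral_add (hg.integrable _) (integrable_const _),
      integral_add (hg.integrable _) (integrable_const _)] at h
    simp only [integral_const, probReal_univ, smul_eq_mul, mul_one] at h
    linarith
  have h1' := key f hf h1
  have h2 := key (fun y => 0 - f y) ((BM.const 0).sub hf) (by simpa using h1)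
  simp only [zero_sub, integral_neg] at h2
  rw [abs_le]
  constructor <;> linarith

theorem norm_integral_sub_le (hu : TVBound P π u) (n : ℕ) (x : X) {f : X → ℂ} (hf : BM f)
    (h1 : ∀ y, ‖f y‖ ≤ 1) : ‖∫ y, f y ∂(P ^ n) x - ∫ y, f y ∂π‖ ≤ 4 * u n x := by
  have hre : BM fun y => (f y).re := ⟨Complex.continuous_re.comp_stronglyMeasurable hf.sm, 1,
    fun y => (Complex.abs_re_le_norm _).trans (h1 y)⟩
  have him : BM fun y => (f y).im := ⟨Complex.continuous_im.comp_stronglyMeasurable hf.sm, 1,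
    fun y => (Complex.abs_im_le_norm _).trans (h1 y)⟩
  have h2 := hu.abs_integral_sub_le n x hre fun y => (Complex.abs_re_le_norm _).trans (h1 y)
  have h3 := hu.abs_integral_sub_le n x him fun y => (Complex.abs_im_le_norm _).trans (h1 y)
  refine (Complex.norm_le_abs_re_add_abs_im _).trans ?_
  rw [Complex.sub_re, Complex.sub_im]
  have r1 : ∀ (μ : Measure X) [IsFiniteMeasure μ], (∫ y, f y ∂μ).re = ∫ y, (f y).re ∂μ := fun μ _ =>
    ((RCLike.reCLM (K := ℂ)).integral_comp_comm (hf.integrable μ)).symm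
  have r2 : ∀ (μ : Measure X) [IsFiniteMeasure μ], (∫ y, f y ∂μ).im = ∫ y, (f y).im ∂μ := fun μ _ =>
    ((RCLike.imCLM (K := ℂ)).integral_comp_comm (hf.integrable μ)).symm
  rw [r1, r1, r2, r2]
  linarith

/-- One improvement step for bounds of the form `u n ≤ θ + β V`. -/
theorem exists_improved_bound (H : DriftData P π ν V s δ b) (hu : TVBound P π u) {β : ℝ}
    (hβ : 0 < β) {θ : ℝ} (hθ : 0 ≤ θ) {n : ℕ} (hn : ∀ x, u n x ≤ θ + β * V x) :
    ∃ n', ∀ x, u n' x ≤ θ * (1 - δ / b) + β * (2 * (b / δ) + 2) + β * V x := by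
  have := H.prob
  have h0 : 0 ≤ 1 - δ := by linarith [H.δ_lt_one]
  have hd := H.δ_pos
  have hb := H.b_pos
  have hB : 0 < b / δ := div_pos hb hd
  -- a time at which `ν (u m)` is small
  have hνlim : Tendsto (fun m => ∫ y, u m y ∂ν) atTop (𝓝 0) := by
    have := tendsto_integral_of_dominated_convergence (μ := ν) (F := fun m y => u m y)
      (f := fun _ => 0) (fun _ => 1) (fun m => (hu.bm m).sm.aestronglyMeasurable) (integrable_const _)
      (fun m => ae_of_all _ fun y => by
        rw [Real.norm_of_nonneg (hu.nonneg m y)]; exact hu.le_one m y) (ae_of_all _ hu.lim)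
    simpa using this
  obtain ⟨m, hm1, hm2⟩ := ((hνlim.eventually (gt_mem_nhds hβ)).and (eventually_ge_atTop n)).exists
  have hmV : ∀ x, u m x ≤ θ + β * V x := fun x => (hu.anti x hm2).trans (hn x)
  -- The first L resolvent weights carry all but β of the mass, so the resolvent average of u_m
  -- dominates u_{m+L} up to β.
  obtain ⟨L, hL⟩ := (hasSum_geomWeight.tendsto_sum_nat.eventually
    (lt_mem_nhds (show 1 - β < 1 by linarith))).exists
  have hVB : ∀ k x, ∫ y, V y ∂(P ^ k) x ≤ V x + b / δ := fun k x =>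
    (H.integral_V_pow_le k x).trans (by
      have : (1 - δ) ^ k * V x ≤ 1 * V x :=
        mul_le_mul_of_nonneg_right (pow_le_one₀ h0 (by linarith)) (H.V_pos x).le
      linarith)
  -- Apply the minorization to the nonnegative function θ + βV - u_m, whose ν-integral is at least θ
  -- - β by the choice of m. The two additional β come from this loss and from truncating the
  -- resolvent.
  have hstep : ∀ x, u (m + L) x ≤ θ + β * (V x + b / δ + 2) - θ * s x := by
    intro x
    have hsumm : Summable fun k => geomWeight k * ∫ y, u m y ∂(P ^ k) x := by
      refine Summable.of_nonneg_of_le (fun k => mul_nonneg (geomWeight_pos k).le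
        (integral_nonneg (hu.nonneg m))) (fun k => ?_) hasSum_geomWeight.summable
      refine mul_le_of_le_one_right (geomWeight_pos k).le ?_
      calc _ ≤ ∫ y, (1 : ℝ) ∂(P ^ k) x :=
            integral_mono ((hu.bm m).integrable _) (integrable_const _) (hu.le_one m)
        _ = 1 := by simp
    have hgi : ∀ k, Integrable (fun y => θ + β * V y - u m y) ((P ^ k) x) := fun k =>
      ((integrable_const _).add ((H.integrable_V_pow k x).const_mul _)).sub ((hu.bm m).integrable _)
    have hmin := H.integral_minor_le x (g := fun y => θ + β * V y - u m y)
      ((measurable_const.add (H.measurable_V.const_mul β)).sub (hu.bm m).sm.measurable)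
      (fun y => sub_nonneg.2 (hmV y)) hgi
      (a := fun k => θ + β * (V x + b / δ) - ∫ y, u m y ∂(P ^ k) x)
      (A := (θ + β * (V x + b / δ)) - ∑' k, geomWeight k * ∫ y, u m y ∂(P ^ k) x)
      (fun k => by
        have e1 : ∫ y, (θ + β * V y - u m y) ∂(P ^ k) x =
            ∫ y, (θ + β * V y) ∂(P ^ k) x - ∫ y, u m y ∂(P ^ k) x :=
          integral_sub ((integrable_const _).add ((H.integrable_V_pow k x).const_mul _))
            ((hu.bm m).integrable _)
        have e2 : ∫ y, (θ + β * V y) ∂(P ^ k) x = θ + β * ∫ y, V y ∂(P ^ k) x := by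
          rw [integral_add (integrable_const _) ((H.integrable_V_pow k x).const_mul _),
            integral_const_mul]
          simp
        rw [e1, e2]
        have := mul_le_mul_of_nonneg_left (hVB k x) hβ.le
        linarith)
      (by
        have h1 := (hasSum_geomWeight.mul_right (θ + β * (V x + b / δ))).sub hsumm.hasSum
        rw [one_mul] at h1
        simpa only [mul_sub] using h1)
    have hνg : θ - β ≤ ∫ y, (θ + β * V y - u m y) ∂ν := by
      calc θ - β ≤ ∫ y, (θ - u m y) ∂ν := by
            rw [integral_sub (integrable_const _) ((hu.bm m).integrable _)]
            simp only [integral_const, probReal_univ, one_smul]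
            linarith
        _ ≤ _ := integral_mono ((integrable_const _).sub ((hu.bm m).integrable _)) hmin.1
            fun y => by have := mul_pos hβ (H.V_pos y); simp only; linarith
    have hlow : u (m + L) x - β ≤ ∑' k, geomWeight k * ∫ y, u m y ∂(P ^ k) x := by
      refine le_trans ?_ (hsumm.sum_le_tsum (Finset.range L) fun k _ =>
        mul_nonneg (geomWeight_pos k).le (integral_nonneg (hu.nonneg m)))
      calc u (m + L) x - β ≤ (∑ k ∈ Finset.range L, geomWeight k) * u (m + L) x := by
            have h1 := mul_le_mul_of_nonneg_right hL.le (hu.nonneg (m + L) x)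
            have h2 := mul_le_mul_of_nonneg_left (hu.le_one (m + L) x) hβ.le
            linarith
        _ ≤ _ := by
            rw [Finset.sum_mul]
            refine Finset.sum_le_sum fun k hk => mul_le_mul_of_nonneg_left ?_ (geomWeight_pos k).le
            exact (hu.anti x (by have := Finset.mem_range.1 hk; omega)).trans
              (hu.le_integral_pow m k x)
    have h3 := mul_le_mul_of_nonneg_left hνg (H.s_pos x).le
    have h4 := mul_le_mul_of_nonneg_left (H.s_le_one x) hβ.le
    have h5 := hmin.2
    nlinarith
  -- averaging along the drift
  have hr1 : |1 - δ| < 1 := by rw [abs_of_nonneg h0]; linarith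
  -- This will be the coefficient of V(x) left after averaging; M is taken so large that it is at
  -- most β.
  have hlimM : Tendsto (fun M : ℕ => β * ((M + 1 : ℕ) * (1 - δ) ^ (M + 1)) / (1 - δ) +
      θ / b * (1 - δ) ^ (M + 1)) atTop (𝓝 0) := by
    have h1 := (tendsto_self_mul_const_pow_of_abs_lt_one hr1).comp (tendsto_add_atTop_nat 1)
    have h2 := (tendsto_pow_atTop_nhds_zero_of_abs_lt_one hr1).comp (tendsto_add_atTop_nat 1)
    simpa using ((h1.const_mul β).div_const (1 - δ)).add (h2.const_mul (θ / b))
  obtain ⟨M, hM⟩ := (hlimM.eventually (gt_mem_nhds hβ)).exists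
  refine ⟨m + L + M, fun x => ?_⟩
  set Z := ∑ i ∈ Finset.range (M + 1), (1 - δ) ^ (M + 1 - 1 - i) with hZ
  have hZ1 : Z ≤ 1 / δ := H.sum_pow_le (M + 1)
  have hZ0 : 1 ≤ Z := by
    have := Finset.single_le_sum (f := fun i => (1 - δ) ^ (M + 1 - 1 - i))
      (fun i _ => pow_nonneg h0 _) (Finset.mem_range.2 (Nat.lt_succ_self M))
    simpa [hZ] using this
  -- The previous bound is transported i steps back by P^i and weighted exactly as the terms P^i s
  -- in the iterated drift inequality.
  have hterm : ∀ i ∈ Finset.range (M + 1), (1 - δ) ^ (M + 1 - 1 - i) * u (m + L + M) x ≤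
      (1 - δ) ^ (M + 1 - 1 - i) * (θ + β * (2 * (b / δ) + 2)) + β * V x * (1 - δ) ^ M -
        θ * ((1 - δ) ^ (M + 1 - 1 - i) * ∫ y, s y ∂(P ^ i) x) := by
    intro i hi
    have hi' : i ≤ M := Nat.lt_succ_iff.1 (Finset.mem_range.1 hi)
    have h1 : u (m + L + M) x ≤ θ + β * ((1 - δ) ^ i * V x + 2 * (b / δ) + 2) -
        θ * ∫ y, s y ∂(P ^ i) x := by
      refine (hu.anti x (show m + L + i ≤ m + L + M by omega)).trans
        ((hu.le_integral_pow (m + L) i x).trans ?_)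
      have hi1 : Integrable (fun y => θ + β * (V y + b / δ + 2)) ((P ^ i) x) :=
        (integrable_const _).add ((((H.integrable_V_pow i x).add (integrable_const _)).add
          (integrable_const _)).const_mul _)
      have hi2 : Integrable (fun y => θ * s y) ((P ^ i) x) := (H.bm_s.integrable _).const_mul _
      have hi3 : Integrable (fun y => θ + β * (b / δ + 2) + β * V y) ((P ^ i) x) :=
        (integrable_const _).add ((H.integrable_V_pow i x).const_mul _)
      calc ∫ y, u (m + L) y ∂(P ^ i) x
          ≤ ∫ y, (θ + β * (V y + b / δ + 2) - θ * s y) ∂(P ^ i) x :=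
            integral_mono ((hu.bm _).integrable _) (hi1.sub hi2) hstep
        _ = ∫ y, (θ + β * (b / δ + 2) + β * V y) ∂(P ^ i) x - ∫ y, θ * s y ∂(P ^ i) x := by
            rw [← integral_sub hi3 hi2]
            exact integral_congr_ae (ae_of_all _ fun y => by ring)
        _ = θ + β * (b / δ + 2) + β * ∫ y, V y ∂(P ^ i) x - θ * ∫ y, s y ∂(P ^ i) x := by
            rw [integral_add (integrable_const _) ((H.integrable_V_pow i x).const_mul _),
              integral_const_mul, integral_const_mul]
            simp
        _ ≤ _ := by
            have := mul_le_mul_of_nonneg_left (H.integral_V_pow_le i x) hβ.le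
            linarith
    have h2 := mul_le_mul_of_nonneg_left h1 (pow_nonneg h0 (M + 1 - 1 - i))
    have h3 : (1 - δ) ^ (M + 1 - 1 - i) * (1 - δ) ^ i = (1 - δ) ^ M := by
      rw [← pow_add]; congr 1; omega
    calc _ ≤ _ := h2
      _ = (1 - δ) ^ (M + 1 - 1 - i) * (θ + β * (2 * (b / δ) + 2)) +
          β * V x * ((1 - δ) ^ (M + 1 - 1 - i) * (1 - δ) ^ i) -
          θ * ((1 - δ) ^ (M + 1 - 1 - i) * ∫ y, s y ∂(P ^ i) x) := by ring
      _ = _ := by rw [h3]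
  have hsum := Finset.sum_le_sum hterm
  rw [← Finset.sum_mul, Finset.sum_sub_distrib, Finset.sum_add_distrib, ← Finset.sum_mul,
    ← Finset.mul_sum, Finset.sum_const, Finset.card_range, nsmul_eq_mul, ← hZ] at hsum
  set T := ∑ i ∈ Finset.range (M + 1), (1 - δ) ^ (M + 1 - 1 - i) * ∫ y, s y ∂(P ^ i) x with hT
  have hV1 : 1 ≤ (1 - δ) ^ (M + 1) * V x + b * T := by
    refine le_trans ?_ (H.integral_V_pow_le_sum (M + 1) x)
    calc (1 : ℝ) = ∫ y, (1 : ℝ) ∂(P ^ (M + 1)) x := by simp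
      _ ≤ _ := integral_mono (integrable_const _) (H.integrable_V_pow _ x) H.one_le
  -- The gain: the iterated drift bounds the discounted visits T below by nearly 1 / b. Dividing by
  -- the total weight Z ≤ 1 / δ turns this into the improvement θδ / b.
  have hT' : θ / b - θ / b * (1 - δ) ^ (M + 1) * V x ≤ θ * T := by
    have := mul_le_mul_of_nonneg_left hV1 (div_nonneg hθ hb.le)
    have e : θ / b * (b * T) = θ * T := by field_simp
    nlinarith
  have hMV : (β * ((M + 1 : ℕ) * (1 - δ) ^ M) + θ / b * (1 - δ) ^ (M + 1)) * V x ≤ β * V x := by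
    refine mul_le_mul_of_nonneg_right (le_trans (le_of_eq ?_) hM.le) (H.V_pos x).le
    have : (1 - δ) ≠ 0 := by linarith [H.δ_lt_one]
    rw [pow_succ]
    field_simp
  have hZV : β * V x ≤ Z * (β * V x) := le_mul_of_one_le_left (mul_pos hβ (H.V_pos x)).le hZ0
  have hZθ : Z * (θ * (δ / b)) ≤ θ / b := by
    calc Z * (θ * (δ / b)) ≤ 1 / δ * (θ * (δ / b)) :=
          mul_le_mul_of_nonneg_right hZ1 (mul_nonneg hθ (div_pos hd hb).le)
      _ = θ / b := by field_simp
  refine le_of_mul_le_mul_left ?_ (zero_lt_one.trans_le hZ0)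
  have e : Z * (θ * (1 - δ / b) + β * (2 * (b / δ) + 2) + β * V x) =
      Z * (θ + β * (2 * (b / δ) + 2)) - Z * (θ * (δ / b)) + Z * (β * V x) := by ring
  rw [e]
  rw [← Finset.mul_sum, ← hT] at hsum
  linarith

/-- Iterating the improvement step with β fixed drives θ geometrically to the fixed point β(2b/δ +
2)(b/δ) of θ ↦ θ(1 - δ/b) + β(2b/δ + 2). That point is proportional to β, so C does not depend on β.
-/
theorem exists_uniform_bound (H : DriftData P π ν V s δ b) (hu : TVBound P π u) :
    ∃ C : ℝ, 0 < C ∧ ∀ β : ℝ, 0 < β → ∃ N, ∀ n ≥ N, ∀ x, u n x ≤ β * (C + V x) := by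
  have hd := H.δ_pos
  have hb := H.b_pos
  have hB : 0 < b / δ := div_pos hb hd
  refine ⟨1 + (2 * (b / δ) + 2) * (b / δ), by positivity, fun β hβ => ?_⟩
  have hdb : δ / b ≤ 1 := by
    rw [div_le_one hb]; linarith [H.δ_lt_one, H.one_le_b]
  have key : ∀ k : ℕ, ∃ n, ∀ x,
      u n x ≤ ((1 - δ / b) ^ k + β * (2 * (b / δ) + 2) * (b / δ)) + β * V x := by
    intro k
    induction k with
    | zero =>
      refine ⟨0, fun x => (hu.le_one 0 x).trans ?_⟩
      have h1 : 0 ≤ β * (2 * (b / δ) + 2) * (b / δ) := by positivity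
      have h2 := mul_pos hβ (H.V_pos x)
      rw [pow_zero]
      linarith
    | succ k ih =>
      obtain ⟨n, hn⟩ := ih
      obtain ⟨n', hn'⟩ := exists_improved_bound H hu hβ (add_nonneg
        (pow_nonneg (sub_nonneg.2 hdb) k) (by positivity)) hn
      refine ⟨n', fun x => (hn' x).trans (le_of_eq ?_)⟩
      have e : b / δ * (δ / b) = 1 := by field_simp
      rw [pow_succ]
      linear_combination -(β * (2 * (b / δ) + 2)) * e
  have hlim := tendsto_pow_atTop_nhds_zero_of_lt_one (sub_nonneg.2 hdb)
    (show 1 - δ / b < 1 by linarith [div_pos hd hb])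
  obtain ⟨k, hk⟩ := (hlim.eventually (gt_mem_nhds hβ)).exists
  obtain ⟨N, hN⟩ := key k
  refine ⟨N, fun n hn x => ((hu.anti x hn).trans (hN x)).trans ?_⟩
  nlinarith

end TVBound

theorem exists_half_pow_le (N : ℕ) (hN : 0 < N) :
    ∃ ρ : ℝ, 0 < ρ ∧ ρ < 1 ∧ ∀ n : ℕ, (1 / 2 : ℝ) ^ (n / N) ≤ 2 * ρ ^ n := by
  have hN' : (0 : ℝ) < N := by exact_mod_cast hN
  refine ⟨(1 / 2 : ℝ) ^ (1 / (N : ℝ)), by positivity,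
    Real.rpow_lt_one (by norm_num) (by norm_num) (by positivity), fun n => ?_⟩
  have h1 : ((1 / 2 : ℝ) ^ (1 / (N : ℝ))) ^ N = 1 / 2 := by
    rw [← Real.rpow_natCast, ← Real.rpow_mul (by norm_num), one_div_mul_cancel hN'.ne', Real.rpow_one]
  have h2 : ((1 / 2 : ℝ) ^ (1 / (N : ℝ))) ^ (N * (n / N + 1)) ≤
      ((1 / 2 : ℝ) ^ (1 / (N : ℝ))) ^ n :=
    pow_le_pow_of_le_one (by positivity)
      (Real.rpow_le_one (by norm_num) (by norm_num) (by positivity))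
      (Nat.lt_mul_div_succ n hN).le
  rw [pow_mul, h1, pow_succ] at h2
  linarith

/-- `V`-geometric contraction of the semigroup on mean-zero functions. -/
theorem DriftData.exists_contraction [MeasurableSpace.CountablyGenerated X]
    (H : DriftData P π ν V s δ b) (hap : IsAperiodic P π) :
    ∃ (β : ℝ) (N : ℕ), 0 < β ∧ 0 < N ∧ ∀ f : X → ℂ, BM f → ∫ x, f x ∂π = 0 → ∀ D : ℝ, 0 ≤ D →
      (∀ x, ‖f x‖ ≤ D * (1 + β * V x)) →
      ∀ x, ‖∫ y, f y ∂(P ^ N) x‖ ≤ D * (1 / 2) * (1 + β * V x) := by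
  obtain ⟨u, hu⟩ := H.exists_tvBound hap
  obtain ⟨C, hC, hβ⟩ := hu.exists_uniform_bound H
  have hd := H.δ_pos
  have hB : 0 < b / δ := div_pos H.b_pos hd
  set v := ∫ x, V x ∂π with hv
  have hv0 : 0 ≤ v := integral_nonneg fun x => (H.V_pos x).le
  -- A small weight on V: the two constants that survive from the unbounded part, βπ(V) and βb/δ,
  -- then add up to 1/4.
  set β : ℝ := 1 / (4 * (v + b / δ)) with hβdef
  have hβ0 : 0 < β := by positivity
  have hβe : β * (v + b / δ) = 1 / 4 := by
    have : v + b / δ ≠ 0 := by positivity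
    rw [hβdef, one_div, mul_inv, mul_assoc, inv_mul_cancel₀ this]
    norm_num
  obtain ⟨N₁, hN₁⟩ := hβ (min (1 / (16 * C)) (β / 16)) (by positivity)
  have h0 : 0 ≤ 1 - δ := by linarith [H.δ_lt_one]
  obtain ⟨N, ⟨hN2, hN3⟩, hN4⟩ := (((tendsto_pow_atTop_nhds_zero_of_lt_one h0 (by linarith)).eventually
    (gt_mem_nhds (show (0 : ℝ) < 1 / 4 by norm_num))).and (eventually_ge_atTop N₁)).and
    (eventually_gt_atTop 0) |>.exists
  have key : ∀ f : X → ℂ, BM f → ∫ x, f x ∂π = 0 → (∀ x, ‖f x‖ ≤ 1 + β * V x) →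
      ∀ x, ‖∫ y, f y ∂(P ^ N) x‖ ≤ 1 / 2 * (1 + β * V x) := by
    intro f hf hf0 hfV x
    -- Radial truncation to the unit disc. The bounded part is handled by total variation
    -- convergence, and the remainder, at most βV, by the drift.
    set f₁ : X → ℂ := fun y => ((1 / max 1 ‖f y‖ : ℝ) : ℂ) * f y with hf₁
    have hm1 : ∀ y, 1 ≤ max 1 ‖f y‖ := fun y => le_max_left _ _
    have hwB : BM fun y => (1 / max 1 ‖f y‖ : ℝ) := BM.of_measurable_le
      (measurable_const.div (measurable_const.max hf.sm.norm.measurable)) (C := 1) fun y => by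
        rw [abs_of_nonneg (by have := hm1 y; positivity), div_le_one (by linarith [hm1 y])]
        exact hm1 y
    have hB1 : BM f₁ := hwB.ofReal.mul hf
    have h1 : ∀ y, ‖f₁ y‖ ≤ 1 := fun y => by
      rw [hf₁, norm_mul, Complex.norm_real, Real.norm_of_nonneg (by have := hm1 y; positivity),
        one_div_mul_eq_div, div_le_one (by linarith [hm1 y])]
      exact le_max_right _ _
    have h2 : ∀ y, ‖f y - f₁ y‖ ≤ β * V y := fun y => by
      have e : f y - f₁ y = ((1 - 1 / max 1 ‖f y‖ : ℝ) : ℂ) * f y := by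
        simp only [hf₁]; push_cast; ring
      have hp : 0 ≤ 1 - 1 / max 1 ‖f y‖ := by
        rw [sub_nonneg, div_le_one (by linarith [hm1 y])]; exact hm1 y
      rw [e, norm_mul, Complex.norm_real, Real.norm_of_nonneg hp]
      have hVp := mul_pos hβ0 (H.V_pos y)
      rcases le_total ‖f y‖ 1 with h | h
      · rw [max_eq_left h]; simpa using hVp.le
      · rw [max_eq_right h, sub_mul, one_div_mul_cancel (by linarith)]
        linarith [hfV y]
    have hB2 : BM fun y => f y - f₁ y := hf.sub hB1
    have hbd : ∀ (μ : Measure X) [IsProbabilityMeasure μ], Integrable V μ →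
        ‖∫ y, (f y - f₁ y) ∂μ‖ ≤ β * ∫ y, V y ∂μ := fun μ _ hVμ => by
      rw [← integral_const_mul]
      exact norm_integral_le_of_norm_le (hVμ.const_mul β) (ae_of_all _ h2)
    have e1 : ∫ y, f y ∂(P ^ N) x = (∫ y, f₁ y ∂(P ^ N) x - ∫ y, f₁ y ∂π) -
        ∫ y, (f y - f₁ y) ∂π + ∫ y, (f y - f₁ y) ∂(P ^ N) x := by
      rw [integral_sub (hf.integrable _) (hB1.integrable _),
        integral_sub (hf.integrable _) (hB1.integrable _), hf0]
      ring
    have a1 := hu.norm_integral_sub_le N x hB1 h1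
    have a2 := hN₁ N hN3 x
    have a3 := hbd π H.integrable_V
    have a4 := hbd ((P ^ N) x) (H.integrable_V_pow N x)
    have a5 := mul_le_mul_of_nonneg_left (H.integral_V_pow_le N x) hβ0.le
    have a6 : (1 - δ) ^ N * (β * V x) ≤ 1 / 4 * (β * V x) :=
      mul_le_mul_of_nonneg_right hN2.le (mul_pos hβ0 (H.V_pos x)).le
    have a7 : min (1 / (16 * C)) (β / 16) * C ≤ 1 / 16 := by
      calc _ ≤ 1 / (16 * C) * C := mul_le_mul_of_nonneg_right (min_le_left _ _) hC.le
        _ = 1 / 16 := by field_simp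
    have a8 : min (1 / (16 * C)) (β / 16) * V x ≤ β / 16 * V x :=
      mul_le_mul_of_nonneg_right (min_le_right _ _) (H.V_pos x).le
    have hn := norm_add_le ((∫ y, f₁ y ∂(P ^ N) x - ∫ y, f₁ y ∂π) -
        ∫ y, (f y - f₁ y) ∂π) (∫ y, (f y - f₁ y) ∂(P ^ N) x)
    have hn2 := norm_sub_le (∫ y, f₁ y ∂(P ^ N) x - ∫ y, f₁ y ∂π) (∫ y, (f y - f₁ y) ∂π)
    rw [e1]
    rw [mul_add] at a2
    linarith
  refine ⟨β, N, hβ0, hN4, fun f hf hf0 D hD hfD x => ?_⟩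
  rcases hD.eq_or_lt with rfl | hD
  · have : ∀ y, f y = 0 := fun y => by simpa using hfD y
    simp [this]
  · have hDc : (D : ℂ) ≠ 0 := by exact_mod_cast hD.ne'
    have h := key (fun y => (D : ℂ)⁻¹ * f y) ((BM.const _).mul hf)
      (by rw [integral_const_mul, hf0, mul_zero]) (fun y => by
        rw [norm_mul, norm_inv, Complex.norm_real, Real.norm_of_nonneg hD.le, inv_mul_le_iff₀ hD]
        exact hfD y) x
    rw [integral_const_mul, norm_mul, norm_inv, Complex.norm_real, Real.norm_of_nonneg hD.le,
      inv_mul_le_iff₀ hD] at h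
    linarith

/-- The halving of the weighted norm every N steps is iterated; the n mod N leftover steps cost only
a constant through the drift, and 1 + βV is comparable to V because V ≥ 1. -/
theorem DriftData.exists_geometric_decay [MeasurableSpace.CountablyGenerated X]
    (H : DriftData P π ν V s δ b) (hap : IsAperiodic P π) :
    ∃ C ρ : ℝ, 0 < C ∧ 0 < ρ ∧ ρ < 1 ∧ ∀ f : X → ℂ, BM f → ∫ x, f x ∂π = 0 → ∀ D : ℝ, 0 ≤ D →
      (∀ x, ‖f x‖ ≤ D * V x) → ∀ n x, ‖∫ y, f y ∂(P ^ n) x‖ ≤ D * C * ρ ^ n * V x := by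
  obtain ⟨β, N, hβ, hN, hcon⟩ := H.exists_contraction hap
  obtain ⟨ρ, hρ0, hρ1, hρ⟩ := exists_half_pow_le N hN
  have hB : 0 < b / δ := div_pos H.b_pos H.δ_pos
  refine ⟨2 * (1 / β) * (1 + β * (1 + b / δ)), ρ, by positivity, hρ0, hρ1,
    fun f hf hf0 D hD hfD n x => ?_⟩
  have hW : ∀ k : ℕ, ∀ x, ‖∫ y, f y ∂(P ^ (k * N)) x‖ ≤ D / β * (1 / 2) ^ k * (1 + β * V x) := by
    intro k
    induction k with
    | zero =>
      intro x
      rw [zero_mul, integral_pow_zero x hf.sm, pow_zero, mul_one]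
      refine (hfD x).trans ?_
      have : D / β * (1 + β * V x) = D / β + D * V x := by field_simp
      rw [this]
      have : 0 ≤ D / β := by positivity
      linarith
    | succ k ih =>
      intro x
      rw [show (k + 1) * N = k * N + N by ring, integral_pow_add (k * N) N x (hf.integrable _)]
      have h := hcon _ (hf.integral_kernel (P ^ (k * N)))
        (by rw [integral_invariant (invariant_pow H.invariant _) (hf.integrable _), hf0])
        (D / β * (1 / 2) ^ k) (by positivity) ih x
      rwa [mul_assoc (D / β), ← pow_succ] at h
  have hn : n = n / N * N + n % N := by rw [mul_comm]; exact (Nat.div_add_mod n N).symm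
  conv_lhs => rw [hn]
  rw [integral_pow_add _ _ x (hf.integrable _)]
  have hVi := H.integrable_V_pow (n % N) x
  have h1 : ‖∫ z, ∫ y, f y ∂(P ^ (n / N * N)) z ∂(P ^ (n % N)) x‖ ≤
      ∫ z, D / β * (1 / 2) ^ (n / N) * (1 + β * V z) ∂(P ^ (n % N)) x :=
    norm_integral_le_of_norm_le (((integrable_const _).add (hVi.const_mul β)).const_mul _)
      (ae_of_all _ (hW (n / N)))
  have h2 : ∫ z, D / β * (1 / 2) ^ (n / N) * (1 + β * V z) ∂(P ^ (n % N)) x =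
      D / β * (1 / 2) ^ (n / N) * (1 + β * ∫ z, V z ∂(P ^ (n % N)) x) := by
    rw [integral_const_mul, integral_add (integrable_const _) (hVi.const_mul β),
      integral_const_mul]
    simp
  rw [h2] at h1
  refine h1.trans ?_
  have h3 : 1 + β * ∫ z, V z ∂(P ^ (n % N)) x ≤ (1 + β * (1 + b / δ)) * V x := by
    have := mul_le_mul_of_nonneg_left (H.integral_V_pow_le' (n % N) x) hβ.le
    have := H.one_le x
    nlinarith
  calc _ ≤ D / β * (2 * ρ ^ n) * ((1 + β * (1 + b / δ)) * V x) := by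
        have h5 : 0 ≤ ∫ z, V z ∂(P ^ (n % N)) x := integral_nonneg fun z => (H.V_pos z).le
        have := hρ n
        gcongr
    _ = _ := by ring

end MarkovEdgeworth

/-! ### The chain with random initial state; moment generating functions of bounded variables -/

namespace MarkovEdgeworth

section PathKernel

variable {X : Type*} [MeasurableSpace X]

/-- The path law of the chain as a kernel in the initial state. -/
noncomputable def chainKernel (P : Kernel X X) [IsMarkovKernel P] : Kernel X (ℕ → X) :=
  (Kernel.traj (X := fun _ => X)
    (fun n => P.comap (fun (path : Finset.Iic n → X) => path ⟨n, Finset.mem_Iic.2 le_rfl⟩)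
      (measurable_pi_apply _)) 0).comap (fun x _ => x) (measurable_pi_lambda _ fun _ => measurable_id)

variable {P : Kernel X X} [IsMarkovKernel P]

instance isMarkovKernel_chainKernel : IsMarkovKernel (chainKernel P) := by
  unfold chainKernel; infer_instance

/-- The path law of the chain with random initial state. -/
noncomputable def averagedLaw (P : Kernel X X) [IsMarkovKernel P] (π : Measure X) :
    Measure (ℕ → X) :=
  (chainKernel P ∘ₖ Kernel.const Unit π) ()

instance isProbabilityMeasure_averagedLaw {π : Measure X} [IsProbabilityMeasure π] :
    IsProbabilityMeasure (averagedLaw P π) := by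
  unfold averagedLaw; infer_instance

theorem integral_averagedLaw {E : Type*} [NormedAddCommGroup E] [NormedSpace ℝ E] [CompleteSpace E]
    {π : Measure X} [IsProbabilityMeasure π] {f : (ℕ → X) → E} (hf : BM f) :
    ∫ w, f w ∂averagedLaw P π = ∫ x, ∫ w, f w ∂chainLaw P x ∂π := by
  have h := Kernel.integral_comp (κ := Kernel.const Unit π) (η := chainKernel P) (a := ())
    (f := f) (hf.integrable _)
  rw [Kernel.const_apply] at h
  exact h

end PathKernel

section BoundedMGF

variable {Ω : Type*} [MeasurableSpace Ω] {μ : Measure Ω} [IsProbabilityMeasure μ] {S : Ω → ℝ}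

theorem integrableExpSet_eq_univ_of_abs_le (hS : Measurable S) {c : ℝ} (hc : ∀ w, |S w| ≤ c) :
    integrableExpSet S μ = Set.univ := by
  refine Set.eq_univ_of_forall fun t => ?_
  refine Integrable.of_bound (Real.measurable_exp.comp (hS.const_mul t)).aestronglyMeasurable
    (Real.exp (|t| * c)) (ae_of_all _ fun w => ?_)
  rw [Real.norm_of_nonneg (Real.exp_pos _).le]
  refine Real.exp_le_exp.2 ((le_abs_self _).trans ?_)
  rw [abs_mul]
  exact mul_le_mul_of_nonneg_left (hc w) (abs_nonneg _)

theorem differentiable_complexMGF_of_abs_le (hS : Measurable S) {c : ℝ} (hc : ∀ w, |S w| ≤ c) :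
    Differentiable ℂ (complexMGF S μ) := fun z =>
  (hasDerivAt_complexMGF (by
    rw [integrableExpSet_eq_univ_of_abs_le hS hc]; simp)).differentiableAt

theorem complexMGF_zero_eq_one : complexMGF S μ 0 = 1 := by simp [complexMGF]

theorem mgf_pos_of_abs_le (hS : Measurable S) {c : ℝ} (hc : ∀ w, |S w| ≤ c) (t : ℝ) :
    0 < mgf S μ t := mgf_pos (by
  have : t ∈ integrableExpSet S μ := by rw [integrableExpSet_eq_univ_of_abs_le hS hc]; trivial
  exact this)

end BoundedMGF

/-! ### Normalized power iteration for small complex parameters -/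

variable {X : Type*} [MeasurableSpace X] {P : Kernel X X} [IsMarkovKernel P] {π ν : Measure X}
  [IsProbabilityMeasure π] {V s : X → ℝ} {δ b : ℝ} {F : X → ℝ}

theorem twist_iterate_one (hF : Measurable F) (hF1 : ∀ x, |F x| ≤ 1) (z : ℂ) (n : ℕ) (x : X) :
    (twist P F z)^[n] (fun _ => 1) x = complexMGF (partialSum F n) (chainLaw P x) z := by
  rw [← integral_exp_partialSum hF hF1 z n x (BM.const 1)]
  simp [complexMGF]

theorem integral_twist_iterate_one (hF : Measurable F) (hF1 : ∀ x, |F x| ≤ 1) (z : ℂ) (n : ℕ) :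
    ∫ x, (twist P F z)^[n] (fun _ => 1) x ∂π =
      complexMGF (partialSum F n) (averagedLaw P π) z := by
  simp_rw [twist_iterate_one hF hF1]
  exact (integral_averagedLaw (bm_exp_partialSum hF hF1 z n)).symm

theorem norm_exp_mul_sub_one_le (hF1 : ∀ x, |F x| ≤ 1) {z : ℂ} (hz : ‖z‖ ≤ 1) (x : X) :
    ‖Complex.exp (z * F x) - 1‖ ≤ 2 * ‖z‖ := by
  have h1 : ‖z * F x‖ ≤ ‖z‖ := by
    rw [norm_mul, Complex.norm_real]
    exact mul_le_of_le_one_right (norm_nonneg _) (hF1 x)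
  exact (Complex.norm_exp_sub_one_le (h1.trans hz)).trans (by linarith)

theorem integral_twist (hinv : Kernel.Invariant P π) (hF : Measurable F) (hF1 : ∀ x, |F x| ≤ 1) (z : ℂ)
    {f : X → ℂ} (hf : BM f) :
    ∫ x, twist P F z f x ∂π =
      ∫ x, (Complex.exp (z * F x) - 1) * ∫ y, f y ∂P x ∂π + ∫ x, f x ∂π := by
  rw [← integral_invariant hinv (hf.integrable π), ← integral_add
    ((((bm_exp hF hF1 z).sub (BM.const 1)).mul (hf.integral_kernel P)).integrable π)
    ((hf.integral_kernel P).integrable π)]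
  refine integral_congr_ae (ae_of_all _ fun x => ?_)
  simp only [twist]
  ring

theorem DriftData.norm_integral_twist_sub_le (H : DriftData P π ν V s δ b) (hF : Measurable F)
    (hF1 : ∀ x, |F x| ≤ 1) {z : ℂ} (hz : ‖z‖ ≤ 1) {f : X → ℂ} (hf : BM f) {D : ℝ}
    (hfD : ∀ x, ‖f x‖ ≤ D * V x) :
    ‖∫ x, twist P F z f x ∂π - ∫ x, f x ∂π‖ ≤ 2 * ‖z‖ * (D * ∫ x, V x ∂π) := by
  rw [integral_twist H.invariant hF hF1 z hf, add_sub_cancel_right]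
  refine (norm_integral_le_of_norm_le ((hf.norm.integral_kernel P).integrable π |>.const_mul (2 * ‖z‖))
    (ae_of_all _ fun x => ?_)).trans ?_
  · rw [norm_mul]
    exact mul_le_mul (norm_exp_mul_sub_one_le hF1 hz x) (norm_integral_le_integral_norm _)
      (norm_nonneg _) (mul_nonneg two_pos.le (norm_nonneg z))
  · rw [integral_const_mul, integral_invariant H.invariant (hf.norm.integrable π), ← integral_const_mul D]
    exact mul_le_mul_of_nonneg_left (integral_mono (hf.norm.integrable π)
      (H.integrable_V.const_mul D) hfD) (mul_nonneg two_pos.le (norm_nonneg z))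

/-- One step of the normalized power iteration contracts increments. -/
theorem DriftData.twist_increment_bound (H : DriftData P π ν V s δ b) (hF : Measurable F)
    (hF1 : ∀ x, |F x| ≤ 1) {C ρ : ℝ} (hρ1 : ρ < 1)
    (hdec : ∀ f : X → ℂ, BM f → ∫ x, f x ∂π = 0 → ∀ D : ℝ, 0 ≤ D →
      (∀ x, ‖f x‖ ≤ D * V x) → ∀ n x, ‖∫ y, f y ∂(P ^ n) x‖ ≤ D * C * ρ ^ n * V x)
    {z : ℂ} (hz : ‖z‖ ≤ 1) {w v : X → ℂ} (hw : BM w) (hw0 : ∫ x, w x ∂π = 0) {D : ℝ} (hD : 0 ≤ D)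
    (hwD : ∀ k x, ‖∫ y, w y ∂(P ^ k) x‖ ≤ D * ρ ^ k * V x) (hv : BM v) (hv1 : ∫ x, v x ∂π = 1)
    (hvV : ∀ x, ‖v x‖ ≤ 2 * V x) (k : ℕ) (x : X) :
    ‖∫ y, (twist P F z w y - (∫ y', twist P F z w y' ∂π) * v y) ∂(P ^ k) x‖ ≤
      D * (ρ + 2 * C * (1 + 2 * ∫ x, V x ∂π) * ‖z‖) * ρ ^ k * V x := by
  set q := ∫ y', twist P F z w y' ∂π with hq
  set B := ∫ x, V x ∂π
  have hB0 : 0 ≤ B := integral_nonneg fun x => (H.V_pos x).le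
  have hw1 : ∀ x, ‖w x‖ ≤ D * V x := fun x => by
    have := hwD 0 x
    rwa [integral_pow_zero x hw.sm, pow_zero, mul_one] at this
  have hqn : ‖q‖ ≤ 2 * ‖z‖ * (D * B) := by
    have := H.norm_integral_twist_sub_le hF hF1 hz hw hw1
    rwa [hw0, sub_zero] at this
  have hPw : ∀ x, ‖∫ y, w y ∂P x‖ ≤ D * V x := fun x => by
    have := hwD 1 x
    rw [pow_one, pow_one] at this
    refine this.trans ?_
    have := mul_nonneg hD (H.V_pos x).le
    nlinarith
  have hPwB : BM fun x => ∫ y, w y ∂P x := hw.integral_kernel P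
  -- The new increment is Pw + g, with g of mean zero and of size O(‖z‖D). Measuring w by the
  -- supremum over k of ρ^{-k}‖P^k w‖, relative to V, makes Pw contract by exactly ρ, without a
  -- constant, so the perturbation g still leaves a contraction.
  set g : X → ℂ := fun y => (Complex.exp (z * F y) - 1) * ∫ y', w y' ∂P y - q * v y with hg
  have hexpB : BM fun y => (Complex.exp (z * F y) - 1) * ∫ y', w y' ∂P y :=
    ((bm_exp hF hF1 z).sub (BM.const 1)).mul hPwB
  have hgB : BM g := hexpB.sub ((BM.const q).mul hv)
  have hqe : q = ∫ x, (Complex.exp (z * F x) - 1) * ∫ y, w y ∂P x ∂π := by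
    rw [hq, integral_twist H.invariant hF hF1 z hw, hw0, add_zero]
  have hg0 : ∫ x, g x ∂π = 0 := by
    rw [hg, integral_sub (hexpB.integrable _) (((BM.const q).mul hv).integrable _),
      integral_const_mul, hv1, mul_one, ← hqe, sub_self]
  have hgD : ∀ y, ‖g y‖ ≤ (2 * ‖z‖ * D * (1 + 2 * B)) * V y := fun y => by
    refine (norm_sub_le _ _).trans ?_
    rw [norm_mul, norm_mul]
    have h1 := mul_le_mul (norm_exp_mul_sub_one_le hF1 hz y) (hPw y) (norm_nonneg _)
      (by positivity : 0 ≤ 2 * ‖z‖)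
    have h2 := mul_le_mul hqn (hvV y) (norm_nonneg _) (by positivity)
    linarith
  have e : ∀ y, twist P F z w y - q * v y = ∫ y', w y' ∂P y + g y := fun y => by
    simp only [twist, hg]; ring
  simp_rw [e]
  rw [integral_add (hPwB.integrable _) (hgB.integrable _)]
  have h1 : ∫ y, ∫ y', w y' ∂P y ∂(P ^ k) x = ∫ y, w y ∂(P ^ (k + 1)) x := by
    rw [add_comm k 1, integral_pow_add 1 k x (hw.integrable _), pow_one]
  rw [h1]
  refine (norm_add_le _ _).trans ?_
  have h2 := hdec g hgB hg0 _ (by positivity) hgD k x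
  have h3 := hwD (k + 1) x
  rw [show D * ρ ^ (k + 1) * V x = D * ρ * ρ ^ k * V x by ring] at h3
  linarith

/-- The normalized power iteration of the twisted operator near `z = 0`. -/
theorem DriftData.exists_normalized_orbit [MeasurableSpace.CountablyGenerated X]
    (H : DriftData P π ν V s δ b) (hap : IsAperiodic P π) (hF : Measurable F)
    (hF1 : ∀ x, |F x| ≤ 1) :
    ∃ η r : ℝ, 0 < η ∧ 0 < r ∧ r < 1 ∧ ∀ z : ℂ, ‖z‖ ≤ η → ∃ (v : ℕ → X → ℂ) (a : ℕ → ℂ),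
      v 0 = (fun _ => 1) ∧ (∀ n x, twist P F z (v n) x = a n * v (n + 1) x) ∧
      (∀ n, ∫ x, v n x ∂π = 1) ∧ (∀ n, BM (v n)) ∧ (∀ n x, ‖v n x‖ ≤ 2 * V x) ∧
      (∀ n, ‖a n - 1‖ ≤ 1 / 4) ∧ ∀ n, ‖a (n + 1) - a n‖ ≤ r ^ n := by
  obtain ⟨C, ρ, hC, hρ, hρ1, hdec⟩ := H.exists_geometric_decay hap
  set B := ∫ x, V x ∂π
  have hB0 : 0 ≤ B := integral_nonneg fun x => (H.V_pos x).le
  -- In order, the last four conditions keep the normalizing constants near 1, control their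
  -- increments, keep the contraction factor below r after normalization, and keep the total of all
  -- increments at most V.
  have hη : ∃ η : ℝ, 0 < η ∧ η ≤ 1 ∧ 2 * η * (2 * B) ≤ (1 - ρ) / 4 ∧ 2 * η * B ≤ 1 ∧
      2 * C * (1 + 2 * B) * η ≤ (1 - ρ) / 4 ∧ 8 * η * C ≤ (1 - ρ) / 2 := by
    have hev : ∀ c d : ℝ, 0 < d → ∀ᶠ η in 𝓝[>] (0 : ℝ), c * η ≤ d := fun c d hd => by
      have h : Tendsto (fun η : ℝ => c * η) (𝓝[>] 0) (𝓝 (c * 0)) :=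
        (continuous_const.mul continuous_id).continuousWithinAt
      rw [mul_zero] at h
      exact (h.eventually (gt_mem_nhds hd)).mono fun _ h => h.le
    have h4 : 0 < (1 - ρ) / 4 := by linarith
    obtain ⟨η, h1, h2, h3, h4, h5, h6⟩ := ((eventually_mem_nhdsWithin).and ((hev 1 1 one_pos).and
      ((hev (2 * (2 * B)) _ h4).and ((hev (2 * B) 1 one_pos).and
        ((hev (2 * C * (1 + 2 * B)) _ h4).and (hev (8 * C) ((1 - ρ) / 2) (by linarith))))))).exists
    exact ⟨η, Set.mem_Ioi.1 h1, by linarith, by linarith, by linarith, h5, by linarith⟩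
  obtain ⟨η, hη0, hη1, hη2, hη3, hη4, hη5⟩ := hη
  refine ⟨η, (1 + ρ) / 2, hη0, by linarith, by linarith, fun z hzη => ?_⟩
  have hz : ‖z‖ ≤ 1 := hzη.trans hη1
  set r := (1 + ρ) / 2 with hr
  have hr1 : 0 < 1 - r := by linarith
  have hr0 : 0 < r := by linarith
  -- The first increment v₁ - v₀ is at most 8ηV, and C is the constant of the geometric decay.
  set D₀ := 8 * η * C with hD₀
  have hD0 : 0 < D₀ := by positivity
  let step : (X → ℂ) → X → ℂ := fun v x => (∫ y, twist P F z v y ∂π)⁻¹ * twist P F z v x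
  let v : ℕ → X → ℂ := fun n => step^[n] fun _ => 1
  let a : ℕ → ℂ := fun n => ∫ y, twist P F z (v n) y ∂π
  have hvs : ∀ n x, v (n + 1) x = (a n)⁻¹ * twist P F z (v n) x := fun n x => by
    simp only [v, Function.iterate_succ_apply']; rfl
  have hvB : ∀ n, BM (v n) := by
    intro n
    induction n with
    | zero => exact BM.const 1
    | succ n ih =>
      have : v (n + 1) = fun x => (a n)⁻¹ * twist P F z (v n) x := funext (hvs n)
      rw [this]
      exact (BM.const _).mul (ih.twist hF hF1 z)
  have hgeom : ∀ n, D₀ * ∑ i ∈ Finset.range n, r ^ i ≤ 1 := by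
    intro n
    have h := (summable_geometric_of_lt_one hr0.le (by linarith)).sum_le_tsum
      (Finset.range n) (fun i _ => pow_nonneg hr0.le i)
    rw [tsum_geometric_of_lt_one hr0.le (by linarith)] at h
    calc D₀ * ∑ i ∈ Finset.range n, r ^ i ≤ (1 - r) * (1 - r)⁻¹ :=
          mul_le_mul (by rw [hr]; linarith) h
            (Finset.sum_nonneg fun i _ => pow_nonneg hr0.le i) hr1.le
      _ = 1 := mul_inv_cancel₀ hr1.ne'
  have habound : ∀ n, ∫ x, v n x ∂π = 1 → (∀ x, ‖v n x‖ ≤ 2 * V x) → ‖a n - 1‖ ≤ (1 - ρ) / 4 := by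
    intro n h1 h2
    have := H.norm_integral_twist_sub_le hF hF1 hz (hvB n) h2
    rw [h1] at this
    refine this.trans (le_trans ?_ hη2)
    gcongr
  have hane : ∀ n, ‖a n - 1‖ ≤ (1 - ρ) / 4 → 1 - (1 - ρ) / 4 ≤ ‖a n‖ := by
    intro n h
    have := norm_sub_norm_le (1 : ℂ) (a n)
    rw [norm_one, norm_sub_rev] at this
    linarith
  have hane0 : ∀ n, ‖a n - 1‖ ≤ (1 - ρ) / 4 → a n ≠ 0 := by
    intro n h h0
    have := hane n h
    rw [h0, norm_zero] at this
    linarith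
  have hnext : ∀ n, a n ≠ 0 → ∫ x, v (n + 1) x ∂π = 1 := by
    intro n h
    simp_rw [hvs]
    rw [integral_const_mul]
    exact inv_mul_cancel₀ h
  -- The size bound and the increment bound must be proved together: the contraction of increments
  -- needs ‖v_n‖ ≤ 2V, which in turn is the sum of the previous increments.
  have key : ∀ n, ∫ x, v n x ∂π = 1 ∧ (∀ x, ‖v n x‖ ≤ (1 + D₀ * ∑ i ∈ Finset.range n, r ^ i) * V x) ∧
      ∀ k x, ‖∫ y, (v (n + 1) y - v n y) ∂(P ^ k) x‖ ≤ D₀ * r ^ n * ρ ^ k * V x := by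
    intro n
    induction n with
    | zero =>
      have hi : ∫ x, v 0 x ∂π = 1 := by simp [v]
      have hb0 : ∀ x, ‖v 0 x‖ ≤ 2 * V x := fun x => by
        have := H.one_le x
        simp only [v, Function.iterate_zero, id, norm_one]
        linarith
      refine ⟨hi, fun x => ?_, fun k x => ?_⟩
      · simpa [v] using H.one_le x
      · have ha := habound 0 hi hb0
        have hd : ∫ y, (v (0 + 1) y - v 0 y) ∂π = 0 := by
          rw [integral_sub ((hvB _).integrable _) ((hvB _).integrable _), hnext 0 (hane0 0 ha), hi,
            sub_self]
        have htw : ∀ y, twist P F z (v 0) y = Complex.exp (z * F y) := fun y => by simp [twist, v]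
        have ha1 : ‖a 0 - 1‖ ≤ 2 * ‖z‖ := by
          have e : a 0 - 1 = ∫ y, (Complex.exp (z * F y) - 1) ∂π := by
            rw [integral_sub ((bm_exp hF hF1 z).integrable _) (integrable_const _)]
            simp [a, htw]
          rw [e]
          simpa using norm_integral_le_of_norm_le_const (μ := π)
            (ae_of_all _ (norm_exp_mul_sub_one_le hF1 hz))
        have hanorm : 1 / 2 ≤ ‖a 0‖ := (hane 0 ha).trans' (by linarith)
        have := hdec _ ((hvB (0 + 1)).sub (hvB 0)) hd (8 * η) (by positivity) (fun y => ?_) k x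
        · simpa [hD₀] using this
        · have e : v (0 + 1) y - v 0 y = (a 0)⁻¹ * ((Complex.exp (z * F y) - 1) - (a 0 - 1)) := by
            rw [hvs, htw]
            have := hane0 0 ha
            simp only [v, Function.iterate_zero, id]
            field_simp
            ring
          rw [e, norm_mul, norm_inv, inv_mul_le_iff₀ (by linarith)]
          calc _ ≤ 2 * ‖z‖ + 2 * ‖z‖ :=
                (norm_sub_le _ _).trans (add_le_add (norm_exp_mul_sub_one_le hF1 hz y) ha1)
            _ ≤ 1 / 2 * (8 * η * 1) := by linarith
            _ ≤ ‖a 0‖ * (8 * η * V y) := by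
                have := H.one_le y
                gcongr
    | succ n ih =>
      obtain ⟨i1, i2, i3⟩ := ih
      have hb : ∀ m : ℕ, (∀ x, ‖v m x‖ ≤ (1 + D₀ * ∑ i ∈ Finset.range m, r ^ i) * V x) →
          ∀ x, ‖v m x‖ ≤ 2 * V x := fun m h x => (h x).trans
        (mul_le_mul_of_nonneg_right (by linarith [hgeom m]) (H.V_pos x).le)
      have ha := habound n i1 (hb n i2)
      have j1 := hnext n (hane0 n ha)
      have j2 : ∀ x, ‖v (n + 1) x‖ ≤ (1 + D₀ * ∑ i ∈ Finset.range (n + 1), r ^ i) * V x := by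
        intro x
        have h0 := i3 0 x
        rw [integral_pow_zero x ((hvB _).sub (hvB _)).sm, pow_zero, mul_one] at h0
        have h1 := norm_add_le (v n x) (v (n + 1) x - v n x)
        rw [add_sub_cancel] at h1
        rw [Finset.sum_range_succ]
        linarith [i2 x]
      refine ⟨j1, j2, fun k x => ?_⟩
      have ha' := habound (n + 1) j1 (hb _ j2)
      have hne := hane0 _ ha'
      have hw0 : ∫ x, (v (n + 1) x - v n x) ∂π = 0 := by
        rw [integral_sub ((hvB _).integrable _) ((hvB _).integrable _), j1, i1, sub_self]
      have hst := H.twist_increment_bound hF hF1 hρ1 hdec hz ((hvB (n + 1)).sub (hvB n)) hw0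
        (D := D₀ * r ^ n) (by positivity) i3 (hvB (n + 1)) j1 (hb _ j2) k x
      have htl : ∀ y, twist P F z (fun x => v (n + 1) x - v n x) y =
          twist P F z (v (n + 1)) y - twist P F z (v n) y := fun y => by
        simp only [twist]
        rw [integral_sub ((hvB _).integrable _) ((hvB _).integrable _), mul_sub]
      have hq : ∫ y, twist P F z (fun x => v (n + 1) x - v n x) y ∂π = a (n + 1) - a n := by
        simp_rw [htl]
        exact integral_sub (((hvB _).twist hF hF1 z).integrable _)
          (((hvB _).twist hF hF1 z).integrable _)
      -- Subtracting two consecutive normalized steps; the change of normalization a_{n+1} - a_n is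
      -- the π-mean of the twisted increment.
      have e : ∀ y, v (n + 1 + 1) y - v (n + 1) y = (a (n + 1))⁻¹ *
          (twist P F z (fun x => v (n + 1) x - v n x) y -
            (∫ y, twist P F z (fun x => v (n + 1) x - v n x) y ∂π) * v (n + 1) y) := fun y => by
        rw [hq, htl, hvs (n + 1)]
        have h1 : twist P F z (v n) y = a n * v (n + 1) y := by
          rw [hvs n, ← mul_assoc, mul_inv_cancel₀ (hane0 n ha), one_mul]
        rw [h1]
        field_simp
        ring
      simp_rw [e]
      rw [integral_const_mul, norm_mul, norm_inv, inv_mul_le_iff₀ (norm_pos_iff.2 hne)]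
      refine hst.trans ?_
      have h1 : ρ + 2 * C * (1 + 2 * B) * ‖z‖ ≤ ‖a (n + 1)‖ * r := by
        have h2 : 2 * C * (1 + 2 * B) * ‖z‖ ≤ (1 - ρ) / 4 := le_trans (by gcongr) hη4
        have h3 := mul_le_mul_of_nonneg_right (hane _ ha') hr0.le
        have h4 : (1 - ρ) / 4 * r ≤ (1 - ρ) / 4 * 1 :=
          mul_le_mul_of_nonneg_left (by linarith) (by linarith)
        have h5 : r - (1 - ρ) / 4 = ρ + (1 - ρ) / 4 := by rw [hr]; ring
        linarith
      calc _ ≤ D₀ * r ^ n * (‖a (n + 1)‖ * r) * ρ ^ k * V x := by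
            have := (H.V_pos x).le
            gcongr
        _ = _ := by rw [pow_succ]; ring
  have hb : ∀ n x, ‖v n x‖ ≤ 2 * V x := fun n x => ((key n).2.1 x).trans
    (mul_le_mul_of_nonneg_right (by linarith [hgeom n]) (H.V_pos x).le)
  have ha : ∀ n, ‖a n - 1‖ ≤ (1 - ρ) / 4 := fun n => habound n (key n).1 (hb n)
  refine ⟨v, a, rfl, fun n x => ?_, fun n => (key n).1, hvB, hb, fun n => (ha n).trans (by linarith),
    fun n => ?_⟩
  · rw [hvs n, ← mul_assoc, mul_inv_cancel₀ (hane0 n (ha n)), one_mul]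
  · have hw0 : ∫ x, (v (n + 1) x - v n x) ∂π = 0 := by
      rw [integral_sub ((hvB _).integrable _) ((hvB _).integrable _), (key _).1, (key _).1, sub_self]
    have hwD : ∀ x, ‖v (n + 1) x - v n x‖ ≤ (D₀ * r ^ n) * V x := fun x => by
      have h0 := (key n).2.2 0 x
      rwa [integral_pow_zero x ((hvB _).sub (hvB _)).sm, pow_zero, mul_one] at h0
    have htl : ∀ y, twist P F z (fun x => v (n + 1) x - v n x) y =
        twist P F z (v (n + 1)) y - twist P F z (v n) y := fun y => by
      simp only [twist]
      rw [integral_sub ((hvB _).integrable _) ((hvB _).integrable _), mul_sub]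
    have hq : ∫ y, twist P F z (fun x => v (n + 1) x - v n x) y ∂π = a (n + 1) - a n := by
      simp_rw [htl]
      exact integral_sub (((hvB _).twist hF hF1 z).integrable _)
        (((hvB _).twist hF hF1 z).integrable _)
    have := H.norm_integral_twist_sub_le hF hF1 hz ((hvB (n + 1)).sub (hvB n)) hwD
    rw [hq, hw0, sub_zero] at this
    refine this.trans ?_
    have hD1 : D₀ ≤ 1 := by rw [hD₀]; linarith
    calc 2 * ‖z‖ * (D₀ * r ^ n * B) ≤ 2 * η * (1 * r ^ n * B) := by gcongr
      _ = (2 * η * B) * r ^ n := by ring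
      _ ≤ 1 * r ^ n := by gcongr
      _ = r ^ n := one_mul _

end MarkovEdgeworth

/-! ### The limiting logarithmic moment generating function -/

namespace MarkovEdgeworth

variable {X : Type*} [MeasurableSpace X] {P : Kernel X X} [IsMarkovKernel P] {π ν : Measure X}
  [IsProbabilityMeasure π] {V s : X → ℝ} {δ b : ℝ} {F : X → ℝ}

/-- An analytic limiting log-moment generating function, with uniformly controlled prefactors. -/
structure Pressure (P : Kernel X X) [IsMarkovKernel P] (F V : X → ℝ) (η C : ℝ) (L : ℂ → ℂ) :
    Prop where
  η_pos : 0 < η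
  C_pos : 0 < C
  diff : DifferentiableOn ℂ L (Metric.ball 0 η)
  zero : L 0 = 0
  im_eq_zero : ∀ a : ℝ, |a| < η → (L a).im = 0
  bound : ∀ n x, ∀ z ∈ Metric.ball (0 : ℂ) η,
    ‖complexMGF (partialSum F n) (chainLaw P x) z * Complex.exp (-(n * L z))‖ ≤ C * V x

theorem mem_slitPlane_of_norm_sub_one_le {w : ℂ} (hw : ‖w - 1‖ ≤ 1 / 4) : w ∈ Complex.slitPlane := by
  have := Complex.mem_slitPlane_of_norm_lt_one (z := w - 1) (by linarith)
  rwa [add_sub_cancel] at this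

theorem norm_log_sub_log_le {w w' : ℂ} (hw : ‖w - 1‖ ≤ 1 / 4) (hw' : ‖w' - 1‖ ≤ 1 / 4) :
    ‖Complex.log w' - Complex.log w‖ ≤ 2 * ‖w' - w‖ := by
  refine (convex_closedBall (1 : ℂ) (1 / 4)).norm_image_sub_le_of_norm_hasDerivWithin_le
    (f := Complex.log) (f' := fun z => z⁻¹) (fun z hz => ?_) (fun z hz => ?_) ?_ ?_
  · rw [mem_closedBall_iff_norm] at hz
    exact (Complex.hasDerivAt_log (mem_slitPlane_of_norm_sub_one_le hz)).hasDerivWithinAt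
  · rw [mem_closedBall_iff_norm] at hz
    have := norm_sub_norm_le (1 : ℂ) z
    rw [norm_one, norm_sub_rev] at this
    rw [norm_inv]
    exact inv_le_of_inv_le₀ two_pos (by norm_num; linarith)
  · exact mem_closedBall_iff_norm.2 hw
  · exact mem_closedBall_iff_norm.2 hw'

/-- The logarithms of the normalizing constants converge geometrically, so their sum differs from
nL(z) by a bounded amount. This gives both the holomorphy of L, as a locally uniform limit, and the
uniform bound on the prefactor. -/
theorem DriftData.exists_pressure [MeasurableSpace.CountablyGenerated X]
    (H : DriftData P π ν V s δ b) (hap : IsAperiodic P π) (hF : Measurable F)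
    (hF1 : ∀ x, |F x| ≤ 1) : ∃ (η C : ℝ) (L : ℂ → ℂ), Pressure P F V η C L := by
  obtain ⟨η, r, hη, hr0, hr1, horb⟩ := H.exists_normalized_orbit hap hF hF1
  -- The orbits are obtained separately for each z, with no regularity in z. Holomorphy is recovered
  -- by recognizing the normalizing constants as ratios of these entire functions.
  set m : ℕ → ℂ → ℂ := fun n z => complexMGF (partialSum F n) (averagedLaw P π) z with hm
  have hmdiff : ∀ n, Differentiable ℂ (m n) := fun n =>
    differentiable_complexMGF_of_abs_le (measurable_partialSum hF n) (abs_partialSum_le hF1 n)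
  have hm0 : ∀ z, m 0 z = 1 := fun z => by simp [hm, complexMGF, partialSum]
  have hmain : ∀ z : ℂ, ‖z‖ ≤ η → (∀ n, m n z ≠ 0) ∧ (∀ n, ‖m (n + 1) z / m n z - 1‖ ≤ 1 / 4) ∧
      (∀ n, ‖m (n + 2) z / m (n + 1) z - m (n + 1) z / m n z‖ ≤ r ^ n) ∧
      ∀ n x, ‖complexMGF (partialSum F n) (chainLaw P x) z‖ ≤ ‖m n z‖ * (2 * V x) := by
    intro z hz
    obtain ⟨v, a, h0, h1, h2, h3, h4, h5, h6⟩ := horb z hz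
    have ha : ∀ n, a n ≠ 0 := fun n h => by
      have := h5 n
      rw [h, zero_sub, norm_neg, norm_one] at this
      norm_num at this
    have hiter : ∀ n x, (twist P F z)^[n] (fun _ => 1) x = (∏ j ∈ Finset.range n, a j) * v n x := by
      intro n
      induction n with
      | zero => intro x; simp [h0]
      | succ n ih =>
        intro x
        rw [Function.iterate_succ_apply', funext ih, Finset.prod_range_succ, mul_assoc, ← h1]
        simp only [twist, integral_const_mul]
        ring
    have hmp : ∀ n, m n z = ∏ j ∈ Finset.range n, a j := by
      intro n
      rw [hm]
      simp only
      rw [← integral_twist_iterate_one hF hF1]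
      simp_rw [hiter]
      rw [integral_const_mul, h2, mul_one]
    have hne : ∀ n, m n z ≠ 0 := fun n => by
      rw [hmp]; exact Finset.prod_ne_zero_iff.2 fun j _ => ha j
    have hrat : ∀ n, m (n + 1) z / m n z = a n := fun n => by
      rw [div_eq_iff (hne n), hmp, hmp, Finset.prod_range_succ, mul_comm]
    refine ⟨hne, fun n => by rw [hrat]; exact h5 n,
      fun n => by rw [hrat (n + 1), hrat]; exact h6 n, fun n x => ?_⟩
    rw [← twist_iterate_one hF hF1, hiter, ← hmp, norm_mul]
    exact mul_le_mul_of_nonneg_left (h4 n x) (norm_nonneg _)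
  set l : ℕ → ℂ → ℂ := fun n z => Complex.log (m (n + 1) z / m n z) with hl
  have hdist : ∀ z : ℂ, ‖z‖ ≤ η → ∀ n, dist (l n z) (l (n + 1) z) ≤ 2 * r ^ n := by
    intro z hz n
    obtain ⟨-, h2, h3, -⟩ := hmain z hz
    rw [dist_comm, dist_eq_norm]
    exact (norm_log_sub_log_le (h2 n) (h2 (n + 1))).trans
      (mul_le_mul_of_nonneg_left (h3 n) two_pos.le)
  have hlim : ∀ z : ℂ, ‖z‖ ≤ η → ∃ y, Tendsto (fun n => l n z) atTop (𝓝 y) := fun z hz =>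
    cauchySeq_tendsto_of_complete (cauchySeq_of_le_geometric r 2 hr1 (hdist z hz))
  choose! L hL using hlim
  have hLd : ∀ z : ℂ, ‖z‖ ≤ η → ∀ n, ‖l n z - L z‖ ≤ 2 * r ^ n / (1 - r) := fun z hz n => by
    rw [← dist_eq_norm]
    exact dist_le_of_le_geometric_of_tendsto r 2 hr1 (hdist z hz) (hL z hz) n
  have hball : ∀ z ∈ Metric.ball (0 : ℂ) η, ‖z‖ ≤ η := fun z hz => (mem_ball_zero_iff.1 hz).le
  refine ⟨η, Real.exp (2 / (1 - r) * (1 / (1 - r))) * 2, L, hη, by positivity, ?_, ?_, ?_, ?_⟩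
  · have hunif : TendstoUniformlyOn l L atTop (Metric.ball 0 η) := by
      rw [Metric.tendstoUniformlyOn_iff]
      intro ε hε
      have h0 : Tendsto (fun n : ℕ => 2 * r ^ n / (1 - r)) atTop (𝓝 0) := by
        simpa using ((tendsto_pow_atTop_nhds_zero_of_lt_one hr0.le hr1).const_mul 2).div_const (1 - r)
      filter_upwards [h0.eventually (gt_mem_nhds hε)] with n hn z hz
      rw [dist_comm, dist_eq_norm]
      exact (hLd z (hball z hz) n).trans_lt hn
    refine hunif.tendstoLocallyUniformlyOn.differentiableOn (Eventually.of_forall fun n => ?_)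
      Metric.isOpen_ball
    refine DifferentiableOn.clog (((hmdiff _).differentiableOn).div (hmdiff _).differentiableOn
      fun z hz => (hmain z (hball z hz)).1 n) fun z hz => ?_
    exact mem_slitPlane_of_norm_sub_one_le ((hmain z (hball z hz)).2.1 n)
  · refine tendsto_nhds_unique (hL 0 (by simpa using hη.le)) (tendsto_const_nhds.congr fun n => ?_)
    simp [hl, hm, complexMGF_zero_eq_one]
  -- For real a the stationary moment generating functions are nonnegative reals, so the logarithms
  -- are real.
  · intro a ha
    have ha' : ‖(a : ℂ)‖ ≤ η := by simpa using ha.le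
    have h := (Complex.continuous_im.tendsto _).comp (hL a ha')
    refine tendsto_nhds_unique h (tendsto_const_nhds.congr fun n => ?_)
    simp only [hl, hm, Function.comp, complexMGF_ofReal]
    rw [← Complex.ofReal_div, ← Complex.ofReal_log, Complex.ofReal_im]
    exact div_nonneg mgf_nonneg mgf_nonneg
  · intro n x z hz
    have hz' := hball z hz
    obtain ⟨h1, -, -, h4⟩ := hmain z hz'
    have hmexp : ∀ n, m n z = Complex.exp (∑ j ∈ Finset.range n, l j z) := by
      intro n
      induction n with
      | zero => simp [hm0]
      | succ n ih =>
        rw [Finset.sum_range_succ, Complex.exp_add, ← ih, hl]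
        simp only
        rw [Complex.exp_log (div_ne_zero (h1 _) (h1 _)), mul_div_cancel₀ _ (h1 n)]
    have hdiff : ‖m n z * Complex.exp (-(n * L z))‖ ≤ Real.exp (2 / (1 - r) * (1 / (1 - r))) := by
      rw [hmexp, ← Complex.exp_add]
      refine (Complex.norm_exp_le_exp_norm _).trans (Real.exp_le_exp.2 ?_)
      have e : ∑ j ∈ Finset.range n, l j z + -(n * L z) = ∑ j ∈ Finset.range n, (l j z - L z) := by
        rw [Finset.sum_sub_distrib]; simp; ring
      rw [e]
      refine (norm_sum_le _ _).trans ((Finset.sum_le_sum fun j _ => hLd z hz' j).trans ?_)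
      have h := (summable_geometric_of_lt_one hr0.le hr1).sum_le_tsum
        (Finset.range n) (fun i _ => pow_nonneg hr0.le i)
      rw [tsum_geometric_of_lt_one hr0.le hr1] at h
      have hr' : 0 < 1 - r := by linarith
      calc ∑ j ∈ Finset.range n, 2 * r ^ j / (1 - r) =
            2 / (1 - r) * ∑ j ∈ Finset.range n, r ^ j := by
              rw [Finset.mul_sum]; exact Finset.sum_congr rfl fun j _ => by ring
        _ ≤ 2 / (1 - r) * (1 / (1 - r)) := by
              rw [one_div (1 - r)]; exact mul_le_mul_of_nonneg_left h (by positivity)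
    rw [norm_mul] at hdiff ⊢
    calc _ ≤ (‖m n z‖ * (2 * V x)) * ‖Complex.exp (-(n * L z))‖ :=
          mul_le_mul_of_nonneg_right (h4 n x) (norm_nonneg _)
      _ = (‖m n z‖ * ‖Complex.exp (-(n * L z))‖) * (2 * V x) := by ring
      _ ≤ _ := by
        have := (H.V_pos x).le
        rw [mul_assoc (Real.exp _)]
        exact mul_le_mul_of_nonneg_right hdiff (by positivity)

end MarkovEdgeworth

/-! ### Poisson equation, asymptotic variance and the prefactor -/

namespace MarkovEdgeworth

variable {X : Type*} [MeasurableSpace X] {P : Kernel X X} [IsMarkovKernel P] {π ν : Measure X}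
  [IsProbabilityMeasure π] {V s : X → ℝ} {δ b : ℝ} {F : X → ℝ}

theorem bm_partialSum (hF : Measurable F) (hF1 : ∀ x, |F x| ≤ 1) (n : ℕ) : BM (partialSum F n) :=
  BM.of_measurable_le (measurable_partialSum hF n) (abs_partialSum_le hF1 n)

theorem integral_partialSum (hF : Measurable F) (hF1 : ∀ x, |F x| ≤ 1) (n : ℕ) (x : X) :
    ∫ w, partialSum F n w ∂chainLaw P x = ∑ k ∈ Finset.range n, ∫ y, F y ∂(P ^ k) x := by
  have hB : BM F := BM.of_measurable_le hF hF1
  simp only [partialSum]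
  rw [integral_finsetSum _ fun i _ => ((hB.comp (measurable_pi_apply i)).integrable _)]
  exact Finset.sum_congr rfl fun k _ => integral_chainLaw x k hB

/-- E_x[S_n] is the partial sum of Σ P^k F(x), which converges geometrically with constant
proportional to V(x). -/
theorem DriftData.exists_poisson_limit [MeasurableSpace.CountablyGenerated X]
    (H : DriftData P π ν V s δ b) (hap : IsAperiodic P π) (hF : Measurable F)
    (hF1 : ∀ x, |F x| ≤ 1) (hmean : ∫ x, F x ∂π = 0) :
    ∃ (Fhat : X → ℝ) (C : ℝ), 0 < C ∧
      (∀ x, Tendsto (fun n => ∫ w, partialSum F n w ∂chainLaw P x) atTop (𝓝 (Fhat x))) ∧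
      ∀ n x, |∫ w, partialSum F n w ∂chainLaw P x| ≤ C * V x := by
  obtain ⟨C, ρ, hC, hρ0, hρ1, hdec⟩ := H.exists_geometric_decay hap
  have hB : BM F := BM.of_measurable_le hF hF1
  have hk : ∀ k x, |∫ y, F y ∂(P ^ k) x| ≤ C * V x * ρ ^ k := by
    intro k x
    have h := hdec (fun x => (F x : ℂ)) hB.ofReal (by rw [integral_complex_ofReal, hmean]; rfl) 1
      zero_le_one (fun y => by
        rw [Complex.norm_real, one_mul]; exact (hF1 y).trans (H.one_le y)) k x
    rw [integral_complex_ofReal, Complex.norm_real, Real.norm_eq_abs] at h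
    linarith
  have hsum : ∀ x, Summable fun k => C * V x * ρ ^ k := fun x =>
    (summable_geometric_of_lt_one hρ0.le hρ1).mul_left _
  have hsum' : ∀ x, Summable fun k => ∫ y, F y ∂(P ^ k) x := fun x =>
    Summable.of_norm_bounded (hsum x) fun k => hk k x
  refine ⟨fun x => ∑' k, ∫ y, F y ∂(P ^ k) x, C * (1 - ρ)⁻¹, by
    have : 0 < 1 - ρ := by linarith
    positivity, fun x => ?_, fun n x => ?_⟩
  · simp_rw [integral_partialSum hF hF1]
    exact (hsum' x).hasSum.tendsto_sum_nat
  · rw [integral_partialSum hF hF1]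
    refine (Finset.abs_sum_le_sum_abs _ _).trans ((Finset.sum_le_sum fun k _ => hk k x).trans ?_)
    have h := (hsum x).sum_le_tsum (Finset.range n) (fun k _ =>
      mul_nonneg (mul_nonneg hC.le (H.V_pos x).le) (pow_nonneg hρ0.le k))
    rw [tsum_mul_left, tsum_geometric_of_lt_one hρ0.le hρ1] at h
    linarith

section Derivatives

variable {Ω : Type*} [MeasurableSpace Ω] {μ : Measure Ω} [IsProbabilityMeasure μ] {S : Ω → ℝ}
  {c η : ℝ} {L : ℂ → ℂ} {n : ℂ}

theorem hasDerivAt_tilted (hS : Measurable S) (hc : ∀ w, |S w| ≤ c)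
    (hL : DifferentiableOn ℂ L (Metric.ball 0 η)) {z : ℂ} (hz : z ∈ Metric.ball (0 : ℂ) η) :
    HasDerivAt (fun z => complexMGF S μ z * Complex.exp (-(n * L z)))
      ((∫ w, S w * Complex.exp (z * S w) ∂μ - n * deriv L z * complexMGF S μ z) *
        Complex.exp (-(n * L z))) z := by
  have h1 := hasDerivAt_complexMGF (X := S) (μ := μ) (z := z) (by
    rw [integrableExpSet_eq_univ_of_abs_le hS hc]; simp)
  have h2 := (hL.differentiableAt (Metric.isOpen_ball.mem_nhds hz)).hasDerivAt
  have h3 := (h2.const_mul n).neg.cexp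
  refine (h1.mul h3).congr_deriv ?_
  change (∫ w, S w * Complex.exp (z * S w) ∂μ) * Complex.exp (-(n * L z)) +
    complexMGF S μ z * (Complex.exp (-(n * L z)) * -(n * deriv L z)) = _
  ring

theorem deriv_tilted_zero (hS : Measurable S) (hc : ∀ w, |S w| ≤ c) (hη : 0 < η)
    (hL : DifferentiableOn ℂ L (Metric.ball 0 η)) (hL0 : L 0 = 0) :
    deriv (fun z => complexMGF S μ z * Complex.exp (-(n * L z))) 0 =
      ((∫ w, S w ∂μ : ℝ) : ℂ) - n * deriv L 0 := by
  rw [(hasDerivAt_tilted hS hc hL (Metric.mem_ball_self hη)).deriv, hL0, complexMGF_zero_eq_one]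
  simp [integral_complex_ofReal]

theorem iteratedDeriv_two_tilted_zero (hS : Measurable S) (hc : ∀ w, |S w| ≤ c) (hη : 0 < η)
    (hL : DifferentiableOn ℂ L (Metric.ball 0 η)) (hL0 : L 0 = 0) (hL1 : deriv L 0 = 0) :
    iteratedDeriv 2 (fun z => complexMGF S μ z * Complex.exp (-(n * L z))) 0 =
      ((∫ w, S w ^ 2 ∂μ : ℝ) : ℂ) - n * iteratedDeriv 2 L 0 := by
  rw [iteratedDeriv_succ, iteratedDeriv_one, iteratedDeriv_succ, iteratedDeriv_one]
  have hnb : Metric.ball (0 : ℂ) η ∈ 𝓝 (0 : ℂ) := Metric.ball_mem_nhds _ hη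
  have he : deriv (fun z => complexMGF S μ z * Complex.exp (-(n * L z))) =ᶠ[𝓝 0] fun z =>
      (∫ w, S w * Complex.exp (z * S w) ∂μ - n * deriv L z * complexMGF S μ z) *
        Complex.exp (-(n * L z)) := by
    filter_upwards [hnb] with z hz using (hasDerivAt_tilted hS hc hL hz).deriv
  rw [he.deriv_eq]
  have huniv : (0 : ℂ).re ∈ interior (integrableExpSet S μ) := by
    rw [integrableExpSet_eq_univ_of_abs_le hS hc]; simp
  have h1 := hasDerivAt_integral_pow_mul_exp (X := S) (μ := μ) (z := 0) huniv 1
  have h2 := hasDerivAt_complexMGF (X := S) (μ := μ) (z := 0) huniv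
  have h3 := (hL.differentiableAt hnb).hasDerivAt
  have h4 : HasDerivAt (deriv L) (deriv (deriv L) 0) 0 :=
    ((hL.deriv Metric.isOpen_ball).differentiableAt hnb).hasDerivAt
  simp only [pow_one] at h1
  have h5 := (h1.sub ((h4.const_mul n).mul h2)).mul (h3.const_mul n).neg.cexp
  refine h5.deriv.trans ?_
  have e : ∫ w, (S w : ℂ) ^ 2 ∂μ = ((∫ w, S w ^ 2 ∂μ : ℝ) : ℂ) := by
    rw [← integral_complex_ofReal]
    simp
  simp [hL0, hL1, complexMGF_zero_eq_one, ← e]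

end Derivatives

/-- First order Taylor estimate for a bounded holomorphic function. -/
theorem exists_norm_sub_sub_le {f : ℂ → ℂ} {η M : ℝ} (hη : 0 < η)
    (hf : DifferentiableOn ℂ f (Metric.ball 0 η)) (hM : ∀ z ∈ Metric.ball (0 : ℂ) η, ‖f z‖ ≤ M)
    {z : ℂ} (hz : z ∈ Metric.ball (0 : ℂ) η) :
    ‖f z - f 0 - z * deriv f 0‖ ≤ 4 * M / η ^ 2 * ‖z‖ ^ 2 := by
  have hnb : Metric.ball (0 : ℂ) η ∈ 𝓝 (0 : ℂ) := Metric.ball_mem_nhds _ hη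
  have h0 : (0 : ℂ) ∈ Metric.ball (0 : ℂ) η := Metric.mem_ball_self hη
  set g := dslope f 0 with hg
  have hgd : DifferentiableOn ℂ g (Metric.ball 0 η) := (Complex.differentiableOn_dslope hnb).2 hf
  have h1 : ∀ z ∈ Metric.ball (0 : ℂ) η, ‖g z‖ ≤ 2 * M / η := fun z hz =>
    Complex.norm_dslope_le_div_of_mapsTo_ball hf (fun w hw => by
      rw [mem_closedBall_iff_norm]
      exact (norm_sub_le _ _).trans (by linarith [hM w hw, hM 0 h0])) hz
  have h2 : ‖dslope g 0 z‖ ≤ (4 * M / η) / η :=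
    Complex.norm_dslope_le_div_of_mapsTo_ball hgd (fun w hw => by
      rw [mem_closedBall_iff_norm]
      refine (norm_sub_le _ _).trans ((add_le_add (h1 w hw) (h1 0 h0)).trans (le_of_eq ?_))
      ring) hz
  have e1 : f z - f 0 = z * g z := by
    have := sub_smul_dslope f 0 z
    simpa using this.symm
  have e2 : g z - g 0 = z * dslope g 0 z := by
    have := sub_smul_dslope g 0 z
    simpa using this.symm
  have e3 : g 0 = deriv f 0 := dslope_same f 0
  have e : f z - f 0 - z * deriv f 0 = z ^ 2 * dslope g 0 z := by
    rw [e1, ← e3, ← mul_sub, e2]; ring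
  rw [e, norm_mul, norm_pow, mul_comm]
  refine mul_le_mul_of_nonneg_right (h2.trans (le_of_eq ?_)) (by positivity)
  field_simp

namespace Pressure

variable {η C : ℝ} {L : ℂ → ℂ}

theorem differentiableOn_tilted (h : Pressure P F V η C L) (hF : Measurable F)
    (hF1 : ∀ x, |F x| ≤ 1) (n : ℕ) (x : X) : DifferentiableOn ℂ
      (fun z => complexMGF (partialSum F n) (chainLaw P x) z * Complex.exp (-(n * L z)))
      (Metric.ball 0 η) := fun _ hz =>
  (hasDerivAt_tilted (n := n) (measurable_partialSum hF n) (abs_partialSum_le hF1 n) h.diff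
    hz).differentiableAt.differentiableWithinAt

/-- Cauchy's estimate on the circle of radius η/2. Its independence of n is what lets a single bound
on the prefactor control every moment of S_n. -/
theorem norm_iteratedDeriv_tilted_le (h : Pressure P F V η C L) (hF : Measurable F)
    (hF1 : ∀ x, |F x| ≤ 1) (n : ℕ) (x : X) (k : ℕ) : ‖iteratedDeriv k
      (fun z => complexMGF (partialSum F n) (chainLaw P x) z * Complex.exp (-(n * L z))) 0‖ ≤
      k.factorial * (C * V x) / (η / 2) ^ k := by
  have hsub : Metric.closedBall (0 : ℂ) (η / 2) ⊆ Metric.ball 0 η :=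
    Metric.closedBall_subset_ball (by linarith [h.η_pos])
  exact Complex.norm_iteratedDeriv_le_of_forall_mem_sphere_norm_le k (half_pos h.η_pos)
    ((h.differentiableOn_tilted hF hF1 n x).diffContOnCl_ball hsub) fun z hz =>
      h.bound n x z (hsub (Metric.sphere_subset_closedBall hz))

theorem eq_zero_of_nat_mul_le {a : ℂ} {K : ℝ} (h : ∀ n : ℕ, ‖(n : ℂ) * a‖ ≤ K) : a = 0 := by
  by_contra ha
  have hp := norm_pos_iff.2 ha
  obtain ⟨n, hn⟩ := exists_nat_gt (K / ‖a‖)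
  have h1 := h n
  rw [norm_mul, Complex.norm_natCast] at h1
  rw [div_lt_iff₀ hp] at hn
  linarith

/-- The first Taylor coefficient of the prefactor is E_x[S_n] - nL'(0). It is bounded in n, and so
is E_x[S_n]. -/
theorem deriv_eq_zero (h : Pressure P F V η C L) (hF : Measurable F) (hF1 : ∀ x, |F x| ≤ 1) {x : X}
    {K : ℝ} (hK : ∀ n, |∫ w, partialSum F n w ∂chainLaw P x| ≤ K) : deriv L 0 = 0 := by
  refine eq_zero_of_nat_mul_le (K := K + C * V x / (η / 2)) fun n => ?_
  have h1 := h.norm_iteratedDeriv_tilted_le hF hF1 n x 1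
  rw [iteratedDeriv_one, deriv_tilted_zero (measurable_partialSum hF n) (abs_partialSum_le hF1 n)
    h.η_pos h.diff h.zero] at h1
  simp only [Nat.factorial_one, Nat.cast_one, one_mul, pow_one] at h1
  have h2 := norm_sub_norm_le ((n : ℂ) * deriv L 0) ((∫ w, partialSum F n w ∂chainLaw P x : ℝ) : ℂ)
  rw [norm_sub_rev, Complex.norm_real, Real.norm_eq_abs] at h2
  linarith [hK n]

theorem norm_second_moment_sub_le (h : Pressure P F V η C L) (hF : Measurable F)
    (hF1 : ∀ x, |F x| ≤ 1) (hL1 : deriv L 0 = 0) (n : ℕ) (x : X) :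
    ‖((∫ w, partialSum F n w ^ 2 ∂chainLaw P x : ℝ) : ℂ) - n * iteratedDeriv 2 L 0‖ ≤
      8 * C / η ^ 2 * V x := by
  have h1 := h.norm_iteratedDeriv_tilted_le hF hF1 n x 2
  rw [iteratedDeriv_two_tilted_zero (measurable_partialSum hF n) (abs_partialSum_le hF1 n)
    h.η_pos h.diff h.zero hL1] at h1
  refine h1.trans (le_of_eq ?_)
  have := h.η_pos
  rw [Nat.factorial_two]
  push_cast
  field_simp
  ring

theorem tendsto_second_moment_div (h : Pressure P F V η C L) (hF : Measurable F)
    (hF1 : ∀ x, |F x| ≤ 1) (hL1 : deriv L 0 = 0) (x : X) :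
    Tendsto (fun n : ℕ => (((∫ w, partialSum F n w ^ 2 ∂chainLaw P x) / n : ℝ) : ℂ)) atTop
      (𝓝 (iteratedDeriv 2 L 0)) := by
  rw [tendsto_iff_norm_sub_tendsto_zero]
  refine squeeze_zero' (Eventually.of_forall fun n => norm_nonneg _) ?_
    (tendsto_const_div_atTop_nhds_zero_nat (8 * C / η ^ 2 * V x))
  filter_upwards [eventually_gt_atTop 0] with n hn
  have hn' : (n : ℂ) ≠ 0 := by exact_mod_cast hn.ne'
  have hnr : (0 : ℝ) < n := by exact_mod_cast hn
  rw [le_div_iff₀ hnr]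
  refine le_trans (le_of_eq ?_) (h.norm_second_moment_sub_le hF hF1 hL1 n x)
  have e : ∀ a : ℂ, ‖a‖ * (n : ℝ) = ‖a * n‖ := fun a => by rw [norm_mul, Complex.norm_natCast]
  rw [e]
  congr 1
  push_cast
  field_simp

/-- The second Taylor coefficient gives E_x[S_n²] = nL''(0) + O(1), and the squared mean is
negligible because E_x[S_n] converges. -/
theorem hasAsymptoticVariance (h : Pressure P F V η C L) (hF : Measurable F)
    (hF1 : ∀ x, |F x| ≤ 1) {Fhat : X → ℝ}
    (hFhat : ∀ x, Tendsto (fun n => ∫ w, partialSum F n w ∂chainLaw P x) atTop (𝓝 (Fhat x)))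
    (hL1 : deriv L 0 = 0) : HasAsymptoticVariance P F (iteratedDeriv 2 L 0).re := by
  intro x
  have h1 : Tendsto (fun n : ℕ => (∫ w, partialSum F n w ^ 2 ∂chainLaw P x) / n) atTop
      (𝓝 (iteratedDeriv 2 L 0).re) :=
    (Complex.continuous_re.tendsto _).comp (h.tendsto_second_moment_div hF hF1 hL1 x)
  have h2 : Tendsto (fun n : ℕ => (∫ w, partialSum F n w ∂chainLaw P x) ^ 2 / (n : ℝ)) atTop
      (𝓝 0) := ((hFhat x).pow 2).div_atTop tendsto_natCast_atTop_atTop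
  have h3 := h1.sub h2
  rw [sub_zero] at h3
  refine h3.congr fun n => ?_
  have hB := bm_partialSum (F := F) hF hF1 n
  rw [variance_eq_sub (MemLp.of_bound hB.sm.aestronglyMeasurable n
    (ae_of_all _ (abs_partialSum_le hF1 n))), sub_div]
  rfl

theorem im_iteratedDeriv_two (h : Pressure P F V η C L) (hF : Measurable F)
    (hF1 : ∀ x, |F x| ≤ 1) (hL1 : deriv L 0 = 0) (x : X) : (iteratedDeriv 2 L 0).im = 0 := by
  have h1 := (Complex.continuous_im.tendsto _).comp (h.tendsto_second_moment_div hF hF1 hL1 x)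
  refine tendsto_nhds_unique h1 (tendsto_const_nhds.congr fun n => ?_)
  simp only [Function.comp, Complex.ofReal_im]

theorem re_iteratedDeriv_two_nonneg (h : Pressure P F V η C L) (hF : Measurable F)
    (hF1 : ∀ x, |F x| ≤ 1) (hL1 : deriv L 0 = 0) (x : X) : 0 ≤ (iteratedDeriv 2 L 0).re := by
  have h1 := (Complex.continuous_re.tendsto _).comp (h.tendsto_second_moment_div hF hF1 hL1 x)
  refine ge_of_tendsto' h1 fun n => ?_
  simp only [Function.comp, Complex.ofReal_re]
  exact div_nonneg (integral_nonneg fun w => sq_nonneg _) n.cast_nonneg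

/-- Second order control of the prefactor, uniformly in time. -/
theorem norm_tilted_sub_le (h : Pressure P F V η C L) (hF : Measurable F)
    (hF1 : ∀ x, |F x| ≤ 1) (hL1 : deriv L 0 = 0) (n : ℕ) (x : X) {z : ℂ}
    (hz : z ∈ Metric.ball (0 : ℂ) η) :
    ‖complexMGF (partialSum F n) (chainLaw P x) z * Complex.exp (-(n * L z)) - 1 -
      z * ((∫ w, partialSum F n w ∂chainLaw P x : ℝ) : ℂ)‖ ≤ 4 * C / η ^ 2 * V x * ‖z‖ ^ 2 := by
  have h1 := exists_norm_sub_sub_le h.η_pos (h.differentiableOn_tilted hF hF1 n x)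
    (h.bound n x) hz
  rw [deriv_tilted_zero (measurable_partialSum hF n) (abs_partialSum_le hF1 n)
    h.η_pos h.diff h.zero, hL1] at h1
  simp only [h.zero, mul_zero, neg_zero, Complex.exp_zero, mul_one, complexMGF_zero_eq_one,
    sub_zero] at h1
  refine h1.trans (le_of_eq ?_)
  ring

end Pressure

end MarkovEdgeworth

/-! ### The limit on the real axis and its Taylor expansion -/

namespace MarkovEdgeworth

variable {X : Type*} [MeasurableSpace X] {P : Kernel X X} [IsMarkovKernel P] {π ν : Measure X}
  [IsProbabilityMeasure π] {V s : X → ℝ} {δ b : ℝ} {F : X → ℝ}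

theorem bm_mgf_partialSum (hF : Measurable F) (hF1 : ∀ x, |F x| ≤ 1) (a : ℝ) (n : ℕ) :
    BM (fun x => mgf (partialSum F n) (chainLaw P x) a) := by
  have h := BM.twist_iterate (P := P) hF hF1 a (BM.const (X := X) (1 : ℂ)) n
  have e : (fun x => mgf (partialSum F n) (chainLaw P x) a) =
      fun x => ((twist P F a)^[n] (fun _ => 1) x).re := by
    funext x
    rw [twist_iterate_one hF hF1, complexMGF_ofReal, Complex.ofReal_re]
  rw [e]
  obtain ⟨C, hC⟩ := h.bdd
  exact ⟨Complex.continuous_re.comp_stronglyMeasurable h.sm, C,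
    fun x => (Complex.abs_re_le_norm _).trans (hC x)⟩

/-- Markov property at time m, together with aS_m ≥ -m|a|. It moves a lower bound from typical
states to an arbitrary initial state. -/
theorem exp_mul_integral_mgf_le (hF : Measurable F) (hF1 : ∀ x, |F x| ≤ 1) (a : ℝ) (m n : ℕ) (x : X) :
    Real.exp (-(m * |a|)) * ∫ y, mgf (partialSum F n) (chainLaw P y) a ∂(P ^ m) x ≤
      mgf (partialSum F (m + n)) (chainLaw P x) a := by
  have hB := bm_mgf_partialSum (P := P) hF hF1 a n
  have h1 : mgf (partialSum F (m + n)) (chainLaw P x) a =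
      ∫ w, Real.exp (a * partialSum F m w) * mgf (partialSum F n) (chainLaw P (w m)) a
        ∂chainLaw P x := by
    have h := integral_exp_partialSum (P := P) hF hF1 a m x hB.ofReal
    have e : (fun y => ((mgf (partialSum F n) (chainLaw P y) a : ℝ) : ℂ)) =
        (twist P F a)^[n] (fun _ => 1) := by
      funext y
      rw [twist_iterate_one hF hF1, complexMGF_ofReal]
    rw [e, ← Function.iterate_add_apply, twist_iterate_one hF hF1, complexMGF_ofReal] at h
    have e2 : ∀ w : ℕ → X, Complex.exp (a * partialSum F m w) *
        ((mgf (partialSum F n) (chainLaw P (w m)) a : ℝ) : ℂ) =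
        ((Real.exp (a * partialSum F m w) * mgf (partialSum F n) (chainLaw P (w m)) a : ℝ) : ℂ) :=
      fun w => by push_cast; rfl
    simp_rw [e2] at h
    rw [integral_complex_ofReal] at h
    exact_mod_cast h.symm
  have hwB := hB.comp (measurable_pi_apply (X := fun _ : ℕ => X) m)
  rw [h1, ← integral_chainLaw x m hB, ← integral_const_mul]
  refine integral_mono ((hwB.integrable _).const_mul _) ?_ fun w => ?_
  · have hexp : BM fun w : ℕ → X => Real.exp (a * partialSum F m w) := by
      refine BM.of_measurable_le (Real.measurable_exp.comp ((measurable_partialSum hF m).const_mul a))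
        (C := Real.exp (|a| * m)) fun w => ?_
      rw [abs_of_pos (Real.exp_pos _)]
      refine Real.exp_le_exp.2 ((le_abs_self _).trans ?_)
      rw [abs_mul]
      exact mul_le_mul_of_nonneg_left (abs_partialSum_le hF1 m w) (abs_nonneg _)
    exact (hexp.mul hwB).integrable _
  · refine mul_le_mul_of_nonneg_right (Real.exp_le_exp.2 ?_) mgf_nonneg
    have h2 : |a * partialSum F m w| ≤ m * |a| := by
      rw [abs_mul, mul_comm]
      exact mul_le_mul_of_nonneg_right (abs_partialSum_le hF1 m w) (abs_nonneg _)
    exact (abs_le.1 h2).1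

namespace Pressure

variable {η C : ℝ} {L : ℂ → ℂ}

/-- The upper bound is the bound on the prefactor. A direct lower bound at x would need |a| small
depending on V(x); to get one neighbourhood for all x, it is proved only where V ≤ 4b/δ, and the
drift brings the chain there after a time depending on x. -/
theorem isLimitLogMGF (h : Pressure P F V η C L) (H : DriftData P π ν V s δ b) (hF : Measurable F)
    (hF1 : ∀ x, |F x| ≤ 1) (hL1 : deriv L 0 = 0) {K : ℝ} (hK0 : 0 < K)
    (hK : ∀ n x, |∫ w, partialSum F n w ∂chainLaw P x| ≤ K * V x) :
    IsLimitLogMGF P F fun a => (L a).re := by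
  have hη := h.η_pos
  have hC := h.C_pos
  set B := b / δ with hB
  have hB0 : 0 < B := div_pos H.b_pos H.δ_pos
  set K' := K + 4 * C / η ^ 2 with hK'
  have hK'0 : 0 < K' := by positivity
  -- The last condition makes the correction |a|K'V at most 1/2 wherever V ≤ 4B, so that the
  -- prefactor there is at least 1/2.
  have hev : ∀ᶠ a : ℝ in 𝓝 0, |a| < η ∧ |a| < 1 ∧ |a| < 1 / (8 * K' * B) := by
    have h0 : Tendsto (fun a : ℝ => |a|) (𝓝 0) (𝓝 0) := by
      simpa using (continuous_abs.tendsto (0 : ℝ))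
    exact (h0.eventually (gt_mem_nhds hη)).and ((h0.eventually (gt_mem_nhds one_pos)).and
      (h0.eventually (gt_mem_nhds (by positivity))))
  filter_upwards [hev] with a ⟨ha1, ha2, ha3⟩ x
  set Λ := (L a).re with hΛ
  have hLa : L a = (Λ : ℂ) := Complex.ext rfl (by simpa using h.im_eq_zero a ha1)
  have hball : (a : ℂ) ∈ Metric.ball (0 : ℂ) η := by simpa using ha1
  have e1 : ∀ n y, complexMGF (partialSum F n) (chainLaw P y) a * Complex.exp (-(n * L a)) =
      ((mgf (partialSum F n) (chainLaw P y) a * Real.exp (-(n * Λ)) : ℝ) : ℂ) := fun n y => by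
    rw [complexMGF_ofReal, hLa]; push_cast; rfl
  have hpos : ∀ n y, 0 < mgf (partialSum F n) (chainLaw P y) a := fun n y =>
    mgf_pos_of_abs_le (measurable_partialSum hF n) (abs_partialSum_le hF1 n) a
  have hexpinv : ∀ n : ℕ, Real.exp (-(n * Λ)) * Real.exp (n * Λ) = 1 := fun n => by
    rw [← Real.exp_add]; simp
  have hup : ∀ (n : ℕ) y, mgf (partialSum F n) (chainLaw P y) a ≤ C * V y * Real.exp (n * Λ) := by
    intro n y
    have h1 := h.bound n y a hball
    rw [e1, Complex.norm_real, Real.norm_of_nonneg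
      (mul_nonneg (hpos n y).le (Real.exp_pos _).le)] at h1
    have h2 := mul_le_mul_of_nonneg_right h1 (Real.exp_pos (n * Λ)).le
    rwa [mul_assoc, hexpinv, mul_one] at h2
  -- The factor 1 - V/(4B) makes the bound trivial where V > 4B, and is affine in V, hence easy to
  -- integrate.
  have hlow : ∀ (n : ℕ) y, 1 / 2 * (1 - V y / (4 * B)) * Real.exp (n * Λ) ≤
      mgf (partialSum F n) (chainLaw P y) a := by
    intro n y
    by_cases hy : V y ≤ 4 * B
    · have h1 := h.norm_tilted_sub_le hF hF1 hL1 n y hball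
      rw [e1] at h1
      set q := mgf (partialSum F n) (chainLaw P y) a * Real.exp (-(n * Λ)) with hq
      set κ := ∫ w, partialSum F n w ∂chainLaw P y
      have e2 : ((q : ℝ) : ℂ) - 1 - (a : ℂ) * ((κ : ℝ) : ℂ) = ((q - 1 - a * κ : ℝ) : ℂ) := by
        push_cast; rfl
      rw [e2, Complex.norm_real, Complex.norm_real, Real.norm_eq_abs, Real.norm_eq_abs] at h1
      have h2 : |a * κ| ≤ |a| * (K * V y) := by
        rw [abs_mul]; exact mul_le_mul_of_nonneg_left (hK n y) (abs_nonneg _)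
      have h3 : 4 * C / η ^ 2 * V y * |a| ^ 2 ≤ 4 * C / η ^ 2 * V y * |a| := by
        have := H.V_pos y
        have h4 : |a| ^ 2 ≤ |a| := by nlinarith [abs_nonneg a]
        gcongr
      have h4 : |a| * (K' * V y) ≤ 1 / 2 := by
        have h5 : |a| * (K' * V y) ≤ 1 / (8 * K' * B) * (K' * (4 * B)) := by
          have := H.V_pos y
          gcongr
        refine h5.trans (le_of_eq ?_)
        field_simp
        norm_num
      have h5 : 1 / 2 ≤ q := by
        have h6 := (abs_le.1 h1).1
        have h7 := (abs_le.1 h2).1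
        have h8 : |a| * (K' * V y) = |a| * (K * V y) + 4 * C / η ^ 2 * V y * |a| := by
          rw [hK']; ring
        linarith
      have h6 := mul_le_mul_of_nonneg_right h5 (Real.exp_pos (n * Λ)).le
      rw [hq, mul_assoc _ (Real.exp _), hexpinv, mul_one] at h6
      refine le_trans ?_ h6
      refine mul_le_mul_of_nonneg_right ?_ (Real.exp_pos _).le
      have : 0 ≤ V y / (4 * B) := div_nonneg (H.V_pos y).le (by positivity)
      linarith
    · refine le_trans ?_ (hpos n y).le
      refine mul_nonpos_of_nonpos_of_nonneg ?_ (Real.exp_pos _).le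
      have : 1 ≤ V y / (4 * B) := (one_le_div (by positivity)).2 (not_le.1 hy).le
      linarith
  -- After m steps the mean of V is below 2B, half the threshold 4B.
  obtain ⟨m, hm⟩ := ((((tendsto_pow_atTop_nhds_zero_of_lt_one
    (show 0 ≤ 1 - δ by linarith [H.δ_lt_one]) (by linarith [H.δ_pos])).mul_const (V x))).eventually
    (gt_mem_nhds (show 0 * V x < B by simpa using hB0))).exists
  have hlow2 : ∀ n : ℕ, 1 / 4 * Real.exp (-(m * |a|)) * Real.exp (n * Λ) ≤
      mgf (partialSum F (m + n)) (chainLaw P x) a := by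
    intro n
    refine le_trans ?_ (exp_mul_integral_mgf_le hF hF1 a m n x)
    have hVi := H.integrable_V_pow m x
    have h1 : ∫ y, 1 / 2 * (1 - V y / (4 * B)) * Real.exp (n * Λ) ∂(P ^ m) x ≤
        ∫ y, mgf (partialSum F n) (chainLaw P y) a ∂(P ^ m) x :=
      integral_mono ((((integrable_const _).sub (hVi.div_const _)).const_mul _).mul_const _)
        ((bm_mgf_partialSum hF hF1 a n).integrable _) (hlow n)
    rw [integral_mul_const, integral_const_mul, integral_sub (integrable_const _)
      (hVi.div_const _), integral_div] at h1
    simp only [integral_const, probReal_univ, one_smul] at h1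
    have h2 : (∫ y, V y ∂(P ^ m) x) / (4 * B) ≤ 1 / 2 := by
      rw [div_le_iff₀ (by positivity)]
      linarith [H.integral_V_pow_le m x]
    have h3 : 1 / 4 * Real.exp (n * Λ) ≤ ∫ y, mgf (partialSum F n) (chainLaw P y) a ∂(P ^ m) x :=
      le_trans (mul_le_mul_of_nonneg_right (by linarith) (Real.exp_pos _).le) h1
    have := mul_le_mul_of_nonneg_left h3 (Real.exp_pos (-(m * |a|))).le
    linarith
  -- squeeze
  have hCV : 0 < C * V x := mul_pos hC (H.V_pos x)
  have hT : ∀ c : ℝ, Tendsto (fun n : ℕ => Λ + c / (n : ℝ)) atTop (𝓝 Λ) := fun c => by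
    simpa using (tendsto_const_nhds (x := Λ)).add (tendsto_const_div_atTop_nhds_zero_nat c)
  set c₀ := Real.log (1 / 4 * Real.exp (-(m * |a|)) * Real.exp (-(m * Λ))) with hc₀
  refine tendsto_of_tendsto_of_tendsto_of_le_of_le' (hT c₀) (hT (Real.log (C * V x))) ?_ ?_
  · filter_upwards [eventually_ge_atTop m, eventually_gt_atTop 0] with n hn hn0
    obtain ⟨k, rfl⟩ := Nat.exists_eq_add_of_le hn
    have hnr : (0 : ℝ) < (m + k : ℕ) := by exact_mod_cast hn0
    rw [cgf, ← sub_nonneg]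
    have h1 : c₀ + (m + k : ℕ) * Λ ≤ Real.log (mgf (partialSum F (m + k)) (chainLaw P x) a) := by
      rw [Real.le_log_iff_exp_le (hpos _ _), Real.exp_add, hc₀, Real.exp_log (by positivity)]
      refine le_trans (le_of_eq ?_) (hlow2 k)
      rw [mul_assoc (1 / 4 * Real.exp (-(m * |a|))), ← Real.exp_add]
      congr 2
      push_cast
      ring
    have h2 : Real.log (mgf (partialSum F (m + k)) (chainLaw P x) a) / (m + k : ℕ) -
        (Λ + c₀ / (m + k : ℕ)) = (Real.log (mgf (partialSum F (m + k)) (chainLaw P x) a) -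
          (c₀ + (m + k : ℕ) * Λ)) / (m + k : ℕ) := by
      field_simp
      ring
    rw [h2]
    exact div_nonneg (by linarith) hnr.le
  · filter_upwards [eventually_gt_atTop 0] with n hn0
    have hnr : (0 : ℝ) < n := by exact_mod_cast hn0
    rw [cgf, div_le_iff₀ hnr]
    have h1 := Real.log_le_log (hpos n x) (hup n x)
    rw [Real.log_mul hCV.ne' (Real.exp_pos _).ne', Real.log_exp] at h1
    refine h1.trans (le_of_eq ?_)
    field_simp
    ring

theorem analyticAt_zero (h : Pressure P F V η C L) : AnalyticAt ℂ L 0 :=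
  h.diff.analyticAt (Metric.ball_mem_nhds _ h.η_pos)

end Pressure

theorem analyticAt_re_ofReal {f : ℂ → ℂ} (hf : AnalyticAt ℂ f 0) :
    AnalyticAt ℝ (fun a : ℝ => (f a).re) 0 := by
  have h1 : AnalyticAt ℝ f ((0 : ℝ) : ℂ) := by
    rw [Complex.ofReal_zero]; exact hf.restrictScalars
  have h2 : AnalyticAt ℝ (fun a : ℝ => (a : ℂ)) 0 := Complex.ofRealCLM.analyticAt 0
  have h3 : AnalyticAt ℝ (fun a : ℝ => f a) 0 := h1.comp h2
  exact (Complex.reCLM.analyticAt _).comp h3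

theorem differentiableOn_iteratedDeriv {f : ℂ → ℂ} {η : ℝ}
    (hf : DifferentiableOn ℂ f (Metric.ball 0 η)) (k : ℕ) :
    DifferentiableOn ℂ (iteratedDeriv k f) (Metric.ball 0 η) := by
  induction k with
  | zero => rwa [iteratedDeriv_zero]
  | succ k ih => rw [iteratedDeriv_succ]; exact ih.deriv Metric.isOpen_ball

theorem iteratedDeriv_re_ofReal {f : ℂ → ℂ} {η : ℝ}
    (hf : DifferentiableOn ℂ f (Metric.ball 0 η)) (k : ℕ) {a : ℝ} (ha : |a| < η) :
    iteratedDeriv k (fun a : ℝ => (f a).re) a = (iteratedDeriv k f a).re := by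
  induction k generalizing a with
  | zero => simp
  | succ k ih =>
    rw [iteratedDeriv_succ, iteratedDeriv_succ]
    have hev : iteratedDeriv k (fun a : ℝ => (f a).re) =ᶠ[𝓝 a]
        fun a : ℝ => (iteratedDeriv k f a).re := by
      filter_upwards [(continuous_abs.tendsto a).eventually (gt_mem_nhds ha)] with a' ha' using ih ha'
    rw [hev.deriv_eq]
    exact (HasDerivAt.real_of_complex ((differentiableOn_iteratedDeriv hf k).differentiableAt
      (Metric.isOpen_ball.mem_nhds (by simpa using ha))).hasDerivAt).deriv

/-- Apply the real-part formula to -if, whose real part along the real axis is the imaginary part of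
f and thus vanishes near 0. -/
theorem im_iteratedDeriv_eq_zero {f : ℂ → ℂ} {η : ℝ} (hη : 0 < η)
    (hf : DifferentiableOn ℂ f (Metric.ball 0 η)) (him : ∀ a : ℝ, |a| < η → (f a).im = 0) (k : ℕ) :
    (iteratedDeriv k f 0).im = 0 := by
  have hf' : DifferentiableOn ℂ (fun z => -Complex.I * f z) (Metric.ball 0 η) := hf.const_mul _
  have h1 := iteratedDeriv_re_ofReal hf' k (a := 0) (by simpa using hη)
  have hev : (fun a : ℝ => (-Complex.I * f a).re) =ᶠ[𝓝 0] fun _ => 0 := by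
    filter_upwards [(continuous_abs.tendsto (0 : ℝ)).eventually (gt_mem_nhds (by simpa using hη))]
      with a ha
    simpa using him a ha
  have h2 : iteratedDeriv k (fun _ : ℝ => (0 : ℝ)) 0 = 0 := by
    simp
  rw [hev.iteratedDeriv_eq k, h2, Complex.ofReal_zero, iteratedDeriv_const_mul_field] at h1
  simpa using h1.symm

theorem exists_taylor_three {f : ℂ → ℂ} (hf : AnalyticAt ℂ f 0) (h0 : f 0 = 0) (h1 : deriv f 0 = 0) :
    ∃ K r : ℝ, 0 < K ∧ 0 < r ∧ ∀ z : ℂ, ‖z‖ < r →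
      ‖f z - (iteratedDeriv 2 f 0 / 2 * z ^ 2 + iteratedDeriv 3 f 0 / 6 * z ^ 3)‖ ≤ K * ‖z‖ ^ 4 := by
  have h := hf.hasFPowerSeriesAt.isBigO_sub_partialSum_pow 4
  obtain ⟨K, hK, hbd⟩ := h.exists_pos
  rw [Asymptotics.isBigOWith_iff] at hbd
  obtain ⟨r, hr, hball⟩ := Metric.eventually_nhds_iff_ball.1 hbd
  refine ⟨K, r, hK, hr, fun z hz => ?_⟩
  have h2 := hball z (by simpa using hz)
  rw [zero_add, Real.norm_of_nonneg (by positivity)] at h2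
  refine le_trans (le_of_eq ?_) h2
  congr 1
  rw [FormalMultilinearSeries.partialSum]
  simp only [FormalMultilinearSeries.ofScalars_apply_eq, Finset.sum_range_succ, Finset.sum_range_zero,
    iteratedDeriv_zero, iteratedDeriv_one, h0, h1, smul_eq_mul]
  norm_num [Nat.factorial]

end MarkovEdgeworth

/-! ### Unimodular eigenfunctions and the almost lattice property -/

namespace MarkovEdgeworth

variable {X : Type*} [MeasurableSpace X] {P : Kernel X X} [IsMarkovKernel P] {π ν : Measure X}
  [IsProbabilityMeasure π] {V s : X → ℝ} {δ b : ℝ} {F : X → ℝ}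

theorem ae_ae_of_invariant {κ : Kernel X X} (hκ : Kernel.Invariant κ π) {p : X → Prop}
    (hp : ∀ᵐ x ∂π, p x) : ∀ᵐ x ∂π, ∀ᵐ y ∂κ x, p y := by
  have h : ∀ᵐ x ∂(π.bind κ), p x := by rwa [hκ.def]
  exact Measure.ae_ae_of_ae_comp h

/-- Equality case of the triangle inequality for integrals. -/
theorem ae_eq_integral_of_norm_eq {μ : Measure X} [IsProbabilityMeasure μ] {g : X → ℂ} (hg : BM g)
    {c : ℝ} (h1 : ∀ᵐ y ∂μ, ‖g y‖ = c) (h2 : ‖∫ y, g y ∂μ‖ = c) : ∀ᵐ y ∂μ, g y = ∫ y, g y ∂μ := by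
  set I := ∫ y, g y ∂μ with hI
  have hgI : BM fun y => g y * (starRingEnd ℂ) I := hg.mul (BM.const _)
  have hre : BM fun y => (g y * (starRingEnd ℂ) I).re := by
    obtain ⟨C, hC⟩ := hgI.bdd
    exact ⟨Complex.continuous_re.comp_stronglyMeasurable hgI.sm, C,
      fun y => (Complex.abs_re_le_norm _).trans (hC y)⟩
  have e1 : ∫ y, (g y * (starRingEnd ℂ) I).re ∂μ = c ^ 2 := by
    have h3 : ∫ y, (g y * (starRingEnd ℂ) I).re ∂μ = (∫ y, g y * (starRingEnd ℂ) I ∂μ).re :=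
      (RCLike.reCLM (K := ℂ)).integral_comp_comm (hgI.integrable μ)
    rw [h3, integral_mul_const, ← hI, Complex.mul_conj, Complex.ofReal_re, Complex.normSq_eq_norm_sq,
      h2]
  have e2 : ∀ᵐ y ∂μ, ‖g y - I‖ ^ 2 = 2 * c ^ 2 - 2 * (g y * (starRingEnd ℂ) I).re := by
    filter_upwards [h1] with y hy
    rw [← Complex.normSq_eq_norm_sq, Complex.normSq_sub, Complex.normSq_eq_norm_sq,
      Complex.normSq_eq_norm_sq, hy, h2]
    ring
  have e3 : ∫ y, ‖g y - I‖ ^ 2 ∂μ = 0 := by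
    rw [integral_congr_ae e2, integral_sub (integrable_const _) ((hre.integrable μ).const_mul 2),
      integral_const_mul (2 : ℝ) (fun y => (g y * (starRingEnd ℂ) I).re), e1]
    simp
  have hB : BM fun y => ‖g y - I‖ ^ 2 := by
    have := ((hg.sub (BM.const I)).norm.mul (hg.sub (BM.const I)).norm)
    simpa only [sq] using this
  rw [integral_eq_zero_iff_of_nonneg (fun y => sq_nonneg _) (hB.integrable μ)] at e3
  filter_upwards [e3] with y hy
  have : ‖g y - I‖ ^ 2 = 0 := hy
  exact sub_eq_zero.1 (norm_eq_zero.1 (pow_eq_zero_iff two_ne_zero |>.1 this))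

/-- If the twisted iterates do not vanish in `L^∞ → L¹(π)` norm, there is a unimodular
eigenfunction. -/
theorem DriftData.exists_eigenfunction [MeasurableSpace.CountablyGenerated X]
    (H : DriftData P π ν V s δ b) (hap : IsAperiodic P π) (hF : Measurable F)
    (hF1 : ∀ x, |F x| ≤ 1) (t : ℝ) {b₀ : ℝ} (hb₀ : 0 < b₀)
    (hb : ∀ n, ∃ f : X → ℂ, BM f ∧ (∀ x, ‖f x‖ ≤ 1) ∧
      b₀ ≤ ∫ x, ‖(twist P F (t * Complex.I))^[n] f x‖ ∂π) :
    ∃ (g : X → ℂ) (θ : ℂ), Measurable g ∧ (∀ x, ‖g x‖ = 1) ∧ ‖θ‖ = 1 ∧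
      ∀ᵐ x ∂π, ∀ᵐ y ∂P x, g y = θ * Complex.exp (-(t * Complex.I * F x)) * g x := by
  obtain ⟨C, ρ, hC, hρ0, hρ1, hdec⟩ := H.exists_geometric_decay hap
  have hQ1 : ∀ f : X → ℂ, BM f → (∀ x, ‖f x‖ ≤ 1) → ∀ x, ‖twist P F (t * Complex.I) f x‖ ≤ 1 :=
    fun f hf h1 x => (norm_twist_le t f x).trans (by
      calc ∫ y, ‖f y‖ ∂P x ≤ ∫ y, (1 : ℝ) ∂P x :=
            integral_mono (hf.norm.integrable _) (integrable_const _) h1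
        _ = 1 := by simp)
  obtain ⟨g, c, hc, hg⟩ := H.exists_biinfinite_orbit hF hF1 t
    (fun f => BM f ∧ ∀ x, ‖f x‖ ≤ 1) (fun f hf => hf)
    (fun f hf => ⟨hf.1.twist hF hF1 _, hQ1 f hf.1 hf.2⟩)
    (fun u g hu hlim => by
      have h1 : ∀ x, ‖g x‖ ≤ 1 := fun x => le_of_tendsto' (hlim x).norm fun n => (hu n).2 x
      exact ⟨⟨stronglyMeasurable_of_tendsto atTop (fun n => (hu n).1.sm) (tendsto_pi_nhds.2 hlim), 1,
        h1⟩, h1⟩) hb₀ (fun n => by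
      obtain ⟨f, h1, h2, h3⟩ := hb n
      exact ⟨f, ⟨h1, h2⟩, h3⟩)
  have hgB : ∀ j, BM (g j) := fun j => (hg j).1.1
  have hg1 : ∀ j x, ‖g j x‖ ≤ 1 := fun j => (hg j).1.2
  have hgQ : ∀ j, twist P F (t * Complex.I) (g j) = g (j + 1) := fun j => (hg j).2.1
  have hgc : ∀ j, ∫ x, ‖g j x‖ ∂π = c := fun j => (hg j).2.2
  have hc1 : c ≤ 1 := by
    rw [← hgc 0]
    calc _ ≤ ∫ x, (1 : ℝ) ∂π := integral_mono ((hgB 0).norm.integrable _) (integrable_const _) (hg1 0)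
      _ = 1 := by simp
  have hiter : ∀ (m : ℕ) (j : ℤ), (twist P F (t * Complex.I))^[m] (g (j - m)) = g j := by
    intro m
    induction m with
    | zero => intro j; simp
    | succ m ih =>
      intro j
      rw [Function.iterate_succ_apply, hgQ, show j - (m + 1 : ℕ) + 1 = j - m by push_cast; ring, ih]
  have hρlim : ∀ K : ℝ, Tendsto (fun m : ℕ => K * ρ ^ m) atTop (𝓝 0) := fun K => by
    simpa using (tendsto_pow_atTop_nhds_zero_of_lt_one hρ0.le hρ1).const_mul K
  -- constant modulus
  have hmod : ∀ j, ∀ᵐ x ∂π, ‖g j x‖ = c := by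
    intro j
    -- A pointwise inequality between functions with the same π-mean c is an almost sure equality.
    -- Geometric ergodicity then sends the right side to c as m → ∞.
    have h1 : ∀ m : ℕ, ∀ᵐ x ∂π, ‖g j x‖ = ∫ y, ‖g (j - m) y‖ ∂(P ^ m) x := by
      intro m
      have hi1 := ((hgB (j - m)).norm.integral_kernel (P ^ m)).integrable π
      have hi2 := (hgB j).norm.integrable π
      have hle : ∀ x, ‖g j x‖ ≤ ∫ y, ‖g (j - m) y‖ ∂(P ^ m) x := fun x => by
        rw [← hiter m j]
        exact norm_twist_iterate_le hF hF1 t (hgB _) m x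
      have hz : ∫ x, (∫ y, ‖g (j - m) y‖ ∂(P ^ m) x - ‖g j x‖) ∂π = 0 := by
        rw [integral_sub hi1 hi2, integral_invariant (invariant_pow H.invariant m)
          ((hgB _).norm.integrable _), hgc, hgc, sub_self]
      rw [integral_eq_zero_iff_of_nonneg (fun x => sub_nonneg.2 (hle x)) (hi1.sub hi2)] at hz
      filter_upwards [hz] with x hx
      exact (sub_eq_zero.1 hx).symm
    filter_upwards [ae_all_iff.2 h1] with x hx
    have h2 : ∀ m : ℕ, |‖g j x‖ - c| ≤ C * V x * ρ ^ m := by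
      intro m
      have hB := (hgB (j - m)).norm
      have h3 := hdec (fun y => ((‖g (j - m) y‖ - c : ℝ) : ℂ)) ((hB.sub (BM.const c)).ofReal)
        (by
          rw [integral_complex_ofReal, integral_sub (hB.integrable _) (integrable_const _), hgc]
          simp) 1 zero_le_one (fun y => by
          rw [Complex.norm_real, Real.norm_eq_abs, one_mul]
          refine le_trans ?_ (H.one_le y)
          rw [abs_le]
          constructor <;> linarith [norm_nonneg (g (j - m) y), hg1 (j - m) y]) m x
      rw [integral_complex_ofReal, integral_sub (hB.integrable _) (integrable_const _), ← hx m,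
        Complex.norm_real] at h3
      simp only [integral_const, probReal_univ, one_smul, Real.norm_eq_abs] at h3
      linarith
    have h3 := ge_of_tendsto' (hρlim (C * V x)) h2
    exact sub_eq_zero.1 (abs_nonpos_iff.1 h3)
  -- constancy along transitions
  have htrans : ∀ j, ∀ᵐ x ∂π, ∀ᵐ y ∂P x,
      g j y = Complex.exp (-(t * Complex.I * F x)) * g (j + 1) x := by
    intro j
    filter_upwards [hmod (j + 1), ae_ae_of_invariant H.invariant (hmod j)] with x hx1 hx2
    have e1 : g (j + 1) x = Complex.exp (t * Complex.I * F x) * ∫ y, g j y ∂P x := by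
      rw [← hgQ j]; rfl
    have e2 : ∫ y, g j y ∂P x = Complex.exp (-(t * Complex.I * F x)) * g (j + 1) x := by
      rw [e1, ← mul_assoc, ← Complex.exp_add, neg_add_cancel, Complex.exp_zero, one_mul]
    have e3 : ‖Complex.exp (-(t * Complex.I * F x))‖ = 1 := by
      rw [show (-(t * Complex.I * F x) : ℂ) = ((-(t * F x) : ℝ) : ℂ) * Complex.I by push_cast; ring]
      exact Complex.norm_exp_ofReal_mul_I _
    -- An average of points of the circle of radius c that itself has modulus c forces these points
    -- to coincide.
    have h3 := ae_eq_integral_of_norm_eq (hgB j) hx2 (by rw [e2, norm_mul, e3, one_mul, hx1])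
    filter_upwards [h3] with y hy
    rw [hy, e2]
  -- In this product the phases e^{-itF} cancel, so along transitions r_j at the new state equals
  -- r_{j+1} at the old one: an orbit of the untwisted P.
  set r : ℤ → X → ℂ := fun j x => g (j + 1) x * (starRingEnd ℂ) (g j x) with hr
  have hconjB : ∀ j, BM fun x => (starRingEnd ℂ) (g j x) := fun j =>
    ⟨Complex.continuous_conj.comp_stronglyMeasurable (hgB j).sm, 1, fun x => by
      rw [Complex.norm_conj]; exact hg1 j x⟩
  have hrB : ∀ j, BM (r j) := fun j => (hgB (j + 1)).mul (hconjB j)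
  have hr1 : ∀ j x, ‖r j x‖ ≤ 1 := fun j x => by
    rw [hr]
    simp only [norm_mul, Complex.norm_conj]
    exact mul_le_one₀ (hg1 _ x) (norm_nonneg _) (hg1 _ x)
  have hrstep : ∀ j, ∀ᵐ x ∂π, r (j + 1) x = ∫ y, r j y ∂P x := by
    intro j
    filter_upwards [htrans j, htrans (j + 1)] with x h1 h2
    have h3 : ∀ᵐ y ∂P x, r j y = r (j + 1) x := by
      filter_upwards [h1, h2] with y hy1 hy2
      simp only [hr]
      rw [hy1, hy2, map_mul, ← Complex.exp_conj]
      have e : (starRingEnd ℂ) (-(t * Complex.I * F x)) = t * Complex.I * F x := by simp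
      rw [e]
      have : Complex.exp (-(t * Complex.I * F x)) * Complex.exp (t * Complex.I * F x) = 1 := by
        rw [← Complex.exp_add, neg_add_cancel, Complex.exp_zero]
      linear_combination (g (j + 1 + 1) x * (starRingEnd ℂ) (g (j + 1) x)) * this
    rw [integral_congr_ae h3]
    simp
  have hrpow : ∀ (m : ℕ) (j : ℤ), ∀ᵐ x ∂π, r j x = ∫ y, r (j - m) y ∂(P ^ m) x := by
    intro m
    induction m with
    | zero =>
      intro j
      refine ae_of_all _ fun x => ?_
      rw [integral_pow_zero x (hrB _).sm]
      simp
    | succ m ih =>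
      intro j
      have h1 := hrstep (j - (m + 1 : ℕ))
      rw [show j - (m + 1 : ℕ) + 1 = j - m by push_cast; ring] at h1
      filter_upwards [ih j, ae_ae_of_invariant (invariant_pow H.invariant m) h1] with x hx1 hx2
      rw [hx1, integral_congr_ae hx2, add_comm m 1, integral_pow_add 1 m x ((hrB _).integrable _),
        pow_one]
  have hrmean : ∀ (m : ℕ) (j : ℤ), ∫ x, r (j - m) x ∂π = ∫ x, r j x ∂π := fun m j => by
    rw [integral_congr_ae (hrpow m j), integral_invariant (invariant_pow H.invariant m)
      ((hrB _).integrable _)]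
  -- r₀ = P^m r_{-m} with the r_{-m} uniformly bounded and of the same mean, so geometric ergodicity
  -- makes r₀ constant; hence g₁ is a constant multiple of g₀ and g₀ is an eigenfunction.
  have hrconst : ∀ᵐ x ∂π, r 0 x = ∫ x, r 0 x ∂π := by
    filter_upwards [ae_all_iff.2 fun m => hrpow m 0] with x hx
    have h2 : ∀ m : ℕ, ‖r 0 x - ∫ x, r 0 x ∂π‖ ≤ 2 * C * V x * ρ ^ m := by
      intro m
      have hK : ‖∫ x, r 0 x ∂π‖ ≤ 1 := by
        simpa using norm_integral_le_of_norm_le_const (μ := π) (ae_of_all _ (hr1 0))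
      have h3 := hdec (fun y => r (0 - m) y - ∫ x, r 0 x ∂π) ((hrB _).sub (BM.const _))
        (by
          rw [integral_sub ((hrB _).integrable _) (integrable_const _), hrmean m 0]
          simp) 2 zero_le_two (fun y => by
          refine (norm_sub_le _ _).trans ?_
          have := H.one_le y
          linarith [hr1 (0 - m) y]) m x
      rw [integral_sub ((hrB _).integrable _) (integrable_const _), ← hx m] at h3
      simp only [integral_const, probReal_univ, one_smul] at h3
      linarith
    have h3 := ge_of_tendsto' (hρlim (2 * C * V x)) h2
    exact sub_eq_zero.1 (norm_le_zero_iff.1 h3)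
  set θ := (∫ x, r 0 x ∂π) / (c : ℂ) ^ 2 with hθ
  have hc0 : (c : ℂ) ≠ 0 := by exact_mod_cast hc.ne'
  have hθg : ∀ᵐ x ∂π, g 1 x = θ * g 0 x := by
    filter_upwards [hrconst, hmod 0] with x h1 h2
    have e : r 0 x * g 0 x = (c : ℂ) ^ 2 * g 1 x := by
      simp only [hr, zero_add]
      rw [mul_assoc, mul_comm ((starRingEnd ℂ) _), Complex.mul_conj, Complex.normSq_eq_norm_sq, h2]
      push_cast
      ring
    rw [hθ, ← h1, div_mul_eq_mul_div, e, mul_div_cancel_left₀ _ (pow_ne_zero 2 hc0)]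
  have hθ1 : ‖θ‖ = 1 := by
    obtain ⟨x, h1, h2, h3⟩ := (hθg.and ((hmod 0).and (hmod 1))).exists
    have h4 := congrArg norm h1
    rw [norm_mul, h2, h3] at h4
    exact (mul_right_cancel₀ hc.ne' (by linarith : ‖θ‖ * c = 1 * c))
  have hmS : MeasurableSet {x | ‖g 0 x‖ = c} :=
    measurableSet_eq_fun (hgB 0).sm.norm.measurable measurable_const
  classical
  -- The value 1 on the exceptional null set makes the function unimodular everywhere.
  refine ⟨fun x => if ‖g 0 x‖ = c then g 0 x / c else 1, θ,
    Measurable.ite hmS ((hgB 0).sm.measurable.div_const _) measurable_const, fun x => ?_, hθ1, ?_⟩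
  · simp only
    split_ifs with h
    · rw [norm_div, Complex.norm_real, Real.norm_of_nonneg hc.le, h, div_self hc.ne']
    · exact norm_one
  · filter_upwards [htrans 0, hθg, hmod 0, ae_ae_of_invariant H.invariant (hmod 0)]
      with x h1 h2 h3 h4
    filter_upwards [h1, h4] with y hy1 hy2
    rw [zero_add] at hy1
    rw [if_pos hy2, if_pos h3, hy1, h2]
    ring

/-- A bounded function that is a coboundary off a `π`-null set has zero asymptotic variance. -/
theorem DriftData.hasAsymptoticVariance_zero [MeasurableSpace.CountablyGenerated X]
    (H : DriftData P π ν V s δ b) (hap : IsAperiodic P π) {F₀ α : X → ℝ} {K : ℝ} (hK0 : 0 < K)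
    (hF₀m : Measurable F₀) (hF₀b : ∀ x, |F₀ x| ≤ 2 * K) (hαm : Measurable α) (hαb : ∀ x, |α x| ≤ K)
    {N : Set X} (hNm : MeasurableSet N) (hπN : π N = 0)
    (hgood : ∀ x, x ∉ N → ∀ᵐ y ∂P x, F₀ x = α x - α y) : HasAsymptoticVariance P F₀ 0 := by
  obtain ⟨C, ρ, hC, hρ0, hρ1, hdec⟩ := H.exists_geometric_decay hap
  -- Asymptotic variance is required from every initial state, including those from which the
  -- exceptional null set N is charged. Geometric ergodicity bounds how often this happens.
  have hPN : ∀ (i : ℕ) x, ((P ^ i) x).real N ≤ C * V x * ρ ^ i := by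
    intro i x
    have h1 := hdec (fun y => ((N.indicator (fun _ => (1 : ℝ)) y : ℝ) : ℂ))
      (BM.indicator hNm (1 : ℝ)).ofReal (by
        rw [integral_complex_ofReal, integral_indicator_const _ hNm, Measure.real, hπN]; simp) 1
      zero_le_one (fun y => by
        rw [Complex.norm_real, one_mul]
        refine le_trans ?_ (H.one_le y)
        by_cases hy : y ∈ N <;> simp [hy]) i x
    rw [integral_complex_ofReal, integral_indicator_const _ hNm, Complex.norm_real, smul_eq_mul,
      mul_one, Real.norm_of_nonneg measureReal_nonneg] at h1
    linarith
  -- the defect of the coboundary equation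
  set D : X → X → ℝ := fun x y => F₀ x - (α x - α y) with hD
  have hDm : Measurable fun p : X × X => D p.1 p.2 :=
    (hF₀m.comp measurable_fst).sub ((hαm.comp measurable_fst).sub (hαm.comp measurable_snd))
  have hDb : ∀ x y, D x y ^ 2 ≤ (4 * K) ^ 2 := fun x y => by
    rw [sq_le_sq, abs_of_pos (by positivity : 0 < 4 * K), abs_le]
    have h1 := abs_le.1 (hF₀b x)
    have h2 := abs_le.1 (hαb x)
    have h3 := abs_le.1 (hαb y)
    constructor <;> simp only [hD] <;> linarith
  have hD2B : BM fun p : X × X => D p.1 p.2 ^ 2 :=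
    BM.of_measurable_le (hDm.pow_const 2) (C := (4 * K) ^ 2) fun p => by
      rw [abs_of_nonneg (sq_nonneg _)]; exact hDb _ _
  have hDsec : ∀ x, BM fun y => D x y ^ 2 := fun x => hD2B.comp (measurable_prodMk_left (x := x))
  have hpB : BM fun x => ∫ y, D x y ^ 2 ∂P x := by
    refine ⟨hD2B.sm.integral_kernel_prod_right' (κ := P), (4 * K) ^ 2, fun x => ?_⟩
    have := norm_integral_le_of_norm_le_const (μ := P x) (f := fun y => D x y ^ 2) (C := (4 * K) ^ 2)
      (ae_of_all _ fun y => by rw [Real.norm_of_nonneg (sq_nonneg _)]; exact hDb x y)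
    simpa using this
  have hpN : ∀ x, ∫ y, D x y ^ 2 ∂P x ≤ N.indicator (fun _ => (4 * K) ^ 2) x := by
    intro x
    by_cases hx : x ∈ N
    · rw [Set.indicator_of_mem hx]
      calc ∫ y, D x y ^ 2 ∂P x ≤ ∫ y, (4 * K) ^ 2 ∂P x :=
            integral_mono ((hDsec x).integrable _) (integrable_const _) (hDb x)
        _ = (4 * K) ^ 2 := by simp
    · rw [Set.indicator_of_notMem hx]
      have : ∀ᵐ y ∂P x, D x y ^ 2 = 0 := by
        filter_upwards [hgood x hx] with y hy
        simp only [hD, hy]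
        ring
      rw [integral_congr_ae this]
      simp
  have hED : ∀ (i : ℕ) x, ∫ w, D (w i) (w (i + 1)) ^ 2 ∂chainLaw P x ≤
      (4 * K) ^ 2 * (C * V x) * ρ ^ i := by
    intro i x
    rw [integral_pair_chainLaw x i (g := fun x y => D x y ^ 2) hD2B, integral_chainLaw x i hpB]
    calc _ ≤ ∫ y, N.indicator (fun _ => (4 * K) ^ 2) y ∂(P ^ i) x :=
          integral_mono (hpB.integrable _) ((BM.indicator hNm _).integrable _) hpN
      _ = ((P ^ i) x).real N * (4 * K) ^ 2 := by
          rw [integral_indicator_const _ hNm, smul_eq_mul]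
      _ ≤ (C * V x * ρ ^ i) * (4 * K) ^ 2 := mul_le_mul_of_nonneg_right (hPN i x) (sq_nonneg _)
      _ = _ := by ring
  -- Weights for Cauchy–Schwarz: (Σ D_i)² ≤ (Σ q^i)(Σ D_i²/q^i). Since E[D_i²] = O(ρ^i), both sums
  -- have geometric bounds of ratio q, so E_x[S_n²] is bounded in n.
  set q := √ρ with hq
  have hq0 : 0 < q := Real.sqrt_pos.2 hρ0
  have hq1 : q < 1 := by rw [hq, Real.sqrt_lt' one_pos]; simpa using hρ1
  have hqq : q * q = ρ := Real.mul_self_sqrt hρ0.le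
  have hqi : ∀ n, ∑ i ∈ Finset.range n, q ^ i ≤ (1 - q)⁻¹ := fun n => by
    have h := (summable_geometric_of_lt_one hq0.le hq1).sum_le_tsum
      (Finset.range n) (fun i _ => pow_nonneg hq0.le i)
    rwa [tsum_geometric_of_lt_one hq0.le hq1] at h
  have hDwB : ∀ i : ℕ, BM fun w : ℕ → X => D (w i) (w (i + 1)) ^ 2 := fun i =>
    BM.comp (f := fun p : X × X => D p.1 p.2 ^ 2) hD2B
      (g := fun w : ℕ → X => (w i, w (i + 1)))
      ((measurable_pi_apply i).prodMk (measurable_pi_apply (i + 1)))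
  have hq1' : 0 < 1 - q := by linarith
  intro x
  set M := 2 * (2 * K) ^ 2 + 2 * ((1 - q)⁻¹ * ((4 * K) ^ 2 * (C * V x) * (1 - q)⁻¹)) with hM
  have hbound : ∀ n, variance (partialSum F₀ n) (chainLaw P x) ≤ M := by
    intro n
    obtain ⟨G, hGi, hGle, hGpt⟩ : ∃ G : (ℕ → X) → ℝ, Integrable G (chainLaw P x) ∧
        ∫ w, G w ∂chainLaw P x ≤ (4 * K) ^ 2 * (C * V x) * (1 - q)⁻¹ ∧
        ∀ w, (∑ i ∈ Finset.range n, D (w i) (w (i + 1))) ^ 2 ≤ (1 - q)⁻¹ * G w := by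
      have hiD : ∀ i, Integrable (fun w : ℕ → X => D (w i) (w (i + 1)) ^ 2 / q ^ i)
          (chainLaw P x) := fun i => ((hDwB i).integrable _).div_const _
      refine ⟨fun w => ∑ i ∈ Finset.range n, D (w i) (w (i + 1)) ^ 2 / q ^ i,
        integrable_finsetSum _ fun i _ => hiD i, ?_, fun w => ?_⟩
      · rw [integral_finsetSum _ fun i _ => hiD i]
        have hV := (H.V_pos x).le
        calc _ ≤ ∑ i ∈ Finset.range n, (4 * K) ^ 2 * (C * V x) * q ^ i := by
              refine Finset.sum_le_sum fun i _ => ?_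
              rw [integral_div, div_le_iff₀ (pow_pos hq0 i), mul_assoc _ (q ^ i), ← mul_pow, hqq]
              exact hED i x
          _ = (4 * K) ^ 2 * (C * V x) * ∑ i ∈ Finset.range n, q ^ i := by
              rw [Finset.mul_sum]
          _ ≤ _ := mul_le_mul_of_nonneg_left (hqi n)
              (mul_nonneg (sq_nonneg _) (mul_nonneg hC.le hV))
      · have hd : ∀ i ∈ Finset.range n, 0 ≤ D (w i) (w (i + 1)) ^ 2 / q ^ i := fun i _ =>
          div_nonneg (sq_nonneg _) (pow_nonneg hq0.le i)
        refine (Finset.sum_sq_le_sum_mul_sum_of_sq_le_mul _ (fun i _ => pow_nonneg hq0.le i)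
          hd (fun i _ => ?_)).trans
          (mul_le_mul_of_nonneg_right (hqi n) (Finset.sum_nonneg hd))
        rw [mul_div_cancel₀ _ (pow_pos hq0 i).ne']
    have hpt : ∀ w : ℕ → X, (partialSum F₀ n w) ^ 2 ≤ 2 * (2 * K) ^ 2 + 2 * (1 - q)⁻¹ * G w := by
      intro w
      have e : partialSum F₀ n w = (α (w 0) - α (w n)) +
          ∑ i ∈ Finset.range n, D (w i) (w (i + 1)) := by
        rw [← Finset.sum_range_sub' (fun i => α (w i)) n, ← Finset.sum_add_distrib]
        exact Finset.sum_congr rfl fun i _ => by simp only [hD]; ring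
      have h3 : (α (w 0) - α (w n)) ^ 2 ≤ (2 * K) ^ 2 := by
        rw [sq_le_sq, abs_of_pos (by positivity : 0 < 2 * K)]
        exact (abs_sub _ _).trans (by linarith [hαb (w 0), hαb (w n)])
      rw [e]
      refine add_sq_le.trans ?_
      linarith [hGpt w]
    have hSB : BM (partialSum F₀ n) := BM.of_measurable_le (measurable_partialSum hF₀m n)
      (C := n * (2 * K)) fun w => by
        refine (Finset.abs_sum_le_sum_abs _ _).trans ?_
        calc _ ≤ ∑ i ∈ Finset.range n, 2 * K := Finset.sum_le_sum fun i _ => hF₀b _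
          _ = n * (2 * K) := by simp
    have hS2 : Integrable (fun w => (partialSum F₀ n w) ^ 2) (chainLaw P x) := by
      have := (hSB.mul hSB).integrable (chainLaw P x)
      simpa only [sq] using this
    refine (variance_le_expectation_sq
      (measurable_partialSum hF₀m n).aestronglyMeasurable).trans ?_
    refine (integral_mono hS2 ((integrable_const _).add (hGi.const_mul _)) hpt).trans ?_
    rw [integral_add' (integrable_const _) (hGi.const_mul _), integral_const_mul (2 * (1 - q)⁻¹) G]
    simp only [integral_const, probReal_univ, one_smul]
    have h5 := mul_le_mul_of_nonneg_left hGle (inv_pos.2 hq1').le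
    rw [hM]
    linarith
  refine squeeze_zero (fun n => div_nonneg (variance_nonneg _ _) n.cast_nonneg)
    (fun n => div_le_div_of_nonneg_right (hbound n) n.cast_nonneg)
    (tendsto_const_div_atTop_nhds_zero_nat M)

/-- A unimodular eigenfunction of the twisted operator exhibits `F` as almost lattice. -/
theorem DriftData.isAlmostLattice [MeasurableSpace.CountablyGenerated X]
    (H : DriftData P π ν V s δ b) (hap : IsAperiodic P π) (hF : Measurable F) {t : ℝ} (ht : t ≠ 0)
    {g : X → ℂ} {θ : ℂ} (hg : Measurable g) (hg1 : ∀ x, ‖g x‖ = 1) (hθ : ‖θ‖ = 1)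
    (h : ∀ᵐ x ∂π, ∀ᵐ y ∂P x, g y = θ * Complex.exp (-(t * Complex.I * F x)) * g x) :
    IsAlmostLattice P F (2 * Real.pi / |t|) := by
  have htp : 0 < |t| := abs_pos.2 ht
  set g' : X → ℂ := fun x => θ * Complex.exp (-(t * Complex.I * F x)) * g x with hg'
  have hg'm : Measurable g' := by
    refine (measurable_const.mul (Complex.measurable_exp.comp ?_)).mul hg
    exact (measurable_const.mul (Complex.measurable_ofReal.comp hF)).neg
  have hg'1 : ∀ x, ‖g' x‖ = 1 := fun x => by
    have e3 : ‖Complex.exp (-(t * Complex.I * F x))‖ = 1 := by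
      rw [show (-(t * Complex.I * F x) : ℂ) = ((-(t * F x) : ℝ) : ℂ) * Complex.I by push_cast; ring]
      exact Complex.norm_exp_ofReal_mul_I _
    rw [hg', norm_mul, norm_mul, hθ, e3, hg1]; norm_num
  set α : X → ℝ := fun x => (g x).arg / t with hα
  have hαm : Measurable α := (Complex.measurable_arg.comp hg).div_const t
  set K := Real.pi / |t| with hK
  have hK0 : 0 < K := div_pos Real.pi_pos htp
  have harg : ∀ z : ℂ, |z.arg / t| ≤ K := fun z => by
    rw [abs_div]; exact div_le_div_of_nonneg_right (Complex.abs_arg_le_pi z) htp.le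
  -- Along almost every transition g(y) = g'(x), so this is the coboundary α(x) - α(y). Defining it
  -- through g' keeps it a function of x alone.
  set F₀ : X → ℝ := fun x => α x - (g' x).arg / t with hF₀
  have hF₀m : Measurable F₀ := hαm.sub ((Complex.measurable_arg.comp hg'm).div_const t)
  have hF₀b : ∀ x, |F₀ x| ≤ 2 * K := fun x => (abs_sub _ _).trans (by linarith [harg (g x), harg (g' x)])
  -- the exceptional set
  obtain ⟨N, hbadN, hNm, hπN⟩ := exists_measurable_superset_of_null (ae_iff.1 h)
  have hgood : ∀ x, x ∉ N → ∀ᵐ y ∂P x, g y = g' x := fun x hx => by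
    by_contra hc
    exact hx (hbadN hc)
  have hvar : HasAsymptoticVariance P F₀ 0 := by
    refine H.hasAsymptoticVariance_zero hap hK0 hF₀m hF₀b hαm (fun x => harg _) hNm hπN
      fun x hx => ?_
    filter_upwards [hgood x hx] with y hy
    simp only [hF₀, hα, hy]
  -- the lattice part
  set h' := 2 * Real.pi / |t| with hh'
  have hh'0 : 0 < h' := by positivity
  have hlat : ∀ x, ∃ k : ℤ, F x - F₀ x = θ.arg / t + k * h' := by
    intro x
    have hgne : g x ≠ 0 := fun h0 => by have := hg1 x; rw [h0, norm_zero] at this; norm_num at this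
    have hexp : ∀ z : ℂ, ‖z‖ = 1 → Complex.exp (z.arg * Complex.I) = z := fun z hz => by
      have := Complex.norm_mul_exp_arg_mul_I z
      rwa [hz, Complex.ofReal_one, one_mul] at this
    -- The phases of g and g' cancel, leaving only θ; the branch of the argument does not matter, as
    -- it changes F₀ by multiples of 2π/t.
    have e1 : Complex.exp ((t * (F x - F₀ x) : ℝ) * Complex.I) = Complex.exp (θ.arg * Complex.I) := by
      have e2 : ((t * (F x - F₀ x) : ℝ) : ℂ) * Complex.I = t * Complex.I * F x +
          (-((g x).arg * Complex.I) + (g' x).arg * Complex.I) := by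
        have : t * (F x - F₀ x) = t * F x + (-(g x).arg + (g' x).arg) := by
          simp only [hF₀, hα]; field_simp; ring
        rw [this]; push_cast; ring
      rw [e2, Complex.exp_add, Complex.exp_add, hexp _ (hg'1 x), Complex.exp_neg, hexp _ (hg1 x),
        hexp _ hθ]
      simp only [hg']
      have : Complex.exp (t * Complex.I * F x) * Complex.exp (-(t * Complex.I * F x)) = 1 := by
        rw [← Complex.exp_add, add_neg_cancel, Complex.exp_zero]
      field_simp
      linear_combination θ * this
    obtain ⟨n, hn⟩ := Complex.exp_eq_exp_iff_exists_int.1 e1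
    have hn' : t * (F x - F₀ x) = θ.arg + n * (2 * Real.pi) := by
      have h3 : ((t * (F x - F₀ x) : ℝ) : ℂ) * Complex.I =
          ((θ.arg + n * (2 * Real.pi) : ℝ) : ℂ) * Complex.I := by
        rw [hn]; push_cast; ring
      exact_mod_cast mul_right_cancel₀ Complex.I_ne_zero h3
    rcases lt_or_gt_of_ne ht with htn | htpos
    · refine ⟨-n, ?_⟩
      rw [hh', abs_of_neg htn]
      push_cast
      field_simp
      linarith
    · refine ⟨n, ?_⟩
      rw [hh', abs_of_pos htpos]
      field_simp
      linarith
  -- The offset arg θ / t is reduced modulo the step into [0, h').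
  refine ⟨F₀, fun x => F x - F₀ x, h' * Int.fract (θ.arg / t / h'), hF₀m, ⟨2 * K, hF₀b⟩, hvar,
    ⟨hh'0, mul_nonneg hh'0.le (Int.fract_nonneg _), mul_lt_of_lt_one_right hh'0 (Int.fract_lt_one _),
      fun x => ?_⟩, fun x => by ring⟩
  obtain ⟨k, hk⟩ := hlat x
  refine ⟨k + ⌊θ.arg / t / h'⌋, ?_⟩
  have e := Int.fract_add_floor (θ.arg / t / h')
  have e2 : θ.arg / t = h' * (θ.arg / t / h') := by field_simp
  refine hk.trans ?_
  push_cast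
  calc _ = h' * (θ.arg / t / h') + k * h' := by rw [← e2]
    _ = h' * (Int.fract (θ.arg / t / h') + ⌊θ.arg / t / h'⌋) + k * h' := by rw [e]
    _ = _ := by ring

end MarkovEdgeworth

/-! ### Decay of characteristic functions away from zero -/

namespace MarkovEdgeworth

variable {X : Type*} [MeasurableSpace X] {P : Kernel X X} [IsMarkovKernel P] {π ν : Measure X}
  [IsProbabilityMeasure π] {V s : X → ℝ} {δ b : ℝ} {F : X → ℝ}

/-- Failure would give an eigenfunction and make F almost lattice with step 2π/|t|, which exceeds h;
this contradicts the maximality of the span. -/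
theorem DriftData.exists_integral_norm_twist_lt [MeasurableSpace.CountablyGenerated X]
    (H : DriftData P π ν V s δ b) (hap : IsAperiodic P π) (hF : Measurable F)
    (hF1 : ∀ x, |F x| ≤ 1) {h : ℝ} (hh : 0 < h) (hspan : HasSpan P F h) {t : ℝ} (ht : t ≠ 0)
    (hth : |t| < 2 * Real.pi / h) {ε : ℝ} (hε : 0 < ε) :
    ∃ n, ∀ f : X → ℂ, BM f → (∀ x, ‖f x‖ ≤ 1) →
      ∫ x, ‖(twist P F (t * Complex.I))^[n] f x‖ ∂π < ε := by
  by_contra! hcon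
  obtain ⟨g, θ, h1, h2, h3, h4⟩ := H.exists_eigenfunction hap hF hF1 t hε hcon
  have h5 := hspan.2 (H.isAlmostLattice hap hF ht h1 h2 h3 h4)
  have htp : 0 < |t| := abs_pos.2 ht
  rw [div_le_iff₀ htp] at h5
  rw [lt_div_iff₀ hh] at hth
  linarith

theorem twist_iterate_sub (hF : Measurable F) (hF1 : ∀ x, |F x| ≤ 1) (z : ℂ) {f g : X → ℂ}
    (hf : BM f) (hg : BM g) (n : ℕ) (x : X) :
    (twist P F z)^[n] (fun y => f y - g y) x = (twist P F z)^[n] f x - (twist P F z)^[n] g x := by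
  have hn := measurable_pi_apply (X := fun _ : ℕ => X) n
  rw [← integral_exp_partialSum hF hF1 z n x (hf.sub hg),
    ← integral_exp_partialSum hF hF1 z n x hf, ← integral_exp_partialSum hF hF1 z n x hg,
    ← integral_sub (((bm_exp_partialSum hF hF1 z n).mul (hf.comp hn)).integrable _)
      (((bm_exp_partialSum hF hF1 z n).mul (hg.comp hn)).integrable _)]
  exact integral_congr_ae (ae_of_all _ fun w => mul_sub _ _ _)

theorem twist_iterate_const_mul (hF : Measurable F) (hF1 : ∀ x, |F x| ≤ 1) (z a : ℂ) {f : X → ℂ}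
    (hf : BM f) (n : ℕ) (x : X) :
    (twist P F z)^[n] (fun y => a * f y) x = a * (twist P F z)^[n] f x := by
  rw [← integral_exp_partialSum hF hF1 z n x ((BM.const a).mul hf),
    ← integral_exp_partialSum hF hF1 z n x hf, ← integral_const_mul]
  exact integral_congr_ae (ae_of_all _ fun w => mul_left_comm _ _ _)

theorem norm_exp_mul_I_sub_exp_le (t t₀ S : ℝ) :
    ‖Complex.exp (t * Complex.I * S) - Complex.exp (t₀ * Complex.I * S)‖ ≤ |t - t₀| * |S| := by
  have e : Complex.exp (t * Complex.I * S) - Complex.exp (t₀ * Complex.I * S) =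
      Complex.exp ((t₀ * S : ℝ) * Complex.I) *
        (Complex.exp (Complex.I * ((t - t₀) * S : ℝ)) - 1) := by
    rw [mul_sub, ← Complex.exp_add, mul_one]
    congr 2 <;> push_cast <;> ring
  rw [e, norm_mul, Complex.norm_exp_ofReal_mul_I, one_mul, ← abs_mul]
  exact Real.norm_exp_I_mul_ofReal_sub_one_le

theorem norm_twist_iterate_sub_le (hF : Measurable F) (hF1 : ∀ x, |F x| ≤ 1) (t t₀ : ℝ) {f : X → ℂ}
    (hf : BM f) (n : ℕ) (x : X) :
    ‖(twist P F (t * Complex.I))^[n] f x - (twist P F (t₀ * Complex.I))^[n] f x‖ ≤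
      |t - t₀| * n * ∫ y, ‖f y‖ ∂(P ^ n) x := by
  have hn := measurable_pi_apply (X := fun _ : ℕ => X) n
  rw [← integral_exp_partialSum hF hF1 _ n x hf, ← integral_exp_partialSum hF hF1 _ n x hf,
    ← integral_sub (((bm_exp_partialSum hF hF1 _ n).mul (hf.comp hn)).integrable _)
      (((bm_exp_partialSum hF hF1 _ n).mul (hf.comp hn)).integrable _),
    ← integral_chainLaw x n hf.norm, ← integral_const_mul]
  refine norm_integral_le_of_norm_le (((hf.norm.comp hn).integrable _).const_mul _)
    (ae_of_all _ fun w => ?_)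
  rw [← sub_mul, norm_mul]
  refine mul_le_mul_of_nonneg_right ((norm_exp_mul_I_sub_exp_le t t₀ _).trans ?_) (norm_nonneg _)
  exact mul_le_mul_of_nonneg_left (abs_partialSum_le hF1 n w) (abs_nonneg _)

theorem DriftData.integral_weight_le (H : DriftData P π ν V s δ b) {β : ℝ} {f : X → ℂ}
    (hf : BM f) {D : ℝ} (hfD : ∀ x, ‖f x‖ ≤ D * (1 + β * V x)) (n : ℕ) (x : X) :
    ∫ y, ‖f y‖ ∂(P ^ n) x ≤ D * (1 + β * ∫ y, V y ∂(P ^ n) x) := by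
  have hVi := H.integrable_V_pow n x
  calc _ ≤ ∫ y, D * (1 + β * V y) ∂(P ^ n) x := integral_mono (hf.norm.integrable _)
        (((integrable_const _).add (hVi.const_mul β)).const_mul _) hfD
    _ = _ := by
      rw [integral_const_mul, integral_add (integrable_const _) (hVi.const_mul β),
        integral_const_mul]
      simp

/-- Away from the dual lattice the twisted operator contracts a weighted supremum norm. -/
theorem DriftData.exists_twist_contraction [MeasurableSpace.CountablyGenerated X]
    (H : DriftData P π ν V s δ b) (hap : IsAperiodic P π) (hF : Measurable F)
    (hF1 : ∀ x, |F x| ≤ 1) {h : ℝ} (hh : 0 < h) (hspan : HasSpan P F h) {t : ℝ} (ht : t ≠ 0)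
    (hth : |t| < 2 * Real.pi / h) :
    ∃ (β : ℝ) (N : ℕ), 0 < β ∧ 0 < N ∧ ∀ f : X → ℂ, BM f → ∀ D : ℝ, 0 ≤ D →
      (∀ x, ‖f x‖ ≤ D * (1 + β * V x)) →
      ∀ x, ‖(twist P F (t * Complex.I))^[N] f x‖ ≤ D * (1 / 4) * (1 + β * V x) := by
  obtain ⟨u, hu⟩ := H.exists_tvBound hap
  obtain ⟨C, hC, hβ⟩ := hu.exists_uniform_bound H
  have hd := H.δ_pos
  have hB : 0 < b / δ := div_pos H.b_pos hd
  -- The target 1/4 is split in two: 1/8 for the unbounded remainder (through βb/δ = 1/8) and 1/8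
  -- for the truncated part (1/16 from L¹(π) smallness, 1/16 from total variation).
  set β : ℝ := 1 / (8 * (b / δ)) with hβdef
  have hβ0 : 0 < β := by positivity
  have hβe : β * (b / δ) = 1 / 8 := by
    have : b / δ ≠ 0 := hB.ne'
    rw [hβdef, one_div, mul_inv, mul_assoc, inv_mul_cancel₀ this]
    norm_num
  obtain ⟨n₀, hn₀⟩ := H.exists_integral_norm_twist_lt hap hF hF1 hh hspan ht hth
    (show (0 : ℝ) < 1 / 16 by norm_num)
  obtain ⟨N₁, hN₁⟩ := hβ (min (1 / (32 * C)) (β / 16)) (by positivity)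
  have h0 : 0 ≤ 1 - δ := by linarith [H.δ_lt_one]
  obtain ⟨k, ⟨hk2, hk3⟩, hk4⟩ := (((tendsto_pow_atTop_nhds_zero_of_lt_one h0 (by linarith)).eventually
    (gt_mem_nhds (show (0 : ℝ) < 1 / 8 by norm_num))).and (eventually_ge_atTop N₁)).and
    (eventually_gt_atTop 0) |>.exists
  set Q := twist P F (t * Complex.I) with hQ
  have key : ∀ f : X → ℂ, BM f → (∀ x, ‖f x‖ ≤ 1 + β * V x) →
      ∀ x, ‖Q^[k + n₀] f x‖ ≤ 1 / 4 * (1 + β * V x) := by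
    intro f hf hfV x
    set f₁ : X → ℂ := fun y => ((1 / max 1 ‖f y‖ : ℝ) : ℂ) * f y with hf₁
    have hm1 : ∀ y, 1 ≤ max 1 ‖f y‖ := fun y => le_max_left _ _
    have hwB : BM fun y => (1 / max 1 ‖f y‖ : ℝ) := BM.of_measurable_le
      (measurable_const.div (measurable_const.max hf.sm.norm.measurable)) (C := 1) fun y => by
        rw [abs_of_nonneg (by have := hm1 y; positivity), div_le_one (by linarith [hm1 y])]
        exact hm1 y
    have hB1 : BM f₁ := hwB.ofReal.mul hf
    have h1 : ∀ y, ‖f₁ y‖ ≤ 1 := fun y => by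
      rw [hf₁, norm_mul, Complex.norm_real, Real.norm_of_nonneg (by have := hm1 y; positivity),
        one_div_mul_eq_div, div_le_one (by linarith [hm1 y])]
      exact le_max_right _ _
    have h2 : ∀ y, ‖f y - f₁ y‖ ≤ β * V y := fun y => by
      have e : f y - f₁ y = ((1 - 1 / max 1 ‖f y‖ : ℝ) : ℂ) * f y := by
        simp only [hf₁]; push_cast; ring
      have hp : 0 ≤ 1 - 1 / max 1 ‖f y‖ := by
        rw [sub_nonneg, div_le_one (by linarith [hm1 y])]; exact hm1 y
      rw [e, norm_mul, Complex.norm_real, Real.norm_of_nonneg hp]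
      have hVp := mul_pos hβ0 (H.V_pos y)
      rcases le_total ‖f y‖ 1 with h | h
      · rw [max_eq_left h]; simpa using hVp.le
      · rw [max_eq_right h, sub_mul, one_div_mul_cancel (by linarith)]
        linarith [hfV y]
    have hB2 : BM fun y => f y - f₁ y := hf.sub hB1
    have a1 : ‖Q^[k + n₀] f x - Q^[k + n₀] f₁ x‖ ≤ β * ∫ y, V y ∂(P ^ (k + n₀)) x := by
      rw [hQ, ← twist_iterate_sub hF hF1 _ hf hB1]
      refine (norm_twist_iterate_le hF hF1 t hB2 _ x).trans ?_
      rw [← integral_const_mul]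
      exact integral_mono (hB2.norm.integrable _) ((H.integrable_V_pow _ x).const_mul β) h2
    set q := Q^[n₀] f₁ with hq
    have hqB : BM q := hB1.twist_iterate hF hF1 _ n₀
    have hq1 : ∀ y, ‖q y‖ ≤ 1 := fun y =>
      (norm_twist_iterate_le hF hF1 t hB1 n₀ y).trans (by
        calc _ ≤ ∫ y', (1 : ℝ) ∂(P ^ n₀) y :=
              integral_mono (hB1.norm.integrable _) (integrable_const _) h1
          _ = 1 := by simp)
    -- The first n₀ twisted steps make the L¹(π) norm small; the last k discard the phases and use
    -- only that P^k(x,·) is close to π.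
    have a2 : ‖Q^[k + n₀] f₁ x‖ ≤ ∫ y, ‖q y‖ ∂(P ^ k) x := by
      rw [Function.iterate_add_apply]
      exact norm_twist_iterate_le hF hF1 t hqB k x
    have a3 := hu.abs_integral_sub_le k x hqB.norm (fun y => by rw [abs_norm]; exact hq1 y)
    have a4 := hn₀ f₁ hB1 h1
    have a5 := hN₁ k hk3 x
    have a6 := mul_le_mul_of_nonneg_left (H.integral_V_pow_le (k + n₀) x) hβ0.le
    have a7 : (1 - δ) ^ (k + n₀) * (β * V x) ≤ 1 / 8 * (β * V x) := by
      refine mul_le_mul_of_nonneg_right ?_ (mul_pos hβ0 (H.V_pos x)).le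
      refine le_trans ?_ hk2.le
      exact pow_le_pow_of_le_one h0 (by linarith) (Nat.le_add_right _ _)
    have a8 : min (1 / (32 * C)) (β / 16) * C ≤ 1 / 32 := by
      calc _ ≤ 1 / (32 * C) * C := mul_le_mul_of_nonneg_right (min_le_left _ _) hC.le
        _ = 1 / 32 := by field_simp
    have a9 : min (1 / (32 * C)) (β / 16) * V x ≤ β / 16 * V x :=
      mul_le_mul_of_nonneg_right (min_le_right _ _) (H.V_pos x).le
    have a10 := norm_add_le (Q^[k + n₀] f x - Q^[k + n₀] f₁ x) (Q^[k + n₀] f₁ x)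
    rw [sub_add_cancel] at a10
    have a11 := (abs_le.1 a3).2
    rw [mul_add] at a5
    change ∫ x, ‖q x‖ ∂π < 1 / 16 at a4
    linarith
  refine ⟨β, k + n₀, hβ0, by omega, fun f hf D hD hfD x => ?_⟩
  rcases hD.eq_or_lt with rfl | hD
  · have hz : ∀ y, f y = 0 := fun y => by simpa using hfD y
    have h1 := norm_twist_iterate_le (P := P) hF hF1 t hf (k + n₀) x
    simp only [hz, norm_zero, integral_zero] at h1
    simpa using h1
  · have hDc : (D : ℂ) ≠ 0 := by exact_mod_cast hD.ne'
    have h := key (fun y => (D : ℂ)⁻¹ * f y) ((BM.const _).mul hf) (fun y => by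
        rw [norm_mul, norm_inv, Complex.norm_real, Real.norm_of_nonneg hD.le, inv_mul_le_iff₀ hD]
        exact hfD y) x
    rw [hQ, twist_iterate_const_mul hF hF1 _ _ hf, norm_mul, norm_inv, Complex.norm_real,
      Real.norm_of_nonneg hD.le, inv_mul_le_iff₀ hD] at h
    linarith

/-- Locally uniform geometric decay of the characteristic functions. -/
theorem DriftData.exists_nhds_decay [MeasurableSpace.CountablyGenerated X]
    (H : DriftData P π ν V s δ b) (hap : IsAperiodic P π) (hF : Measurable F)
    (hF1 : ∀ x, |F x| ≤ 1) {h : ℝ} (hh : 0 < h) (hspan : HasSpan P F h) {t₀ : ℝ} (ht : t₀ ≠ 0)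
    (hth : |t₀| < 2 * Real.pi / h) :
    ∃ U ∈ 𝓝 t₀, ∃ C ρ : ℝ, 0 < ρ ∧ ρ < 1 ∧ ∀ t ∈ U, ∀ n x,
      ‖complexMGF (partialSum F n) (chainLaw P x) (t * Complex.I)‖ ≤ C * ρ ^ n * V x := by
  obtain ⟨β, N, hβ, hN, hcon⟩ := H.exists_twist_contraction hap hF hF1 hh hspan ht hth
  obtain ⟨ρ, hρ0, hρ1, hρ⟩ := exists_half_pow_le N hN
  have hB : 0 < b / δ := div_pos H.b_pos H.δ_pos
  have hNr : (0 : ℝ) < N := by exact_mod_cast hN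
  have hweight : ∀ n x, 1 + β * ∫ y, V y ∂(P ^ n) x ≤ (1 + b / δ) * (1 + β * V x) := fun n x => by
    have := mul_le_mul_of_nonneg_left (H.integral_V_pow_le' n x) hβ.le
    have := mul_pos hβ (H.V_pos x)
    linarith
  -- Changing the frequency moves the N-th iterate by at most |t - t₀|N times the drift constant;
  -- this radius makes it another 1/4, for a contraction factor of 1/2 throughout the ball.
  refine ⟨Metric.ball t₀ (1 / (4 * N * (1 + b / δ))), Metric.ball_mem_nhds _ (by positivity),
    2 * ((1 + b / δ) * (1 + β)), ρ, hρ0, hρ1, fun t htU n x => ?_⟩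
  rw [Metric.mem_ball, Real.dist_eq] at htU
  have hstep : ∀ f : X → ℂ, BM f → ∀ D : ℝ, 0 ≤ D → (∀ x, ‖f x‖ ≤ D * (1 + β * V x)) →
      ∀ x, ‖(twist P F (t * Complex.I))^[N] f x‖ ≤ D * (1 / 2) * (1 + β * V x) := by
    intro f hf D hD hfD x
    have h1 := hcon f hf D hD hfD x
    have h2 := norm_twist_iterate_sub_le (P := P) hF hF1 t t₀ hf N x
    have h3 : |t - t₀| * N * ∫ y, ‖f y‖ ∂(P ^ N) x ≤ D * (1 / 4) * (1 + β * V x) := by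
      have h4 := H.integral_weight_le hf hfD N x
      have h5 := mul_le_mul_of_nonneg_left (hweight N x) hD
      have hW : 0 < 1 + β * V x := by have := mul_pos hβ (H.V_pos x); linarith
      calc |t - t₀| * N * ∫ y, ‖f y‖ ∂(P ^ N) x
          ≤ 1 / (4 * N * (1 + b / δ)) * N * (D * ((1 + b / δ) * (1 + β * V x))) := by
            have h6 : 0 ≤ ∫ y, ‖f y‖ ∂(P ^ N) x := integral_nonneg fun y => norm_nonneg _
            exact mul_le_mul (mul_le_mul_of_nonneg_right htU.le hNr.le) (h4.trans h5) h6
              (by positivity)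
        _ = D * (1 / 4) * (1 + β * V x) := by
            have : 1 + b / δ ≠ 0 := by positivity
            generalize 1 + b / δ = c at this
            field_simp
    have h7 := norm_add_le ((twist P F (t * Complex.I))^[N] f x -
      (twist P F (t₀ * Complex.I))^[N] f x) ((twist P F (t₀ * Complex.I))^[N] f x)
    rw [sub_add_cancel] at h7
    linarith
  have h1B : BM fun _ : X => (1 : ℂ) := BM.const 1
  have hiter : ∀ (k : ℕ) x, ‖(twist P F (t * Complex.I))^[N * k] (fun _ => 1) x‖ ≤
      (1 / 2) ^ k * (1 + β * V x) := by
    intro k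
    induction k with
    | zero =>
      intro x
      have := mul_pos hβ (H.V_pos x)
      simp only [mul_zero, Function.iterate_zero, id, norm_one, pow_zero, one_mul]
      linarith
    | succ k ih =>
      intro x
      rw [show N * (k + 1) = N + N * k by ring, Function.iterate_add_apply, pow_succ]
      exact hstep _ (h1B.twist_iterate hF hF1 _ _) _ (by positivity) ih x
  rw [← twist_iterate_one hF hF1]
  have hn : n = n % N + N * (n / N) := (Nat.mod_add_div n N).symm
  conv_lhs => rw [hn, Function.iterate_add_apply]
  have hB' := h1B.twist_iterate (P := P) hF hF1 (t * Complex.I) (N * (n / N))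
  refine (norm_twist_iterate_le hF hF1 t hB' (n % N) x).trans
    ((H.integral_weight_le hB' (hiter (n / N)) (n % N) x).trans ?_)
  have h3 : 1 + β * V x ≤ (1 + β) * V x := by
    have := H.one_le x
    linarith
  have h4 : 0 ≤ (1 : ℝ) + b / δ := by positivity
  have hVx := (H.V_pos x).le
  calc _ ≤ (2 * ρ ^ n) * ((1 + b / δ) * ((1 + β) * V x)) :=
        mul_le_mul (hρ n) ((hweight _ x).trans (mul_le_mul_of_nonneg_left h3 h4))
          (by
            have : 0 ≤ ∫ z, V z ∂(P ^ (n % N)) x := integral_nonneg fun z => (H.V_pos z).le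
            positivity) (by positivity)
    _ = _ := by ring

/-- The frequencies form a compact subset of 0 < |t| < 2π/h, so finitely many of the local decay
estimates suffice. -/
theorem DriftData.exists_uniform_decay [MeasurableSpace.CountablyGenerated X]
    (H : DriftData P π ν V s δ b) (hap : IsAperiodic P π) (hF : Measurable F)
    (hF1 : ∀ x, |F x| ≤ 1) {h : ℝ} (hh : 0 < h) (hspan : HasSpan P F h) {η : ℝ} (hη : 0 < η) :
    ∃ C ρ : ℝ, 0 < ρ ∧ ρ < 1 ∧ ∀ t : ℝ, η ≤ |t| → |t| ≤ Real.pi / h → ∀ n x,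
      ‖complexMGF (partialSum F n) (chainLaw P x) (t * Complex.I)‖ ≤ C * ρ ^ n * V x := by
  have hcpt : IsCompact (Set.Icc (-(Real.pi / h)) (Real.pi / h) ∩ {t : ℝ | η ≤ |t|}) :=
    isCompact_Icc.inter_right (isClosed_le continuous_const continuous_abs)
  have hind : ∃ C ρ : ℝ, 0 < ρ ∧ ρ < 1 ∧
      ∀ t ∈ (Set.Icc (-(Real.pi / h)) (Real.pi / h) ∩ {t : ℝ | η ≤ |t|}), ∀ n x,
      ‖complexMGF (partialSum F n) (chainLaw P x) (t * Complex.I)‖ ≤ C * ρ ^ n * V x := by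
    refine hcpt.induction_on (p := fun s => ∃ C ρ : ℝ, 0 < ρ ∧ ρ < 1 ∧ ∀ t ∈ s, ∀ n x,
      ‖complexMGF (partialSum F n) (chainLaw P x) (t * Complex.I)‖ ≤ C * ρ ^ n * V x)
      ⟨0, 1 / 2, by norm_num, by norm_num, fun t ht => ht.elim⟩ ?_ ?_ ?_
    · rintro s t hst ⟨C, ρ, h1, h2, h3⟩
      exact ⟨C, ρ, h1, h2, fun x hx => h3 x (hst hx)⟩
    · rintro s t ⟨C, ρ, h1, h2, h3⟩ ⟨C', ρ', h1', h2', h3'⟩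
      refine ⟨max (max C C') 0, max ρ ρ', lt_max_of_lt_left h1, max_lt h2 h2', fun y hy n x => ?_⟩
      have hV := (H.V_pos x).le
      have hm : 0 ≤ max (max C C') 0 := le_max_right _ _
      rcases hy with hy | hy
      · refine (h3 y hy n x).trans (mul_le_mul_of_nonneg_right ?_ hV)
        exact mul_le_mul ((le_max_left _ _).trans (le_max_left _ _))
          (pow_le_pow_left₀ h1.le (le_max_left _ _) n) (pow_nonneg h1.le n) hm
      · refine (h3' y hy n x).trans (mul_le_mul_of_nonneg_right ?_ hV)
        exact mul_le_mul ((le_max_right _ _).trans (le_max_left _ _))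
          (pow_le_pow_left₀ h1'.le (le_max_right _ _) n) (pow_nonneg h1'.le n) hm
    · rintro t ⟨ht1, ht2⟩
      have ht0 : t ≠ 0 := fun h0 => by
        rw [h0] at ht2
        have : η ≤ |(0 : ℝ)| := ht2
        rw [abs_zero] at this
        linarith
      have hlt : |t| < 2 * Real.pi / h := by
        refine (abs_le.2 ht1).trans_lt ?_
        rw [div_lt_div_iff_of_pos_right hh]
        linarith [Real.pi_pos]
      obtain ⟨U, hU, C, ρ, h1, h2, h3⟩ := H.exists_nhds_decay hap hF hF1 hh hspan ht0 hlt
      exact ⟨U, mem_nhdsWithin_of_mem_nhds hU, C, ρ, h1, h2, h3⟩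
  obtain ⟨C, ρ, h1, h2, h3⟩ := hind
  exact ⟨C, ρ, h1, h2, fun t ht1 ht2 n x => h3 t ⟨abs_le.1 ht2, ht1⟩ n x⟩

end MarkovEdgeworth

namespace MarkovEdgeworth

/-! ### Fourier inversion for lattice distributions -/

section LatticeInversion

open Complex in
theorem integral_exp_neg_mul_I_eq {t : ℝ} (ht : t ≠ 0) (a b : ℝ) :
    ∫ y in a..b, exp (-(t * y) * I) = (exp (-(t * b) * I) - exp (-(t * a) * I)) / (-(t * I)) := by
  have hc : -((t : ℂ) * I) ≠ 0 := by simp [ht]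
  have e : ∀ y : ℝ, exp (-((t : ℂ) * y) * I) = exp (-((t : ℂ) * I) * y) := fun y => by
    congr 1; ring
  simp_rw [e]
  rw [integral_exp_mul_complex hc]

theorem norm_exp_neg_mul_I (t y : ℝ) : ‖Complex.exp (-(t * y) * Complex.I)‖ = 1 := by
  have := Complex.norm_exp_ofReal_mul_I (-(t * y))
  push_cast at this
  exact this

theorem norm_integral_exp_neg_mul_I_le (t a b : ℝ) :
    ‖∫ y in a..b, Complex.exp (-(t * y) * Complex.I)‖ * |t| ≤ 2 := by
  rcases eq_or_ne t 0 with rfl | ht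
  · simp
  · rw [integral_exp_neg_mul_I_eq ht, norm_div, norm_neg, norm_mul, Complex.norm_I, mul_one,
      Complex.norm_real, Real.norm_eq_abs, div_mul_cancel₀ _ (abs_ne_zero.2 ht)]
    refine (norm_sub_le _ _).trans ?_
    rw [norm_exp_neg_mul_I, norm_exp_neg_mul_I]; norm_num

theorem norm_integral_exp_neg_mul_I_le_abs (t a b : ℝ) :
    ‖∫ y in a..b, Complex.exp (-(t * y) * Complex.I)‖ ≤ |b - a| := by
  have := intervalIntegral.norm_integral_le_of_norm_le_const (a := a) (b := b) (C := 1)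
    (f := fun y : ℝ => Complex.exp (-(t * y) * Complex.I))
    fun y _ => (norm_exp_neg_mul_I t y).le
  simpa using this

/-- The transform of a uniform cell is the character at its centre times a sinc; the centre of a
cell is a lattice point when its endpoints are midpoints. -/
theorem integral_exp_cell (t a h : ℝ) :
    ∫ y in a..(a + h), Complex.exp (-(t * y) * Complex.I) =
      h * Complex.exp (-(t * (a + h / 2 : ℝ)) * Complex.I) * (Real.sinc (t * h / 2) : ℝ) := by
  rcases eq_or_ne t 0 with rfl | ht
  · simp
  rcases eq_or_ne h 0 with rfl | hh
  · simp
  have h2 : t * h / 2 ≠ 0 := by positivity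
  have htc : (t : ℂ) ≠ 0 := by exact_mod_cast ht
  have hhc : (h : ℂ) ≠ 0 := by exact_mod_cast hh
  have hI := Complex.I_ne_zero
  rw [integral_exp_neg_mul_I_eq ht, Real.sinc_of_ne_zero h2]
  push_cast
  rw [Complex.sin]
  have e1 : Complex.exp (-((t : ℂ) * (a + h)) * Complex.I) =
      Complex.exp (-((t : ℂ) * (a + h / 2)) * Complex.I) *
        Complex.exp (-((t : ℂ) * h / 2) * Complex.I) := by
    rw [← Complex.exp_add]; congr 1; ring
  have e2 : Complex.exp (-((t : ℂ) * a) * Complex.I) =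
      Complex.exp (-((t : ℂ) * (a + h / 2)) * Complex.I) *
        Complex.exp (((t : ℂ) * h / 2) * Complex.I) := by
    rw [← Complex.exp_add]; congr 1; ring
  rw [e1, e2]
  generalize Complex.exp (-((t : ℂ) * (a + h / 2)) * Complex.I) = A
  generalize Complex.exp (-((t : ℂ) * h / 2) * Complex.I) = B
  generalize Complex.exp (((t : ℂ) * h / 2) * Complex.I) = C
  field_simp
  linear_combination (C * A - B * A) * Complex.I_sq

/-- The sum of the characters at the lattice points between `a` and `a + N h`. -/
noncomputable def latticeKernel (h a : ℝ) (N : ℕ) (t : ℝ) : ℂ :=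
  ∑ i ∈ Finset.range N, h * Complex.exp (-(t * (a + i * h + h / 2 : ℝ)) * Complex.I)

theorem continuous_latticeKernel (h a : ℝ) (N : ℕ) : Continuous (latticeKernel h a N) := by
  unfold latticeKernel
  fun_prop

theorem norm_latticeKernel_le (h a : ℝ) (N : ℕ) (t : ℝ) : ‖latticeKernel h a N t‖ ≤ N * |h| := by
  refine (norm_sum_le _ _).trans (le_of_eq ?_)
  rw [Finset.sum_congr rfl fun i _ => by
    rw [norm_mul, norm_exp_neg_mul_I, mul_one, Complex.norm_real, Real.norm_eq_abs]]
  simp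

/-- The cells fill the interval from a to a + Nh. This identity links lattice inversion to the
continuous transform used for the Edgeworth approximation, and the right side satisfies bounds in t
uniform in N. -/
theorem latticeKernel_mul_sinc (h a : ℝ) (N : ℕ) (t : ℝ) :
    latticeKernel h a N t * (Real.sinc (t * h / 2) : ℝ) =
      ∫ y in a..(a + N * h), Complex.exp (-(t * y) * Complex.I) := by
  have := intervalIntegral.sum_integral_adjacent_intervals (μ := volume)
    (f := fun y : ℝ => Complex.exp (-(t * y) * Complex.I)) (a := fun i : ℕ => a + i * h) (n := N)
    fun k _ => (Continuous.intervalIntegrable (by fun_prop) _ _)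
  simp only [Nat.cast_zero, zero_mul, add_zero] at this
  rw [← this, latticeKernel, Finset.sum_mul]
  refine Finset.sum_congr rfl fun i _ => ?_
  rw [← integral_exp_cell]
  congr 1
  push_cast; ring

theorem integral_exp_int_mul {h : ℝ} (hh : 0 < h) (p : ℤ) :
    ∫ t in (-(Real.pi / h))..(Real.pi / h), (h : ℂ) * Complex.exp (t * (p * h : ℝ) * Complex.I) =
      (if p = 0 then 2 * Real.pi else 0 : ℝ) := by
  have hhc : (h : ℂ) ≠ 0 := by exact_mod_cast hh.ne'
  split_ifs with hp
  · subst hp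
    simp
    field_simp
    norm_num
  · have hpc : (p : ℂ) ≠ 0 := by exact_mod_cast hp
    have hc : ((p * h : ℝ) : ℂ) * Complex.I ≠ 0 := by
      push_cast
      exact mul_ne_zero (mul_ne_zero hpc hhc) Complex.I_ne_zero
    have e : ∀ t : ℝ, (h : ℂ) * Complex.exp (t * (p * h : ℝ) * Complex.I) =
        h * Complex.exp (((p * h : ℝ) : ℂ) * Complex.I * t) := fun t => by
      congr 2; ring
    simp_rw [e]
    rw [intervalIntegral.integral_const_mul, integral_exp_mul_complex hc]
    have e2 : Complex.exp (((p * h : ℝ) : ℂ) * Complex.I * (Real.pi / h : ℝ)) =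
        Complex.exp (((p * h : ℝ) : ℂ) * Complex.I * (-(Real.pi / h) : ℝ)) := by
      rw [Complex.exp_eq_exp_iff_exists_int]
      refine ⟨p, ?_⟩
      push_cast
      field_simp
      ring
    rw [e2, sub_self, zero_div, mul_zero, Complex.ofReal_zero]

/-- Orthogonality of characters over one period of the dual lattice: only the cell centred at s
contributes. As a is a midpoint, no lattice point lies on an endpoint. -/
theorem integral_exp_mul_latticeKernel {h : ℝ} (hh : 0 < h) (a : ℝ) (N : ℕ) {s : ℝ}
    (hs : ∃ k : ℤ, s = a + h / 2 + k * h) :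
    ∫ t in (-(Real.pi / h))..(Real.pi / h),
      Complex.exp (t * Complex.I * s) * latticeKernel h a N t =
      (2 * Real.pi : ℝ) * (Set.Ioc a (a + N * h)).indicator 1 s := by
  obtain ⟨k, rfl⟩ := hs
  have e : ∀ t : ℝ, Complex.exp (t * Complex.I * (a + h / 2 + k * h : ℝ)) * latticeKernel h a N t =
      ∑ i ∈ Finset.range N,
        (h : ℂ) * Complex.exp (t * (((k - i : ℤ) : ℝ) * h : ℝ) * Complex.I) := fun t => by
    rw [latticeKernel, Finset.mul_sum]
    refine Finset.sum_congr rfl fun i _ => ?_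
    rw [mul_left_comm, ← Complex.exp_add]
    congr 2
    push_cast; ring
  simp_rw [e]
  rw [intervalIntegral.integral_finsetSum fun i _ => Continuous.intervalIntegrable (by fun_prop) _ _]
  simp_rw [integral_exp_int_mul hh]
  by_cases hk : 0 ≤ k ∧ k < N
  · obtain ⟨m, rfl⟩ := Int.eq_ofNat_of_zero_le hk.1
    have hm : m < N := by exact_mod_cast hk.2
    rw [Finset.sum_eq_single m]
    · rw [if_pos (sub_self _), Set.indicator_of_mem]
      · simp
      · have h1 : (m : ℝ) + 1 ≤ N := by exact_mod_cast hm
        push_cast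
        constructor
        · nlinarith [mul_nonneg (Nat.cast_nonneg (α := ℝ) m) hh.le]
        · nlinarith
    · intro i _ hi
      rw [if_neg, Complex.ofReal_zero]
      omega
    · intro hm'; exact absurd (Finset.mem_range.2 hm) hm'
  · rw [Set.indicator_of_notMem, mul_zero]
    · refine Finset.sum_eq_zero fun i hi => ?_
      have := Finset.mem_range.1 hi
      rw [if_neg (by omega), Complex.ofReal_zero]
    · rintro ⟨h1, h2⟩
      refine hk ⟨?_, ?_⟩
      · have : (-1 : ℝ) < k := by
          by_contra hc
          nlinarith
        have h3 : (-1 : ℤ) < k := by exact_mod_cast this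
        omega
      · have : (k : ℝ) < N := by
          by_contra hc
          nlinarith
        exact_mod_cast this

variable {Ω : Type*} [MeasurableSpace Ω] {μ : Measure Ω} [IsProbabilityMeasure μ] {S : Ω → ℝ}

theorem integral_complexMGF_mul_latticeKernel (hS : Measurable S) {h : ℝ} (hh : 0 < h) (a : ℝ)
    (N : ℕ) (hl : ∀ w, ∃ k : ℤ, S w = a + h / 2 + k * h) :
    ∫ t in (-(Real.pi / h))..(Real.pi / h), complexMGF S μ (t * Complex.I) * latticeKernel h a N t =
      (2 * Real.pi : ℝ) * (μ.real {w | S w ≤ a + N * h} - μ.real {w | S w ≤ a} : ℝ) := by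
  have hle : -(Real.pi / h) ≤ Real.pi / h := by
    have : 0 < Real.pi / h := div_pos Real.pi_pos hh
    linarith
  have e : ∀ t : ℝ, complexMGF S μ (t * Complex.I) * latticeKernel h a N t =
      ∫ w, Complex.exp (t * Complex.I * S w) * latticeKernel h a N t ∂μ := fun t => by
    rw [integral_mul_const]; rfl
  simp_rw [e]
  have hsw := intervalIntegral_integral_swap (μ := μ) (a := -(Real.pi / h)) (b := Real.pi / h)
    (f := fun t w => Complex.exp (t * Complex.I * S w) * latticeKernel h a N t) (by
      have hfin : IsFiniteMeasure
          ((volume : Measure ℝ).restrict (Set.uIoc (-(Real.pi / h)) (Real.pi / h))) := by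
        rw [Set.uIoc_of_le hle]; infer_instance
      refine Integrable.of_bound (C := N * |h|) ?_ (ae_of_all _ fun q => ?_)
      · refine Measurable.aestronglyMeasurable ?_
        have := (continuous_latticeKernel h a N).measurable
        unfold Function.uncurry
        fun_prop
      · have h1 : ‖Complex.exp (q.1 * Complex.I * S q.2)‖ = 1 := by
          rw [mul_right_comm]
          exact_mod_cast Complex.norm_exp_ofReal_mul_I (q.1 * S q.2)
        rw [Function.uncurry, norm_mul, h1, one_mul]
        exact norm_latticeKernel_le h a N q.1)
  rw [hsw]
  simp_rw [fun w => integral_exp_mul_latticeKernel hh a N (hl w)]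
  rw [integral_const_mul]
  congr 1
  have e1 : ∀ w, (Set.Ioc a (a + N * h)).indicator (1 : ℝ → ℂ) (S w) =
      (S ⁻¹' Set.Ioc a (a + N * h)).indicator (fun _ => (1 : ℂ)) w := fun w => rfl
  simp_rw [e1]
  rw [integral_indicator_const _ (hS measurableSet_Ioc)]
  have e2 : S ⁻¹' Set.Ioc a (a + N * h) = {w | S w ≤ a + N * h} \ {w | S w ≤ a} := by
    ext w
    simp [and_comm]
  have hNh : 0 ≤ N * h := by positivity
  rw [e2, measureReal_sdiff (s₁ := {w | S w ≤ a + N * h}) (s₂ := {w | S w ≤ a})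
    (fun w (hw : S w ≤ a) => (hw.trans (by linarith) : S w ≤ a + N * h)) (hS measurableSet_Iic)]
  simp

end LatticeInversion

end MarkovEdgeworth

namespace MarkovEdgeworth

/-! ### Fourier representation of the Edgeworth approximation -/

section GaussianFourier

theorem gaussianPDFReal_std (u : ℝ) :
    gaussianPDFReal 0 1 u = (√(2 * Real.pi))⁻¹ * Real.exp (-u ^ 2 / 2) := by
  simp [gaussianPDFReal_def]

theorem hasDerivAt_gaussianPDFReal_std (u : ℝ) :
    HasDerivAt (gaussianPDFReal 0 1) (-u * gaussianPDFReal 0 1 u) u := by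
  have e : gaussianPDFReal 0 1 = fun u => (√(2 * Real.pi))⁻¹ * Real.exp (-u ^ 2 / 2) :=
    funext gaussianPDFReal_std
  rw [e]
  have h1 : HasDerivAt (fun u : ℝ => -u ^ 2 / 2) (-u) u := by
    refine (((hasDerivAt_pow 2 u).neg).div_const 2).congr_deriv ?_
    push_cast
    ring
  refine ((h1.exp).const_mul _).congr_deriv ?_
  ring

theorem continuous_gaussianPDFReal_std : Continuous (gaussianPDFReal 0 1) :=
  continuous_iff_continuousAt.2 fun u => (hasDerivAt_gaussianPDFReal_std u).continuousAt

theorem hasDerivAt_cdf_gaussianReal_std (u : ℝ) :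
    HasDerivAt (cdf (gaussianReal 0 1)) (gaussianPDFReal 0 1 u) u := by
  have hint := integrable_gaussianPDFReal 0 1
  have e : (cdf (gaussianReal 0 1) : ℝ → ℝ) = fun u =>
      (∫ x in (0 : ℝ)..u, gaussianPDFReal 0 1 x) + cdf (gaussianReal 0 1) 0 := by
    have h1 : ∀ u, cdf (gaussianReal 0 1) u = ∫ x in Set.Iic u, gaussianPDFReal 0 1 x := fun u => by
      rw [cdf_eq_real, measureReal_def, gaussianReal_apply_eq_integral 0 one_ne_zero,
        ENNReal.toReal_ofReal]
      exact integral_nonneg fun x => gaussianPDFReal_nonneg _ _ _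
    funext u
    rw [h1, h1, ← intervalIntegral.integral_Iic_sub_Iic hint.integrableOn hint.integrableOn,
      sub_add_cancel]
  rw [e]
  exact (intervalIntegral.integral_hasDerivAt_right hint.intervalIntegrable
    (stronglyMeasurable_gaussianPDFReal 0 1).stronglyMeasurableAtFilter
    continuous_gaussianPDFReal_std.continuousAt).add_const _

/-- The Gaussian moments against e^{zt} are obtained by differentiating e^{z²/2} repeatedly;
uniqueness of derivatives gives the formulas below. -/
theorem hasDerivAt_integral_pow_mul_exp_gaussian (k : ℕ) (z : ℂ) :
    HasDerivAt (fun z : ℂ => ∫ t : ℝ, (t : ℂ) ^ k * Complex.exp (z * t) ∂gaussianReal 0 1)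
      (∫ t : ℝ, (t : ℂ) ^ (k + 1) * Complex.exp (z * t) ∂gaussianReal 0 1) z :=
  hasDerivAt_integral_pow_mul_exp (X := id) (μ := gaussianReal 0 1) (z := z)
    (by rw [integrableExpSet_id_gaussianReal]; simp) k

theorem integral_exp_gaussian (z : ℂ) :
    ∫ t : ℝ, Complex.exp (z * t) ∂gaussianReal 0 1 = Complex.exp (z ^ 2 / 2) := by
  have := complexMGF_id_gaussianReal (μ := 0) (v := 1) z
  simpa [complexMGF] using this

theorem hasDerivAt_exp_sq_div_two (z : ℂ) :
    HasDerivAt (fun z : ℂ => Complex.exp (z ^ 2 / 2)) (z * Complex.exp (z ^ 2 / 2)) z := by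
  have h1 : HasDerivAt (fun z : ℂ => z ^ 2 / 2) z z := by
    refine ((hasDerivAt_pow 2 z).div_const 2).congr_deriv ?_
    simp
  exact h1.cexp.congr_deriv (mul_comm _ _)

theorem integral_mul_exp_gaussian (z : ℂ) :
    ∫ t : ℝ, (t : ℂ) * Complex.exp (z * t) ∂gaussianReal 0 1 = z * Complex.exp (z ^ 2 / 2) := by
  have h := hasDerivAt_integral_pow_mul_exp_gaussian 0 z
  simp only [pow_zero, one_mul, integral_exp_gaussian, zero_add, pow_one] at h
  exact h.unique (hasDerivAt_exp_sq_div_two z)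

theorem integral_sq_mul_exp_gaussian (z : ℂ) :
    ∫ t : ℝ, (t : ℂ) ^ 2 * Complex.exp (z * t) ∂gaussianReal 0 1 =
      (1 + z ^ 2) * Complex.exp (z ^ 2 / 2) := by
  have h := hasDerivAt_integral_pow_mul_exp_gaussian 1 z
  simp only [pow_one, integral_mul_exp_gaussian, Nat.reduceAdd] at h
  refine h.unique (((hasDerivAt_id z).mul (hasDerivAt_exp_sq_div_two z)).congr_deriv ?_)
  simp only [id]
  ring

theorem integral_cube_mul_exp_gaussian (z : ℂ) :
    ∫ t : ℝ, (t : ℂ) ^ 3 * Complex.exp (z * t) ∂gaussianReal 0 1 =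
      (3 * z + z ^ 3) * Complex.exp (z ^ 2 / 2) := by
  have h := hasDerivAt_integral_pow_mul_exp_gaussian 2 z
  simp only [integral_sq_mul_exp_gaussian, Nat.reduceAdd] at h
  refine h.unique (((((hasDerivAt_pow 2 z).const_add 1)).mul
    (hasDerivAt_exp_sq_div_two z)).congr_deriv ?_)
  push_cast
  ring

theorem integrable_pow_mul_exp_gaussian (k : ℕ) (z : ℂ) :
    Integrable (fun t : ℝ => (t : ℂ) ^ k * Complex.exp (z * t)) (gaussianReal 0 1) :=
  integrable_pow_mul_cexp_of_re_mem_interior_integrableExpSet (X := id)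
    (by rw [integrableExpSet_id_gaussianReal]; simp) k

/-- The polynomial factor in the characteristic function of the Edgeworth approximation. -/
noncomputable def edgeworthSymbol (τ r c t : ℝ) : ℂ :=
  1 + c / τ * (t * Complex.I) + r / τ * (t * Complex.I) ^ 3

/-- The derivative of the Edgeworth approximation. -/
noncomputable def edgeworthDensity (τ r c u : ℝ) : ℝ :=
  gaussianPDFReal 0 1 u * (1 + (c * u + r * (u ^ 3 - 3 * u)) / τ)

theorem continuous_edgeworthSymbol (τ r c : ℝ) : Continuous (edgeworthSymbol τ r c) := by
  unfold edgeworthSymbol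
  fun_prop

theorem continuous_edgeworthDensity (τ r c : ℝ) : Continuous (edgeworthDensity τ r c) := by
  have := continuous_gaussianPDFReal_std
  unfold edgeworthDensity
  fun_prop

/-- The Gaussian is its own transform, so e^{-t²/2} is treated as the standard normal law in t. The
powers it and (it)³ produce the Hermite polynomials u and u³ - 3u. -/
theorem integral_edgeworthSymbol_mul_exp (τ r c u : ℝ) :
    ∫ t : ℝ, edgeworthSymbol τ r c t * Complex.exp (-(t * u) * Complex.I) ∂gaussianReal 0 1 =
      (√(2 * Real.pi) * edgeworthDensity τ r c u : ℝ) := by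
  have h0 := integrable_pow_mul_exp_gaussian 0 (-(u * Complex.I))
  have h1 := integrable_pow_mul_exp_gaussian 1 (-(u * Complex.I))
  have h3 := integrable_pow_mul_exp_gaussian 3 (-(u * Complex.I))
  simp only [pow_zero, one_mul, pow_one] at h0 h1
  have e : ∀ t : ℝ, edgeworthSymbol τ r c t * Complex.exp (-(t * u) * Complex.I) =
      Complex.exp (-(u * Complex.I) * t) +
        ((c / τ * Complex.I) * (t * Complex.exp (-(u * Complex.I) * t)) +
        (-(r / τ * Complex.I)) * (t ^ 3 * Complex.exp (-(u * Complex.I) * t))) := fun t => by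
    have e1 : -((t : ℂ) * u) * Complex.I = -(u * Complex.I) * t := by ring
    rw [e1, edgeworthSymbol]
    linear_combination (r / τ * t ^ 3 * Complex.I * Complex.exp (-(u * Complex.I) * t)) *
      Complex.I_sq
  have h13 : Integrable (fun t : ℝ =>
      (c / τ * Complex.I) * (t * Complex.exp (-(u * Complex.I) * t)) +
        (-(r / τ * Complex.I)) * (t ^ 3 * Complex.exp (-(u * Complex.I) * t)))
      (gaussianReal 0 1) := (h1.const_mul _).add (h3.const_mul _)
  simp_rw [e]
  rw [integral_add h0 h13, integral_add (h1.const_mul _) (h3.const_mul _), integral_const_mul, integral_const_mul,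
    integral_exp_gaussian, integral_mul_exp_gaussian, integral_cube_mul_exp_gaussian,
    edgeworthDensity, gaussianPDFReal_std]
  have h2 : √(2 * Real.pi) ≠ 0 := by positivity
  have e2 : √(2 * Real.pi) * ((√(2 * Real.pi))⁻¹ * Real.exp (-u ^ 2 / 2) *
      (1 + (c * u + r * (u ^ 3 - 3 * u)) / τ)) =
      Real.exp (-u ^ 2 / 2) * (1 + (c * u + r * (u ^ 3 - 3 * u)) / τ) := by
    field_simp
  have e3 : (-((u : ℂ) * Complex.I)) ^ 2 = -u ^ 2 := by
    linear_combination (u : ℂ) ^ 2 * Complex.I_sq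
  have e4 : (-((u : ℂ) * Complex.I)) ^ 3 = u ^ 3 * Complex.I := by
    linear_combination -(u : ℂ) ^ 3 * Complex.I * Complex.I_sq
  rw [e2, e3, e4]
  push_cast
  generalize Complex.exp (-(u : ℂ) ^ 2 / 2) = A
  linear_combination (-(c / τ * u * A) - r / τ * (u ^ 3 - 3 * u) * A) * Complex.I_sq

theorem integrable_edgeworthSymbol_mul_pow (τ r c : ℝ) (k : ℕ) :
    Integrable (fun t : ℝ => edgeworthSymbol τ r c t * (t : ℂ) ^ k) (gaussianReal 0 1) := by
  have h := fun j : ℕ => integrable_pow_mul_exp_gaussian j 0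
  simp only [zero_mul, Complex.exp_zero, mul_one] at h
  refine ((h k).add (((h (k + 1)).const_mul (c / τ * Complex.I)).add
    ((h (k + 3)).const_mul (r / τ * Complex.I ^ 3)))).congr (ae_of_all _ fun t => ?_)
  simp only [Pi.add_apply, edgeworthSymbol]
  ring

theorem integrable_edgeworthSymbol (τ r c : ℝ) :
    Integrable (edgeworthSymbol τ r c) (gaussianReal 0 1) := by
  simpa using integrable_edgeworthSymbol_mul_pow τ r c 0

theorem integral_edgeworthDensity (τ r c a b : ℝ) :
    ((∫ u in a..b, edgeworthDensity τ r c u : ℝ) : ℂ) = (√(2 * Real.pi) : ℝ)⁻¹ *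
      ∫ t : ℝ, edgeworthSymbol τ r c t * (∫ y in a..b, Complex.exp (-(t * y) * Complex.I))
        ∂gaussianReal 0 1 := by
  have hsw := intervalIntegral_integral_swap (μ := gaussianReal 0 1) (a := a) (b := b)
    (f := fun y t => edgeworthSymbol τ r c t * Complex.exp (-(t * y) * Complex.I)) (by
      have hfin : IsFiniteMeasure ((volume : Measure ℝ).restrict (Set.uIoc a b)) := by
        rw [Set.uIoc]; infer_instance
      have h1 : Integrable (fun q : ℝ × ℝ => edgeworthSymbol τ r c q.2)
          (((volume : Measure ℝ).restrict (Set.uIoc a b)).prod (gaussianReal 0 1)) :=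
        (integrable_edgeworthSymbol τ r c).comp_snd _
      refine h1.mono ?_ (ae_of_all _ fun q => ?_)
      · have := (continuous_edgeworthSymbol τ r c).measurable
        unfold Function.uncurry
        refine Measurable.aestronglyMeasurable ?_
        fun_prop
      · rw [Function.uncurry, norm_mul, norm_exp_neg_mul_I, mul_one])
  simp_rw [integral_edgeworthSymbol_mul_exp, intervalIntegral.integral_const_mul] at hsw
  rw [← hsw, intervalIntegral.integral_ofReal, intervalIntegral.integral_const_mul]
  have h2 : (√(2 * Real.pi) : ℝ) ≠ 0 := by positivity
  push_cast
  rw [inv_mul_cancel_left₀ (by exact_mod_cast h2)]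

theorem hasDerivAt_edgeworth (σ ρ c : ℝ) (n : ℕ) (u : ℝ) :
    HasDerivAt (edgeworth σ ρ c n)
      (edgeworthDensity (σ * √n) (ρ / (6 * σ ^ 2)) c u) u := by
  have h1 := hasDerivAt_gaussianPDFReal_std u
  have h2 : HasDerivAt (fun y : ℝ => ρ / (6 * σ ^ 2) * (1 - y ^ 2) - c)
      (ρ / (6 * σ ^ 2) * (-(2 * u))) u := by
    refine ((((hasDerivAt_pow 2 u).const_sub 1).const_mul _).sub_const c).congr_deriv ?_
    simp
  refine ((hasDerivAt_cdf_gaussianReal_std u).add ((h1.div_const (σ * √n)).mul h2)).congr_deriv ?_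
  rw [edgeworthDensity]
  generalize ρ / (6 * σ ^ 2) = r
  ring

theorem edgeworth_sub_edgeworth (σ ρ c : ℝ) (n : ℕ) (a b : ℝ) :
    ((edgeworth σ ρ c n b - edgeworth σ ρ c n a : ℝ) : ℂ) = (√(2 * Real.pi) : ℝ)⁻¹ *
      ∫ t : ℝ, edgeworthSymbol (σ * √n) (ρ / (6 * σ ^ 2)) c t *
        (∫ y in a..b, Complex.exp (-(t * y) * Complex.I)) ∂gaussianReal 0 1 := by
  rw [← integral_edgeworthDensity, intervalIntegral.integral_eq_sub_of_hasDerivAt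
    (fun u _ => hasDerivAt_edgeworth σ ρ c n u)
    ((continuous_edgeworthDensity _ _ _).intervalIntegrable _ _)]

end GaussianFourier

end MarkovEdgeworth

namespace MarkovEdgeworth

/-! ### Comparison of transforms near frequency zero -/

section FourierEstimates

theorem abs_one_sub_sinc_le {θ : ℝ} (h : |θ| ≤ 1) : |1 - Real.sinc θ| ≤ θ ^ 2 / 4 := by
  wlog h0 : 0 ≤ θ generalizing θ
  · have := this (θ := -θ) (by rwa [abs_neg]) (by linarith)
    rwa [Real.sinc_neg, neg_sq] at this
  rw [abs_of_nonneg (by linarith [Real.sinc_le_one θ])]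
  rcases h0.eq_or_lt with rfl | hp
  · simp
  · have h1 := Real.sin_gt_sub_cube hp
    rw [Real.sinc_of_ne_zero hp.ne', sub_le_comm, le_div_iff₀ hp]
    nlinarith [pow_pos hp 3]

theorem abs_inv_sinc_sub_one_le {θ : ℝ} (h : |θ| ≤ 1) : |(Real.sinc θ)⁻¹ - 1| ≤ θ ^ 2 := by
  have h1 := abs_one_sub_sinc_le h
  have h2 : θ ^ 2 ≤ 1 := by nlinarith [sq_abs θ, abs_nonneg θ]
  have h3 : 3 / 4 ≤ Real.sinc θ := by linarith [le_abs_self (1 - Real.sinc θ)]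
  have h4 : 0 < Real.sinc θ := by linarith
  have e : (Real.sinc θ)⁻¹ - 1 = (1 - Real.sinc θ) / Real.sinc θ := by field_simp
  rw [e, abs_div, abs_of_pos h4, div_le_iff₀ h4]
  nlinarith [sq_nonneg θ]

theorem two_div_pi_le_sinc {θ : ℝ} (h : |θ| ≤ Real.pi / 2) : 2 / Real.pi ≤ Real.sinc θ := by
  wlog h0 : 0 ≤ θ generalizing θ
  · have := this (θ := -θ) (by rwa [abs_neg]) (by linarith)
    rwa [Real.sinc_neg] at this
  rcases h0.eq_or_lt with rfl | hp
  · rw [Real.sinc_zero, div_le_one Real.pi_pos]; exact Real.two_le_pi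
  · rw [Real.sinc_of_ne_zero hp.ne', le_div_iff₀ hp]
    exact Real.mul_le_sin h0 (le_of_abs_le h)

/-- One term of the exponential series of a(1 + y). It absorbs polynomial factors into a small part
of the Gaussian decay. -/
theorem one_add_pow_le_mul_exp {a : ℝ} (ha : 0 < a) (k : ℕ) {y : ℝ} (hy : 0 ≤ y) :
    (1 + y) ^ k ≤ k.factorial / a ^ k * Real.exp a * Real.exp (a * y) := by
  have h := Real.pow_div_factorial_le_exp (a * (1 + y)) (by positivity) k
  rw [mul_assoc, ← Real.exp_add, show a + a * y = a * (1 + y) by ring, div_mul_eq_mul_div,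
    le_div_iff₀ (by positivity)]
  rw [div_le_iff₀ (by positivity), mul_pow] at h
  linarith

theorem norm_exp_sub_one_le_mul_exp (w : ℂ) : ‖Complex.exp w - 1‖ ≤ ‖w‖ * Real.exp ‖w‖ := by
  simpa using Complex.norm_exp_sub_sum_le_norm_mul_exp w 1

theorem norm_exp_sub_one_sub_le_mul_exp (w : ℂ) :
    ‖Complex.exp w - 1 - w‖ ≤ ‖w‖ ^ 2 * Real.exp ‖w‖ := by
  have := Complex.norm_exp_sub_sum_le_norm_mul_exp w 2
  simpa [Finset.sum_range_succ, ← sub_sub] using this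

/-- Here w is the non-Gaussian part of the exponent with cubic part w₃, R the prefactor with linear
part a, b the target for a, and p the inverse sinc. To first order the product is 1 + a + w₃; the
terms list the second-order errors and the mismatch of a with b. -/
theorem norm_exp_mul_mul_sub_le {w w₃ R a b p : ℂ} :
    ‖Complex.exp w * R * p - (1 + b + w₃)‖ ≤
      ‖w‖ ^ 2 * Real.exp ‖w‖ + ‖w - w₃‖ + ‖w‖ * Real.exp ‖w‖ * ‖R - 1‖ + ‖R - 1 - a‖ + ‖a - b‖
        + Real.exp ‖w‖ * ‖R‖ * ‖p - 1‖ := by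
  have e : Complex.exp w * R * p - (1 + b + w₃) = (Complex.exp w - 1 - w) + (w - w₃) +
      (Complex.exp w - 1) * (R - 1) + (R - 1 - a) + (a - b) + Complex.exp w * R * (p - 1) := by
    ring
  rw [e]
  refine (norm_add_le _ _).trans (add_le_add ((norm_add_le _ _).trans (add_le_add_left
    ((norm_add_le _ _).trans (add_le_add_left ((norm_add_le _ _).trans (add_le_add
    ((norm_add_le _ _).trans (add_le_add_left (norm_exp_sub_one_sub_le_mul_exp w) _)) ?_)) _)) _))
    ?_)
  · rw [norm_mul]
    exact mul_le_mul_of_nonneg_right (norm_exp_sub_one_le_mul_exp w) (norm_nonneg _)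
  · rw [norm_mul, norm_mul]
    gcongr
    exact Complex.norm_exp_le_exp_norm w

theorem error_terms_le {n x E K K' B h W e d r₁ r₂ r p D : ℝ} (hn : 0 ≤ n) (hx : 0 ≤ x)
    (hE : 1 ≤ E) (hK : 0 ≤ K) (hK' : 0 ≤ K') (hB : 0 ≤ B) (hW0 : 0 ≤ W)
    (hW : W ≤ n * (K' * x ^ 3)) (he0 : 0 ≤ e) (he : e ≤ E) (hd : d ≤ n * (K * x ^ 4))
    (hr0 : 0 ≤ r₁) (hr₁ : r₁ ≤ B * x) (hr₂ : r₂ ≤ K * x ^ 2) (hr00 : 0 ≤ r) (hr : r ≤ 1 + B)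
    (hp0 : 0 ≤ p) (hp : p ≤ h ^ 2 * x ^ 2) :
    W ^ 2 * e + d + W * e * r₁ + r₂ + D + e * r * p ≤
      E * ((K' ^ 2 + K + K' * B + K + (1 + B) * h ^ 2) * (x ^ 2 + n * x ^ 4 + n ^ 2 * x ^ 6))
        + D := by
  have h1 : W ^ 2 * e ≤ (n * (K' * x ^ 3)) ^ 2 * E := by gcongr
  have h2 : W * e * r₁ ≤ n * (K' * x ^ 3) * E * (B * x) := by gcongr
  have h3 : e * r * p ≤ E * (1 + B) * (h ^ 2 * x ^ 2) := by gcongr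
  have h4 : n * (K * x ^ 4) ≤ E * (n * (K * x ^ 4)) := le_mul_of_one_le_left (by positivity) hE
  have h5 : K * x ^ 2 ≤ E * (K * x ^ 2) := le_mul_of_one_le_left (by positivity) hE
  have e1 : E * ((K' ^ 2 + K + K' * B + K + (1 + B) * h ^ 2) * (x ^ 2 + n * x ^ 4 + n ^ 2 * x ^ 6)) =
      (n * (K' * x ^ 3)) ^ 2 * E + E * (n * (K * x ^ 4)) + n * (K' * x ^ 3) * E * (B * x) +
      E * (K * x ^ 2) + E * (1 + B) * (h ^ 2 * x ^ 2) +
      (E * (x ^ 2 * (K' ^ 2 + K + K' * B)) + E * (n * x ^ 4 * (K' ^ 2 + K + (1 + B) * h ^ 2)) +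
        E * (n ^ 2 * x ^ 6 * (K + K' * B + K + (1 + B) * h ^ 2))) := by ring
  have e2 : 0 ≤ E * (x ^ 2 * (K' ^ 2 + K + K' * B)) +
      E * (n * x ^ 4 * (K' ^ 2 + K + (1 + B) * h ^ 2)) +
        E * (n ^ 2 * x ^ 6 * (K + K' * B + K + (1 + B) * h ^ 2)) := by positivity
  rw [e1]
  linarith

-- In the unscaled frequency s write φ = e^{nl}R. After removing the Gaussian, nl leaves w = O(ns³),
-- so w², the quartic remainder, wR and the sinc error are all of order 1/n times a polynomial in
-- s√n. The factor |t|, with t = sσ√n, is kept outside because the inversion kernel is only bounded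
-- by 2/|t|.
set_option maxHeartbeats 1000000 in
theorem exists_near_bound {σ h : ℝ} (hσ : 0 < σ) (hh : 0 < h) (ρ : ℝ) {K A : ℝ} (hK : 0 ≤ K)
    (hA : 0 ≤ A) :
    ∃ η₀ M : ℝ, 0 < η₀ ∧ 0 < M ∧ ∀ (n : ℕ) (s κ c : ℝ) (φ l : ℂ), 1 ≤ n → |s| ≤ η₀ → |κ| ≤ A →
      ‖l - (σ ^ 2 / 2 * (s * Complex.I) ^ 2 + ρ / 6 * (s * Complex.I) ^ 3)‖ ≤ K * |s| ^ 4 →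
      ‖φ * Complex.exp (-(n * l)) - 1 - s * Complex.I * κ‖ ≤ K * |s| ^ 2 →
      ‖φ * ((Real.sinc (s * h / 2))⁻¹ : ℝ) - Real.exp (-(s * (σ * √n)) ^ 2 / 2) *
        edgeworthSymbol (σ * √n) (ρ / (6 * σ ^ 2)) c (s * (σ * √n))‖ ≤
      |s * (σ * √n)| * Real.exp (-(s * (σ * √n)) ^ 2 / 8) * (M / n + |κ - c| / (σ * √n)) := by
  set K' := |ρ| + K with hK'
  have hK'0 : 0 ≤ K' := by positivity
  set B := A + K with hB
  have hB0 : 0 ≤ B := by positivity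
  set M₀ := K' ^ 2 + K + K' * B + K + (1 + B) * h ^ 2 with hM₀
  have hM₀0 : 0 ≤ M₀ := by positivity
  set M₁ := (3 : ℕ).factorial / (σ ^ 2 / 8) ^ 3 * Real.exp (σ ^ 2 / 8) with hM₁
  have hM₁0 : 0 < M₁ := by positivity
  -- The radius keeps the argument of sinc small and forces ‖w‖ ≤ t²/4, so half of the Gaussian
  -- exponent survives e^{‖w‖}.
  refine ⟨min (min 1 (1 / h)) (σ ^ 2 / (4 * (K' + 1))), M₀ * M₁ / σ + 1, by positivity,
    by positivity, fun n s κ c φ l hn hs hκ hl hφ => ?_⟩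
  have hs1 : |s| ≤ 1 := hs.trans ((min_le_left _ _).trans (min_le_left _ _))
  have hsh : |s| * h ≤ 1 := by
    have := hs.trans ((min_le_left _ _).trans (min_le_right _ _))
    rwa [le_div_iff₀ hh] at this
  have hsK : K' * |s| ≤ σ ^ 2 / 4 := by
    have := hs.trans (min_le_right _ _)
    rw [le_div_iff₀ (by positivity)] at this
    linarith [mul_comm K' |s|, mul_add |s| (4 * K') 4, abs_nonneg s, mul_left_comm |s| 4 K']
  have hn0 : (0 : ℝ) < n := by exact_mod_cast hn
  set m := √(n : ℝ) with hm
  have hm0 : 0 < m := Real.sqrt_pos.2 hn0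
  have hmn : m ^ 2 = n := Real.sq_sqrt hn0.le
  set y := |s| * m with hy
  have hy0 : 0 ≤ y := by positivity
  set τ := σ * m with hτ
  have hτ0 : 0 < τ := by positivity
  have hts : |s * τ| = σ * y := by rw [abs_mul, abs_of_pos hτ0, hτ, hy]; ring
  have hts2 : (s * τ) ^ 2 = σ ^ 2 * y ^ 2 := by rw [← sq_abs, hts]; ring
  set w : ℂ := n * l + ((s * τ) ^ 2 / 2 : ℝ) with hw
  set w₃ : ℂ := n * (ρ / 6 * (s * Complex.I) ^ 3) with hw₃
  set R : ℂ := φ * Complex.exp (-(n * l)) with hR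
  have hmnc : (m : ℂ) ^ 2 = n := by exact_mod_cast hmn
  have hw1 : ‖w - w₃‖ ≤ n * (K * |s| ^ 4) := by
    have e : w - w₃ =
        n * (l - (σ ^ 2 / 2 * (s * Complex.I) ^ 2 + ρ / 6 * (s * Complex.I) ^ 3)) := by
      rw [hw, hw₃, hτ]
      push_cast
      linear_combination (s ^ 2 * σ ^ 2 / 2 : ℂ) * hmnc + n * (s ^ 2 * σ ^ 2 / 2) * Complex.I_sq
    rw [e, norm_mul, Complex.norm_natCast]
    exact mul_le_mul_of_nonneg_left hl hn0.le
  have hw₃n : ‖w₃‖ ≤ n * (|ρ| * |s| ^ 3) := by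
    rw [hw₃, norm_mul, Complex.norm_natCast, norm_mul, norm_pow, norm_mul, Complex.norm_I, mul_one,
      norm_div, Complex.norm_real, Complex.norm_real, Real.norm_eq_abs, Real.norm_eq_abs]
    gcongr
    norm_num
    linarith [abs_nonneg ρ]
  have hwn : ‖w‖ ≤ n * (K' * |s| ^ 3) := by
    calc ‖w‖ = ‖(w - w₃) + w₃‖ := by rw [sub_add_cancel]
      _ ≤ n * (K * |s| ^ 4) + n * (|ρ| * |s| ^ 3) := (norm_add_le _ _).trans (add_le_add hw1 hw₃n)
      _ ≤ n * (K * |s| ^ 3) + n * (|ρ| * |s| ^ 3) := by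
        have : |s| ^ 4 ≤ |s| ^ 3 := pow_le_pow_of_le_one (abs_nonneg s) hs1 (by norm_num)
        gcongr
      _ = _ := by rw [hK']; ring
  have hwq : ‖w‖ ≤ σ ^ 2 * y ^ 2 / 4 := by
    calc ‖w‖ ≤ n * (K' * |s| ^ 3) := hwn
      _ = (K' * |s|) * (n * |s| ^ 2) := by ring
      _ ≤ (σ ^ 2 / 4) * (n * |s| ^ 2) := by gcongr
      _ = _ := by rw [hy, mul_pow, hmn]; ring
  set E := Real.exp (σ ^ 2 * y ^ 2 / 4) with hE
  have hE1 : 1 ≤ E := Real.one_le_exp (by positivity)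
  have hwE : Real.exp ‖w‖ ≤ E := Real.exp_le_exp.2 hwq
  have hRa : ‖R - 1 - s * Complex.I * κ‖ ≤ K * |s| ^ 2 := hφ
  have hR1 : ‖R - 1‖ ≤ B * |s| := by
    calc ‖R - 1‖ = ‖(R - 1 - s * Complex.I * κ) + s * Complex.I * κ‖ := by rw [sub_add_cancel]
      _ ≤ K * |s| ^ 2 + |s| * A := by
        refine (norm_add_le _ _).trans (add_le_add hRa ?_)
        rw [norm_mul, norm_mul, Complex.norm_I, mul_one, Complex.norm_real, Complex.norm_real,
          Real.norm_eq_abs, Real.norm_eq_abs]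
        gcongr
      _ ≤ K * |s| + |s| * A := by
        have : |s| ^ 2 ≤ |s| := by simpa using pow_le_pow_of_le_one (abs_nonneg s) hs1 one_le_two
        gcongr
      _ = _ := by rw [hB]; ring
  have hRn : ‖R‖ ≤ 1 + B := by
    calc ‖R‖ = ‖(R - 1) + 1‖ := by rw [sub_add_cancel]
      _ ≤ B * |s| + 1 := (norm_add_le _ _).trans (by rw [norm_one]; linarith)
      _ ≤ 1 + B := by linarith [mul_le_mul_of_nonneg_left hs1 hB0]
  set p : ℂ := (((Real.sinc (s * h / 2))⁻¹ : ℝ) : ℂ) with hp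
  have hp1 : ‖p - 1‖ ≤ h ^ 2 * |s| ^ 2 := by
    have h1 : |s * h / 2| ≤ 1 := by
      rw [abs_div, abs_mul, abs_of_pos hh, abs_two]; linarith
    have := abs_inv_sinc_sub_one_le h1
    rw [hp, ← Complex.ofReal_one, ← Complex.ofReal_sub, Complex.norm_real, Real.norm_eq_abs, sq_abs]
    rw [div_pow, mul_pow] at this
    linarith [mul_nonneg (sq_nonneg s) (sq_nonneg h), mul_comm (s ^ 2) (h ^ 2)]
  have hab : ‖(s * Complex.I * κ : ℂ) - c * (s * Complex.I)‖ = |s| * |κ - c| := by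
    have e : (s * Complex.I * κ : ℂ) - c * (s * Complex.I) = s * Complex.I * (κ - c : ℝ) := by
      push_cast; ring
    rw [e, norm_mul, norm_mul, Complex.norm_I, mul_one, Complex.norm_real, Complex.norm_real,
      Real.norm_eq_abs, Real.norm_eq_abs]
  have hmain := norm_exp_mul_mul_sub_le (w := w) (w₃ := w₃) (R := R) (p := p)
    (a := s * Complex.I * κ) (b := c * (s * Complex.I))
  have hbound : ‖Complex.exp w * R * p - (1 + c * (s * Complex.I) + w₃)‖ ≤
      E * (M₀ / n * (y ^ 2 + y ^ 4 + y ^ 6)) + |s| * |κ - c| := by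
    have e2 : y ^ 2 = n * |s| ^ 2 := by rw [hy, mul_pow, hmn]; ring
    have e4 : y ^ 4 = n ^ 2 * |s| ^ 4 := by
      rw [show y ^ 4 = (y ^ 2) ^ 2 by ring, e2]; ring
    have e6 : y ^ 6 = n ^ 3 * |s| ^ 6 := by
      rw [show y ^ 6 = (y ^ 2) ^ 3 by ring, e2]; ring
    have e7 : M₀ / n * (y ^ 2 + y ^ 4 + y ^ 6) =
        M₀ * (|s| ^ 2 + n * |s| ^ 4 + n ^ 2 * |s| ^ 6) := by
      rw [e2, e4, e6]; field_simp
    rw [e7]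
    rw [hab] at hmain
    exact hmain.trans (error_terms_le hn0.le (abs_nonneg s) hE1 hK hK'0 hB0 (norm_nonneg _) hwn
      (Real.exp_pos _).le hwE hw1 (norm_nonneg _) hR1 hRa (norm_nonneg _) hRn (norm_nonneg _) hp1)
  have hfac : φ * p - Real.exp (-(s * τ) ^ 2 / 2) *
      edgeworthSymbol τ (ρ / (6 * σ ^ 2)) c (s * τ) = Real.exp (-(s * τ) ^ 2 / 2) *
        (Complex.exp w * R * p - (1 + c * (s * Complex.I) + w₃)) := by
    have e1 : φ = Real.exp (-(s * τ) ^ 2 / 2) * (Complex.exp w * R) := by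
      have : φ = Complex.exp (-(s * τ) ^ 2 / 2 + w + -(n * l)) * φ := by
        have e : (-(s * τ) ^ 2 / 2 + w + -(n * l) : ℂ) = 0 := by
          rw [hw]; push_cast; ring
        rw [e, Complex.exp_zero, one_mul]
      rw [Complex.exp_add, Complex.exp_add] at this
      rw [hR]
      push_cast
      linear_combination this
    have e2 : edgeworthSymbol τ (ρ / (6 * σ ^ 2)) c (s * τ) = 1 + c * (s * Complex.I) + w₃ := by
      have hτc : (τ : ℂ) ≠ 0 := by exact_mod_cast hτ0.ne'
      have hσc : (σ : ℂ) ≠ 0 := by exact_mod_cast hσ.ne'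
      have e3 : (τ : ℂ) ^ 2 = σ ^ 2 * n := by rw [hτ, ← hmnc]; push_cast; ring
      have e4 : (n : ℂ) = τ ^ 2 / σ ^ 2 := by rw [e3]; field_simp
      rw [edgeworthSymbol, hw₃, e4]
      push_cast
      field_simp
    rw [e2]
    nth_rewrite 1 [e1]
    ring
  rw [hfac, norm_mul, Complex.norm_real, Real.norm_of_nonneg (Real.exp_pos _).le, hts]
  have hx : -(s * τ) ^ 2 / 2 = -(σ ^ 2 * y ^ 2 / 2) := by rw [hts2]; ring
  have hx8 : -(s * τ) ^ 2 / 8 = -(σ ^ 2 * y ^ 2 / 8) := by rw [hts2]; ring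
  rw [hx, hx8]
  -- Absorbing the polynomial costs e^{t²/8}: of e^{-t²/2}, a factor e^{t²/4} went to e^{‖w‖}, and
  -- e^{-t²/8} remains.
  have hpoly : y ^ 2 + y ^ 4 + y ^ 6 ≤ y * (M₁ * Real.exp (σ ^ 2 * y ^ 2 / 8)) := by
    have h1 := one_add_pow_le_mul_exp (a := σ ^ 2 / 8) (by positivity) 3 (sq_nonneg y)
    rw [← hM₁, show σ ^ 2 / 8 * y ^ 2 = σ ^ 2 * y ^ 2 / 8 by ring] at h1
    refine le_trans ?_ (mul_le_mul_of_nonneg_left h1 hy0)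
    have h2 : y + y ^ 3 + y ^ 5 ≤ (1 + y ^ 2) ^ 3 := by
      nlinarith [sq_nonneg (y - 1), sq_nonneg (y ^ 2 - y), sq_nonneg (y ^ 3 - y ^ 2)]
    calc y ^ 2 + y ^ 4 + y ^ 6 = y * (y + y ^ 3 + y ^ 5) := by ring
      _ ≤ _ := mul_le_mul_of_nonneg_left h2 hy0
  calc Real.exp (-(σ ^ 2 * y ^ 2 / 2)) * ‖Complex.exp w * R * p - (1 + c * (s * Complex.I) + w₃)‖
      ≤ Real.exp (-(σ ^ 2 * y ^ 2 / 2)) * (E * (M₀ / n * (y * (M₁ * Real.exp (σ ^ 2 * y ^ 2 / 8))))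
          + |s| * |κ - c|) := by
        gcongr
        refine hbound.trans ?_
        gcongr
    _ = σ * y * Real.exp (-(σ ^ 2 * y ^ 2 / 8)) * (M₀ * M₁ / σ / n) +
        Real.exp (-(σ ^ 2 * y ^ 2 / 2)) * (|s| * |κ - c|) := by
        have e : Real.exp (-(σ ^ 2 * y ^ 2 / 2)) * E * Real.exp (σ ^ 2 * y ^ 2 / 8) =
            Real.exp (-(σ ^ 2 * y ^ 2 / 8)) := by
          rw [hE, ← Real.exp_add, ← Real.exp_add]; congr 1; ring
        rw [← e]
        field_simp
    _ ≤ σ * y * Real.exp (-(σ ^ 2 * y ^ 2 / 8)) * ((M₀ * M₁ / σ + 1) / n) +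
        Real.exp (-(σ ^ 2 * y ^ 2 / 8)) * (|s| * |κ - c|) := by
        gcongr
        · linarith
        · norm_num
    _ = _ := by
        have e : |s| = σ * y / τ := by rw [hy, hτ]; field_simp
        rw [e]
        ring

end FourierEstimates

end MarkovEdgeworth

namespace MarkovEdgeworth

/-! ### From transforms to distribution functions -/

section Smoothing

theorem norm_edgeworthSymbol_le (τ r c t : ℝ) :
    ‖edgeworthSymbol τ r c t‖ ≤ (1 + |c / τ| + |r / τ|) * (1 + t ^ 2) ^ 2 := by
  have h1 : |t| ≤ (1 + t ^ 2) ^ 2 := by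
    have := sq_abs t
    nlinarith [sq_nonneg (|t| - 1), sq_nonneg (t ^ 2)]
  have h2 : |t| ^ 3 ≤ (1 + t ^ 2) ^ 2 := by
    have := sq_abs t
    have h3 : |t| ^ 3 = |t| * t ^ 2 := by rw [← this]; ring
    nlinarith [mul_nonneg (sq_nonneg t) (sq_nonneg (|t| - 1)), sq_nonneg (t ^ 2), sq_nonneg t]
  have h3 : 1 ≤ (1 + t ^ 2) ^ 2 := one_le_pow₀ (by nlinarith [sq_nonneg t])
  have hn : ‖(t * Complex.I : ℂ)‖ = |t| := by simp
  rw [edgeworthSymbol]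
  refine (norm_add₃_le).trans ?_
  rw [norm_one, norm_mul (c / τ : ℂ), norm_mul (r / τ : ℂ), norm_pow, hn, ← Complex.ofReal_div, ← Complex.ofReal_div,
    Complex.norm_real, Complex.norm_real, Real.norm_eq_abs, Real.norm_eq_abs]
  have h4 := mul_le_mul_of_nonneg_left h1 (abs_nonneg (c / τ))
  have h5 := mul_le_mul_of_nonneg_left h2 (abs_nonneg (r / τ))
  linarith

/-- For |t| ≥ η₀σ√n one has 1 ≤ t²/(η₀²σ²n); multiplying by this ratio produces the factor 1/n, and
the extra powers of t are absorbed by the Gaussian. -/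
theorem exists_far_bound {σ η₀ : ℝ} (hσ : 0 < σ) (hη : 0 < η₀) (r c : ℝ) :
    ∃ M : ℝ, 0 < M ∧ ∀ (n : ℕ) (t : ℝ), 1 ≤ n → η₀ * (σ * √n) ≤ |t| →
      ‖(Real.exp (-t ^ 2 / 2) : ℂ) * edgeworthSymbol (σ * √n) r c t‖ ≤
        |t| * Real.exp (-t ^ 2 / 8) * (M / n) := by
  set K := 1 + |c| / σ + |r| / σ with hK
  have hK0 : 0 < K := by positivity
  set M₁ := (3 : ℕ).factorial / (1 / 4 : ℝ) ^ 3 * Real.exp (1 / 4) with hM₁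
  have hM₁0 : 0 < M₁ := by positivity
  refine ⟨K * M₁ / (η₀ ^ 2 * σ ^ 2), by positivity, fun n t hn ht => ?_⟩
  have hn1 : (1 : ℝ) ≤ n := by exact_mod_cast hn
  have hn0 : (0 : ℝ) < n := by linarith
  have hm1 : 1 ≤ √(n : ℝ) := Real.one_le_sqrt.2 hn1
  have hτ : σ ≤ σ * √n := le_mul_of_one_le_right hσ.le hm1
  have hτ0 : 0 < σ * √n := hσ.trans_le hτ
  have hq : ‖edgeworthSymbol (σ * √n) r c t‖ ≤ K * (1 + t ^ 2) ^ 2 := by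
    refine (norm_edgeworthSymbol_le _ _ _ _).trans ?_
    rw [abs_div, abs_div, abs_of_pos hτ0, hK]
    gcongr
  have hsq : η₀ ^ 2 * σ ^ 2 * n ≤ t ^ 2 := by
    have := pow_le_pow_left₀ (by positivity) ht 2
    rw [mul_pow, mul_pow, Real.sq_sqrt hn0.le, sq_abs] at this
    linarith
  have h1 := one_add_pow_le_mul_exp (a := 1 / 4) (by norm_num) 3 (sq_nonneg t)
  rw [← hM₁] at h1
  have h2 : |t| ≤ 1 + t ^ 2 := by nlinarith [sq_abs t, sq_nonneg (|t| - 1)]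
  rw [norm_mul, Complex.norm_real, Real.norm_of_nonneg (Real.exp_pos _).le]
  have e1 : Real.exp (-t ^ 2 / 2) * Real.exp (1 / 4 * t ^ 2) ≤ Real.exp (-t ^ 2 / 8) := by
    rw [← Real.exp_add]
    exact Real.exp_le_exp.2 (by nlinarith [sq_nonneg t])
  have e2 : 1 ≤ t ^ 2 / (η₀ ^ 2 * σ ^ 2 * n) := (one_le_div (by positivity)).2 hsq
  calc Real.exp (-t ^ 2 / 2) * ‖edgeworthSymbol (σ * √n) r c t‖
      ≤ Real.exp (-t ^ 2 / 2) * (K * (1 + t ^ 2) ^ 2) := by gcongr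
    _ ≤ Real.exp (-t ^ 2 / 2) * (K * (1 + t ^ 2) ^ 2) * (t ^ 2 / (η₀ ^ 2 * σ ^ 2 * n)) :=
        le_mul_of_one_le_right (by positivity) e2
    _ = Real.exp (-t ^ 2 / 2) * K * |t| * ((1 + t ^ 2) ^ 2 * |t|) / (η₀ ^ 2 * σ ^ 2 * n) := by
        rw [← sq_abs t]; ring
    _ ≤ Real.exp (-t ^ 2 / 2) * K * |t| * (M₁ * Real.exp (1 / 4 * t ^ 2)) /
          (η₀ ^ 2 * σ ^ 2 * n) := by
        have e3 : (1 + t ^ 2) ^ 2 * |t| ≤ M₁ * Real.exp (1 / 4 * t ^ 2) := by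
          refine le_trans ?_ h1
          rw [pow_succ (1 + t ^ 2) 2]
          gcongr
        exact div_le_div_of_nonneg_right (mul_le_mul_of_nonneg_left e3 (by positivity))
          (by positivity)
    _ = |t| * (Real.exp (-t ^ 2 / 2) * Real.exp (1 / 4 * t ^ 2)) *
          (K * M₁ / (η₀ ^ 2 * σ ^ 2) / n) := by
        field_simp
    _ ≤ _ := by gcongr

theorem integrable_gaussianReal_std_iff {f : ℝ → ℂ} :
    Integrable f (gaussianReal 0 1) ↔ Integrable (fun t => gaussianPDFReal 0 1 t • f t) := by
  rw [gaussianReal_of_var_ne_zero _ one_ne_zero, integrable_withDensity_iff_integrable_smul'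
    (measurable_gaussianPDF 0 1) (ae_of_all _ fun _ => gaussianPDF_lt_top)]
  simp_rw [toReal_gaussianPDF]

theorem smul_gaussianPDFReal_std (t : ℝ) (z : ℂ) :
    gaussianPDFReal 0 1 t • z = (√(2 * Real.pi) : ℝ)⁻¹ * (Real.exp (-t ^ 2 / 2) * z) := by
  rw [gaussianPDFReal_std, Complex.real_smul]
  push_cast
  ring

variable {Ω : Type*} [MeasurableSpace Ω] {μ : Measure Ω} [IsProbabilityMeasure μ] {S : Ω → ℝ}

/-- Both increments are integrals against the same transform J of the interval: φ/sinc on one period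
for the lattice law, the Gaussian times the symbol on the whole line for the approximation. The
bound does not involve N. -/
theorem abs_lattice_sub_edgeworth_le (hS : Measurable S) {h : ℝ} (hh : 0 < h) (a : ℝ) (N : ℕ)
    (hl : ∀ w, ∃ k : ℤ, S w = a + h / 2 + k * h) {σ ρ c : ℝ} {n : ℕ} {G₀ G₁ : ℝ}
    (hG₀ : 0 ≤ G₀) (hG₁ : 0 ≤ G₁)
    (hnear : ∀ t : ℝ, |t| ≤ Real.pi / h →
      ‖complexMGF S μ (t * Complex.I) * ((Real.sinc (t * h / 2))⁻¹ : ℝ) -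
        Real.exp (-t ^ 2 / 2) * edgeworthSymbol (σ * √n) (ρ / (6 * σ ^ 2)) c t‖ ≤
      |t| * (Real.exp (-t ^ 2 / 8) * G₀ + G₁))
    (hfar : ∀ t : ℝ, Real.pi / h ≤ |t| →
      ‖(Real.exp (-t ^ 2 / 2) : ℂ) * edgeworthSymbol (σ * √n) (ρ / (6 * σ ^ 2)) c t‖ ≤
      |t| * (Real.exp (-t ^ 2 / 8) * G₀)) :
    |(μ.real {w | S w ≤ a + N * h} - μ.real {w | S w ≤ a}) -
      (edgeworth σ ρ c n (a + N * h) - edgeworth σ ρ c n a)| ≤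
      Real.pi⁻¹ * (√(8 * Real.pi) * G₀ + 2 * (Real.pi / h) * G₁) := by
  have hp : 0 < Real.pi / h := div_pos Real.pi_pos hh
  set q := edgeworthSymbol (σ * √n) (ρ / (6 * σ ^ 2)) c with hq
  set J : ℝ → ℂ := fun t => ∫ y in a..(a + N * h), Complex.exp (-(t * y) * Complex.I) with hJ
  set D := latticeKernel h a N with hD
  have hJD : ∀ t, D t * (Real.sinc (t * h / 2) : ℝ) = J t := latticeKernel_mul_sinc h a N
  have hJc : Continuous J := by
    have e : J = fun t => D t * (Real.sinc (t * h / 2) : ℝ) := funext fun t => (hJD t).symm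
    have h1 := continuous_latticeKernel h a N
    have h2 := Real.continuous_sinc
    rw [e]
    fun_prop
  have hφc : Continuous fun t : ℝ => complexMGF S μ (t * Complex.I) := by
    have := continuous_charFun (μ := μ.map S) 
    refine this.congr fun t => ?_
    rw [complexMGF_mul_I hS.aemeasurable]
  have hP := integral_complexMGF_mul_latticeKernel (μ := μ) hS hh a N hl
  have hE := edgeworth_sub_edgeworth σ ρ c n a (a + N * h)
  have hqJi : Integrable (fun t => q t * J t) (gaussianReal 0 1) := by
    refine ((integrable_edgeworthSymbol (σ * √n) (ρ / (6 * σ ^ 2)) c).norm.mul_const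
      |a + N * h - a|).mono' ?_ (ae_of_all _ fun t => ?_)
    · exact ((continuous_edgeworthSymbol _ _ _).mul hJc).aestronglyMeasurable
    · rw [norm_mul]
      exact mul_le_mul_of_nonneg_left (norm_integral_exp_neg_mul_I_le_abs t _ _) (norm_nonneg _)
  have hs2 : (√(2 * Real.pi) : ℂ) ≠ 0 := by
    have : √(2 * Real.pi) ≠ 0 := by positivity
    exact_mod_cast this
  have hgi : Integrable (fun t : ℝ => (Real.exp (-t ^ 2 / 2) : ℂ) * (q t * J t)) := by
    have h1 := integrable_gaussianReal_std_iff.1 hqJi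
    simp_rw [smul_gaussianPDFReal_std] at h1
    refine (h1.const_mul (√(2 * Real.pi) : ℂ)).congr (ae_of_all _ fun t => ?_)
    push_cast
    rw [mul_inv_cancel_left₀ hs2]
  have hE2 : (2 * Real.pi : ℝ) * ((edgeworth σ ρ c n (a + N * h) - edgeworth σ ρ c n a : ℝ) : ℂ) =
      ∫ t : ℝ, (Real.exp (-t ^ 2 / 2) : ℂ) * (q t * J t) := by
    rw [hE, integral_gaussianReal_eq_integral_smul one_ne_zero]
    simp_rw [smul_gaussianPDFReal_std]
    rw [integral_const_mul, ← mul_assoc, ← mul_assoc]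
    have h1 : ((2 * Real.pi : ℝ) : ℂ) * ((√(2 * Real.pi) : ℝ) : ℂ)⁻¹ *
        ((√(2 * Real.pi) : ℝ) : ℂ)⁻¹ = 1 := by
      have h2 : ((2 * Real.pi : ℝ) : ℂ) = (√(2 * Real.pi) : ℂ) * √(2 * Real.pi) := by
        rw [← Complex.ofReal_mul, Real.mul_self_sqrt (by positivity)]
      rw [h2]
      field_simp
    rw [Complex.ofReal_inv, h1, one_mul]
  rw [intervalIntegral.integral_of_le (by linarith), ← integral_indicator measurableSet_Ioc] at hP
  set f₁ : ℝ → ℂ := (Set.Ioc (-(Real.pi / h)) (Real.pi / h)).indicator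
    fun t => complexMGF S μ (t * Complex.I) * D t with hf₁
  have hf₁i : Integrable f₁ := by
    rw [hf₁, integrable_indicator_iff measurableSet_Ioc]
    exact (hφc.mul (continuous_latticeKernel h a N)).integrableOn_Ioc
  have hexp : ∀ t : ℝ, Real.exp (-t ^ 2 / 8) = Real.exp (-(1 / 8) * t ^ 2) := fun t => by
    congr 1; ring
  have hg1 : Integrable fun t : ℝ => 2 * (Real.exp (-t ^ 2 / 8) * G₀) := by
    simp_rw [hexp]
    exact ((integrable_exp_neg_mul_sq (b := 1 / 8) (by norm_num)).mul_const _).const_mul _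
  have hg2 : Integrable fun t : ℝ =>
      (Set.Ioc (-(Real.pi / h)) (Real.pi / h)).indicator (fun _ => 2 * G₁) t := by
    rw [integrable_indicator_iff measurableSet_Ioc]
    exact continuous_const.integrableOn_Ioc
  have hgb : Integrable fun t : ℝ => 2 * (Real.exp (-t ^ 2 / 8) * G₀) +
      (Set.Ioc (-(Real.pi / h)) (Real.pi / h)).indicator (fun _ => 2 * G₁) t := by
    exact hg1.add hg2
  -- The factor |t| in the hypotheses is consumed by ‖J t‖|t| ≤ 2, which removes the singularity at
  -- t = 0 uniformly in the length of the interval.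
  have hpt : ∀ t : ℝ, ‖f₁ t - (Real.exp (-t ^ 2 / 2) : ℂ) * (q t * J t)‖ ≤
      2 * (Real.exp (-t ^ 2 / 8) * G₀) +
      (Set.Ioc (-(Real.pi / h)) (Real.pi / h)).indicator (fun _ => 2 * G₁) t := by
    intro t
    have hJt : ‖J t‖ * |t| ≤ 2 := norm_integral_exp_neg_mul_I_le t a (a + N * h)
    by_cases ht : t ∈ Set.Ioc (-(Real.pi / h)) (Real.pi / h)
    · have hab : |t| ≤ Real.pi / h := abs_le.2 ⟨ht.1.le, ht.2⟩
      have hθ : |t * h / 2| ≤ Real.pi / 2 := by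
        rw [abs_div, abs_mul, abs_of_pos hh, abs_two]
        rw [le_div_iff₀ hh] at hab
        linarith
      have hsp : 0 < Real.sinc (t * h / 2) :=
        lt_of_lt_of_le (by positivity) (two_div_pi_le_sinc hθ)
      have hspc : (Real.sinc (t * h / 2) : ℂ) ≠ 0 := by exact_mod_cast hsp.ne'
      rw [hf₁, Set.indicator_of_mem ht, Set.indicator_of_mem ht]
      have e : complexMGF S μ (t * Complex.I) * D t - (Real.exp (-t ^ 2 / 2) : ℂ) * (q t * J t) =
          J t * (complexMGF S μ (t * Complex.I) * ((Real.sinc (t * h / 2))⁻¹ : ℝ) -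
            Real.exp (-t ^ 2 / 2) * q t) := by
        rw [← hJD t, Complex.ofReal_inv]
        field_simp
      rw [e, norm_mul]
      have hb := hnear t hab
      refine (mul_le_mul_of_nonneg_left hb (norm_nonneg _)).trans ?_
      have h3 : 0 ≤ Real.exp (-t ^ 2 / 8) * G₀ + G₁ := by positivity
      linarith [mul_le_mul_of_nonneg_right hJt h3,
        mul_assoc ‖J t‖ |t| (Real.exp (-t ^ 2 / 8) * G₀ + G₁)]
    · have hab : Real.pi / h ≤ |t| := by
        by_contra hc
        rw [not_le, abs_lt] at hc
        exact ht ⟨hc.1, hc.2.le⟩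
      rw [hf₁, Set.indicator_of_notMem ht, Set.indicator_of_notMem ht, zero_sub, norm_neg,
        add_zero]
      have e : (Real.exp (-t ^ 2 / 2) : ℂ) * (q t * J t) =
          J t * ((Real.exp (-t ^ 2 / 2) : ℂ) * q t) := by ring
      rw [e, norm_mul]
      have hb := hfar t hab
      refine (mul_le_mul_of_nonneg_left hb (norm_nonneg _)).trans ?_
      have h3 : 0 ≤ Real.exp (-t ^ 2 / 8) * G₀ := by positivity
      linarith [mul_le_mul_of_nonneg_right hJt h3,
        mul_assoc ‖J t‖ |t| (Real.exp (-t ^ 2 / 8) * G₀)]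
  have hfin := norm_integral_le_of_norm_le hgb (ae_of_all _ hpt)
  rw [integral_sub hf₁i hgi, hP, ← hE2, ← mul_sub, norm_mul, ← Complex.ofReal_sub,
    Complex.norm_real, Complex.norm_real, Real.norm_eq_abs, Real.norm_eq_abs,
    abs_of_pos (by positivity)] at hfin
  have hint : ∫ t : ℝ, (2 * (Real.exp (-t ^ 2 / 8) * G₀) +
      (Set.Ioc (-(Real.pi / h)) (Real.pi / h)).indicator (fun _ => 2 * G₁) t) =
      2 * (√(8 * Real.pi) * G₀) + 2 * (Real.pi / h) * (2 * G₁) := by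
    rw [integral_add hg1 hg2, integral_indicator_const _ measurableSet_Ioc]
    simp_rw [hexp]
    rw [integral_const_mul, integral_mul_const, integral_gaussian, Real.volume_real_Ioc_of_le
      (by linarith), smul_eq_mul, div_div_eq_mul_div, div_one, mul_comm Real.pi 8]
    ring
  rw [hint] at hfin
  rw [inv_mul_eq_div, le_div_iff₀ Real.pi_pos]
  linarith

end Smoothing

end MarkovEdgeworth

namespace MarkovEdgeworth

/-! ### The expansion at midpoints -/

section Midpoint

theorem tendsto_edgeworth_atBot (σ ρ c : ℝ) (n : ℕ) : Tendsto (edgeworth σ ρ c n) atBot (𝓝 0) := by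
  set r := ρ / (6 * σ ^ 2) with hr
  have h1 : Tendsto (fun y : ℝ => gaussianPDFReal 0 1 y / (σ * √n) * (r * (1 - y ^ 2) - c))
      atBot (𝓝 0) := by
    set M := (1 : ℕ).factorial / (1 / 4 : ℝ) ^ 1 * Real.exp (1 / 4) with hM
    have h2 : Tendsto (fun y : ℝ => (√(2 * Real.pi))⁻¹ / |σ * √n| * ((|r| + |c|) * M) *
        Real.exp (-(1 / 4 * y ^ 2))) atBot
        (𝓝 ((√(2 * Real.pi))⁻¹ / |σ * √n| * ((|r| + |c|) * M) * 0)) := by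
      refine Tendsto.const_mul _ (Real.tendsto_exp_neg_atTop_nhds_zero.comp ?_)
      refine Tendsto.const_mul_atTop (by norm_num) ?_
      exact ((tendsto_pow_atTop two_ne_zero).comp tendsto_abs_atBot_atTop).congr fun y => sq_abs y
    rw [mul_zero] at h2
    refine squeeze_zero_norm (fun y => ?_) h2
    have h3 := one_add_pow_le_mul_exp (a := 1 / 4) (by norm_num) 1 (sq_nonneg y)
    rw [← hM, pow_one] at h3
    have h4 : |r * (1 - y ^ 2) - c| ≤ (|r| + |c|) * (1 + y ^ 2) := by
      refine (abs_sub _ _).trans ?_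
      rw [abs_mul]
      have h5 : |1 - y ^ 2| ≤ 1 + y ^ 2 := by
        rw [abs_le]; constructor <;> nlinarith [sq_nonneg y]
      nlinarith [mul_le_mul_of_nonneg_left h5 (abs_nonneg r), abs_nonneg c,
        mul_nonneg (abs_nonneg c) (sq_nonneg y)]
    rw [Real.norm_eq_abs, abs_mul, abs_div, gaussianPDFReal_std, abs_mul,
      abs_of_nonneg (Real.exp_pos _).le, abs_of_nonneg (inv_nonneg.2 (Real.sqrt_nonneg _))]
    have e : Real.exp (-y ^ 2 / 2) * Real.exp (1 / 4 * y ^ 2) = Real.exp (-(1 / 4 * y ^ 2)) := by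
      rw [← Real.exp_add]; congr 1; ring
    rw [← e]
    calc (√(2 * Real.pi))⁻¹ * Real.exp (-y ^ 2 / 2) / |σ * √n| * |r * (1 - y ^ 2) - c|
        ≤ (√(2 * Real.pi))⁻¹ * Real.exp (-y ^ 2 / 2) / |σ * √n| *
            ((|r| + |c|) * (M * Real.exp (1 / 4 * y ^ 2))) := by
          refine mul_le_mul_of_nonneg_left (h4.trans ?_) (by positivity)
          exact mul_le_mul_of_nonneg_left h3 (by positivity)
      _ = _ := by ring
  have := (tendsto_cdf_atBot (gaussianReal 0 1)).add h1
  rw [add_zero] at this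
  exact this

theorem complexMGF_div_mul_I {Ω : Type*} [MeasurableSpace Ω] {μ : Measure Ω} (S : Ω → ℝ)
    (τ t : ℝ) : complexMGF (fun w => S w / τ) μ (t * Complex.I) =
      complexMGF S μ ((t / τ : ℝ) * Complex.I) := by
  simp only [complexMGF]
  congr 1
  funext w
  congr 1
  push_cast
  ring

variable {X : Type*} [MeasurableSpace X] {P : Kernel X X} [IsMarkovKernel P] {V : X → ℝ}
  {F : X → ℝ}

theorem IsLattice.exists_partialSum_eq {d h : ℝ} (hl : IsLattice F d h) (n : ℕ) (w : ℕ → X) :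
    ∃ k : ℤ, partialSum F n w = n * d + k * h := by
  choose k hk using hl.2.2.2
  refine ⟨∑ i ∈ Finset.range n, k (w i), ?_⟩
  simp only [partialSum, hk, Finset.sum_add_distrib, Finset.sum_const, Finset.card_range, nsmul_eq_mul]
  push_cast
  rw [Finset.sum_mul]

/-- With s = t/(σ√n), the range |s| ≤ η₀ is handled by the expansion of the prefactor and of L, the
range η₀ ≤ |s| ≤ π/h by geometric decay, and the rest of the line by the Gaussian tail. The
difference E_x[S_n] - c is kept explicit, since it is o(1) but enters at order n^{-1/2}. -/
theorem Pressure.exists_midpoint_bound {η C : ℝ} {L : ℂ → ℂ} (hPr : Pressure P F V η C L)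
    (hF : Measurable F) (hF1 : ∀ x, |F x| ≤ 1) (hV : ∀ x, 1 ≤ V x) {σ ρ : ℝ} (hσ : 0 < σ)
    (hL1 : deriv L 0 = 0) (hL2 : iteratedDeriv 2 L 0 = (σ ^ 2 : ℝ))
    (hL3 : iteratedDeriv 3 L 0 = (ρ : ℝ)) {K₀ : ℝ}
    (hK₀ : ∀ n x, |∫ w, partialSum F n w ∂chainLaw P x| ≤ K₀ * V x) {d h : ℝ}
    (hl : IsLattice F d h)
    (hdec : ∀ η : ℝ, 0 < η → ∃ C r : ℝ, 0 < r ∧ r < 1 ∧ ∀ t : ℝ, η ≤ |t| → |t| ≤ Real.pi / h →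
      ∀ n x, ‖complexMGF (partialSum F n) (chainLaw P x) (t * Complex.I)‖ ≤ C * r ^ n * V x)
    (x : X) (c : ℝ) :
    ∃ M r : ℝ, 0 < M ∧ 0 < r ∧ r < 1 ∧ ∀ (n : ℕ) (k : ℤ) (y : ℝ), 1 ≤ n →
      y = (n * d + (k + 1 / 2) * h) / (σ * √n) →
      |normalizedCDF P F σ x n y - edgeworth σ ρ c n y| ≤
        M * (1 / n + |∫ w, partialSum F n w ∂chainLaw P x - c| / √n + r ^ n) := by
  have hh := hl.1
  have hVx : 0 < V x := one_pos.trans_le (hV x)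
  have hη := hPr.η_pos
  have hC := hPr.C_pos
  have hK₀x : 0 ≤ K₀ * V x := (abs_nonneg _).trans (hK₀ 0 x)
  obtain ⟨K₁, r₁, hK₁, hr₁, htay⟩ := exists_taylor_three hPr.analyticAt_zero hPr.zero hL1
  have hK₂ : 0 ≤ 4 * C / η ^ 2 * V x := by positivity
  obtain ⟨η₁, M₁, hη₁, hM₁, hnear⟩ := exists_near_bound hσ hh ρ
    (K := K₁ + 4 * C / η ^ 2 * V x) (by positivity) hK₀x
  -- Within reach of the near estimate, strictly inside the disc of the prefactor bound and that of
  -- the Taylor estimate, and at most π/h so that the tail bound covers all frequencies outside one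
  -- period.
  set η₀ := min (min η₁ (η / 2)) (min (r₁ / 2) (Real.pi / h)) with hη₀
  have hη₀0 : 0 < η₀ := lt_min (lt_min hη₁ (half_pos hη))
    (lt_min (half_pos hr₁) (div_pos Real.pi_pos hh))
  have hη₀1 : η₀ ≤ η₁ := (min_le_left _ _).trans (min_le_left _ _)
  have hη₀2 : η₀ < η := ((min_le_left _ _).trans (min_le_right _ _)).trans_lt (half_lt_self hη)
  have hη₀3 : η₀ < r₁ := ((min_le_right _ _).trans (min_le_left _ _)).trans_lt (half_lt_self hr₁)
  have hη₀4 : η₀ ≤ Real.pi / h := (min_le_right _ _).trans (min_le_right _ _)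
  obtain ⟨M₂, hM₂, hfar⟩ := exists_far_bound hσ hη₀0 (ρ / (6 * σ ^ 2)) c
  obtain ⟨C₃, r, hr0, hr1, hunif⟩ := hdec η₀ hη₀0
  set K₃ := |C₃| * V x * (Real.pi / 2) with hK₃
  have hK₃0 : 0 ≤ K₃ := by positivity
  set M₀ := Real.pi⁻¹ * (√(8 * Real.pi) * (M₁ + M₂ + 1 / σ) + 2 * (Real.pi / h) * (K₃ / η₀)) with hM₀
  refine ⟨M₀, r, by positivity, hr0, hr1, fun n k y hn hy => ?_⟩
  have hn0 : (0 : ℝ) < n := by exact_mod_cast hn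
  have hm0 : 0 < √(n : ℝ) := Real.sqrt_pos.2 hn0
  set κ := ∫ w, partialSum F n w ∂chainLaw P x with hκ
  set τ := σ * √(n : ℝ) with hτ
  have hτ0 : 0 < τ := by positivity
  set G₀ := (M₁ + M₂) / n + |κ - c| / τ with hG₀
  -- The required factor |t| is available because |t| ≥ η₀τ on the middle range. The τ in the
  -- denominator cancels the length of that range in the rescaled variable.
  set G₁ := K₃ * r ^ n / (η₀ * τ) with hG₁
  have hG₀0 : 0 ≤ G₀ := by positivity
  have hG₁0 : 0 ≤ G₁ := by positivity
  have hgfar : ∀ t : ℝ, η₀ * τ ≤ |t| →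
      ‖(Real.exp (-t ^ 2 / 2) : ℂ) * edgeworthSymbol τ (ρ / (6 * σ ^ 2)) c t‖ ≤
      |t| * (Real.exp (-t ^ 2 / 8) * G₀) := fun t ht => by
    refine (hfar n t hn ht).trans ?_
    rw [mul_assoc]
    have : M₂ / n ≤ G₀ := by
      rw [hG₀, add_div]
      have h1 : 0 ≤ M₁ / n := by positivity
      have h2 : 0 ≤ |κ - c| / τ := by positivity
      linarith
    gcongr
  have hcell : ∀ N : ℕ, |((chainLaw P x).real {w | partialSum F n w / τ ≤ y} -
      (chainLaw P x).real {w | partialSum F n w / τ ≤ y - N * (h / τ)}) -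
      (edgeworth σ ρ c n y - edgeworth σ ρ c n (y - N * (h / τ)))| ≤
      Real.pi⁻¹ * (√(8 * Real.pi) * G₀ + 2 * (Real.pi / (h / τ)) * G₁) := by
    intro N
    have hmain := abs_lattice_sub_edgeworth_le (μ := chainLaw P x)
      (S := fun w => partialSum F n w / τ) ((measurable_partialSum hF n).div_const τ)
      (h := h / τ) (by positivity) (y - N * (h / τ)) N (fun w => by
        obtain ⟨j, hj⟩ := hl.exists_partialSum_eq n w
        -- The left endpoint lies N cells below the midpoint k + 1/2, so its first cell is centred
        -- at the lattice point k + 1 - N.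
        refine ⟨j - k + N - 1, ?_⟩
        rw [hj, hy]
        push_cast
        field_simp
        ring) (σ := σ) (ρ := ρ) (c := c) (n := n) hG₀0 hG₁0 (fun t ht => ?_) (fun t ht => ?_)
    · rwa [sub_add_cancel] at hmain
    · have hst : t / τ * τ = t := div_mul_cancel₀ _ hτ0.ne'
      have hsinc : t * (h / τ) / 2 = t / τ * h / 2 := by ring
      rw [complexMGF_div_mul_I, hsinc]
      have hta : |t| = |t / τ| * τ := by rw [abs_div, abs_of_pos hτ0, div_mul_cancel₀ _ hτ0.ne']
      rcases le_total |t / τ| η₀ with hs | hs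
      · have hsI : ‖((t / τ : ℝ) : ℂ) * Complex.I‖ = |t / τ| := by
          rw [norm_mul, Complex.norm_I, mul_one, Complex.norm_real, Real.norm_eq_abs]
        have h1 := hnear n (t / τ) κ c
          (complexMGF (partialSum F n) (chainLaw P x) ((t / τ : ℝ) * Complex.I))
          (L ((t / τ : ℝ) * Complex.I)) hn (hs.trans hη₀1) (hK₀ n x) (by
            have := htay ((t / τ : ℝ) * Complex.I) (by rw [hsI]; linarith)
            rw [hL2, hL3, hsI, Complex.ofReal_pow] at this
            refine this.trans ?_
            gcongr
            linarith) (by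
            have := hPr.norm_tilted_sub_le hF hF1 hL1 n x (z := (t / τ : ℝ) * Complex.I)
              (by rw [mem_ball_zero_iff, hsI]; linarith)
            rw [hsI] at this
            refine this.trans ?_
            gcongr
            linarith)
        rw [← hτ, hst] at h1
        refine h1.trans ?_
        rw [mul_assoc]
        have h2 : M₁ / n + |κ - c| / τ ≤ G₀ := by
          rw [hG₀]; gcongr; linarith
        gcongr
        refine (mul_le_mul_of_nonneg_left h2 (Real.exp_pos _).le).trans ?_
        linarith
      · have hsp : |t / τ| ≤ Real.pi / h := by
          rw [div_div_eq_mul_div] at ht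
          rw [abs_div, abs_of_pos hτ0, div_le_iff₀ hτ0]
          exact ht.trans_eq (by ring)
        have h1 := hunif (t / τ) hs hsp n x
        have hθ : |t / τ * h / 2| ≤ Real.pi / 2 := by
          rw [abs_div, abs_mul, abs_of_pos hh, abs_two]
          rw [le_div_iff₀ hh] at hsp
          linarith
        have h2 := two_div_pi_le_sinc hθ
        have h3 : 0 < 2 / Real.pi := by positivity
        have h4 : (Real.sinc (t / τ * h / 2))⁻¹ ≤ Real.pi / 2 := by
          rw [← inv_div 2 Real.pi]
          exact inv_anti₀ h3 h2
        have h5 : 0 < Real.sinc (t / τ * h / 2) := h3.trans_le h2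
        refine (norm_sub_le _ _).trans ?_
        have h6 := hgfar t (by rw [hta]; gcongr)
        have h7 : ‖complexMGF (partialSum F n) (chainLaw P x) ((t / τ : ℝ) * Complex.I) *
            (((Real.sinc (t / τ * h / 2))⁻¹ : ℝ) : ℂ)‖ ≤ |t| * G₁ := by
          rw [norm_mul, Complex.norm_real, Real.norm_of_nonneg (inv_nonneg.2 h5.le)]
          have h8 : C₃ * r ^ n * V x ≤ |C₃| * r ^ n * V x := by
            gcongr
            exact le_abs_self _
          calc _ ≤ |C₃| * r ^ n * V x * (Real.pi / 2) :=
                mul_le_mul (h1.trans h8) h4 (inv_nonneg.2 h5.le) (by positivity)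
            _ = K₃ * r ^ n * 1 := by rw [hK₃]; ring
            _ ≤ K₃ * r ^ n * (|t / τ| / η₀) := by
                gcongr
                exact (one_le_div hη₀0).2 hs
            _ = |t| * G₁ := by rw [hG₁, hta]; field_simp
        linarith
    · refine hgfar t (le_trans ?_ ht)
      rw [div_div_eq_mul_div, mul_div_right_comm]
      gcongr
  -- The left endpoint goes to -∞ along midpoints; the cell bound is independent of N, so it passes
  -- from increments to the distribution functions themselves.
  have hlim : Tendsto (fun N : ℕ => y - N * (h / τ)) atTop atBot := by
    refine tendsto_atBot_add_const_left _ _ (tendsto_neg_atTop_atBot.comp ?_)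
    exact tendsto_natCast_atTop_atTop.atTop_mul_const (by positivity)
  have hE := (tendsto_edgeworth_atBot σ ρ c n).comp hlim
  have hG : Tendsto (fun N : ℕ =>
      (chainLaw P x).real {w | partialSum F n w / τ ≤ y - N * (h / τ)}) atTop (𝓝 0) := by
    refine tendsto_const_nhds.congr' ?_
    filter_upwards [hlim.eventually_lt_atBot (-(n / τ))] with N hN
    have : {w : ℕ → X | partialSum F n w / τ ≤ y - N * (h / τ)} = ∅ := by
      refine Set.eq_empty_of_forall_notMem fun w (hw : partialSum F n w / τ ≤ _) => ?_
      have h1 := (abs_le.1 (abs_partialSum_le hF1 n w)).1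
      have h2 : -(n / τ) ≤ partialSum F n w / τ := by
        rw [← neg_div]; gcongr
      linarith
    rw [this, measureReal_empty]
  have hfin := le_of_tendsto (((tendsto_const_nhds.sub hG).sub (tendsto_const_nhds.sub hE)).abs)
    (Eventually.of_forall hcell)
  rw [sub_zero, sub_zero] at hfin
  refine hfin.trans ?_
  have e1 : 2 * (Real.pi / (h / τ)) * G₁ = 2 * (Real.pi / h) * (K₃ / η₀) * r ^ n := by
    rw [hG₁]; field_simp
  have e2 : G₀ = (M₁ + M₂) * (1 / n) + 1 / σ * (|κ - c| / √n) := by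
    rw [hG₀, hτ]; field_simp
  rw [e1, e2, hM₀, mul_assoc Real.pi⁻¹]
  refine mul_le_mul_of_nonneg_left ?_ (by positivity)
  have p1 : 0 ≤ 1 / (n : ℝ) := by positivity
  have p2 : 0 ≤ |κ - c| / √n := by positivity
  have p3 : 0 ≤ r ^ n := by positivity
  have q1 : 0 ≤ 2 * (Real.pi / h) * (K₃ / η₀) := by positivity
  have q2 : 0 ≤ √(8 * Real.pi) := Real.sqrt_nonneg _
  have q3 : 0 < 1 / σ := by positivity
  generalize 1 / (n : ℝ) = a1 at *
  generalize |κ - c| / √n = a2 at *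
  generalize r ^ n = a3 at *
  generalize 2 * (Real.pi / h) * (K₃ / η₀) = b1 at *
  generalize √(8 * Real.pi) = b2 at *
  generalize 1 / σ = b3 at *
  have e3 : (b2 * (M₁ + M₂ + b3) + b1) * (a1 + a2 + a3) =
      b2 * ((M₁ + M₂) * a1 + b3 * a2) + b1 * a3 + (b2 * ((M₁ + M₂) * (a2 + a3) + b3 * (a1 + a3)) +
        b1 * (a1 + a2)) := by ring
  rw [e3]
  have : 0 ≤ b2 * ((M₁ + M₂) * (a2 + a3) + b3 * (a1 + a3)) + b1 * (a1 + a2) := by positivity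
  linarith

end Midpoint

end MarkovEdgeworth

namespace MarkovEdgeworth

/-! ### Interpolation between midpoints -/

section Interpolation

/-- A Lipschitz derivative makes the tangent at the interpolation point accurate to Mh² on the whole
cell, and linear interpolation reproduces the tangent exactly. With cells of length h/(σ√n) the
error is O(1/n). -/
theorem abs_interpolate_sub_le {f f' : ℝ → ℝ} (hf : ∀ x, HasDerivAt f (f' x) x) {M : ℝ}
    (hM : ∀ x y, |f' x - f' y| ≤ M * |x - y|) (a : ℝ) {h θ : ℝ} (hh : 0 ≤ h) (hθ0 : 0 ≤ θ)
    (hθ1 : θ ≤ 1) : |(1 - θ) * f a + θ * f (a + h) - f (a + θ * h)| ≤ M * h ^ 2 := by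
  set p := a + θ * h with hp
  have hM0 : 0 ≤ M := by
    have := (abs_nonneg _).trans (hM 1 0)
    simpa using this
  have hθh : θ * h ≤ h := mul_le_of_le_one_left hh hθ1
  have hθh0 : 0 ≤ θ * h := mul_nonneg hθ0 hh
  have key : ∀ x ∈ Set.Icc a (a + h), |f x - f p - f' p * (x - p)| ≤ M * h * h := by
    intro x hx
    have hpm : p ∈ Set.Icc a (a + h) := ⟨by linarith, by linarith⟩
    have h1 := (convex_Icc a (a + h)).norm_image_sub_le_of_norm_hasDerivWithin_le (C := M * h)
      (f := fun x => f x - f' p * (x - p)) (f' := fun x => f' x - f' p * 1)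
      (fun y _ => ((hf y).sub (((hasDerivAt_id y).sub_const p).const_mul _)).hasDerivWithinAt)
      (fun y hy => by
        rw [mul_one, Real.norm_eq_abs]
        refine (hM y p).trans ?_
        gcongr
        rw [abs_le]; constructor <;> linarith [hy.1, hy.2, hpm.1, hpm.2]) hpm hx
    simp only [sub_self, mul_zero, sub_zero, Real.norm_eq_abs] at h1
    have h2 : f x - f p - f' p * (x - p) = f x - f' p * (x - p) - f p := by ring
    rw [h2]
    refine h1.trans ?_
    gcongr
    rw [abs_le]; constructor <;> linarith [hx.1, hx.2, hpm.1, hpm.2]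
  have k1 := key a ⟨le_rfl, by linarith⟩
  have k2 := key (a + h) ⟨by linarith, le_rfl⟩
  have e : (1 - θ) * f a + θ * f (a + h) - f p =
      (1 - θ) * (f a - f p - f' p * (a - p)) + θ * (f (a + h) - f p - f' p * (a + h - p)) := by
    rw [hp]; ring
  rw [e]
  refine (abs_add_le _ _).trans ?_
  rw [abs_mul, abs_mul, abs_of_nonneg hθ0, abs_of_nonneg (sub_nonneg.2 hθ1)]
  calc (1 - θ) * |f a - f p - f' p * (a - p)| + θ * |f (a + h) - f p - f' p * (a + h - p)|
      ≤ (1 - θ) * (M * h * h) + θ * (M * h * h) := by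
        have := sub_nonneg.2 hθ1
        gcongr
    _ = M * h ^ 2 := by ring

/-- Taken from the Fourier representation: the Lipschitz constant is a Gaussian moment of |t| times
the symbol, and it is uniform in n ≥ 1 because σ√n ≥ σ. -/
theorem abs_edgeworthDensity_sub_le {σ : ℝ} (hσ : 0 < σ) (r c : ℝ) :
    ∃ M : ℝ, 0 ≤ M ∧ ∀ (n : ℕ) (u v : ℝ), 1 ≤ n →
      |edgeworthDensity (σ * √n) r c u - edgeworthDensity (σ * √n) r c v| ≤ M * |u - v| := by
  have hi : ∀ k : ℕ, Integrable (fun t : ℝ => |t| ^ k) (gaussianReal 0 1) := fun k => by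
    have := (integrable_pow_mul_exp_gaussian k 0).norm
    simpa using this
  have hi1 := hi 1
  simp only [pow_one] at hi1
  have hint : Integrable (fun t : ℝ => |t| + |c| / σ * |t| ^ 2 + |r| / σ * |t| ^ 4)
      (gaussianReal 0 1) := (hi1.add ((hi 2).const_mul _)).add ((hi 4).const_mul _)
  set M := ∫ t : ℝ, |t| + |c| / σ * |t| ^ 2 + |r| / σ * |t| ^ 4 ∂gaussianReal 0 1 with hM
  have hM0 : 0 ≤ M := integral_nonneg fun t => by positivity
  refine ⟨M, hM0, fun n u v hn => ?_⟩
  have hn1 : (1 : ℝ) ≤ n := by exact_mod_cast hn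
  have hτ : σ ≤ σ * √n := le_mul_of_one_le_right hσ.le (Real.one_le_sqrt.2 hn1)
  set τ := σ * √(n : ℝ) with hτd
  have hτ0 : 0 < τ := hσ.trans_le hτ
  have hiu : ∀ u : ℝ, Integrable (fun t : ℝ =>
      edgeworthSymbol τ r c t * Complex.exp (-(t * u) * Complex.I)) (gaussianReal 0 1) := fun u => by
    refine (integrable_edgeworthSymbol τ r c).mono ?_ (ae_of_all _ fun t => ?_)
    · have := continuous_edgeworthSymbol τ r c
      exact Continuous.aestronglyMeasurable (by fun_prop)
    · rw [norm_mul, norm_exp_neg_mul_I, mul_one]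
  have h1 : ‖((√(2 * Real.pi) * edgeworthDensity τ r c u : ℝ) : ℂ) -
      (√(2 * Real.pi) * edgeworthDensity τ r c v : ℝ)‖ ≤ M * |u - v| := by
    rw [← integral_edgeworthSymbol_mul_exp, ← integral_edgeworthSymbol_mul_exp,
      ← integral_sub (hiu u) (hiu v), hM, ← integral_mul_const]
    refine norm_integral_le_of_norm_le (hint.mul_const _) (ae_of_all _ fun t => ?_)
    rw [← mul_sub, norm_mul]
    have h2 : ‖edgeworthSymbol τ r c t‖ ≤ 1 + |c| / σ * |t| + |r| / σ * |t| ^ 3 := by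
      have hn : ‖(t * Complex.I : ℂ)‖ = |t| := by simp
      rw [edgeworthSymbol]
      refine (norm_add₃_le).trans ?_
      rw [norm_one, norm_mul (c / τ : ℂ), norm_mul (r / τ : ℂ), norm_pow, hn,
        ← Complex.ofReal_div, ← Complex.ofReal_div, Complex.norm_real, Complex.norm_real,
        Real.norm_eq_abs, Real.norm_eq_abs, abs_div, abs_div, abs_of_pos hτ0]
      gcongr
    have h3 : ‖Complex.exp (-(t * u) * Complex.I) - Complex.exp (-(t * v) * Complex.I)‖ ≤
        |u - v| * |t| := by
      have := norm_exp_mul_I_sub_exp_le u v (-t)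
      rw [abs_neg] at this
      convert this using 4 <;> push_cast <;> ring
    calc _ ≤ (1 + |c| / σ * |t| + |r| / σ * |t| ^ 3) * (|u - v| * |t|) := by gcongr
      _ = _ := by ring
  rw [← Complex.ofReal_sub, Complex.norm_real, Real.norm_eq_abs, ← mul_sub, abs_mul,
    abs_of_nonneg (Real.sqrt_nonneg _)] at h1
  refine le_trans (le_mul_of_one_le_left (abs_nonneg _) ?_) h1
  rw [Real.one_le_sqrt]
  linarith [Real.two_le_pi]

theorem exists_edgeworth_interpolate_bound {σ : ℝ} (hσ : 0 < σ) (ρ c h : ℝ) (hh : 0 < h) :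
    ∃ M : ℝ, 0 ≤ M ∧ ∀ (n : ℕ) (a θ : ℝ), 1 ≤ n → 0 ≤ θ → θ ≤ 1 →
      |(1 - θ) * edgeworth σ ρ c n a + θ * edgeworth σ ρ c n (a + h / (σ * √n)) -
        edgeworth σ ρ c n (a + θ * (h / (σ * √n)))| ≤ M * (1 / n) := by
  obtain ⟨M, hM0, hM⟩ := abs_edgeworthDensity_sub_le hσ (ρ / (6 * σ ^ 2)) c
  refine ⟨M * (h ^ 2 / σ ^ 2), by positivity, fun n a θ hn h0 h1 => ?_⟩
  have hn0 : (0 : ℝ) < n := by exact_mod_cast hn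
  refine (abs_interpolate_sub_le (hasDerivAt_edgeworth σ ρ c n) (fun u v => hM n u v hn) a
    (by positivity) h0 h1).trans (le_of_eq ?_)
  rw [div_pow, mul_pow, Real.sq_sqrt hn0.le]
  field_simp

variable {X : Type*} [MeasurableSpace X] {P : Kernel X X} [IsMarkovKernel P] {F : X → ℝ}

/-- Multiplied by √n, all three terms tend to zero, the middle one precisely because u does. -/
theorem eventually_bound_le {u : ℕ → ℝ} (hu : Tendsto u atTop (𝓝 0)) {M r ε : ℝ} (hr0 : 0 < r)
    (hr1 : r < 1) (hε : 0 < ε) :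
    ∀ᶠ n : ℕ in atTop, M * (1 / n + |u n| / √n + r ^ n) ≤ ε / √n := by
  have h1 : Tendsto (fun n : ℕ => 1 / √(n : ℝ)) atTop (𝓝 0) := by
    have := (tendsto_inv_atTop_zero.comp Real.tendsto_sqrt_atTop).comp
      (tendsto_natCast_atTop_atTop (R := ℝ))
    simpa [Function.comp_def] using this
  have h2 := tendsto_self_mul_const_pow_of_lt_one hr0.le hr1
  have h3 := ((h1.add hu.abs).add h2).const_mul |M|
  rw [abs_zero, add_zero, add_zero, mul_zero] at h3
  filter_upwards [h3.eventually_lt_const hε, eventually_ge_atTop 1] with n hn hn1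
  have hn0 : (1 : ℝ) ≤ n := by exact_mod_cast hn1
  have hm1 : 1 ≤ √(n : ℝ) := Real.one_le_sqrt.2 hn0
  have hm0 : 0 < √(n : ℝ) := by linarith
  have hmn : √(n : ℝ) * √(n : ℝ) = n := Real.mul_self_sqrt (by linarith)
  have hmle : √(n : ℝ) ≤ n := by nlinarith
  rw [le_div_iff₀ hm0]
  refine le_trans ?_ hn.le
  have e : M * (1 / n + |u n| / √n + r ^ n) * √n = M * (1 / √n + |u n| + √n * r ^ n) := by
    have : (1 : ℝ) / n = 1 / √n * (1 / √n) := by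
      rw [div_mul_div_comm, hmn, one_mul]
    rw [this]
    field_simp
  rw [e]
  have hr : 0 < r ^ n := by positivity
  calc M * (1 / √n + |u n| + √n * r ^ n) ≤ |M| * (1 / √n + |u n| + √n * r ^ n) := by
        gcongr
        exact le_abs_self M
    _ ≤ _ := by gcongr

theorem normalizedCDF_eq_of_mem {d h : ℝ} (hl : IsLattice F d h) {σ : ℝ} (hσ : 0 < σ) (x : X) {n : ℕ}
    (hn : 1 ≤ n) {k : ℤ} {z : ℝ} (h1 : (n * d + k * h) / (σ * √n) ≤ z)
    (h2 : z < (n * d + (k + 1) * h) / (σ * √n)) :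
    normalizedCDF P F σ x n z = normalizedCDF P F σ x n ((n * d + k * h) / (σ * √n)) := by
  have hn0 : (0 : ℝ) < n := by exact_mod_cast hn
  have hτ : 0 < σ * √(n : ℝ) := by positivity
  have hh := hl.1
  unfold normalizedCDF
  congr 1
  ext w
  obtain ⟨j, hj⟩ := hl.exists_partialSum_eq n w
  change partialSum F n w / (σ * √n) ≤ z ↔ partialSum F n w / (σ * √n) ≤ _
  refine ⟨fun hz => ?_, fun hz => hz.trans h1⟩
  have h3 := hz.trans_lt h2
  rw [hj] at h3 ⊢
  rw [div_lt_div_iff_of_pos_right hτ] at h3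
  have h4 : (j : ℝ) < k + 1 := by nlinarith
  have h5 : j ≤ k := by
    have : j < k + 1 := by exact_mod_cast h4
    omega
  have h6 : (j : ℝ) ≤ k := by exact_mod_cast h5
  gcongr

/-- The distribution function is constant from each lattice point up to the next, so its left limit
is its value at the preceding lattice point. -/
theorem leftLim_normalizedCDF {d h : ℝ} (hl : IsLattice F d h) {σ : ℝ} (hσ : 0 < σ) (x : X) {n : ℕ}
    (hn : 1 ≤ n) (k : ℤ) :
    Function.leftLim (normalizedCDF P F σ x n) ((n * d + (k + 1) * h) / (σ * √n)) =
      normalizedCDF P F σ x n ((n * d + k * h) / (σ * √n)) := by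
  have hn0 : (0 : ℝ) < n := by exact_mod_cast hn
  have hτ : 0 < σ * √(n : ℝ) := by positivity
  have hh := hl.1
  refine leftLim_eq_of_tendsto (tendsto_const_nhds.congr' ?_)
  have hlt : (n * d + k * h) / (σ * √n) < (n * d + (k + 1) * h) / (σ * √n) := by
    gcongr
    linarith
  filter_upwards [Ico_mem_nhdsLT hlt] with z hz
  exact (normalizedCDF_eq_of_mem hl hσ x hn hz.1 hz.2).symm

end Interpolation

end MarkovEdgeworth

namespace MarkovEdgeworth

/-! ### The three forms of the expansion -/

section Expansion

variable {X : Type*} [MeasurableSpace X] {P : Kernel X X} [IsMarkovKernel P] {F : X → ℝ}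

theorem abs_interpolate_normalizedCDF_sub_le {σ ρ c h d : ℝ} (hσ : 0 < σ) (hh : 0 < h) {x : X}
    {B : ℕ → ℝ} (hB : ∀ (n : ℕ) (k : ℤ) (y : ℝ), 1 ≤ n →
      y = (n * d + (k + 1 / 2) * h) / (σ * √n) →
      |normalizedCDF P F σ x n y - edgeworth σ ρ c n y| ≤ B n) :
    ∃ M : ℝ, 0 ≤ M ∧ ∀ (n : ℕ) (k : ℤ) (θ : ℝ), 1 ≤ n → 0 ≤ θ → θ ≤ 1 →
      |(1 - θ) * normalizedCDF P F σ x n ((n * d + (k + 1 / 2) * h) / (σ * √n)) +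
        θ * normalizedCDF P F σ x n ((n * d + (k + 1 + 1 / 2) * h) / (σ * √n)) -
        edgeworth σ ρ c n ((n * d + (k + 1 / 2 + θ) * h) / (σ * √n))| ≤ B n + M * (1 / n) := by
  obtain ⟨M, hM0, hM⟩ := exists_edgeworth_interpolate_bound hσ ρ c h hh
  refine ⟨M, hM0, fun n k θ hn h0 h1 => ?_⟩
  have b1 := hB n k _ hn rfl
  have b2 := hB n (k + 1) _ hn rfl
  push_cast at b2
  have b3 := hM n ((n * d + (k + 1 / 2) * h) / (σ * √n)) θ hn h0 h1
  have e1 : (n * d + (k + 1 / 2) * h) / (σ * √n) + h / (σ * √n) =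
      (n * d + (k + 1 + 1 / 2) * h) / (σ * √n) := by
    rw [← add_div]; congr 1; ring
  have e2 : (n * d + (k + 1 / 2) * h) / (σ * √n) + θ * (h / (σ * √n)) =
      (n * d + (k + 1 / 2 + θ) * h) / (σ * √n) := by
    rw [mul_div_assoc', ← add_div]; congr 1; ring
  rw [e1, e2] at b3
  generalize normalizedCDF P F σ x n ((n * d + (k + 1 / 2) * h) / (σ * √n)) = g1 at *
  generalize normalizedCDF P F σ x n ((n * d + (k + 1 + 1 / 2) * h) / (σ * √n)) = g2 at *
  generalize edgeworth σ ρ c n ((n * d + (k + 1 / 2) * h) / (σ * √n)) = f1 at *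
  generalize edgeworth σ ρ c n ((n * d + (k + 1 + 1 / 2) * h) / (σ * √n)) = f2 at *
  generalize edgeworth σ ρ c n ((n * d + (k + 1 / 2 + θ) * h) / (σ * √n)) = f3 at *
  have e3 : (1 - θ) * g1 + θ * g2 - f3 =
      (1 - θ) * (g1 - f1) + θ * (g2 - f2) + ((1 - θ) * f1 + θ * f2 - f3) := by ring
  have h1' := sub_nonneg.2 h1
  rw [e3]
  refine (abs_add_le _ _).trans (add_le_add ((abs_add_le _ _).trans ?_) b3)
  rw [abs_mul, abs_mul, abs_of_nonneg h0, abs_of_nonneg h1']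
  calc (1 - θ) * |g1 - f1| + θ * |g2 - f2| ≤ (1 - θ) * B n + θ * B n := by gcongr
    _ = B n := by ring

/-- All three forms follow from the midpoint estimate and the smoothness of the approximation: the
polygonal one by interpolating with the fractional part as parameter, the lattice-point one by
interpolating halfway. -/
theorem lattice_expansion {σ ρ c h d : ℝ} (hσ : 0 < σ) (hl : IsLattice F d h) {x : X} {u : ℕ → ℝ}
    (hu : Tendsto u atTop (𝓝 0)) {M r : ℝ} (hr0 : 0 < r) (hr1 : r < 1)
    (hB : ∀ (n : ℕ) (k : ℤ) (y : ℝ), 1 ≤ n → y = (n * d + (k + 1 / 2) * h) / (σ * √n) →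
      |normalizedCDF P F σ x n y - edgeworth σ ρ c n y| ≤ M * (1 / n + |u n| / √n + r ^ n)) :
    (∀ ε > 0, ∀ᶠ n : ℕ in atTop, ∀ y : ℝ,
      |polygonal (normalizedCDF P F σ x n) (n * d / (σ * √n)) (h / (σ * √n)) y
        - edgeworth σ ρ c n y| ≤ ε / √n) ∧
    (∀ ε > 0, ∀ᶠ n : ℕ in atTop, ∀ (k : ℤ) (y : ℝ), y = (n * d + (k + 1 / 2) * h) / (σ * √n) →
      |normalizedCDF P F σ x n y - edgeworth σ ρ c n y| ≤ ε / √n) ∧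
    (∀ ε > 0, ∀ᶠ n : ℕ in atTop, ∀ (k : ℤ) (y : ℝ), y = (n * d + k * h) / (σ * √n) →
      |(normalizedCDF P F σ x n y + Function.leftLim (normalizedCDF P F σ x n) y) / 2
        - edgeworth σ ρ c n y| ≤ ε / √n) := by
  have hh := hl.1
  obtain ⟨M', hM', hint⟩ := abs_interpolate_normalizedCDF_sub_le hσ hh hB
  have hev : ∀ ε > 0, ∀ᶠ n : ℕ in atTop, 1 ≤ n ∧
      M * (1 / n + |u n| / √n + r ^ n) + M' * (1 / n) ≤ ε / √n := fun ε hε => by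
    filter_upwards [eventually_bound_le hu (M := M) hr0 hr1 (half_pos hε),
      eventually_bound_le hu (M := M') hr0 hr1 (half_pos hε), eventually_ge_atTop 1] with n h1 h2 h3
    refine ⟨h3, ?_⟩
    have h4 : M' * (1 / (n : ℝ)) ≤ M' * (1 / n + |u n| / √n + r ^ n) := by
      refine mul_le_mul_of_nonneg_left ?_ hM'
      have : 0 ≤ |u n| / √n := by positivity
      have : 0 ≤ r ^ n := by positivity
      linarith
    have h5 : ε / √n = ε / 2 / √n + ε / 2 / √n := by rw [← add_div, add_halves]
    linarith
  refine ⟨fun ε hε => ?_, fun ε hε => ?_, fun ε hε => ?_⟩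
  · filter_upwards [hev ε hε] with n hn y
    have hn0 : (0 : ℝ) < n := by exact_mod_cast hn.1
    have hτ : 0 < σ * √(n : ℝ) := by positivity
    set t := (y - n * d / (σ * √n)) / (h / (σ * √n)) - 1 / 2 with ht
    have h1 := hint n ⌊t⌋ (Int.fract t) hn.1 (Int.fract_nonneg t) (Int.fract_lt_one t).le
    have e0 : (⌊t⌋ : ℝ) + 1 / 2 + Int.fract t = t + 1 / 2 := by
      rw [add_right_comm, Int.floor_add_fract]
    have ey : (n * d + (⌊t⌋ + 1 / 2 + Int.fract t) * h) / (σ * √n) = y := by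
      rw [e0, ht]; field_simp; ring
    have e1 : (n * d + (⌊t⌋ + 1 / 2) * h) / (σ * √n) =
        n * d / (σ * √n) + (⌊t⌋ + 1 / 2) * (h / (σ * √n)) := by ring
    have e2 : (n * d + (⌊t⌋ + 1 + 1 / 2) * h) / (σ * √n) =
        n * d / (σ * √n) + (⌊t⌋ + 1 + 1 / 2) * (h / (σ * √n)) := by ring
    rw [ey, e1, e2] at h1
    exact h1.trans hn.2
  · filter_upwards [eventually_bound_le hu (M := M) hr0 hr1 hε, eventually_ge_atTop 1]
      with n h1 h2 k y hy
    exact (hB n k y h2 hy).trans h1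
  · filter_upwards [hev ε hε] with n hn k y hy
    have hn0 : (0 : ℝ) < n := by exact_mod_cast hn.1
    have hτ : 0 < σ * √(n : ℝ) := by positivity
    -- The lattice point k is the centre of the segment between the midpoints k - 1/2 and k + 1/2,
    -- where the distribution function takes its left-limit value and its value at k.
    have h1 := hint n (k - 1) (1 / 2) hn.1 (by norm_num) (by norm_num)
    push_cast at h1
    have l1 := leftLim_normalizedCDF (P := P) hl hσ x hn.1 (k - 1)
    have l2 := normalizedCDF_eq_of_mem (P := P) hl hσ x hn.1 (k := k - 1)
      (z := (n * d + (k - 1 + 1 / 2) * h) / (σ * √n))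
      (by push_cast; exact (div_le_div_iff_of_pos_right hτ).2 (by linarith))
      (by push_cast; exact (div_lt_div_iff_of_pos_right hτ).2 (by linarith))
    have l3 := normalizedCDF_eq_of_mem (P := P) hl hσ x hn.1 (k := k)
      (z := (n * d + (k - 1 + 1 + 1 / 2) * h) / (σ * √n))
      ((div_le_div_iff_of_pos_right hτ).2 (by linarith))
      ((div_lt_div_iff_of_pos_right hτ).2 (by linarith))
    push_cast at l1 l2
    have e1 : (k : ℝ) - 1 + 1 / 2 + 1 / 2 = k := by ring
    rw [l2, l3, e1, ← hy] at h1
    rw [sub_add_cancel, ← hy] at l1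
    rw [l1]
    refine le_trans (le_of_eq ?_) (h1.trans hn.2)
    congr 1
    ring

end Expansion

end MarkovEdgeworth

/-! ### The Edgeworth expansion -/

theorem mainTheorem5 {X : Type*} [MeasurableSpace X] [MeasurableSpace.CountablyGenerated X]
    (P : Kernel X X) [IsMarkovKernel P]
    (π : Measure X) [IsProbabilityMeasure π] (hπ : Kernel.Invariant P π)
    (V : X → ℝ) (hV : MarkovEdgeworth.IsGeometricallyErgodic P V)
    (hV2 : Integrable (fun x => V x ^ 2) π)
    (F : X → ℝ) (hF : Measurable F) (hF_bound : ∀ x, |F x| ≤ 1) (hF_mean : ∫ x, F x ∂π = 0)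
    (hF_var : ¬ MarkovEdgeworth.HasAsymptoticVariance P F 0)
    (d h : ℝ) (hF_lattice : MarkovEdgeworth.IsLattice F d h)
    (hF_span : MarkovEdgeworth.HasSpan P F h) :
    -- the asymptotic variance, the limiting log-moment generating function and the solution of
    -- the Poisson equation exist (each is uniquely determined, `Λ` near zero)
    ∃ (σ : ℝ) (Λ : ℝ → ℝ) (Fhat : X → ℝ),
      0 < σ ∧ MarkovEdgeworth.HasAsymptoticVariance P F (σ ^ 2) ∧
      MarkovEdgeworth.IsLimitLogMGF P F Λ ∧ AnalyticAt ℝ Λ 0 ∧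
      MarkovEdgeworth.IsPoissonLimit P π F Fhat ∧
      ∀ x : X,
        -- the expansion of the polygonal approximation, uniformly in `y`
        (∀ ε > 0, ∀ᶠ n : ℕ in atTop, ∀ y : ℝ,
          |MarkovEdgeworth.polygonal (MarkovEdgeworth.normalizedCDF P F σ x n)
              (n * d / (σ * √n)) (h / (σ * √n)) y
            - MarkovEdgeworth.edgeworth σ (iteratedDeriv 3 Λ 0) (Fhat x) n y| ≤ ε / √n) ∧
        -- the distribution function itself at the midpoints of the lattice of `S_n / (σ √n)`
        (∀ ε > 0, ∀ᶠ n : ℕ in atTop, ∀ (k : ℤ) (y : ℝ),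
          y = (n * d + (k + 1 / 2) * h) / (σ * √n) →
          |MarkovEdgeworth.normalizedCDF P F σ x n y
            - MarkovEdgeworth.edgeworth σ (iteratedDeriv 3 Λ 0) (Fhat x) n y| ≤ ε / √n) ∧
        -- the average of the left and right limits at the points of that lattice
        (∀ ε > 0, ∀ᶠ n : ℕ in atTop, ∀ (k : ℤ) (y : ℝ),
          y = (n * d + k * h) / (σ * √n) →
          |(MarkovEdgeworth.normalizedCDF P F σ x n y
              + Function.leftLim (MarkovEdgeworth.normalizedCDF P F σ x n) y) / 2
            - MarkovEdgeworth.edgeworth σ (iteratedDeriv 3 Λ 0) (Fhat x) n y| ≤ ε / √n) := by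
  have hVi : Integrable V π := by
    refine hV2.mono' hV.measurable.aestronglyMeasurable (ae_of_all _ fun x => ?_)
    have := hV.one_le x
    rw [Real.norm_of_nonneg (by linarith)]
    nlinarith
  obtain ⟨ν, s, δ, b, H⟩ := hV.exists_driftData hπ hVi
  obtain ⟨ψ, hψ, hψap⟩ := hV.irreducible_aperiodic
  -- Aperiodicity is given relative to ψ but used for π-positive sets; maximality of ψ transfers it.
  have hπψ : π ≪ ψ := hψ.maximal π inferInstance H.isIrreducible
  have hap : MarkovEdgeworth.IsAperiodic P π := fun A hA hπA =>
    hψap A hA (pos_iff_ne_zero.2 fun h0 => hπA.ne' (hπψ h0))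
  obtain ⟨x₀⟩ : Nonempty X := nonempty_of_isProbabilityMeasure π
  obtain ⟨η, C, L, hPr⟩ := H.exists_pressure hap hF hF_bound
  obtain ⟨Fhat, K, hK, hFhat, hFK⟩ := H.exists_poisson_limit hap hF hF_bound hF_mean
  have hL1 : deriv L 0 = 0 := hPr.deriv_eq_zero hF hF_bound fun n => hFK n x₀
  have hvar := hPr.hasAsymptoticVariance hF hF_bound hFhat hL1
  have hv0 := hPr.re_iteratedDeriv_two_nonneg hF hF_bound hL1 x₀
  -- L''(0) is the asymptotic variance, so its vanishing is what non-triviality excludes.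
  have hvpos : 0 < (iteratedDeriv 2 L 0).re :=
    lt_of_le_of_ne hv0 fun h0 => hF_var (h0 ▸ hvar)
  have hσ2 : √(iteratedDeriv 2 L 0).re ^ 2 = (iteratedDeriv 2 L 0).re := Real.sq_sqrt hv0
  have hρ : iteratedDeriv 3 (fun a : ℝ => (L a).re) 0 = (iteratedDeriv 3 L 0).re := by
    have := MarkovEdgeworth.iteratedDeriv_re_ofReal hPr.diff 3 (a := 0) (by simpa using hPr.η_pos)
    simpa using this
  -- L is real on the real axis near 0, so its real part there is the real-analytic Λ, and the
  -- derivatives of Λ at 0 are those of L.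
  refine ⟨√(iteratedDeriv 2 L 0).re, fun a => (L a).re, Fhat, Real.sqrt_pos.2 hvpos, ?_,
    hPr.isLimitLogMGF H hF hF_bound hL1 hK hFK,
    MarkovEdgeworth.analyticAt_re_ofReal hPr.analyticAt_zero, fun x => ?_, fun x => ?_⟩
  · rwa [hσ2]
  · simpa [hF_mean] using hFhat x
  · rw [hρ]
    obtain ⟨M, r, -, hr0, hr1, hB⟩ := hPr.exists_midpoint_bound hF hF_bound hV.one_le
      (Real.sqrt_pos.2 hvpos) hL1
      (Complex.ext (by rw [hσ2, Complex.ofReal_re])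
        (by rw [Complex.ofReal_im]; exact hPr.im_iteratedDeriv_two hF hF_bound hL1 x₀))
      (ρ := (iteratedDeriv 3 L 0).re)
      (Complex.ext (Complex.ofReal_re _).symm (by
        rw [Complex.ofReal_im]
        exact MarkovEdgeworth.im_iteratedDeriv_eq_zero hPr.η_pos hPr.diff hPr.im_eq_zero 3))
      hFK hF_lattice
      (fun η hη => H.exists_uniform_decay hap hF hF_bound hF_lattice.1 hF_span hη) x (Fhat x)
    have hu : Tendsto (fun n => ∫ w, MarkovEdgeworth.partialSum F n w ∂MarkovEdgeworth.chainLaw P x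
        - Fhat x) atTop (𝓝 0) := by
      have := (hFhat x).sub_const (Fhat x)
      rwa [sub_self] at this
    exact MarkovEdgeworth.lattice_expansion (Real.sqrt_pos.2 hvpos) hF_lattice hu hr0 hr1 hB
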